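/- For odd $d\ge 1$ write $d=d_0d_1^2$ with $d_0$ squarefree and $d_1\ge 1$, and let $\chi_{d_0}$ be the character modulo $4d_0$ given by the Jacobi symbol $\chi_{d_0}(n)=\left(\frac{d_0}{n}\right)$. For a Dirichlet character $\psi$ put $L^{(P)}(s,\psi)=L(s,\psi)\prod_{p\mid P}(1-\psi(p)p^{-s})$, and let $$P^{(\chi)}_{d_0,d_1}(s)=\prod_{p^\alpha\Vert d_1}\Bigl[\sum_{n=0}^{\alpha}\chi(p^{2n})p^{n-2ns}-\sum_{n=0}^{\alpha-1}(\chi_{d_0}\chi)(p^{2n+1})p^{n-(2n+1)s}\Bigr].$$ A smooth weight is a smooth function $h:\mathbb R\to[0,\infty)$ supported on $[1/4,5/4]$ and equal to $1$ on $[1/2,1]$. For a primitive quadratic Dirichlet character $\chi$ modulo $N\ge 1$ (the trivial character modulo $1$ being included) and $X\ge 1$ let $$S(X;\chi)=\sum_{(d,2N)=1}L^{(2N)}(\tfrac12,\chi_{d_0}\chi)\,P^{(\chi)}_{d_0,d_1}(\tfrac12)\,h(d/X).$$ **Theorem.** There is an absolute constant $\delta>0$ such that for every smooth weight $h$ there are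 real coefficients $a_N=a_N(\chi,h)$ and $b_N=b_N(\chi,h)$ with the following property. For every $\varepsilon>0$ one has, for all $N\ge1$, all primitive quadratic characters $\chi$ modulo $N$ and all $X\ge 1$, $$S(X;\chi)=a_NX\log X+b_NX+O_{h,\varepsilon}\bigl(N^{3/8+\varepsilon}X^{1-\delta}\bigr),$$ and, uniformly in $N$ and $\chi$, $$N^{-\varepsilon}\ll_{h,\varepsilon}a_N\ll_{h,\varepsilon}N^{\varepsilon},\qquad N^{-\varepsilon}\ll_{h,\varepsilon}|b_N|\ll_{h,\varepsilon}N^{\varepsilon}.$$ Moreover $a_N>0$ for all $N\ge1$, and $b_N>0$ for all $N>1$. -/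

import Mathlib

noncomputable section

namespace LMoment

open scoped NumberTheorySymbols ContDiff

/-- The positive integer `d₁` in the decomposition `d = d₀ * d₁ ^ 2` with `d₀` squarefree. -/
def sqRoot (d : ℕ) : ℕ := d.factorization.prod fun p k => p ^ (k / 2)

/-- The squarefree positive integer `d₀` in the decomposition `d = d₀ * d₁ ^ 2`. -/
def sqfree (d : ℕ) : ℕ := d.factorization.prod fun p k => p ^ (k % 2)

theorem sqfree_mul_sqRoot_sq {d : ℕ} (hd : d ≠ 0) : sqfree d * sqRoot d ^ 2 = d := by
  conv_rhs => rw [← Nat.prod_factorization_pow_eq_self hd]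
  simp only [sqfree, sqRoot, Finsupp.prod]
  rw [← Finset.prod_pow, ← Finset.prod_mul_distrib]
  refine Finset.prod_congr rfl fun p _ => ?_
  rw [← pow_mul, ← pow_add]
  congr 1
  omega

theorem squarefree_sqfree (d : ℕ) : Squarefree (sqfree d) := by
  rw [sqfree, Finsupp.prod]
  refine Finset.squarefree_prod_of_pairwise_isCoprime ?_ ?_
  · intro p hp q hq hpq
    have hp' := Nat.prime_of_mem_primeFactors hp
    have hq' := Nat.prime_of_mem_primeFactors hq
    exact (Nat.coprime_iff_isRelPrime.1 ((Nat.coprime_primes hp' hq').2 hpq)).pow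
  · intro p hp
    have hp' := Nat.prime_of_mem_primeFactors hp
    rcases Nat.mod_two_eq_zero_or_one (d.factorization p) with h | h
    · simp [h]
    · simpa [h] using hp'.prime.squarefree

theorem sqRoot_pos (d : ℕ) : 0 < sqRoot d :=
  Finset.prod_pos fun _ hp => pow_pos (Nat.prime_of_mem_primeFactors hp).pos _

theorem sqfree_pos (d : ℕ) : 0 < sqfree d :=
  Nat.pos_of_ne_zero (squarefree_sqfree d).ne_zero

instance sqfree_neZero (d : ℕ) : NeZero (sqfree d) := ⟨(sqfree_pos d).ne'⟩

theorem odd_val_of_isUnit {d : ℕ} {x : ZMod (4 * d)} (hx : IsUnit x) : Odd x.val := by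
  have h := ZMod.val_coe_unit_coprime hx.unit
  rw [IsUnit.unit_spec] at h
  exact Nat.coprime_two_right.1 (h.coprime_dvd_right ⟨2 * d, by ring⟩)

open Classical in
/-- The character `χ_d(n) = (d / n)` (Jacobi symbol) modulo `4 * d`. -/
def chi (d : ℕ) [NeZero d] : DirichletCharacter ℂ (4 * d) where
  toFun x := if IsUnit x then ((J((d : ℤ) | x.val) : ℤ) : ℂ) else 0
  map_one' := by
    have h : 4 * d ≠ 1 := by omega
    have : Fact (1 < 4 * d) := ⟨by have := NeZero.pos d; omega⟩
    simp [ZMod.val_one]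
  map_mul' x y := by
    by_cases hx : IsUnit x
    · by_cases hy : IsUnit y
      · have ox := odd_val_of_isUnit hx
        have oy := odd_val_of_isUnit hy
        simp only [hx, hy, hx.mul hy, if_true]
        rw [ZMod.val_mul, ← jacobiSym.mod_right' d (ox.mul oy),
          jacobiSym.mul_right' _ ox.pos.ne' oy.pos.ne']
        push_cast
        rfl
      · simp [hy, IsUnit.mul_iff]
    · simp [hx, IsUnit.mul_iff]
  map_nonunit' x hx := by simp [hx]

/-- The value of `χ_d` at a natural number prime to `4 * d` is the Jacobi symbol. -/
theorem chi_natCast (d : ℕ) [NeZero d] {n : ℕ} (hn : n.Coprime (4 * d)) :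
    chi d (n : ZMod (4 * d)) = ((J((d : ℤ) | n) : ℤ) : ℂ) := by
  have ho : Odd n := Nat.coprime_two_right.1 (hn.coprime_dvd_right ⟨2 * d, by ring⟩)
  have hu : IsUnit (n : ZMod (4 * d)) := (ZMod.isUnit_iff_coprime _ _).2 hn
  change (if IsUnit (n : ZMod (4 * d)) then
    ((J((d : ℤ) | (n : ZMod (4 * d)).val) : ℤ) : ℂ) else 0) = _
  rw [if_pos hu, ZMod.val_natCast, ← jacobiSym.mod_right' d ho]

/-- The product character `χ_{d} χ`, of modulus `4 * d * N`. -/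
def twist {N : ℕ} (d : ℕ) [NeZero d] (χ : DirichletCharacter ℂ N) :
    DirichletCharacter ℂ (4 * d * N) :=
  (chi d).changeLevel (Dvd.intro N rfl) * χ.changeLevel (Dvd.intro_left (4 * d) rfl)

/-- `L^{(P)}(s, χ) = L(s, χ) ∏_{p ∣ P} (1 - χ(p) p^{-s})`, with `L(s, χ)` the analytically
continued Dirichlet `L`-function. -/
def LRemoved {q : ℕ} [NeZero q] (P : ℕ) (s : ℂ) (χ : DirichletCharacter ℂ q) : ℂ :=
  DirichletCharacter.LFunction χ s *
    ∏ p ∈ P.primeFactors, (1 - χ (p : ZMod q) * (p : ℂ) ^ (-s))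

/-- The correction polynomial `P_{d₀,d₁}^{(χ)}(s)`, a product over the prime powers
`p ^ α` exactly dividing `d₁`. -/
def corr {N : ℕ} (d₀ d₁ : ℕ) [NeZero d₀] (χ : DirichletCharacter ℂ N) (s : ℂ) : ℂ :=
  d₁.factorization.prod fun p α =>
    (∑ n ∈ Finset.range (α + 1),
        χ ((p ^ (2 * n) : ℕ) : ZMod N) * (p : ℂ) ^ ((n : ℂ) - 2 * n * s)) -
      ∑ n ∈ Finset.range α,
        twist d₀ χ ((p ^ (2 * n + 1) : ℕ) : ZMod (4 * d₀ * N)) *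
          (p : ℂ) ^ ((n : ℂ) - (2 * n + 1) * s)

/-- Smooth weight functions: smooth, non-negative, supported on `[1/4, 5/4]`
and equal to `1` on `[1/2, 1]`. -/
structure IsSmoothWeight (h : ℝ → ℝ) : Prop where
  smooth : ContDiff ℝ ∞ h
  nonneg : ∀ x, 0 ≤ h x
  support_subset : Function.support h ⊆ Set.Icc (1 / 4) (5 / 4)
  eq_one : ∀ x ∈ Set.Icc (1 / 2 : ℝ) 1, h x = 1

/-- The corrected smoothed first moment
`S(X; χ) = ∑_{(d, 2N) = 1} L^{(2N)}(1/2, χ_{d₀} χ) P_{d₀,d₁}^{(χ)}(1/2) h(d / X)`.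
For `X > 0` and `h` supported on `[1/4, 5/4]` only finitely many terms are non-zero. -/
def S (h : ℝ → ℝ) {N : ℕ} [NeZero N] (χ : DirichletCharacter ℂ N) (X : ℝ) : ℂ :=
  ∑' d : ℕ, if d.Coprime (2 * N) then
    LRemoved (2 * N) (1 / 2) (twist (sqfree d) χ) *
      corr (sqfree d) (sqRoot d) χ (1 / 2) * (h ((d : ℝ) / X) : ℂ)
  else 0

end LMoment

end

/-! ### The quadratic Gauss sum from Jacobi's theta function -/

noncomputable section
namespace LMoment
open Complex Filter Topology HurwitzZeta Finset
open scoped Real NumberTheorySymbols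

/-! Write d = d₀d₁² and let t be the primitive character behind χ_{d₀}χ. At s = 1/2 the correction
polynomial is ∏_{p^α ∥ d₁} (α + 1 - α t(p)/√p), which is the value at d₁ of the Dirichlet
convolution of μ(r)t(r)/√r with the divisor function (`corr_eq`). So the corrected central value
contains L(1/2, χ_{d₀}χ) once for every factorization ef of every quotient d₁/r, and each copy may
be expanded by the approximate functional equation with its own balance parameter, here Y = (e/f)².
The root number is 1, hence the two halves of the expansion are exchanged by e ↔ f and the sum
contains one of them twice. The Möbius sum over r then restricts n to (n, g) = 1, where g = rf and
d₁ = eg, and χ_{d₀}(n) with this restriction is (k/n) for k = d₀g² = d/e². Apart from the prime 2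
the central value thus becomes (`mul_sum_sieveWeight`, `centralValue_eq`) 2 ∑_{e² ∣ d} ∑_n χ(n)
(k/n) n^{-1/2} W(n²e²/(kF)), with d = ke², where W is a normalized incomplete Gamma function and kF
plays the role of a conductor. Squarefree parts have disappeared: summing over d is summing over all
pairs (k, e) prime to 2N. The value of t at 2 and the factor F depend only on d modulo 8, so d is
split into classes modulo 8, and the prime 2 contributes a geometric series on each class.

For fixed e and odd n the smooth sum of (k/n) over k is treated by partial summation. Its deviation
from the expected main term, which is zero unless n is a square, is bounded in two ways: by
Pólya–Vinogradov, roughly 2^{ω(m)} √n log n with m the odd part of N, and trivially by X/e². The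
geometric mean of the two, combined with W(z) ≪ z^{-3/8-ε}, is summable over n and e and costs √X
(XN)^{3/8+ε} up to divisor functions; this is the origin of the exponent 3/8
(`exists_weightedSum_error`).

For n = l² the main terms collapse: since ∑_{el=L} φ(l)/L² = 1/L, they combine to a multiple of ∑
L^{-1} W(L⁴/(XQ)) over L prime to 2m (`mainPair_sq`), averaged over the weight. This is an average
of sieved harmonic sums, which yields the logarithm, Euler's constant and ∑ log p/(p - 1), while the
mean of log t against the density of W is digamma(σ) - log π, where σ is 1/4 or 3/4 according to the
parity of χ (`logMean_spec`).

Let M = ∫h and P = ∏_{p ∣ 2m} (1 - 1/p). Then a_N = ½P²M, and b_N = ½P²(M·ρ + ∫h(y) log y dy) with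
an explicit constant ρ, called `coeffRatio`. The support of h places ∫h log between -M log 4 and M
log(5/4). For N = 1 one has ρ = 3γ + log 2 - π/2 - log π, just below -log(5/4), so b_1 is negative;
for N > 1 one has ρ > log 4 (`coeffRatio_gt`), so b_N is positive. Both inequalities leave a margin,
which gives the lower bound for |b_N|.

The functional equation with root number 1 comes from the theta functional equation of a function
that is its own finite Fourier transform (`SelfDual`). Self-duality of the quadratic characters
rests on the value of the quadratic Gauss sum, read off from Jacobi's theta function near a rational
point. If χ is trivial and d is a square, the twist is principal and the expansion is unavailable;
there are O(√X) such d, each contributing O(X^{3/8}). -/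

theorem hasSum_int_of_residues (q : ℕ) [NeZero q] {g : ℤ → ℂ} {s : Fin q → ℂ}
    (h : ∀ b : Fin q, HasSum (fun m : ℤ => g ((b : ℕ) + q * m)) (s b)) :
    HasSum g (∑ b, s b) := by
  rw [← (Int.divModEquiv q).symm.hasSum_iff]
  have h2 : HasSum (fun x : Fin q × ℤ => g ((x.1 : ℕ) + q * x.2)) (∑ b, s b) := by
    have h3 : ∀ b : Fin q, HasSum (fun x : Fin q × ℤ =>
        if x.1 = b then g ((x.1 : ℕ) + q * x.2) else 0) (s b) := by
      intro b
      have hinj : Function.Injective (fun m : ℤ => (b, m)) := fun m m' h => by simpa using h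
      rw [← hinj.hasSum_iff]
      · simpa [Function.comp_def] using h b
      · rintro ⟨b', m⟩ hx
        have : b' ≠ b := by
          rintro rfl
          exact hx ⟨m, rfl⟩
        simp [this]
    refine (hasSum_sum fun b (_ : b ∈ univ) => h3 b).congr_fun fun x => ?_
    simp
  rw [← (Equiv.prodComm _ _).hasSum_iff]
  refine h2.congr_fun ?_
  rintro ⟨b, m⟩
  simp [Int.divModEquiv_symm_apply]
  congr 1
  ring

theorem hasSum_even_theta (q : ℕ) [NeZero q] (f : ZMod q → ℂ) {t : ℝ} (ht : 0 < t) :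
    HasSum (fun n : ℤ => f n * (rexp (-π * n ^ 2 * t) : ℂ))
      (∑ b : Fin q, f ((b : ℕ) : ZMod q) *
        (evenKernel ((((b : ℕ) : ℝ) / q : ℝ) : UnitAddCircle) (q ^ 2 * t) : ℂ)) := by
  apply hasSum_int_of_residues
  intro b
  have hq : (q : ℝ) ≠ 0 := Nat.cast_ne_zero.2 (NeZero.ne q)
  have := (hasSum_int_evenKernel (((b : ℕ) : ℝ) / q) (t := q ^ 2 * t) (by positivity))
  rw [← hasSum_ofReal] at this
  refine (this.mul_left (f ((b : ℕ) : ZMod q))).congr_fun fun m => ?_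
  push_cast
  simp only [CharP.cast_eq_zero, zero_mul, add_zero]
  congr 2
  have : (q : ℂ) ≠ 0 := Nat.cast_ne_zero.2 (NeZero.ne q)
  field_simp
  ring

/-- The functional equation turns the left side into 1/r times the cosine kernel at 1/(r²t) → ∞,
where only the constant term 1 survives. -/
theorem tendsto_sqrt_mul_evenKernel (a : UnitAddCircle) {r : ℝ} (hr : 0 < r) :
    Tendsto (fun t : ℝ => √t * evenKernel a (r ^ 2 * t)) (𝓝[>] 0) (𝓝 (1 / r)) := by
  obtain ⟨p, hp, hO⟩ := isBigO_atTop_cosKernel_sub a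
  have h1 : Tendsto (fun x => cosKernel a x) atTop (𝓝 1) := by
    have : Tendsto (fun x => cosKernel a x - 1) atTop (𝓝 0) := by
      refine hO.trans_tendsto ?_
      have : Tendsto (fun x : ℝ => p * x) atTop atTop := tendsto_id.const_mul_atTop hp
      exact (Real.tendsto_exp_neg_atTop_nhds_zero.comp this).congr fun x => by simp
    simpa using this.add_const 1
  have h2 : Tendsto (fun t : ℝ => 1 / (r ^ 2 * t)) (𝓝[>] 0) atTop := by
    have : Tendsto (fun t : ℝ => (1 / r ^ 2) * t⁻¹) (𝓝[>] 0) atTop :=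
      tendsto_inv_nhdsGT_zero.const_mul_atTop (by positivity)
    refine this.congr fun t => ?_
    field_simp
  have h3 := (h1.comp h2).const_mul (1 / r)
  rw [mul_one] at h3
  refine h3.congr' ?_
  filter_upwards [self_mem_nhdsWithin] with t ht
  have ht : 0 < t := ht
  simp only [Function.comp]
  rw [evenKernel_functional_equation, ← Real.sqrt_eq_rpow, Real.sqrt_mul (by positivity),
    Real.sqrt_sq hr.le]
  have := Real.sqrt_pos.2 ht
  field_simp

/-- Every residue class contributes equally as t → 0, so only the mean of the periodic coefficients
is visible at the cusp. -/
theorem tendsto_sqrt_mul_theta (q : ℕ) [NeZero q] (f : ZMod q → ℂ) :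
    Tendsto (fun t : ℝ => (√t : ℂ) * ∑' n : ℤ, f n * (rexp (-π * n ^ 2 * t) : ℂ)) (𝓝[>] 0)
      (𝓝 ((∑ b : ZMod q, f b) / q)) := by
  have hq : (0 : ℝ) < q := Nat.cast_pos.2 (NeZero.pos q)
  have h : Tendsto (fun t : ℝ => ∑ b : Fin q, f ((b : ℕ) : ZMod q) *
      ((√t * evenKernel ((((b : ℕ) : ℝ) / q : ℝ) : UnitAddCircle) (q ^ 2 * t) : ℝ) : ℂ))
      (𝓝[>] 0) (𝓝 (∑ b : Fin q, f ((b : ℕ) : ZMod q) * ((1 / q : ℝ) : ℂ))) := by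
    refine tendsto_finsetSum _ fun b _ => ?_
    refine Tendsto.const_mul _ ?_
    exact (continuous_ofReal.tendsto _).comp (tendsto_sqrt_mul_evenKernel _ hq)
  have e : (∑ b : Fin q, f ((b : ℕ) : ZMod q) * ((1 / q : ℝ) : ℂ)) = (∑ b : ZMod q, f b) / q := by
    rw [← Finset.sum_mul, Fintype.sum_equiv (ZMod.finEquiv q).toEquiv
      (fun b : Fin q => f ((b : ℕ) : ZMod q)) f]
    · push_cast; ring
    · intro b
      obtain ⟨n, rfl⟩ : ∃ n, q = n + 1 := ⟨q - 1, by have := NeZero.pos q; omega⟩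
      congr 1
      exact Fin.cast_val_eq_self b
  rw [← e]
  refine h.congr' ?_
  filter_upwards [self_mem_nhdsWithin] with t ht
  rw [(hasSum_even_theta q f ht).tsum_eq, Finset.mul_sum]
  refine Finset.sum_congr rfl fun b _ => ?_
  push_cast
  ring

/-- Lets the point approach the cusp along a curve instead of vertically. The horizontal
displacement δ is smaller than the height η by a factor O(t); replacing exp(πi n²δ) by 1 costs
O(n²|δ|) in the nth term, which half of the Gaussian decay absorbs. -/
theorem tendsto_sqrt_mul_theta_perturbed (q : ℕ) [NeZero q] (f : ZMod q → ℂ) (C : ℝ)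
    {η δ : ℝ → ℝ} (hη : Tendsto η (𝓝[>] 0) (𝓝[>] 0)) (hδ : ∀ t, 0 < t → |δ t| ≤ C * t * η t) :
    Tendsto (fun t : ℝ => (√(η t) : ℂ) *
      ∑' n : ℤ, f n * (rexp (-π * n ^ 2 * η t) : ℂ) * cexp (π * I * n ^ 2 * δ t)) (𝓝[>] 0)
      (𝓝 ((∑ b : ZMod q, f b) / q)) := by
  have hC : ∃ K, ∀ b, ‖f b‖ ≤ K := by
    refine ⟨∑ b, ‖f b‖, fun b => ?_⟩
    exact Finset.single_le_sum (f := fun b => ‖f b‖) (fun _ _ => norm_nonneg _) (mem_univ b)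
  obtain ⟨K, hK⟩ := hC
  have hmain := (tendsto_sqrt_mul_theta q f).comp hη
  have hpos : ∀ᶠ t in 𝓝[>] (0 : ℝ), 0 < η t := hη.eventually self_mem_nhdsWithin
  have hid : Tendsto (fun t : ℝ => t) (𝓝[>] 0) (𝓝 0) := tendsto_nhdsWithin_of_tendsto_nhds tendsto_id
  have hsum : ∀ t : ℝ, 0 < t → Summable (fun n : ℤ => rexp (-π * n ^ 2 * t)) := by
    intro t ht
    have := (hasSum_int_evenKernel 0 ht).summable
    simpa using this
  have herr : Tendsto (fun t : ℝ => (√(η t) : ℂ) *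
      ∑' n : ℤ, f n * (rexp (-π * n ^ 2 * η t) : ℂ) * (cexp (π * I * n ^ 2 * δ t) - 1))
      (𝓝[>] 0) (𝓝 0) := by
    have hη2 : Tendsto (fun t => η t / 2) (𝓝[>] 0) (𝓝[>] 0) := by
      refine tendsto_nhdsWithin_iff.2 ⟨?_, ?_⟩
      · simpa using (tendsto_nhds_of_tendsto_nhdsWithin hη).div_const 2
      · filter_upwards [hpos] with t ht
        exact half_pos ht
    have hb := ((tendsto_sqrt_mul_theta 1 (fun _ => 1)).comp hη2).norm
    have hb2 : Tendsto (fun t : ℝ => 2 * K * C * √2 * t * ‖((√(η t / 2) : ℝ) : ℂ) *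
        ∑' n : ℤ, (1 : ℂ) * (rexp (-π * n ^ 2 * (η t / 2)) : ℂ)‖) (𝓝[>] 0) (𝓝 0) := by
      have := (hid.const_mul (2 * K * C * √2)).mul hb
      simpa [Function.comp_def] using this
    refine squeeze_zero_norm' ?_ hb2
    filter_upwards [hpos, self_mem_nhdsWithin] with t ht ht0
    have ht0 : 0 < t := ht0
    have hKn : 0 ≤ K := (norm_nonneg _).trans (hK 0)
    have hS := hsum (η t / 2) (half_pos ht)
    have hbound : ‖∑' n : ℤ, f n * (rexp (-π * n ^ 2 * η t) : ℂ) *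
        (cexp (π * I * n ^ 2 * δ t) - 1)‖ ≤
        ∑' n : ℤ, K * (2 * C * t) * rexp (-π * n ^ 2 * (η t / 2)) := by
      refine tsum_of_norm_bounded (hS.mul_left _).hasSum fun n => ?_
      rw [norm_mul, norm_mul, mul_assoc ‖f n‖, mul_assoc K]
      refine mul_le_mul (hK _) ?_ (by positivity) hKn
      rw [Complex.norm_real, Real.norm_of_nonneg (Real.exp_pos _).le]
      have h1 : ‖cexp (π * I * n ^ 2 * δ t) - 1‖ ≤ π * n ^ 2 * |δ t| := by
        have := Real.norm_exp_I_mul_ofReal_sub_one_le (x := π * n ^ 2 * δ t)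
        have e : cexp (π * I * n ^ 2 * δ t) = cexp (I * ((π * n ^ 2 * δ t : ℝ) : ℂ)) := by
          congr 1; push_cast; ring
        rw [e]
        refine this.trans (le_of_eq ?_)
        rw [Real.norm_eq_abs, abs_mul, abs_of_nonneg (by positivity)]
      have h2 : π * n ^ 2 * |δ t| ≤ 2 * C * t * (π * n ^ 2 * (η t / 2)) := by
        have := mul_le_mul_of_nonneg_left (hδ t ht0) (show 0 ≤ π * (n : ℝ) ^ 2 by positivity)
        linarith
      have hCn : 0 ≤ C * t := by
        have := (abs_nonneg _).trans (hδ t ht0)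
        exact nonneg_of_mul_nonneg_left this ht
      have h3 : π * n ^ 2 * (η t / 2) ≤ rexp (π * n ^ 2 * (η t / 2)) :=
        (by linarith [Real.add_one_le_exp (π * n ^ 2 * (η t / 2))])
      calc rexp (-π * n ^ 2 * η t) * ‖cexp (π * I * n ^ 2 * δ t) - 1‖
          ≤ rexp (-π * n ^ 2 * η t) * (2 * C * t * rexp (π * n ^ 2 * (η t / 2))) := by
            refine mul_le_mul_of_nonneg_left (h1.trans (h2.trans ?_)) (Real.exp_pos _).le
            exact mul_le_mul_of_nonneg_left h3 (by linarith)
        _ = 2 * C * t * (rexp (-π * n ^ 2 * η t) * rexp (π * n ^ 2 * (η t / 2))) := by ring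
        _ = 2 * C * t * rexp (-π * n ^ 2 * (η t / 2)) := by
            rw [← Real.exp_add]; congr 2; ring
    rw [norm_mul, Complex.norm_real, Real.norm_of_nonneg (Real.sqrt_nonneg _), norm_mul,
      Complex.norm_real, Real.norm_of_nonneg (Real.sqrt_nonneg _)]
    simp only [one_mul]
    rw [← Complex.ofReal_tsum, Complex.norm_real, Real.norm_of_nonneg
      (tsum_nonneg fun n => (Real.exp_pos _).le)]
    refine (mul_le_mul_of_nonneg_left hbound (Real.sqrt_nonneg _)).trans (le_of_eq ?_)
    rw [tsum_mul_left, Real.sqrt_div ht.le]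
    generalize ∑' n : ℤ, rexp (-π * n ^ 2 * (η t / 2)) = Z
    field_simp
  have := hmain.add herr
  rw [add_zero] at this
  refine this.congr' ?_
  filter_upwards [hpos] with t ht
  have hs1 : Summable (fun n : ℤ => f n * (rexp (-π * n ^ 2 * η t) : ℂ)) :=
    (hasSum_even_theta q f ht).summable
  have hs2 : Summable (fun n : ℤ => f n * (rexp (-π * n ^ 2 * η t) : ℂ) *
      (cexp (π * I * n ^ 2 * δ t) - 1)) := by
    refine Summable.of_norm_bounded (g := fun n : ℤ => 2 * ‖f n * (rexp (-π * n ^ 2 * η t) : ℂ)‖)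
      (hs1.norm.mul_left 2) fun n => ?_
    rw [norm_mul, mul_comm]
    refine mul_le_mul_of_nonneg_right ?_ (norm_nonneg _)
    refine (norm_sub_le _ _).trans ?_
    have : (π * I * n ^ 2 * δ t : ℂ) = ((π * n ^ 2 * δ t : ℝ) : ℂ) * I := by push_cast; ring
    rw [this, Complex.norm_exp_ofReal_mul_I]
    norm_num
  simp only [Function.comp]
  rw [← mul_add, ← hs1.tsum_add hs2]
  congr 2
  ext n
  ring

/-- Landsberg–Schaar method: evaluate θ at τ = 2/q + it as t → 0. Directly, the coefficients e(n²/q)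
have period q and mean G/q. After τ ↦ -1/τ the point tends to the cusp -q/2, where the coefficients
have period 2 and mean (1 + (-i)^q)/2. The functional equation of θ equates the two limits. -/
theorem sum_stdAddChar_sq (q : ℕ) [NeZero q] :
    ∑ b : ZMod q, ZMod.stdAddChar (b ^ 2) = (1 + (-I) ^ q) / (1 - I) * √q := by
  have hq : (0 : ℝ) < q := Nat.cast_pos.2 (NeZero.pos q)
  have hqc : (q : ℂ) ≠ 0 := Nat.cast_ne_zero.2 (NeZero.ne q)
  set G := ∑ b : ZMod q, ZMod.stdAddChar (b ^ 2) with hG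
  let τ : ℝ → ℂ := fun t => 2 / q + I * t
  -- Here -1/τ = -q/2 + δ + iη.
  let η : ℝ → ℝ := fun t => t / (4 / q ^ 2 + t ^ 2)
  let δ : ℝ → ℝ := fun t => q / 2 * t * η t
  have hid : Tendsto (fun t : ℝ => t) (𝓝[>] 0) (𝓝 0) := tendsto_nhdsWithin_of_tendsto_nhds tendsto_id
  have hden : ∀ t : ℝ, 0 < 4 / (q : ℝ) ^ 2 + t ^ 2 := fun t => by positivity
  have hη : Tendsto η (𝓝[>] 0) (𝓝[>] 0) := by
    refine tendsto_nhdsWithin_iff.2 ⟨?_, ?_⟩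
    · have : Tendsto η (𝓝 0) (𝓝 (η 0)) := by
        apply Continuous.tendsto
        exact continuous_id.div (by fun_prop) fun t => (hden t).ne'
      simp only [η, zero_div] at this
      exact tendsto_nhdsWithin_of_tendsto_nhds this
    · filter_upwards [self_mem_nhdsWithin] with t ht
      exact div_pos ht (hden t)
  have hA : Tendsto (fun t : ℝ => (√t : ℂ) * jacobiTheta (τ t)) (𝓝[>] 0) (𝓝 (G / q)) := by
    refine (tendsto_sqrt_mul_theta q (fun b => ZMod.stdAddChar (b ^ 2))).congr fun t => ?_
    congr 1
    refine tsum_congr fun n => ?_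
    rw [← Int.cast_pow, ZMod.stdAddChar_coe, Complex.ofReal_exp, ← Complex.exp_add]
    congr 1
    simp only [τ]
    push_cast
    linear_combination (-π * n ^ 2 * t : ℂ) * I_sq
  let f : ZMod 2 → ℂ := ![1, (-I) ^ q]
  have hf : ∀ n : ℤ, f n = cexp (-π * I * n ^ 2 * q / 2) := by
    intro n
    rcases Int.even_or_odd' n with ⟨m, rfl | rfl⟩
    · have e1 : ((2 * m : ℤ) : ZMod 2) = 0 := by
        push_cast
        rw [show (2 : ZMod 2) = 0 from rfl, zero_mul]
      rw [e1]
      have e2 : (-π * I * ((2 * m : ℤ) : ℂ) ^ 2 * q / 2 : ℂ) = ((-(m ^ 2 * q) : ℤ) : ℂ) * (2 * π * I) := by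
        push_cast; ring
      rw [e2, Complex.exp_int_mul_two_pi_mul_I]
      rfl
    · have e1 : ((2 * m + 1 : ℤ) : ZMod 2) = 1 := by
        push_cast
        rw [show (2 : ZMod 2) = 0 from rfl, zero_mul, zero_add]
      rw [e1]
      have e2 : (-π * I * ((2 * m + 1 : ℤ) : ℂ) ^ 2 * q / 2 : ℂ) =
          ((-((m ^ 2 + m) * q) : ℤ) : ℂ) * (2 * π * I) + (q : ℂ) * (-(π / 2 * I)) := by
        push_cast; ring
      rw [e2, Complex.exp_add, Complex.exp_int_mul_two_pi_mul_I, Complex.exp_nat_mul,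
        Complex.exp_neg, Complex.exp_pi_div_two_mul_I, Complex.inv_I, one_mul]
      rfl
  have hB : Tendsto (fun t : ℝ => (√(η t) : ℂ) * jacobiTheta (-1 / τ t)) (𝓝[>] 0)
      (𝓝 ((1 + (-I) ^ q) / 2)) := by
    have h := tendsto_sqrt_mul_theta_perturbed 2 f (q / 2) hη (δ := δ) (by
      intro t ht
      have : 0 ≤ η t := (div_pos ht (hden t)).le
      rw [abs_of_nonneg]
      simp only [δ]; positivity)
    have e : (∑ b : ZMod 2, f b) / (2 : ℕ) = (1 + (-I) ^ q) / 2 := by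
      have : ∑ b : ZMod 2, f b = 1 + (-I) ^ q := Fin.sum_univ_two f
      rw [this]; norm_num
    rw [e] at h
    refine h.congr' ?_
    filter_upwards [self_mem_nhdsWithin] with t ht
    congr 1
    refine tsum_congr fun n => ?_
    rw [hf, Complex.ofReal_exp, ← Complex.exp_add, ← Complex.exp_add]
    congr 1
    have hτ : τ t ≠ 0 := by
      intro h
      have := congrArg Complex.im h
      simp [τ] at this
      exact (ne_of_gt ht) this
    have hd : (4 / (q : ℂ) ^ 2 + t ^ 2) ≠ 0 := by
      have := Complex.ofReal_ne_zero.2 (hden t).ne'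
      push_cast at this
      exact this
    have key : -1 / τ t = -(q : ℂ) / 2 + δ t + I * η t := by
      rw [div_eq_iff hτ]
      simp only [δ, η, τ]
      push_cast
      have h4 : (4 + (q : ℂ) ^ 2 * t ^ 2) ≠ 0 := by
        intro h
        apply hd
        field_simp
        linear_combination h
      have e : (t / (4 / (q : ℂ) ^ 2 + t ^ 2) : ℂ) = q ^ 2 * t / (4 + q ^ 2 * t ^ 2) := by
        field_simp
      rw [e]
      field_simp
      ring_nf
      simp only [I_sq]
      ring
    rw [key]
    push_cast
    linear_combination (-π * n ^ 2 * η t : ℂ) * I_sq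
  have hC : Tendsto (fun t : ℝ => ((√(4 / (q : ℝ) ^ 2 + t ^ 2) : ℝ) : ℂ) *
      (1 / (-I * τ t) ^ (1 / 2 : ℂ)) * ((√(η t) : ℂ) * jacobiTheta (-1 / τ t))) (𝓝[>] 0)
      (𝓝 (((√(4 / (q : ℝ) ^ 2 + 0 ^ 2) : ℝ) : ℂ) * (1 / (-I * τ 0) ^ (1 / 2 : ℂ)) *
        ((1 + (-I) ^ q) / 2))) := by
    refine Tendsto.mul (Tendsto.mul ?_ ?_) hB
    · refine tendsto_nhdsWithin_of_tendsto_nhds ?_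
      exact Continuous.tendsto (f := fun t : ℝ => ((√(4 / (q : ℝ) ^ 2 + t ^ 2) : ℝ) : ℂ)) (by fun_prop) 0
    · refine tendsto_nhdsWithin_of_tendsto_nhds ?_
      have hs : -I * τ 0 ∈ slitPlane := by
        right
        simp [τ, NeZero.ne q]
      have hne : (-I * τ 0) ^ (1 / 2 : ℂ) ≠ 0 := by
        rw [Ne, Complex.cpow_eq_zero_iff]
        exact fun h => slitPlane_ne_zero hs h.1
      refine Tendsto.div tendsto_const_nhds ?_ hne
      refine Tendsto.cpow ?_ tendsto_const_nhds hs
      exact Continuous.tendsto (f := fun t : ℝ => -I * τ t) (by fun_prop) 0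
  have heq : G / q = ((√(4 / (q : ℝ) ^ 2 + 0 ^ 2) : ℝ) : ℂ) * (1 / (-I * τ 0) ^ (1 / 2 : ℂ)) *
        ((1 + (-I) ^ q) / 2) := by
    refine tendsto_nhds_unique hA (hC.congr' ?_)
    filter_upwards [self_mem_nhdsWithin] with t ht
    have ht : 0 < t := ht
    have hFE : jacobiTheta (τ t) = 1 / (-I * τ t) ^ (1 / 2 : ℂ) * jacobiTheta (-1 / τ t) := by
      have := jacobiTheta₂_functional_equation 0 (τ t)
      simpa [← jacobiTheta_eq_jacobiTheta₂] using this
    have hs : √t = √(4 / (q : ℝ) ^ 2 + t ^ 2) * √(η t) := by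
      rw [← Real.sqrt_mul (hden t).le]
      congr 1
      simp only [η]
      have := (hden t).ne'
      field_simp
    rw [hFE, hs]
    push_cast
    ring
  -- -2i/q is the square of (1 - i)/√q, whose real part is positive, so this is the principal root.
  have hsq : (-I * τ 0) ^ (1 / 2 : ℂ) = (1 - I) / √q := by
    have hqs : ((√q : ℝ) : ℂ) ^ 2 = q := by
      rw [← Complex.ofReal_pow, Real.sq_sqrt hq.le]; simp
    have hqs0 : ((√q : ℝ) : ℂ) ≠ 0 := by
      rw [Complex.ofReal_ne_zero]; exact (Real.sqrt_pos.2 hq).ne'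
    have e : -I * τ 0 = ((1 - I) / √q) ^ 2 := by
      simp only [τ]
      rw [div_pow, hqs]
      field_simp
      push_cast
      ring_nf
      simp only [I_sq]
      ring
    rw [e, one_div, Complex.sq_cpow_two_inv]
    have : ((1 - I) / ((√q : ℝ) : ℂ)).re = 1 / √q := by
      rw [Complex.div_ofReal_re]; simp
    rw [this]
    exact one_div_pos.2 (Real.sqrt_pos.2 hq)
  have hs4 : √(4 / (q : ℝ) ^ 2 + 0 ^ 2) = 2 / q := by
    rw [show (4 / (q : ℝ) ^ 2 + 0 ^ 2) = (2 / q) ^ 2 by ring]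
    exact Real.sqrt_sq (by positivity)
  have h1I : (1 - I) ≠ 0 := by
    intro h
    have := congrArg Complex.im h
    simp at this
  rw [hsq, hs4] at heq
  field_simp at heq
  push_cast at heq
  field_simp at heq
  field_simp
  linear_combination heq

/-! ### Self-dual functions and signs of Gauss sums -/

/-- `ψ` is `q`-periodic and equal to its own finite Fourier transform up to the factor `κ √q`. -/
structure SelfDual (q : ℕ) [NeZero q] (κ : ℂ) (ψ : ℤ → ℂ) : Prop where
  periodic : ∀ a b : ℤ, (a : ZMod q) = b → ψ a = ψ b
  dual : ∀ n : ℤ, ∑ b : ZMod q, ψ (b.val : ℤ) * ZMod.stdAddChar (b * (n : ZMod q)) = κ * √q * ψ n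

/-- The normalized quadratic Gauss sum for odd modulus. -/
def gaussSign (m : ℕ) : ℂ := if m % 4 = 1 then 1 else I

/-- Chinese remainder theorem: the classes modulo q₁q₂ are xq₂ + yq₁ and the exponential factors
accordingly. Multiplicativity extracts ψ₁(q₂)ψ₂(q₁), which enters the new constant. -/
theorem SelfDual.mul {q₁ q₂ : ℕ} [NeZero q₁] [NeZero q₂] {κ₁ κ₂ : ℂ} {ψ₁ ψ₂ : ℤ → ℂ}
    (h₁ : SelfDual q₁ κ₁ ψ₁) (h₂ : SelfDual q₂ κ₂ ψ₂) (m₁ : ∀ a b, ψ₁ (a * b) = ψ₁ a * ψ₁ b)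
    (m₂ : ∀ a b, ψ₂ (a * b) = ψ₂ a * ψ₂ b) (hc : q₁.Coprime q₂) :
    SelfDual (q₁ * q₂) (ψ₁ q₂ * ψ₂ q₁ * κ₁ * κ₂) (fun n => ψ₁ n * ψ₂ n) where
  periodic a b h := by
    have e1 : (a : ZMod q₁) = b := by
      have := congrArg (ZMod.castHom (dvd_mul_right q₁ q₂) (ZMod q₁)) h
      simpa using this
    have e2 : (a : ZMod q₂) = b := by
      have := congrArg (ZMod.castHom (dvd_mul_left q₂ q₁) (ZMod q₂)) h
      simpa using this
    rw [h₁.periodic a b e1, h₂.periodic a b e2]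
  dual n := by
    let φ : ZMod q₁ × ZMod q₂ → ZMod (q₁ * q₂) := fun x => ((x.1.val * q₂ + x.2.val * q₁ : ℕ) : ZMod (q₁ * q₂))
    have c1 : ∀ x, ZMod.castHom (dvd_mul_right q₁ q₂) (ZMod q₁) (φ x) = x.1 * q₂ := by
      intro x; simp only [φ, map_natCast]; push_cast; simp
    have c2 : ∀ x, ZMod.castHom (dvd_mul_left q₂ q₁) (ZMod q₂) (φ x) = x.2 * q₁ := by
      intro x; simp only [φ, map_natCast]; push_cast; simp
    have hinj : Function.Injective φ := by
      intro x y hxy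
      have u1 : IsUnit (q₂ : ZMod q₁) := (ZMod.isUnit_iff_coprime _ _).2 hc.symm
      have u2 : IsUnit (q₁ : ZMod q₂) := (ZMod.isUnit_iff_coprime _ _).2 hc
      refine Prod.ext ?_ ?_
      · apply u1.mul_left_injective
        simp only [← c1, hxy]
      · apply u2.mul_left_injective
        simp only [← c2, hxy]
    have hbij : Function.Bijective φ := by
      rw [Fintype.bijective_iff_injective_and_card]
      refine ⟨hinj, ?_⟩
      rw [Fintype.card_prod, ZMod.card, ZMod.card, ZMod.card]
    rw [← (Equiv.ofBijective φ hbij).sum_comp, Fintype.sum_prod_type]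
    have hterm : ∀ x : ZMod q₁, ∀ y : ZMod q₂,
        ψ₁ ((φ (x, y)).val : ℤ) * ψ₂ ((φ (x, y)).val : ℤ) *
          ZMod.stdAddChar (φ (x, y) * (n : ZMod (q₁ * q₂))) =
        (ψ₁ q₂ * (ψ₁ (x.val : ℤ) * ZMod.stdAddChar (x * (n : ZMod q₁)))) *
          (ψ₂ q₁ * (ψ₂ (y.val : ℤ) * ZMod.stdAddChar (y * (n : ZMod q₂)))) := by
      intro x y
      have v1 : ψ₁ ((φ (x, y)).val : ℤ) = ψ₁ (x.val : ℤ) * ψ₁ q₂ := by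
        rw [← m₁]
        apply h₁.periodic
        have := c1 (x, y)
        rw [ZMod.castHom_apply, ZMod.cast_eq_val] at this
        push_cast
        rw [this]; simp
      have v2 : ψ₂ ((φ (x, y)).val : ℤ) = ψ₂ (y.val : ℤ) * ψ₂ q₁ := by
        rw [← m₂]
        apply h₂.periodic
        have := c2 (x, y)
        rw [ZMod.castHom_apply, ZMod.cast_eq_val] at this
        push_cast
        rw [this]; simp
      have q1 : (q₁ : ℂ) ≠ 0 := Nat.cast_ne_zero.2 (NeZero.ne _)
      have q2 : (q₂ : ℂ) ≠ 0 := Nat.cast_ne_zero.2 (NeZero.ne _)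
      have v3 : (ZMod.stdAddChar (φ (x, y) * (n : ZMod (q₁ * q₂))) : ℂ) =
          ZMod.stdAddChar (x * (n : ZMod q₁)) * ZMod.stdAddChar (y * (n : ZMod q₂)) := by
        have e0 : φ (x, y) * (n : ZMod (q₁ * q₂)) =
            (((x.val * q₂ + y.val * q₁) * n : ℤ) : ZMod (q₁ * q₂)) := by
          simp only [φ]; push_cast; ring
        have e1 : x * (n : ZMod q₁) = ((x.val * n : ℤ) : ZMod q₁) := by push_cast; simp
        have e2 : y * (n : ZMod q₂) = ((y.val * n : ℤ) : ZMod q₂) := by push_cast; simp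
        rw [e0, e1, e2, ZMod.stdAddChar_coe, ZMod.stdAddChar_coe, ZMod.stdAddChar_coe,
          ← Complex.exp_add]
        congr 1
        push_cast
        field_simp
      rw [v1, v2, v3]; ring
    simp only [Equiv.ofBijective_apply, hterm, ← Finset.mul_sum, ← Finset.sum_mul]
    rw [h₁.dual, h₂.dual]
    rw [Nat.cast_mul, Real.sqrt_mul (Nat.cast_nonneg _)]
    push_cast; ring

theorem gaussSign_formula {p : ℕ} (hp : Odd p) : (1 + (-I) ^ p) / (1 - I) = gaussSign p := by
  have h1I : (1 - I) ≠ 0 := by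
    intro h
    have := congrArg Complex.im h
    simp at this
  have h4 : (-I) ^ 4 = 1 := by rw [neg_pow, I_pow_four]; norm_num
  have e : (-I) ^ p = (-I) ^ (p % 4) := by
    conv_lhs => rw [← Nat.div_add_mod p 4, pow_add, pow_mul, h4, one_pow, one_mul]
  rw [e, gaussSign]
  have : p % 4 = 1 ∨ p % 4 = 3 := Nat.odd_mod_four_iff.1 (Nat.odd_iff.1 hp)
  rcases this with h | h
  · rw [h]; simp only [if_true, pow_one]; rw [← sub_eq_add_neg, div_self h1I]
  · rw [h, if_neg (by norm_num), div_eq_iff h1I]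
    ring_nf
    rw [show I ^ 3 = -I from I_pow_three, I_sq]; ring

/-- The equation b² = c has 1 + (c/p) solutions, so the sum of e(b²/p) is the Gauss sum of the
Legendre symbol. For p ∤ n substitute b ↦ bn; for p ∣ n both sides vanish. -/
theorem selfDual_prime (p : ℕ) [Fact p.Prime] (hp : p ≠ 2) :
    SelfDual p (gaussSign p) (fun n => ((J(n | p) : ℤ) : ℂ)) where
  periodic a b h := by
    rw [jacobiSym.mod_left' ((ZMod.intCast_eq_intCast_iff a b p).1 h)]
  dual n := by
    have hodd : Odd p := (Fact.out : p.Prime).odd_of_ne_two hp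
    have hchar : ringChar (ZMod p) ≠ 2 := by rwa [ZMod.ringChar_zmod_n]
    let χ : MulChar (ZMod p) ℂ := (quadraticChar (ZMod p)).ringHomComp (Int.castRingHom ℂ)
    have hχ : ∀ a : ℤ, ((J(a | p) : ℤ) : ℂ) = χ (a : ZMod p) := by
      intro a
      rw [← jacobiSym.legendreSym.to_jacobiSym]
      rfl
    have hχ1 : χ ≠ 1 := by
      rw [Ne, MulChar.ringHomComp_eq_one_iff (RingHom.injective_int _)]
      exact quadraticChar_ne_one hchar
    have hsum0 : ∑ b : ZMod p, χ b = 0 := MulChar.sum_eq_zero_of_ne_one hχ1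
    have hadd0 : ∑ b : ZMod p, ZMod.stdAddChar b = (0 : ℂ) := by
      have := (ZMod.isPrimitive_stdAddChar p) (one_ne_zero)
      rw [AddChar.mulShift_one] at this
      exact AddChar.sum_eq_zero_of_ne_one this
    have hg : ∑ b : ZMod p, χ b * ZMod.stdAddChar b = gaussSign p * √p := by
      have h1 := sum_stdAddChar_sq p
      rw [gaussSign_formula hodd] at h1
      rw [← h1]
      have h2 : ∑ b : ZMod p, (ZMod.stdAddChar (b ^ 2) : ℂ) =
          ∑ c : ZMod p, (χ c + 1) * ZMod.stdAddChar c := by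
        rw [← Finset.sum_fiberwise (s := univ) (g := fun b : ZMod p => b ^ 2)]
        refine Finset.sum_congr rfl fun c _ => ?_
        rw [Finset.sum_congr rfl (g := fun _ => (ZMod.stdAddChar c : ℂ))
          (fun b hb => by rw [(Finset.mem_filter.1 hb).2]), Finset.sum_const, nsmul_eq_mul]
        congr 1
        have := quadraticChar_card_sqrts hchar c
        have h3 : ((#{x : ZMod p | x ^ 2 = c} : ℤ) : ℂ) = χ c + 1 := by
          have e : ((χ c + 1 : ℂ)) = ((quadraticChar (ZMod p) c + 1 : ℤ) : ℂ) := by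
            push_cast; rfl
          rw [e, ← this]
          congr 2
          apply congrArg
          ext x; simp
        exact_mod_cast h3
      rw [h2]
      simp only [add_mul, one_mul, Finset.sum_add_distrib, hadd0, add_zero]
    simp only [hχ]
    push_cast
    simp only [ZMod.natCast_val, ZMod.cast_id', id_eq]
    by_cases hn : (n : ZMod p) = 0
    · rw [hn]
      simp only [mul_zero, AddChar.map_zero_eq_one, mul_one, hsum0]
      rw [MulChar.map_zero, mul_zero]
    · rw [← hg, Finset.sum_mul]
      have hu : IsUnit (n : ZMod p) := isUnit_iff_ne_zero.2 hn
      have hsq : χ n * χ n = 1 := by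
        rw [← map_mul, ← sq]
        change ((quadraticChar (ZMod p) (n ^ 2) : ℤ) : ℂ) = 1
        rw [quadraticChar_sq_one' hn]; simp
      rw [← Equiv.sum_comp (Equiv.mulRight₀ (n : ZMod p) hn) (fun b => χ b * ZMod.stdAddChar b * χ n)]
      refine Finset.sum_congr rfl fun b _ => ?_
      simp only [Equiv.mulRight₀_apply, map_mul]
      linear_combination (-χ b * ZMod.stdAddChar (b * (n : ZMod p))) * hsq

/-- The sign of quadratic reciprocity is exactly the failure of `gaussSign` to be multiplicative. -/
theorem gaussSign_mul {a b : ℕ} (ha : Odd a) (hb : Odd b) (hab : a.Coprime b) :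
    ((J((b : ℤ) | a) : ℤ) : ℂ) * ((J((a : ℤ) | b) : ℤ) : ℂ) * gaussSign a * gaussSign b =
      gaussSign (a * b) := by
  have hsq : ((J((b : ℤ) | a) : ℤ) : ℂ) * ((J((b : ℤ) | a) : ℤ) : ℂ) = 1 := by
    have := jacobiSym.sq_one (a := (b : ℤ)) (b := a) (by
      rw [Int.gcd_natCast_natCast]; exact hab.symm)
    rw [← sq]; exact_mod_cast this
  rcases Nat.odd_mod_four_iff.1 (Nat.odd_iff.1 ha) with h | h <;>
  rcases Nat.odd_mod_four_iff.1 (Nat.odd_iff.1 hb) with h' | h'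
  · rw [jacobiSym.quadratic_reciprocity_one_mod_four h hb, hsq]
    simp [gaussSign, h, h', Nat.mul_mod]
  · rw [jacobiSym.quadratic_reciprocity_one_mod_four h hb, hsq]
    simp [gaussSign, h, h', Nat.mul_mod]
  · rw [jacobiSym.quadratic_reciprocity_one_mod_four' ha h', hsq]
    simp [gaussSign, h, h', Nat.mul_mod]
  · rw [jacobiSym.quadratic_reciprocity_three_mod_four h h']
    push_cast
    rw [mul_neg, hsq]
    simp [gaussSign, h, h', Nat.mul_mod]

theorem selfDual_one : SelfDual 1 1 (fun _ => 1) where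
  periodic _ _ _ := rfl
  dual n := by
    have : ∀ b : ZMod 1, b = 0 := fun b => Subsingleton.elim _ _
    simp [this]

theorem selfDual_jacobiSym (m : ℕ) [NeZero m] (hm : Odd m) (hsq : Squarefree m) :
    SelfDual m (gaussSign m) (fun n => ((J(n | m) : ℤ) : ℂ)) := by
  have key : ∀ m : ℕ, Odd m → Squarefree m → ∃ h : NeZero m,
      SelfDual m (gaussSign m) (fun n => ((J(n | m) : ℤ) : ℂ)) := by
    intro m
    induction m using Nat.recOnMul with
    | zero => intro h; simp at h
    | one =>
      intro _ _
      refine ⟨inferInstance, ?_⟩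
      simpa [gaussSign] using selfDual_one
    | prime p hp =>
      intro h _
      have : Fact p.Prime := ⟨hp⟩
      exact ⟨inferInstance, selfDual_prime p (by rintro rfl; exact absurd h (by decide))⟩
    | mul a b iha ihb =>
      intro h hs
      have hab := Nat.odd_mul.1 h
      have hs' := (Nat.squarefree_mul_iff).1 hs
      obtain ⟨_, h1⟩ := iha hab.1 hs'.2.1
      obtain ⟨_, h2⟩ := ihb hab.2 hs'.2.2
      refine ⟨inferInstance, ?_⟩
      have := h1.mul h2 (fun x y => by rw [jacobiSym.mul_left]; push_cast; rfl)
        (fun x y => by rw [jacobiSym.mul_left]; push_cast; rfl) hs'.1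
      rw [gaussSign_mul hab.1 hab.2 hs'.1] at this
      convert this using 2 with n
      rw [jacobiSym.mul_right]; push_cast; rfl
  obtain ⟨_, h⟩ := key m hm hsq
  exact h

/-! ### The characters of 2-power modulus -/

/-- Moduli of the primitive quadratic characters of `2`-power modulus. -/
def etaMod : Fin 4 → ℕ := ![1, 4, 8, 8]

/-- The primitive quadratic characters of `2`-power modulus. -/
def eta : Fin 4 → ℤ → ℤ := ![fun _ => 1, fun n => ZMod.χ₄ n, fun n => ZMod.χ₈ n, fun n => ZMod.χ₈' n]

/-- Normalized Gauss sums of the characters `eta i`. -/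
def etaSign : Fin 4 → ℂ := ![1, I, 1, I]

instance (i : Fin 4) : NeZero (etaMod i) := ⟨by fin_cases i <;> simp [etaMod]⟩

theorem eta_mul (i : Fin 4) (a b : ℤ) : eta i (a * b) = eta i a * eta i b := by
  fin_cases i
  · simp [eta]
  · change ZMod.χ₄ ((a * b : ℤ) : ZMod 4) = _
    rw [Int.cast_mul, map_mul]; rfl
  · change ZMod.χ₈ ((a * b : ℤ) : ZMod 8) = _
    rw [Int.cast_mul, map_mul]; rfl
  · change ZMod.χ₈' ((a * b : ℤ) : ZMod 8) = _
    rw [Int.cast_mul, map_mul]; rfl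

theorem eta_periodic (i : Fin 4) (a b : ℤ) (h : (a : ZMod (etaMod i)) = b) : eta i a = eta i b := by
  fin_cases i
  · rfl
  · exact congrArg ZMod.χ₄ h
  · exact congrArg ZMod.χ₈ h
  · exact congrArg ZMod.χ₈' h

theorem exp_pi_div_four : cexp (π / 4 * I) = (1 + I) / √2 := by
  rw [Complex.exp_mul_I, ← Complex.ofReal_ofNat, ← Complex.ofReal_div, ← Complex.ofReal_cos,
    ← Complex.ofReal_sin]
  simp only [Real.cos_pi_div_four, Real.sin_pi_div_four]
  have h : ((√2 : ℝ) : ℂ) ≠ 0 := by simp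
  have h2 : ((√2 : ℝ) : ℂ) ^ 2 = 2 := by
    rw [← Complex.ofReal_pow, Real.sq_sqrt (by norm_num)]; simp
  push_cast
  field_simp
  linear_combination (1 + I) * h2


/-- Coordinates of the fourth roots of unity with respect to `1, I`. -/
def fourthRootCoord : Fin 2 → ZMod 4 → ℤ := fun j => ![![1, 0, -1, 0], ![0, 1, 0, -1]] j

/-- Coordinates of the eighth roots of unity with respect to `1, I, z, I z`, `z = (1 + I) / √2`. -/
def eighthRootCoord : Fin 4 → ZMod 8 → ℤ := fun j =>
  ![![1, 0, 0, 0, -1, 0, 0, 0], ![0, 0, 1, 0, 0, 0, -1, 0],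
    ![0, 1, 0, 0, 0, -1, 0, 0], ![0, 0, 0, 1, 0, 0, 0, -1]] j

/-- Integer coordinates for roots of unity turn the Gauss sums modulo 4 and 8 into finite integer
identities that `decide` can settle. -/
theorem stdAddChar_four (k : ZMod 4) : (ZMod.stdAddChar k : ℂ) =
    ((fourthRootCoord 0 k : ℤ) : ℂ) + ((fourthRootCoord 1 k : ℤ) : ℂ) * I := by
  have e1 : (ZMod.stdAddChar (1 : ZMod 4) : ℂ) = I := by
    have := ZMod.stdAddChar_coe (N := 4) 1
    simp only [Int.cast_one] at this
    rw [this]; refine Eq.trans ?_ Complex.exp_pi_div_two_mul_I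
    congr 1; push_cast; ring
  have e : (ZMod.stdAddChar k : ℂ) = I ^ k.val := by
    rw [← e1, ← AddChar.map_nsmul_eq_pow]
    simp
  rw [e]
  fin_cases k
  · change I ^ 0 = _; simp [fourthRootCoord]
  · change I ^ 1 = _; simp [fourthRootCoord]
  · change I ^ 2 = _; simp [fourthRootCoord]
  · change I ^ 3 = _; simp [fourthRootCoord, I_pow_three]

theorem stdAddChar_eight (k : ZMod 8) : (ZMod.stdAddChar k : ℂ) =
    ((eighthRootCoord 0 k : ℤ) : ℂ) + ((eighthRootCoord 1 k : ℤ) : ℂ) * I +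
    (((eighthRootCoord 2 k : ℤ) : ℂ) + ((eighthRootCoord 3 k : ℤ) : ℂ) * I) *
      ((1 + I) / √2) := by
  set z : ℂ := (1 + I) / √2 with hz
  have h2 : ((√2 : ℝ) : ℂ) ^ 2 = 2 := by
    rw [← Complex.ofReal_pow, Real.sq_sqrt (by norm_num)]; simp
  have hz2 : z ^ 2 = I := by
    rw [hz, div_pow, h2]
    linear_combination (1 / 2) * I_sq
  have e1 : (ZMod.stdAddChar (1 : ZMod 8) : ℂ) = z := by
    have := ZMod.stdAddChar_coe (N := 8) 1
    simp only [Int.cast_one] at this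
    rw [this, hz, ← exp_pi_div_four]
    congr 1; push_cast; ring
  have e : (ZMod.stdAddChar k : ℂ) = z ^ k.val := by
    rw [← e1, ← AddChar.map_nsmul_eq_pow]
    simp
  rw [e]
  have h4 : z ^ 4 = -1 := by rw [show z ^ 4 = (z ^ 2) ^ 2 by ring, hz2, I_sq]
  have h3 : z ^ 3 = I * z := by rw [← hz2]; ring
  have h5 : z ^ 5 = -z := by rw [show z ^ 5 = z ^ 4 * z by ring, h4]; ring
  have h6 : z ^ 6 = -I := by rw [show z ^ 6 = z ^ 4 * z ^ 2 by ring, h4, hz2]; ring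
  have h7 : z ^ 7 = -I * z := by rw [show z ^ 7 = z ^ 4 * z ^ 2 * z by ring, h4, hz2]; ring
  fin_cases k
  · change z ^ 0 = _; simp [eighthRootCoord]
  · change z ^ 1 = _; simp [eighthRootCoord]
  · change z ^ 2 = _; simp [eighthRootCoord, hz2]
  · change z ^ 3 = _; simp [eighthRootCoord, h3]
  · change z ^ 4 = _; simp [eighthRootCoord, h4]
  · change z ^ 5 = _; simp [eighthRootCoord, h5]
  · change z ^ 6 = _; simp [eighthRootCoord, h6]
  · change z ^ 7 = _; simp [eighthRootCoord, h7]

theorem selfDual_eta (i : Fin 4) : SelfDual (etaMod i) (etaSign i) (fun n => ((eta i n : ℤ) : ℂ)) where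
  periodic a b h := by rw [eta_periodic i a b h]
  dual n := by
    have h2 : ((√2 : ℝ) : ℂ) ^ 2 = 2 := by
      rw [← Complex.ofReal_pow, Real.sq_sqrt (by norm_num)]; simp
    have hs : ((√2 : ℝ) : ℂ) ≠ 0 := by simp
    have h8 : ((√8 : ℝ) : ℂ) = 2 * √2 := by
      rw [show (8 : ℝ) = 2 ^ 2 * 2 by norm_num, Real.sqrt_mul (by norm_num),
        Real.sqrt_sq (by norm_num)]
      push_cast; rfl
    have split : ∀ (q : ℕ) [NeZero q] (χ : ZMod q → ℤ) (c : ZMod q → ℤ) (x : ZMod q),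
        ∑ b : ZMod q, ((χ b : ℤ) : ℂ) * ((c (b * x) : ℤ) : ℂ) = ((∑ b, χ b * c (b * x) : ℤ) : ℂ) := by
      intro q _ χ c x; push_cast; rfl
    fin_cases i
    · have : ∀ b : ZMod 1, b = 0 := fun b => Subsingleton.elim _ _
      change ∑ b : ZMod 1, (((1 : ℤ) : ℂ)) * ZMod.stdAddChar (b * (n : ZMod 1)) =
        1 * ((√((1 : ℕ) : ℝ) : ℝ) : ℂ) * ((1 : ℤ) : ℂ)
      simp [this]
    · change ∑ b : ZMod 4, ((ZMod.χ₄ ((b.val : ℤ) : ZMod 4) : ℤ) : ℂ) *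
        ZMod.stdAddChar (b * (n : ZMod 4)) = I * ((√((4 : ℕ) : ℝ) : ℝ) : ℂ) * ((ZMod.χ₄ (n : ZMod 4) : ℤ) : ℂ)
      have hs4 : √((4 : ℕ) : ℝ) = 2 := by
        rw [show ((4 : ℕ) : ℝ) = 2 ^ 2 by norm_num, Real.sqrt_sq (by norm_num)]
      rw [hs4]
      simp only [stdAddChar_four, mul_add, ← mul_assoc, Finset.sum_add_distrib, ← Finset.sum_mul]
      have hv : ∀ b : ZMod 4, ((b.val : ℤ) : ZMod 4) = b := by decide
      simp only [hv]
      generalize (n : ZMod 4) = x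
      rw [split 4 ZMod.χ₄ (fourthRootCoord 0) x, split 4 ZMod.χ₄ (fourthRootCoord 1) x]
      have c0 : ∀ x : ZMod 4, ∑ b : ZMod 4, ZMod.χ₄ b * fourthRootCoord 0 (b * x) = 0 := by decide
      have c1 : ∀ x : ZMod 4, ∑ b : ZMod 4, ZMod.χ₄ b * fourthRootCoord 1 (b * x) =
        2 * ZMod.χ₄ x := by decide
      rw [c0, c1]
      push_cast; ring
    · change ∑ b : ZMod 8, ((ZMod.χ₈ ((b.val : ℤ) : ZMod 8) : ℤ) : ℂ) *
        ZMod.stdAddChar (b * (n : ZMod 8)) = 1 * ((√((8 : ℕ) : ℝ) : ℝ) : ℂ) * ((ZMod.χ₈ (n : ZMod 8) : ℤ) : ℂ)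
      rw [Nat.cast_ofNat, h8]
      simp only [stdAddChar_eight, mul_add, add_mul, ← mul_assoc, Finset.sum_add_distrib, ← Finset.sum_mul]
      have hv : ∀ b : ZMod 8, ((b.val : ℤ) : ZMod 8) = b := by decide
      simp only [hv]
      generalize (n : ZMod 8) = x
      rw [split 8 ZMod.χ₈ (eighthRootCoord 0) x, split 8 ZMod.χ₈ (eighthRootCoord 1) x,
        split 8 ZMod.χ₈ (eighthRootCoord 2) x, split 8 ZMod.χ₈ (eighthRootCoord 3) x]
      have c0 : ∀ x : ZMod 8, ∑ b : ZMod 8, ZMod.χ₈ b *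
        eighthRootCoord 0 (b * x) = 0 := by decide
      have c1 : ∀ x : ZMod 8, ∑ b : ZMod 8, ZMod.χ₈ b *
        eighthRootCoord 1 (b * x) = 0 := by decide
      have c2 : ∀ x : ZMod 8, ∑ b : ZMod 8, ZMod.χ₈ b *
        eighthRootCoord 2 (b * x) = 2 * ZMod.χ₈ x := by decide
      have c3 : ∀ x : ZMod 8, ∑ b : ZMod 8, ZMod.χ₈ b *
        eighthRootCoord 3 (b * x) = -2 * ZMod.χ₈ x := by decide
      rw [c0, c1, c2, c3]
      push_cast
      field_simp
      linear_combination (-2 * ((ZMod.χ₈ x : ℤ) : ℂ)) * I_sq - (2 * ((ZMod.χ₈ x : ℤ) : ℂ)) * h2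
    · change ∑ b : ZMod 8, ((ZMod.χ₈' ((b.val : ℤ) : ZMod 8) : ℤ) : ℂ) *
        ZMod.stdAddChar (b * (n : ZMod 8)) = I * ((√((8 : ℕ) : ℝ) : ℝ) : ℂ) * ((ZMod.χ₈' (n : ZMod 8) : ℤ) : ℂ)
      rw [Nat.cast_ofNat, h8]
      simp only [stdAddChar_eight, mul_add, add_mul, ← mul_assoc, Finset.sum_add_distrib, ← Finset.sum_mul]
      have hv : ∀ b : ZMod 8, ((b.val : ℤ) : ZMod 8) = b := by decide
      simp only [hv]
      generalize (n : ZMod 8) = x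
      rw [split 8 ZMod.χ₈' (eighthRootCoord 0) x, split 8 ZMod.χ₈' (eighthRootCoord 1) x,
        split 8 ZMod.χ₈' (eighthRootCoord 2) x, split 8 ZMod.χ₈' (eighthRootCoord 3) x]
      have c0 : ∀ x : ZMod 8, ∑ b : ZMod 8, ZMod.χ₈' b *
        eighthRootCoord 0 (b * x) = 0 := by decide
      have c1 : ∀ x : ZMod 8, ∑ b : ZMod 8, ZMod.χ₈' b *
        eighthRootCoord 1 (b * x) = 0 := by decide
      have c2 : ∀ x : ZMod 8, ∑ b : ZMod 8, ZMod.χ₈' b *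
        eighthRootCoord 2 (b * x) = 2 * ZMod.χ₈' x := by decide
      have c3 : ∀ x : ZMod 8, ∑ b : ZMod 8, ZMod.χ₈' b *
        eighthRootCoord 3 (b * x) = 2 * ZMod.χ₈' x := by decide
      rw [c0, c1, c2, c3]
      push_cast
      field_simp
      linear_combination (2 * ((ZMod.χ₈' x : ℤ) : ℂ)) * I_sq - (2 * ((ZMod.χ₈' x : ℤ) : ℂ) * I) * h2

/-- The completely multiplicative function `n ↦ eta i n * (n / m)`. -/
def psi (i : Fin 4) (m : ℕ) (n : ℤ) : ℤ := eta i n * J(n | m)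

theorem psi_mul (i : Fin 4) (m : ℕ) (a b : ℤ) : psi i m (a * b) = psi i m a * psi i m b := by
  simp only [psi, eta_mul, jacobiSym.mul_left]; ring

theorem etaMod_coprime (i : Fin 4) {m : ℕ} (hm : Odd m) : (etaMod i).Coprime m := by
  have h2 : Nat.Coprime 2 m := Nat.coprime_two_left.2 hm
  fin_cases i
  · exact Nat.coprime_one_left m
  · exact h2.pow_left 2
  · exact h2.pow_left 3
  · exact h2.pow_left 3

/-- The functional-equation sign of `psi i m` is the trivial one for its parity. -/
theorem selfDual_psi (i : Fin 4) (m : ℕ) [NeZero m] (hm : Odd m) (hsq : Squarefree m) :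
    (psi i m (-1) = 1 ∧ SelfDual (etaMod i * m) 1 (fun n => ((psi i m n : ℤ) : ℂ))) ∨
    (psi i m (-1) = -1 ∧ SelfDual (etaMod i * m) I (fun n => ((psi i m n : ℤ) : ℂ))) := by
  have h := (selfDual_eta i).mul (selfDual_jacobiSym m hm hsq)
    (fun a b => by rw [eta_mul]; push_cast; rfl)
    (fun a b => by rw [jacobiSym.mul_left]; push_cast; rfl) (etaMod_coprime i hm)
  have e : (fun n : ℤ => ((eta i n : ℤ) : ℂ) * ((J(n | m) : ℤ) : ℂ)) = fun n => ((psi i m n : ℤ) : ℂ) := by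
    ext n; simp [psi]
  rw [e] at h
  have hpar : psi i m (-1) = eta i (-1) * ZMod.χ₄ m := by rw [psi, jacobiSym.at_neg_one hm]
  have h8 : m % 8 = 1 ∨ m % 8 = 3 ∨ m % 8 = 5 ∨ m % 8 = 7 := by
    have := Nat.odd_iff.1 hm; omega
  have J8 : J(8 | m) = ZMod.χ₈ m := by
    have : (8 : ℤ) = 4 * 2 := by norm_num
    rw [this, jacobiSym.mul_left, jacobiSym.at_four hm, one_mul, jacobiSym.at_two hm]
  have key : ∀ κ : ℂ, (((eta i m : ℤ) : ℂ) * ((J((etaMod i : ℤ) | m) : ℤ) : ℂ) * etaSign i * gaussSign m = κ) →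
     SelfDual (etaMod i * m) κ (fun n => ((psi i m n : ℤ) : ℂ)) := by
    intro κ hκ; rw [← hκ]; exact h
  rw [hpar, ZMod.χ₄_nat_eq_if_mod_four]
  have x4 := ZMod.χ₄_nat_eq_if_mod_four m
  have x8 := ZMod.χ₈_nat_eq_if_mod_eight m
  have x8' := ZMod.χ₈'_nat_eq_if_mod_eight m
  have jd : ((J((etaMod i : ℤ) | m) : ℤ) : ℂ) = ![1, 1, ((ZMod.χ₈ m : ℤ) : ℂ), ((ZMod.χ₈ m : ℤ) : ℂ)] i := by
    fin_cases i
    · simp [etaMod]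
    · change ((J(4 | m) : ℤ) : ℂ) = 1
      rw [jacobiSym.at_four hm]; simp
    · change ((J(8 | m) : ℤ) : ℂ) = ((ZMod.χ₈ m : ℤ) : ℂ)
      rw [J8]
    · change ((J(8 | m) : ℤ) : ℂ) = ((ZMod.χ₈ m : ℤ) : ℂ)
      rw [J8]
  have ed : ((eta i m : ℤ) : ℂ) = ![1, ((ZMod.χ₄ m : ℤ) : ℂ), ((ZMod.χ₈ m : ℤ) : ℂ), ((ZMod.χ₈' m : ℤ) : ℂ)] i := by
    fin_cases i <;> simp [eta]
  have en : eta i (-1) = ![1, -1, 1, -1] i := by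
    fin_cases i <;> rfl
  rw [en]
  rw [jd, ed] at key
  have hI := I_mul_I
  -- The 2-part and the class of m modulo 8 determine the parity and every sign in the constant; in
  -- all sixteen cases the constant is 1 for even and I for odd functions.
  rcases h8 with h | h | h | h <;>
  · have h2 : m % 2 = 1 := by omega
    have h4 : m % 4 = (m % 8) % 4 := by omega
    rw [h] at h4
    simp only [gaussSign, x4, x8, x8', h, h2, h4] at key ⊢
    fin_cases i <;>
    first
    | (refine Or.inl ⟨?_, key 1 ?_⟩ <;> simp [etaSign] <;> done)
    | (refine Or.inr ⟨?_, key I ?_⟩ <;> simp [etaSign])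

end LMoment

end

/-! ### Theta functional equations of self-dual functions -/

noncomputable section
namespace LMoment
open Complex Filter Topology HurwitzZeta Finset
open scoped Real NumberTheorySymbols

theorem SelfDual.eq_val {q : ℕ} [NeZero q] {κ : ℂ} {ψ : ℤ → ℂ} (h : SelfDual q κ ψ) (n : ℤ) :
    ψ n = ψ ((n : ZMod q).val : ℤ) := by
  apply h.periodic
  simp

theorem sum_zmod_eq_sum_fin (q : ℕ) [NeZero q] (F : ZMod q → ℂ) :
    ∑ b : ZMod q, F b = ∑ b : Fin q, F ((b : ℕ) : ZMod q) := by
  refine (Fintype.sum_bijective (fun b : Fin q => ((b : ℕ) : ZMod q)) ?_ _ _ fun _ => rfl).symm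
  rw [Fintype.bijective_iff_injective_and_card]
  refine ⟨fun a b hab => ?_, by simp [ZMod.card]⟩
  have := (ZMod.natCast_eq_natCast_iff _ _ _).1 hab
  exact Fin.ext (Nat.ModEq.eq_of_lt_of_lt this a.2 b.2)

theorem SelfDual.sum_exp {q : ℕ} [NeZero q] {κ : ℂ} {ψ : ℤ → ℂ} (h : SelfDual q κ ψ) (n : ℤ) :
    ∑ b : Fin q, ψ (b : ℕ) * cexp (2 * π * I * ((((b : ℕ) : ℝ) / q : ℝ) : ℂ) * n) = κ * √q * ψ n := by
  rw [← h.dual n, sum_zmod_eq_sum_fin]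
  refine Finset.sum_congr rfl fun b _ => ?_
  rw [ZMod.val_cast_of_lt b.2]
  congr 1
  have : (((b : ℕ) : ZMod q) * (n : ZMod q)) = (((b : ℕ) * n : ℤ) : ZMod q) := by push_cast; rfl
  rw [this, ZMod.stdAddChar_coe]
  congr 1
  push_cast
  ring

/-- The kernel of each residue class is transformed separately; the finite Fourier transform over
the classes that results is ψ again by self-duality. -/
theorem SelfDual.hasSum_even {q : ℕ} [NeZero q] {ψ : ℤ → ℂ} (h : SelfDual q 1 ψ)
    {t : ℝ} (ht : 0 < t) : ∃ T : ℂ,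
      HasSum (fun n : ℤ => ψ n * (rexp (-π * n ^ 2 / q * t) : ℂ)) T ∧
      HasSum (fun n : ℤ => ψ n * (rexp (-π * n ^ 2 / q * (1 / t)) : ℂ)) ((t ^ (1 / 2 : ℝ) : ℝ) * T) := by
  have hq : (0 : ℝ) < q := Nat.cast_pos.2 (NeZero.pos q)
  have h1 := hasSum_even_theta q (fun b => ψ (b.val : ℤ)) (t := t / q) (by positivity)
  refine ⟨_, h1.congr_fun fun n => ?_, ?_⟩
  · rw [← h.eq_val]; congr 3; ring
  have h2 : HasSum (fun n : ℤ => ∑ b : Fin q, ψ (b : ℕ) *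
      (cexp (2 * π * I * ((((b : ℕ) : ℝ) / q : ℝ) : ℂ) * n) * rexp (-π * n ^ 2 * (1 / (q * t)))))
      (∑ b : Fin q, ψ (b : ℕ) * cosKernel ((((b : ℕ) : ℝ) / q : ℝ) : UnitAddCircle) (1 / (q * t))) :=
    hasSum_sum fun b _ => (hasSum_int_cosKernel _ (by positivity)).mul_left _
  have hs : (√q : ℂ) ≠ 0 := by
    rw [Ne, ofReal_eq_zero]; exact (Real.sqrt_pos.2 hq).ne'
  have h3 := h2.mul_left ((√q : ℂ)⁻¹)
  convert! h3 using 1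
  · ext n
    simp_rw [← mul_assoc]
    rw [← Finset.sum_mul, h.sum_exp, one_mul, ← mul_assoc, inv_mul_cancel_left₀ hs]
    congr 3
    field_simp
  · rw [Finset.mul_sum, Finset.mul_sum]
    refine Finset.sum_congr rfl fun b _ => ?_
    have e : (q : ℝ) ^ 2 * (t / q) = q * t := by field_simp
    rw [ZMod.val_cast_of_lt b.2, e, evenKernel_functional_equation, Real.mul_rpow hq.le ht.le,
      ← Real.sqrt_eq_rpow, ← Real.sqrt_eq_rpow]
    have : (√t : ℂ) ≠ 0 := by
      rw [Ne, ofReal_eq_zero]; exact (Real.sqrt_pos.2 ht).ne'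
    push_cast
    field_simp

theorem hasSum_odd_theta (q : ℕ) [NeZero q] (f : ZMod q → ℂ) {t : ℝ} (ht : 0 < t) :
    HasSum (fun n : ℤ => f n * (n * rexp (-π * n ^ 2 * t) : ℂ))
      (∑ b : Fin q, f ((b : ℕ) : ZMod q) * (q *
        (oddKernel ((((b : ℕ) : ℝ) / q : ℝ) : UnitAddCircle) (q ^ 2 * t) : ℂ))) := by
  apply hasSum_int_of_residues
  intro b
  have hq : (q : ℝ) ≠ 0 := Nat.cast_ne_zero.2 (NeZero.ne q)
  have := (hasSum_int_oddKernel (((b : ℕ) : ℝ) / q) (x := q ^ 2 * t) (by positivity))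
  rw [← hasSum_ofReal] at this
  refine ((this.mul_left (q : ℂ)).mul_left (f ((b : ℕ) : ZMod q))).congr_fun fun m => ?_
  push_cast
  simp only [CharP.cast_eq_zero, zero_mul, add_zero]
  have : (q : ℂ) ≠ 0 := Nat.cast_ne_zero.2 (NeZero.ne q)
  rw [← mul_assoc (q : ℂ)]
  congr 2
  · field_simp; ring
  congr 1
  field_simp
  ring

/-- As in the even case, with odd kernels. The constant I of the duality cancels the -I in the sine
kernel, so no sign is left. -/
theorem SelfDual.hasSum_odd {q : ℕ} [NeZero q] {ψ : ℤ → ℂ} (h : SelfDual q I ψ)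
    {t : ℝ} (ht : 0 < t) : ∃ T : ℂ,
      HasSum (fun n : ℤ => ψ n * (n * rexp (-π * n ^ 2 / q * t) : ℂ)) T ∧
      HasSum (fun n : ℤ => ψ n * (n * rexp (-π * n ^ 2 / q * (1 / t)) : ℂ))
        ((t ^ (3 / 2 : ℝ) : ℝ) * T) := by
  have hq : (0 : ℝ) < q := Nat.cast_pos.2 (NeZero.pos q)
  have h1 := hasSum_odd_theta q (fun b => ψ (b.val : ℤ)) (t := t / q) (by positivity)
  refine ⟨_, h1.congr_fun fun n => ?_, ?_⟩
  · rw [← h.eq_val]; congr 4; ring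
  have h2 : HasSum (fun n : ℤ => ∑ b : Fin q, ψ (b : ℕ) *
      (-I * n * cexp (2 * π * I * ((((b : ℕ) : ℝ) / q : ℝ) : ℂ) * n) *
        rexp (-π * n ^ 2 * (1 / (q * t)))))
      (∑ b : Fin q, ψ (b : ℕ) * sinKernel ((((b : ℕ) : ℝ) / q : ℝ) : UnitAddCircle) (1 / (q * t))) :=
    hasSum_sum fun b _ => (hasSum_int_sinKernel _ (by positivity)).mul_left _
  have hs : (√q : ℂ) ≠ 0 := by
    rw [Ne, ofReal_eq_zero]; exact (Real.sqrt_pos.2 hq).ne'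
  have h3 := h2.mul_left ((√q : ℂ)⁻¹)
  convert! h3 using 1
  · ext n
    have : ∀ b : Fin q, ψ (b : ℕ) *
      (-I * n * cexp (2 * π * I * ((((b : ℕ) : ℝ) / q : ℝ) : ℂ) * n) *
        rexp (-π * n ^ 2 * (1 / (q * t)))) =
        (ψ (b : ℕ) * cexp (2 * π * I * ((((b : ℕ) : ℝ) / q : ℝ) : ℂ) * n)) *
        (-I * n * rexp (-π * n ^ 2 * (1 / (q * t)))) := fun b => by ring
    rw [Finset.sum_congr rfl fun b _ => this b, ← Finset.sum_mul, h.sum_exp]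
    have e : -π * (n : ℝ) ^ 2 / q * (1 / t) = -π * n ^ 2 * (1 / (q * t)) := by field_simp
    rw [e]
    field_simp
    simp only [I_sq]
    ring
  · rw [Finset.mul_sum, Finset.mul_sum]
    refine Finset.sum_congr rfl fun b _ => ?_
    have e : (q : ℝ) ^ 2 * (t / q) = q * t := by field_simp
    have e2 : (q : ℝ) ^ (3 / 2 : ℝ) = q * √q := by
      rw [Real.sqrt_eq_rpow, ← Real.rpow_one_add' hq.le (by norm_num)]; norm_num
    rw [ZMod.val_cast_of_lt b.2, e, oddKernel_functional_equation, Real.mul_rpow hq.le ht.le, e2]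
    have : ((t ^ (3 / 2 : ℝ) : ℝ) : ℂ) ≠ 0 := by
      rw [Ne, ofReal_eq_zero]; positivity
    have : (q : ℂ) ≠ 0 := Nat.cast_ne_zero.2 (NeZero.ne q)
    push_cast
    field_simp

/-- Symmetric series over the integers reduce to series over the natural numbers. -/
theorem hasSum_nat_of_hasSum_int {g : ℤ → ℂ} {T : ℂ} (h : HasSum g T) (h0 : g 0 = 0)
    (hg : ∀ n, g (-n) = g n) : HasSum (fun n : ℕ => g n) (T / 2) := by
  have := (HasSum.nat_add_neg h).div_const 2
  rw [h0, add_zero] at this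
  refine this.congr_fun fun n => ?_
  rw [hg]; ring

end LMoment

end

/-! ### Incomplete Gamma cutoffs and Mellin transforms of theta series -/

noncomputable section
namespace LMoment
open Complex Filter Topology Finset MeasureTheory Set Asymptotics
open scoped Real NumberTheorySymbols

/-- The full integral `∫_0^∞ t^(σ-1) exp(-π t) dt`. -/
def piGamma (σ : ℝ) : ℝ := ∫ t in Ioi (0 : ℝ), t ^ (σ - 1) * rexp (-(π * t))

/-- The normalized incomplete Gamma function. -/
def cutoff (σ x : ℝ) : ℝ := (∫ t in Ioi x, t ^ (σ - 1) * rexp (-(π * t))) / piGamma σ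

theorem piGamma_eq {σ : ℝ} (hσ : 0 < σ) : piGamma σ = π ^ (-σ) * Real.Gamma σ := by
  rw [piGamma, Real.integral_rpow_mul_exp_neg_mul_Ioi hσ Real.pi_pos, one_div,
    Real.inv_rpow Real.pi_pos.le, Real.rpow_neg Real.pi_pos.le]

theorem piGamma_pos {σ : ℝ} (hσ : 0 < σ) : 0 < piGamma σ := by
  rw [piGamma_eq hσ]
  have := Real.Gamma_pos_of_pos hσ
  positivity

theorem integrableOn_gamma_kernel {σ r : ℝ} (hσ : 0 < σ) (hr : 0 < r) :
    IntegrableOn (fun t : ℝ => t ^ (σ - 1) * rexp (-(r * t))) (Ioi 0) := by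
  by_contra hcon
  have h := Real.integral_rpow_mul_exp_neg_mul_Ioi hσ hr
  rw [integral_undef hcon] at h
  have := Real.Gamma_pos_of_pos hσ
  have : 0 < (1 / r) ^ σ * Real.Gamma σ := by positivity
  linarith

theorem cutoff_nonneg {σ x : ℝ} (hσ : 0 < σ) (hx : 0 ≤ x) : 0 ≤ cutoff σ x := by
  refine div_nonneg (setIntegral_nonneg measurableSet_Ioi fun t ht => ?_) (piGamma_pos hσ).le
  have : 0 < t := lt_of_le_of_lt hx ht
  positivity

theorem cutoff_antitone {σ x y : ℝ} (hσ : 0 < σ) (hx : 0 ≤ x) (hxy : x ≤ y) :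
    cutoff σ y ≤ cutoff σ x := by
  refine div_le_div_of_nonneg_right ?_ (piGamma_pos hσ).le
  refine setIntegral_mono_set ((integrableOn_gamma_kernel hσ Real.pi_pos).mono_set
    (Ioi_subset_Ioi hx)) ?_ (Ioi_subset_Ioi hxy).eventuallyLE
  filter_upwards [ae_restrict_mem measurableSet_Ioi] with t ht
  have : 0 < t := lt_of_le_of_lt hx ht
  simp only [Pi.zero_apply]
  positivity

theorem cutoff_zero {σ : ℝ} (hσ : 0 < σ) : cutoff σ 0 = 1 :=
  div_self (piGamma_pos hσ).ne'

/-- Rankin's trick: (t/x)^β ≥ 1 on the range of integration. -/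
theorem cutoff_le_rpow {σ β x : ℝ} (hσ : 0 < σ) (hβ : 0 ≤ β) (hx : 0 < x) :
    cutoff σ x ≤ piGamma (σ + β) / piGamma σ * x ^ (-β) := by
  rw [cutoff, div_mul_eq_mul_div]
  refine div_le_div_of_nonneg_right ?_ (piGamma_pos hσ).le
  rw [Real.rpow_neg hx.le, ← div_eq_mul_inv, le_div_iff₀ (by positivity), ← integral_mul_const]
  have h0 := integrableOn_gamma_kernel (r := π) (add_pos_of_pos_of_nonneg hσ hβ) Real.pi_pos
  refine le_trans (setIntegral_mono_on (g := fun t : ℝ => t ^ (σ + β - 1) * rexp (-(π * t)))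
    ?_ (h0.mono_set (Ioi_subset_Ioi hx.le))
    measurableSet_Ioi fun t ht => ?_) (setIntegral_mono_set h0 ?_ (Ioi_subset_Ioi hx.le).eventuallyLE)
  · exact ((integrableOn_gamma_kernel hσ Real.pi_pos).mono_set (Ioi_subset_Ioi hx.le)).mul_const _
  · have ht0 : 0 < t := hx.trans ht
    have : t ^ (σ + β - 1) = t ^ (σ - 1) * t ^ β := by
      rw [← Real.rpow_add ht0]; ring_nf
    rw [this]
    have := Real.rpow_le_rpow hx.le (le_of_lt ht) hβ
    have h1 : 0 < t ^ (σ - 1) := by positivity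
    have h2 := Real.exp_pos (-(π * t))
    nlinarith [mul_le_mul_of_nonneg_left this (mul_pos h1 h2).le]
  · filter_upwards [ae_restrict_mem measurableSet_Ioi] with t ht
    have : 0 < t := ht
    simp only [Pi.zero_apply]
    positivity

theorem integral_tail_scaled {σ k Y : ℝ} (hσ : 0 < σ) (hk : 0 < k) (hY : 0 ≤ Y) :
    ∫ t in Ioi Y, t ^ (σ - 1) * rexp (-(π * k * t)) = k ^ (-σ) * (piGamma σ * cutoff σ (k * Y)) := by
  rw [cutoff, mul_div_cancel₀ _ (piGamma_pos hσ).ne']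
  rw [← integral_comp_mul_left_Ioi' (fun t : ℝ => t ^ (σ - 1) * rexp (-(π * t))) Y hk, smul_eq_mul,
    ← integral_const_mul, ← integral_const_mul]
  refine setIntegral_congr_fun measurableSet_Ioi fun t ht => ?_
  have ht0 : 0 < t := lt_of_le_of_lt hY ht
  rw [Real.mul_rpow hk.le ht0.le, Real.rpow_sub_one hk.ne', Real.rpow_neg hk.le]
  field_simp

/-- The theta series of weight `a + 1/2` with coefficients `c` and level `q`. -/
def theta (q : ℝ) (a : ℕ) (c : ℕ → ℂ) (t : ℝ) : ℂ :=
  ∑' n : ℕ, c n * n ^ a * (rexp (-π * n ^ 2 / q * t) : ℂ)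

theorem summable_theta_bound {r : ℝ} (hr : 0 < r) (a : ℕ) :
    Summable fun n : ℕ => (n : ℝ) ^ a * rexp (-r * n ^ 2) := by
  refine (Real.summable_pow_mul_exp_neg_nat_mul a hr).of_nonneg_of_le (fun n => by positivity) fun n => ?_
  have : (n : ℝ) ≤ (n : ℝ) ^ 2 := by exact_mod_cast Nat.le_self_pow two_ne_zero n
  exact mul_le_mul_of_nonneg_left (Real.exp_le_exp.2 (by nlinarith)) (by positivity)

section theta
variable {q : ℝ} {a : ℕ} {c : ℕ → ℂ}

theorem norm_theta_term_le (hc : ∀ n, ‖c n‖ ≤ 1) (n : ℕ) (t : ℝ) :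
    ‖c n * n ^ a * (rexp (-π * n ^ 2 / q * t) : ℂ)‖ ≤ (n : ℝ) ^ a * rexp (-(π * t / q) * n ^ 2) := by
  rw [norm_mul, norm_mul, norm_pow, Complex.norm_natCast, Complex.norm_real, Real.norm_eq_abs,
    Real.abs_exp]
  have : -π * (n : ℝ) ^ 2 / q * t = -(π * t / q) * n ^ 2 := by ring
  rw [this]
  have h := hc n
  gcongr
  calc ‖c n‖ * (n : ℝ) ^ a ≤ 1 * (n : ℝ) ^ a := by gcongr
    _ = _ := one_mul _

theorem hasSum_theta (hq : 0 < q) (hc : ∀ n, ‖c n‖ ≤ 1) {t : ℝ} (ht : 0 < t) :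
    HasSum (fun n : ℕ => c n * n ^ a * (rexp (-π * n ^ 2 / q * t) : ℂ)) (theta q a c t) :=
  (Summable.of_norm_bounded (summable_theta_bound (r := π * t / q) (by positivity) a)
    fun n => norm_theta_term_le hc n t).hasSum

theorem continuousOn_theta (hq : 0 < q) (hc : ∀ n, ‖c n‖ ≤ 1) :
    ContinuousOn (theta q a c) (Ioi 0) := by
  intro t (ht : 0 < t)
  have : ContinuousOn (theta q a c) (Ioi (t / 2)) := by
    refine continuousOn_tsum (u := fun n : ℕ => (n : ℝ) ^ a * rexp (-(π * (t / 2) / q) * n ^ 2))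
      (fun n => by fun_prop) (summable_theta_bound (by positivity) a) fun n x hx => ?_
    refine (norm_theta_term_le hc n x).trans ?_
    have hx' : t / 2 ≤ x := le_of_lt hx
    gcongr
  exact (this.continuousAt (Ioi_mem_nhds (by linarith))).continuousWithinAt

theorem norm_theta_le (hq : 0 < q) (hc : ∀ n, ‖c n‖ ≤ 1) (hc0 : c 0 = 0) :
    ∃ C : ℝ, ∀ t : ℝ, 1 ≤ t → ‖theta q a c t‖ ≤ C * rexp (-(π / q) * t) := by
  have hs := summable_theta_bound (r := π / q) (by positivity) a
  refine ⟨rexp (π / q) * ∑' n : ℕ, (n : ℝ) ^ a * rexp (-(π / q) * n ^ 2), fun t ht => ?_⟩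
  rw [mul_comm (rexp _), mul_assoc, ← tsum_mul_right]
  refine tsum_of_norm_bounded (hs.mul_right _).hasSum fun n => ?_
  rcases Nat.eq_zero_or_pos n with rfl | hn
  · rw [hc0, zero_mul, zero_mul, norm_zero]; positivity
  refine (norm_theta_term_le hc n t).trans ?_
  rw [mul_assoc, ← Real.exp_add, ← Real.exp_add]
  gcongr
  have h1 : (1 : ℝ) ≤ (n : ℝ) ^ 2 := by exact_mod_cast Nat.one_le_pow _ _ hn
  have hp : 0 < π / q := by positivity
  have : -(π * t / q) * (n : ℝ) ^ 2 = -(π / q) * (t * n ^ 2) := by ring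
  rw [this]
  nlinarith [mul_nonneg (sub_nonneg.2 ht) (sub_nonneg.2 h1)]

/-- A theta series with its functional equation, as a functional equation pair. -/
def thetaPair (hq : 0 < q) (hc : ∀ n, ‖c n‖ ≤ 1) (hc0 : c 0 = 0) {σ : ℝ} (hσ : 0 < σ)
    (hfe : ∀ t : ℝ, 0 < t → theta q a c (1 / t) = (t ^ (2 * σ) : ℝ) * theta q a c t) :
    WeakFEPair ℂ where
  f := theta q a c
  g := theta q a c
  k := 2 * σ
  ε := 1
  f₀ := 0
  g₀ := 0
  hf_int := (continuousOn_theta hq hc).locallyIntegrableOn measurableSet_Ioi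
  hg_int := (continuousOn_theta hq hc).locallyIntegrableOn measurableSet_Ioi
  hk := by positivity
  hε := one_ne_zero
  h_feq x hx := by rw [hfe x hx, one_mul, smul_eq_mul]
  hf_top r := by
    obtain ⟨C, hC⟩ := norm_theta_le (a := a) hq hc hc0
    refine (IsBigO.of_bound C ?_).trans (isLittleO_exp_neg_mul_rpow_atTop (a := π / q) (by positivity) r).isBigO
    filter_upwards [eventually_ge_atTop 1] with t ht
    rw [sub_zero, Real.norm_eq_abs, Real.abs_exp]
    exact hC t ht
  hg_top r := by
    obtain ⟨C, hC⟩ := norm_theta_le (a := a) hq hc hc0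
    refine (IsBigO.of_bound C ?_).trans (isLittleO_exp_neg_mul_rpow_atTop (a := π / q) (by positivity) r).isBigO
    filter_upwards [eventually_ge_atTop 1] with t ht
    rw [sub_zero, Real.norm_eq_abs, Real.abs_exp]
    exact hC t ht

theorem mellin_theta_properties (hq : 0 < q) (hc : ∀ n, ‖c n‖ ≤ 1) (hc0 : c 0 = 0) {σ : ℝ} (hσ : 0 < σ)
    (hfe : ∀ t : ℝ, 0 < t → theta q a c (1 / t) = (t ^ (2 * σ) : ℝ) * theta q a c t) :
    Differentiable ℂ (mellin (theta q a c)) ∧ ∀ s, MellinConvergent (theta q a c) s := by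
  have hP : IsStrongFEPair (thetaPair hq hc hc0 hσ hfe) := ⟨rfl, rfl⟩
  have h1 := hP.differentiable_Λ
  rw [hP.Λ_eq] at h1
  exact ⟨h1, fun s => (hP.hasMellin s).1⟩

/-- The tail integral of a theta series. -/
theorem hasSum_tail_theta (hq : 0 < q) (hc : ∀ n, ‖c n‖ ≤ 1) (hc0 : c 0 = 0) {σ : ℝ}
    (hσ : σ = 1 / 4 + a / 2) {Y : ℝ} (hY : 0 < Y) :
    HasSum (fun n : ℕ => c n * ((n : ℝ) ^ (-(1 / 2) : ℝ) * cutoff σ (n ^ 2 * Y / q) : ℝ))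
      ((q ^ (-σ) / piGamma σ : ℝ) * ∫ t in Ioi Y, ((t ^ (σ - 1) : ℝ) : ℂ) * theta q a c t) := by
  have hσ0 : 0 < σ := by rw [hσ]; positivity
  have hG := piGamma_pos hσ0
  have key : ∀ n : ℕ, 0 < n → (n : ℝ) ^ a * ∫ t in Ioi Y, t ^ (σ - 1) * rexp (-π * n ^ 2 / q * t) =
      q ^ σ * piGamma σ * ((n : ℝ) ^ (-(1 / 2) : ℝ) * cutoff σ (n ^ 2 * Y / q)) := by
    intro n hn
    have hn' : (0 : ℝ) < n := Nat.cast_pos.2 hn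
    have := integral_tail_scaled (k := (n : ℝ) ^ 2 / q) hσ0 (by positivity) hY.le
    have e : ∀ t : ℝ, t ^ (σ - 1) * rexp (-π * n ^ 2 / q * t) =
        t ^ (σ - 1) * rexp (-(π * ((n : ℝ) ^ 2 / q) * t)) := fun t => by congr 2; ring
    simp_rw [e]
    rw [this, Real.div_rpow (by positivity) hq.le, Real.rpow_neg hq.le, ← Real.rpow_natCast (n : ℝ) 2,
      ← Real.rpow_mul hn'.le]
    have e2 : (n : ℝ) ^ (-(1 / 2) : ℝ) = (n : ℝ) ^ a * (n : ℝ) ^ (((2 : ℕ) : ℝ) * -σ) := by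
      rw [← Real.rpow_natCast (n : ℝ) a, ← Real.rpow_add hn', hσ]; congr 1; push_cast; ring
    rw [e2]
    have e3 : (n : ℝ) ^ ((2 : ℕ) : ℝ) / q * Y = (n : ℝ) ^ ((2 : ℕ) : ℝ) * Y / q := by ring
    rw [e3]
    field_simp
  have hker : ∀ n : ℕ, 0 < n →
      IntegrableOn (fun t : ℝ => t ^ (σ - 1) * rexp (-π * n ^ 2 / q * t)) (Ioi Y) := by
    intro n hn
    have hn' : (0 : ℝ) < n := Nat.cast_pos.2 hn
    refine ((integrableOn_gamma_kernel (r := π * n ^ 2 / q) hσ0 (by positivity)).mono_set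
      (Ioi_subset_Ioi hY.le)).congr_fun (fun t _ => ?_) measurableSet_Ioi
    simp only
    congr 2; ring
  have hF : ∀ (n : ℕ) (t : ℝ), ((t ^ (σ - 1) : ℝ) : ℂ) * (c n * n ^ a * (rexp (-π * n ^ 2 / q * t) : ℂ)) =
      (c n * n ^ a) * ((t ^ (σ - 1) * rexp (-π * n ^ 2 / q * t) : ℝ) : ℂ) := by
    intro n t; push_cast; ring
  have hnorm : ∀ n : ℕ, ∫ t in Ioi Y, ‖((t ^ (σ - 1) : ℝ) : ℂ) *
      (c n * n ^ a * (rexp (-π * n ^ 2 / q * t) : ℂ))‖ =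
      ‖c n‖ * ((n : ℝ) ^ a * ∫ t in Ioi Y, t ^ (σ - 1) * rexp (-π * n ^ 2 / q * t)) := by
    intro n
    rw [← mul_assoc, ← integral_const_mul]
    refine setIntegral_congr_fun measurableSet_Ioi fun t ht => ?_
    have ht0 : 0 < t := hY.trans ht
    rw [hF, norm_mul, norm_mul, norm_pow, Complex.norm_natCast, Complex.norm_real,
      Real.norm_of_nonneg (by positivity)]
  have hsum : Summable fun n : ℕ => ∫ t in Ioi Y, ‖((t ^ (σ - 1) : ℝ) : ℂ) *
      (c n * n ^ a * (rexp (-π * n ^ 2 / q * t) : ℂ))‖ := by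
    -- The cutoff bound with β = 1 adds n^{-2} to the weight n^{-1/2}.
    have hs : Summable fun n : ℕ => (n : ℝ) ^ (-(5 / 2) : ℝ) :=
      Real.summable_nat_rpow.2 (by norm_num)
    refine (hs.mul_left (q ^ σ * piGamma σ * (piGamma (σ + 1) / piGamma σ * (Y / q) ^ (-1 : ℝ)))).of_nonneg_of_le
      (fun n => integral_nonneg fun t => norm_nonneg _) fun n => ?_
    rw [hnorm]
    rcases Nat.eq_zero_or_pos n with rfl | hn
    · have := piGamma_pos (show 0 < σ + 1 by linarith)
      rw [hc0, norm_zero, zero_mul]; positivity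
    rw [key n hn]
    have hn' : (0 : ℝ) < n := Nat.cast_pos.2 hn
    have hcut := cutoff_le_rpow (β := 1) hσ0 zero_le_one (x := n ^ 2 * Y / q) (by positivity)
    have hcut0 := cutoff_nonneg hσ0 (x := n ^ 2 * Y / q) (by positivity)
    calc ‖c n‖ * (q ^ σ * piGamma σ * ((n : ℝ) ^ (-(1 / 2) : ℝ) * cutoff σ (n ^ 2 * Y / q)))
        ≤ 1 * (q ^ σ * piGamma σ * ((n : ℝ) ^ (-(1 / 2) : ℝ) *
          (piGamma (σ + 1) / piGamma σ * (n ^ 2 * Y / q) ^ (-1 : ℝ)))) := by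
          gcongr
          exact hc n
      _ = _ := by
          have e : (n : ℝ) ^ (-(5 / 2) : ℝ) = (n : ℝ) ^ (-(1 / 2) : ℝ) * ((n : ℝ) ^ 2)⁻¹ := by
            rw [← Real.rpow_natCast, ← Real.rpow_neg hn'.le, ← Real.rpow_add hn']; norm_num
          rw [e, Real.rpow_neg_one, Real.rpow_neg_one]
          field_simp
  have hint := hasSum_integral_of_summable_integral_norm (fun n => ?_) hsum
  · have h2 := hint.mul_left ((q ^ (-σ) / piGamma σ : ℝ) : ℂ)
    convert! h2 using 1
    · ext n
      simp_rw [hF]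
      rw [integral_const_mul, integral_complex_ofReal]
      rcases Nat.eq_zero_or_pos n with rfl | hn
      · simp [hc0]
      have := key n hn
      have h3 : (((n : ℝ) ^ a * ∫ t in Ioi Y, t ^ (σ - 1) * rexp (-π * n ^ 2 / q * t) : ℝ) : ℂ) =
        ((q ^ σ * piGamma σ * ((n : ℝ) ^ (-(1 / 2) : ℝ) * cutoff σ (n ^ 2 * Y / q)) : ℝ) : ℂ) := by
          rw [this]
      push_cast at h3
      have h4 : ((q ^ (-σ) / piGamma σ : ℝ) : ℂ) * ((q ^ σ : ℝ) * (piGamma σ : ℂ)) = 1 := by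
        rw [← ofReal_mul, ← ofReal_mul, ← ofReal_one]
        congr 1
        rw [Real.rpow_neg hq.le]
        field_simp
      rw [mul_assoc (c n), h3]
      push_cast at h4 ⊢
      linear_combination (-(c n * ((((n : ℝ) ^ (-(1 / 2) : ℝ) : ℝ) : ℂ) * cutoff σ (n ^ 2 * Y / q)))) * h4
    · congr 1
      refine setIntegral_congr_fun measurableSet_Ioi fun t ht => ?_
      rw [theta, tsum_mul_left]
  · simp_rw [hF]
    rcases Nat.eq_zero_or_pos n with rfl | hn
    · simp [hc0]
    exact ((hker n hn).ofReal).const_mul _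

/-- The integral below Y is folded by t ↦ 1/t onto (1/Y, ∞). At the central exponent, half of the
weight 2σ, the folding reproduces the same integrand. The free parameter Y is essential: different
copies of one L-value will use different Y. -/
theorem mellin_theta_split (hq : 0 < q) (hc : ∀ n, ‖c n‖ ≤ 1) (hc0 : c 0 = 0) {σ : ℝ} (hσ : 0 < σ)
    (hfe : ∀ t : ℝ, 0 < t → theta q a c (1 / t) = (t ^ (2 * σ) : ℝ) * theta q a c t)
    {Y : ℝ} (hY : 0 < Y) :
    mellin (theta q a c) σ = (∫ t in Ioi Y, ((t ^ (σ - 1) : ℝ) : ℂ) * theta q a c t) +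
      ∫ t in Ioi (1 / Y), ((t ^ (σ - 1) : ℝ) : ℂ) * theta q a c t := by
  have hconv := (mellin_theta_properties hq hc hc0 hσ hfe).2 σ
  set G : ℝ → ℂ := fun t => ((t ^ (σ - 1) : ℝ) : ℂ) * theta q a c t with hG
  have hcongr : ∀ t ∈ Ioi (0 : ℝ), (t : ℂ) ^ ((σ : ℂ) - 1) • theta q a c t = G t := by
    intro t ht
    have : (t : ℂ) ^ ((σ : ℂ) - 1) = ((t ^ (σ - 1) : ℝ) : ℂ) := by
      rw [ofReal_cpow (le_of_lt ht)]; push_cast; rfl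
    rw [smul_eq_mul, this]
  have hGint : IntegrableOn G (Ioi 0) := hconv.congr_fun hcongr measurableSet_Ioi
  have h1 : mellin (theta q a c) σ = ∫ t in Ioi (0 : ℝ), G t :=
    setIntegral_congr_fun measurableSet_Ioi hcongr
  have hsplit : ∫ t in Ioi (0 : ℝ), G t =
      (∫ t in Ioi (0 : ℝ), (Iic Y).indicator G t) + ∫ t in Ioi Y, G t := by
    rw [setIntegral_indicator measurableSet_Iic, Ioi_inter_Iic,
      ← setIntegral_union (by simp) measurableSet_Ioi
      (hGint.mono_set Ioc_subset_Ioi_self) (hGint.mono_set (Ioi_subset_Ioi hY.le)),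
      Ioc_union_Ioi_eq_Ioi hY.le]
  rw [h1, hsplit, add_comm]
  congr 1
  rw [← integral_comp_rpow_Ioi ((Iic Y).indicator G) (p := -1) (by norm_num)]
  have hind : ∀ x ∈ Ioi (0 : ℝ), (|(-1 : ℝ)| * x ^ ((-1 : ℝ) - 1)) • (Iic Y).indicator G (x ^ (-1 : ℝ)) =
      (Ici (1 / Y)).indicator G x := by
    intro x hx
    have hx0 : (0 : ℝ) < x := hx
    rw [Real.rpow_neg_one]
    by_cases hxY : 1 / Y ≤ x
    · have h2 : x⁻¹ ≤ Y := by rw [inv_le_comm₀ hx0 hY, ← one_div]; exact hxY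
      rw [indicator_of_mem (Set.mem_Iic.2 h2), indicator_of_mem (Set.mem_Ici.2 hxY), hG]
      simp only
      rw [← one_div x, hfe x hx0, Complex.real_smul, ← mul_assoc, ← mul_assoc]
      congr 1
      rw [← ofReal_mul, ← ofReal_mul]
      congr 1
      rw [one_div, Real.inv_rpow hx0.le, ← Real.rpow_neg hx0.le, abs_neg, abs_one, one_mul,
        ← Real.rpow_add hx0, ← Real.rpow_add hx0]
      congr 1; ring
    · have h2 : ¬ x⁻¹ ≤ Y := by rw [inv_le_comm₀ hx0 hY, ← one_div]; exact hxY
      rw [indicator_of_notMem (by simpa using h2), indicator_of_notMem (by simpa using hxY), smul_zero]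
  rw [setIntegral_congr_fun measurableSet_Ioi hind, setIntegral_indicator measurableSet_Ici,
    ← integral_Ici_eq_integral_Ioi]
  congr 2
  ext x
  simp only [Set.mem_inter_iff, Set.mem_Ioi, Set.mem_Ici]
  have : 0 < 1 / Y := by positivity
  constructor
  · exact fun h => h.2
  · exact fun h => ⟨by linarith, h⟩

end theta
end LMoment

end

/-! ### The approximate functional equation -/

noncomputable section
namespace LMoment
open Complex Filter Topology Finset MeasureTheory Set Asymptotics
open scoped Real NumberTheorySymbols

/-- The data of a real character with its theta functional equation: `a` is the parity. -/
structure RealSelfDual (q : ℕ) [NeZero q] (a : ℕ) (ψ : ℤ → ℤ) : Prop where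
  map_mul : ∀ m n, ψ (m * n) = ψ m * ψ n
  abs_le_one : ∀ n, |ψ n| ≤ 1
  map_zero : ψ 0 = 0
  dual : (a = 0 ∧ ψ (-1) = 1 ∧ SelfDual q 1 (fun n => (ψ n : ℂ))) ∨
    (a = 1 ∧ ψ (-1) = -1 ∧ SelfDual q I (fun n => (ψ n : ℂ)))

section
variable {q : ℕ} [NeZero q] {a : ℕ} {ψ : ℤ → ℤ}

theorem RealSelfDual.norm_le (h : RealSelfDual q a ψ) (n : ℤ) : ‖((ψ n : ℤ) : ℂ)‖ ≤ 1 := by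
  rw [Complex.norm_intCast]
  exact_mod_cast h.abs_le_one n

theorem RealSelfDual.theta_feq (h : RealSelfDual q a ψ) {t : ℝ} (ht : 0 < t) :
    theta q a (fun n => ((ψ n : ℤ) : ℂ)) (1 / t) =
      (t ^ (2 * (1 / 4 + (a : ℝ) / 2)) : ℝ) * theta q a (fun n => ((ψ n : ℤ) : ℂ)) t := by
  have hneg : ∀ n, ψ (-n) = ψ (-1) * ψ n := fun n => by rw [← h.map_mul]; simp
  have hq : (0 : ℝ) < q := Nat.cast_pos.2 (NeZero.pos q)
  have hs := fun {t : ℝ} (ht : 0 < t) => hasSum_theta (a := a) hq (c := fun n : ℕ => ((ψ n : ℤ) : ℂ))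
    (fun n => h.norm_le n) ht
  have ht' : 0 < 1 / t := by positivity
  rcases h.dual with ⟨rfl, h1, hd⟩ | ⟨rfl, h1, hd⟩
  · obtain ⟨T, hT, hT'⟩ := hd.hasSum_even ht
    have e1 := hasSum_nat_of_hasSum_int hT (by simp [h.map_zero])
      (fun n => by rw [hneg, h1, one_mul]; push_cast; rw [neg_sq])
    have e2 := hasSum_nat_of_hasSum_int hT' (by simp [h.map_zero])
      (fun n => by rw [hneg, h1, one_mul]; push_cast; rw [neg_sq])
    rw [(hs ht).unique (e1.congr_fun fun n => by simp), (hs ht').unique (e2.congr_fun fun n => by simp)]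
    norm_num
    ring
  · obtain ⟨T, hT, hT'⟩ := hd.hasSum_odd ht
    have e1 := hasSum_nat_of_hasSum_int hT (by simp [h.map_zero])
      (fun n => by rw [hneg, h1]; push_cast; rw [neg_sq]; ring)
    have e2 := hasSum_nat_of_hasSum_int hT' (by simp [h.map_zero])
      (fun n => by rw [hneg, h1]; push_cast; rw [neg_sq]; ring)
    rw [(hs ht).unique (e1.congr_fun fun n => by simp [mul_assoc]),
      (hs ht').unique (e2.congr_fun fun n => by simp [mul_assoc])]
    norm_num
    ring

theorem hasSum_mellin_theta {q : ℝ} (hq : 0 < q) {c : ℕ → ℂ} (hc : ∀ n, ‖c n‖ ≤ 1) (hc0 : c 0 = 0)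
    {s : ℂ} (hs : 1 < s.re) :
    HasSum (fun n : ℕ => c n / (n : ℂ) ^ s)
      ((π : ℂ) ^ ((s + a) / 2) * (q : ℂ) ^ (-((s + a) / 2)) * (Complex.Gamma ((s + a) / 2))⁻¹ *
        mellin (theta q a c) ((s + a) / 2)) := by
  set w : ℂ := (s + a) / 2 with hw
  have hwre : w.re = (s.re + a) / 2 := by
    rw [hw]; simp
  have hw0 : 0 < w.re := by rw [hwre]; positivity
  have hqn : ∀ n : ℕ, c n * n ^ a = 0 ∨ 0 < (n : ℝ) ^ 2 / q := by
    intro n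
    rcases Nat.eq_zero_or_pos n with rfl | hn
    · left; rw [hc0, zero_mul]
    · right; positivity
  have hsum : Summable fun n : ℕ => ‖c n * n ^ a‖ / ((n : ℝ) ^ 2 / q) ^ w.re := by
    have h0 : Summable fun n : ℕ => (n : ℝ) ^ (-s.re) := Real.summable_nat_rpow.2 (by linarith)
    refine (h0.mul_left (q ^ w.re)).of_nonneg_of_le (fun n => by positivity) fun n => ?_
    rcases Nat.eq_zero_or_pos n with rfl | hn
    · rw [hc0, zero_mul, norm_zero, zero_div]; positivity
    have hn' : (0 : ℝ) < n := Nat.cast_pos.2 hn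
    rw [norm_mul, norm_pow, Complex.norm_natCast, Real.div_rpow (by positivity) hq.le,
      ← Real.rpow_natCast (n : ℝ) 2, ← Real.rpow_mul hn'.le]
    have e : (n : ℝ) ^ (-s.re) = (n : ℝ) ^ a / (n : ℝ) ^ (((2 : ℕ) : ℝ) * w.re) := by
      rw [← Real.rpow_natCast (n : ℝ) a, ← Real.rpow_sub hn', hwre]; congr 1; push_cast; ring
    rw [e]
    have := hc n
    calc ‖c n‖ * (n : ℝ) ^ a / ((n : ℝ) ^ (((2 : ℕ) : ℝ) * w.re) / q ^ w.re)
        ≤ 1 * (n : ℝ) ^ a / ((n : ℝ) ^ (((2 : ℕ) : ℝ) * w.re) / q ^ w.re) := by gcongr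
      _ = _ := by field_simp
  have hm := hasSum_mellin_pi_mul (F := theta q a c) hqn hw0 (fun t ht =>
    (hasSum_theta hq hc ht).congr_fun fun n => by congr 3; ring) hsum
  refine (hm.mul_left ((π : ℂ) ^ w * (q : ℂ) ^ (-w) * (Complex.Gamma w)⁻¹)).congr_fun fun n => ?_
  have hπ : (π : ℂ) ≠ 0 := ofReal_ne_zero.2 Real.pi_ne_zero
  have hq' : (q : ℂ) ≠ 0 := ofReal_ne_zero.2 hq.ne'
  have hg : Complex.Gamma w ≠ 0 := Complex.Gamma_ne_zero_of_re_pos hw0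
  rcases Nat.eq_zero_or_pos n with rfl | hn
  · simp [hc0]
  have hn' : (n : ℂ) ≠ 0 := Nat.cast_ne_zero.2 hn.ne'
  have hnr : (0 : ℝ) < n := Nat.cast_pos.2 hn
  have e1 : (((n : ℝ) ^ 2 / q : ℝ) : ℂ) ^ w = (n : ℂ) ^ (2 * w) * (q : ℂ) ^ (-w) := by
    rw [div_eq_mul_inv, ofReal_mul, mul_cpow_ofReal_nonneg (by positivity) (by positivity), ofReal_inv,
      inv_cpow _ _ (by rw [arg_ofReal_of_nonneg hq.le]; exact Real.pi_pos.ne), cpow_neg]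
    congr 1
    rw [two_mul, cpow_add _ _ hn', sq, ofReal_mul, mul_cpow_ofReal_nonneg hnr.le hnr.le]
    simp
  have e2 : (n : ℂ) ^ s = (n : ℂ) ^ (2 * w) / (n : ℂ) ^ a := by
    rw [← cpow_natCast, ← cpow_sub _ _ hn', hw]; congr 1; ring
  rw [e1, e2, cpow_neg, cpow_neg]
  have h1 : (π : ℂ) ^ w ≠ 0 := by simp [cpow_eq_zero_iff, hπ]
  have h2 : (q : ℂ) ^ w ≠ 0 := by simp [cpow_eq_zero_iff, hq']
  have h3 : (n : ℂ) ^ (2 * w) ≠ 0 := by simp [cpow_eq_zero_iff, hn']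
  field_simp

/-- The terms of even index form z times the whole series; removing them is removing an Euler factor
at 2. -/
theorem hasSum_odd_part {g : ℕ → ℂ} {T z : ℂ} (h : HasSum g T) (h2 : ∀ n, g (2 * n) = z * g n) :
    HasSum (fun n => if Odd n then g n else 0) ((1 - z) * T) := by
  have hinj : Function.Injective (fun n : ℕ => 2 * n) := fun m n h => by simpa using h
  have h3 : HasSum (fun n => if Even n then g n else 0) (z * T) := by
    rw [← hinj.hasSum_iff]
    · refine (h.mul_left z).congr_fun fun n => ?_
      simp [h2]
    · intro n hn
      rw [if_neg]
      rintro ⟨k, rfl⟩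
      exact hn ⟨k, by simp only; ring⟩
  rw [sub_mul, one_mul]
  refine (h.sub h3).congr_fun fun n => ?_
  rcases Nat.even_or_odd n with hn | hn
  · simp [hn]
  · simp [hn, (Nat.not_even_iff_odd.2 hn)]

/-- Both sides are entire and coincide near 2, where Dirichlet series are available. The factor at 2
is present because χ vanishes at even integers while ψ need not. -/
theorem RealSelfDual.LFunction_eq (h : RealSelfDual q a ψ) {M : ℕ} [NeZero M]
    {χ : DirichletCharacter ℂ M} (hχ : χ ≠ 1)
    (hval : ∀ n : ℕ, χ (n : ZMod M) = if Odd n then ((ψ n : ℤ) : ℂ) else 0) (s : ℂ) :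
    DirichletCharacter.LFunction χ s = (1 - ψ 2 * (2 : ℂ) ^ (-s)) *
      ((π : ℂ) ^ ((s + a) / 2) * (q : ℂ) ^ (-((s + a) / 2)) * (Complex.Gamma ((s + a) / 2))⁻¹ *
        mellin (theta q a (fun n => ((ψ n : ℤ) : ℂ))) ((s + a) / 2)) := by
  have hq : (0 : ℝ) < q := Nat.cast_pos.2 (NeZero.pos q)
  have hd1 : Differentiable ℂ (DirichletCharacter.LFunction χ) :=
    DirichletCharacter.differentiable_LFunction hχ
  have hM := (mellin_theta_properties hq (fun n : ℕ => h.norm_le n) (by simp [h.map_zero])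
    (show 0 < 1 / 4 + (a : ℝ) / 2 by positivity) fun t ht => h.theta_feq ht).1
  have hπ : (π : ℂ) ≠ 0 := ofReal_ne_zero.2 Real.pi_ne_zero
  have hq' : (q : ℂ) ≠ 0 := Nat.cast_ne_zero.2 (NeZero.ne q)
  have hd2 : Differentiable ℂ fun s : ℂ => (1 - ψ 2 * (2 : ℂ) ^ (-s)) *
      ((π : ℂ) ^ ((s + a) / 2) * (q : ℂ) ^ (-((s + a) / 2)) * (Complex.Gamma ((s + a) / 2))⁻¹ *
        mellin (theta q a (fun n => ((ψ n : ℤ) : ℂ))) ((s + a) / 2)) := by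
    have l : Differentiable ℂ fun s : ℂ => (s + a) / 2 := by fun_prop
    have hg : Differentiable ℂ fun s : ℂ => (Complex.Gamma ((s + a) / 2))⁻¹ :=
      Complex.differentiable_one_div_Gamma.comp l
    have hm : Differentiable ℂ fun s : ℂ =>
      mellin (theta q a (fun n => ((ψ n : ℤ) : ℂ))) ((s + a) / 2) := hM.comp l
    have h2 : Differentiable ℂ fun s : ℂ => (2 : ℂ) ^ (-s) :=
      fun s => (differentiableAt_id.neg).const_cpow (Or.inl two_ne_zero)
    have h3 : Differentiable ℂ fun s : ℂ => (π : ℂ) ^ ((s + a) / 2) :=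
      fun s => (l s).const_cpow (Or.inl hπ)
    have h4 : Differentiable ℂ fun s : ℂ => (q : ℂ) ^ (-((s + a) / 2)) :=
      fun s => (l s).neg.const_cpow (Or.inl hq')
    exact ((differentiable_const _).sub ((differentiable_const _).mul h2)).mul (((h3.mul h4).mul hg).mul hm)
  have hEq : (DirichletCharacter.LFunction χ) =ᶠ[𝓝 2] fun s : ℂ => (1 - ψ 2 * (2 : ℂ) ^ (-s)) *
      ((π : ℂ) ^ ((s + a) / 2) * (q : ℂ) ^ (-((s + a) / 2)) * (Complex.Gamma ((s + a) / 2))⁻¹ *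
        mellin (theta q a (fun n => ((ψ n : ℤ) : ℂ))) ((s + a) / 2)) := by
    have : {s : ℂ | 1 < s.re} ∈ 𝓝 (2 : ℂ) :=
      (isOpen_lt continuous_const Complex.continuous_re).mem_nhds (by norm_num)
    filter_upwards [this] with s hs
    have h1 := hasSum_mellin_theta (a := a) hq (fun n : ℕ => h.norm_le n) (by simp [h.map_zero]) hs
    rw [ofReal_natCast] at h1
    have h2 := hasSum_odd_part (z := ψ 2 * (2 : ℂ) ^ (-s)) h1 fun n => by
      push_cast
      rw [h.map_mul, cpow_neg, ← Nat.cast_ofNat (R := ℂ), natCast_mul_natCast_cpow]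
      push_cast
      field_simp
    rw [← h2.tsum_eq, DirichletCharacter.LFunction_eq_LSeries χ hs, LSeries]
    refine tsum_congr fun n => ?_
    rw [LSeries.term_def]
    rcases Nat.eq_zero_or_pos n with rfl | hn
    · simp
    rw [if_neg hn.ne', hval]
    split_ifs <;> simp
  exact congrFun (AnalyticOnNhd.eq_of_eventuallyEq
    (fun z _ => hd1.analyticAt z) (fun z _ => hd2.analyticAt z) hEq) s

/-- The approximate functional equation at the central point. -/
theorem RealSelfDual.approx_feq (h : RealSelfDual q a ψ) {σ : ℝ} (hσ : σ = 1 / 4 + a / 2) {M : ℕ} [NeZero M]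
    {χ : DirichletCharacter ℂ M} (hχ : χ ≠ 1)
    (hval : ∀ n : ℕ, χ (n : ZMod M) = if Odd n then ((ψ n : ℤ) : ℂ) else 0) {Y : ℝ} (hY : 0 < Y) :
    DirichletCharacter.LFunction χ (1 / 2) = (((1 - ψ 2 / √2) *
      ((∑' n : ℕ, ψ n * ((n : ℝ) ^ (-(1 / 2) : ℝ) * cutoff σ (n ^ 2 * Y / q))) +
        ∑' n : ℕ, ψ n * ((n : ℝ) ^ (-(1 / 2) : ℝ) * cutoff σ (n ^ 2 * (1 / Y) / q))) : ℝ) : ℂ) := by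
  have hq : (0 : ℝ) < q := Nat.cast_pos.2 (NeZero.pos q)
  have hσ0 : 0 < σ := by rw [hσ]; positivity
  have hc0 : (fun n : ℕ => ((ψ n : ℤ) : ℂ)) 0 = 0 := by simp [h.map_zero]
  have hs1 := hasSum_tail_theta hq (fun n : ℕ => h.norm_le n) hc0 hσ hY
  have hs2 := hasSum_tail_theta hq (fun n : ℕ => h.norm_le n) hc0 hσ (Y := 1 / Y) (by positivity)
  have hsplit := mellin_theta_split hq (fun n : ℕ => h.norm_le n) hc0 hσ0
    (fun t ht => by rw [hσ]; exact h.theta_feq ht) hY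
  have hw : ((1 / 2 : ℂ) + a) / 2 = (σ : ℂ) := by rw [hσ]; push_cast; ring
  rw [h.LFunction_eq hχ hval, hw, hsplit]
  have t1 : ((∑' n : ℕ, ψ n * ((n : ℝ) ^ (-(1 / 2) : ℝ) * cutoff σ (n ^ 2 * Y / q)) : ℝ) : ℂ) =
    ((q : ℝ) ^ (-σ) / piGamma σ : ℝ) * ∫ t in Ioi Y, ((t ^ (σ - 1) : ℝ) : ℂ) *
      theta q a (fun n : ℕ => ((ψ n : ℤ) : ℂ)) t := by
    rw [← hs1.tsum_eq, ofReal_tsum]; push_cast; rfl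
  have t2 : ((∑' n : ℕ, ψ n * ((n : ℝ) ^ (-(1 / 2) : ℝ) * cutoff σ (n ^ 2 * (1 / Y) / q)) : ℝ) : ℂ) =
    ((q : ℝ) ^ (-σ) / piGamma σ : ℝ) * ∫ t in Ioi (1 / Y), ((t ^ (σ - 1) : ℝ) : ℂ) *
      theta q a (fun n : ℕ => ((ψ n : ℤ) : ℂ)) t := by
    rw [← hs2.tsum_eq, ofReal_tsum]; push_cast; rfl
  have hu : (ψ 2 : ℂ) * (2 : ℂ) ^ (-(1 / 2) : ℂ) = ((ψ 2 / √2 : ℝ) : ℂ) := by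
    rw [cpow_neg, Real.sqrt_eq_rpow]
    push_cast
    rw [ofReal_cpow (by norm_num)]
    push_cast
    simp only [div_eq_mul_inv]
  have hG : (π : ℂ) ^ (σ : ℂ) * (q : ℂ) ^ (-(σ : ℂ)) * (Complex.Gamma σ)⁻¹ =
      ((q : ℝ) ^ (-σ) / piGamma σ : ℝ) := by
    rw [piGamma_eq hσ0, Complex.Gamma_ofReal, Real.rpow_neg Real.pi_pos.le, Real.rpow_neg hq.le]
    push_cast
    rw [ofReal_cpow Real.pi_pos.le, ofReal_cpow hq.le, cpow_neg]
    push_cast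
    have := (Real.Gamma_pos_of_pos hσ0).ne'
    field_simp
  rw [hu, hG, ofReal_mul, ofReal_add, t1, t2]
  push_cast
  ring

end
end LMoment

end

/-! ### The real characters behind the twists -/

noncomputable section
namespace LMoment
open Complex Filter Topology Finset
open scoped Real NumberTheorySymbols

theorem eta_abs_le_one (i : Fin 4) (n : ℤ) : |eta i n| ≤ 1 := by
  fin_cases i
  · simp [eta]
  · change |ZMod.χ₄ (n : ZMod 4)| ≤ 1
    generalize (n : ZMod 4) = x
    revert x; decide
  · change |ZMod.χ₈ (n : ZMod 8)| ≤ 1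
    generalize (n : ZMod 8) = x
    revert x; decide
  · change |ZMod.χ₈' (n : ZMod 8)| ≤ 1
    generalize (n : ZMod 8) = x
    revert x; decide

theorem eta_zero_of_ne {i : Fin 4} (hi : i ≠ 0) : eta i 0 = 0 := by
  fin_cases i
  · exact absurd rfl hi
  all_goals rfl

theorem eta_two_of_ne {i : Fin 4} (hi : i ≠ 0) : eta i 2 = 0 := by
  fin_cases i
  · exact absurd rfl hi
  all_goals rfl

theorem etaMod_even_of_ne {i : Fin 4} (hi : i ≠ 0) : Even (etaMod i) := by
  fin_cases i
  · exact absurd rfl hi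
  all_goals (simp only [etaMod]; decide)

theorem jacobiSym_abs_le_one (a : ℤ) (b : ℕ) : |J(a | b)| ≤ 1 := by
  rcases jacobiSym.trichotomy a b with h | h | h <;> rw [h] <;> simp

theorem psi_abs_le_one (i : Fin 4) (m : ℕ) (n : ℤ) : |psi i m n| ≤ 1 := by
  rw [psi, abs_mul]
  exact mul_le_one₀ (eta_abs_le_one i n) (abs_nonneg _) (jacobiSym_abs_le_one n m)

theorem psi_zero {i : Fin 4} {m : ℕ} (h : i ≠ 0 ∨ 1 < m) : psi i m 0 = 0 := by
  rw [psi]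
  rcases h with h | h
  · rw [eta_zero_of_ne h, zero_mul]
  · rw [jacobiSym.zero_left h, mul_zero]

theorem realSelfDual_psi {i : Fin 4} {m : ℕ} [NeZero m] (hm : Odd m) (hsq : Squarefree m)
    (h : i ≠ 0 ∨ 1 < m) :
    RealSelfDual (etaMod i * m) (if psi i m (-1) = 1 then 0 else 1) (psi i m) where
  map_mul := psi_mul i m
  abs_le_one := psi_abs_le_one i m
  map_zero := psi_zero h
  dual := by
    rcases selfDual_psi i m hm hsq with ⟨h1, h2⟩ | ⟨h1, h2⟩
    · exact Or.inl ⟨by rw [if_pos h1], h1, h2⟩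
    · exact Or.inr ⟨by rw [h1]; rfl, h1, h2⟩

/-- The index of the `2`-part of the product of `χ_d` with a character with `2`-part `i`. -/
def twistIndex (i : Fin 4) (d : ℕ) : Fin 4 := if d % 4 = 3 then ![1, 0, 3, 2] i else i

/-- For d ≡ 3 modulo 4 reciprocity produces a factor χ₄, and multiplication by χ₄ permutes the four
2-power characters on odd arguments. At even arguments the identity fails, since χ₄² is not the
constant 1 there. -/
theorem eta_twistIndex (i : Fin 4) (d : ℕ) {n : ℤ} (hn : Odd n) :
    eta (twistIndex i d) n = (if d % 4 = 3 then ZMod.χ₄ n else 1) * eta i n := by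
  have h4 : ∀ x : ZMod 4, x = 1 ∨ x = 3 ∨ x = 0 ∨ x = 2 := by decide
  rw [twistIndex]
  split_ifs with h
  · obtain ⟨k, rfl⟩ := hn
    have e8 : (((2 * k + 1 : ℤ)) : ZMod 4) = ((((2 * k + 1 : ℤ)) : ZMod 8).cast : ZMod 4) :=
      (ZMod.cast_intCast (by norm_num : (4 : ℕ) ∣ 8) _).symm
    have hx : ∃ y : ZMod 8, (((2 * k + 1 : ℤ)) : ZMod 8) = 2 * y + 1 := ⟨k, by push_cast; rfl⟩
    fin_cases i
    · change ZMod.χ₄ ((2 * k + 1 : ℤ) : ZMod 4) = ZMod.χ₄ _ * 1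
      rw [mul_one]
    · change 1 = ZMod.χ₄ ((2 * k + 1 : ℤ) : ZMod 4) * ZMod.χ₄ ((2 * k + 1 : ℤ) : ZMod 4)
      rw [e8]
      obtain ⟨y, hy⟩ := hx
      rw [hy]; clear hy; revert y; decide
    · change ZMod.χ₈' ((2 * k + 1 : ℤ) : ZMod 8) =
        ZMod.χ₄ ((2 * k + 1 : ℤ) : ZMod 4) * ZMod.χ₈ ((2 * k + 1 : ℤ) : ZMod 8)
      rw [e8]
      obtain ⟨y, hy⟩ := hx
      rw [hy]; clear hy; revert y; decide
    · change ZMod.χ₈ ((2 * k + 1 : ℤ) : ZMod 8) =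
        ZMod.χ₄ ((2 * k + 1 : ℤ) : ZMod 4) * ZMod.χ₈' ((2 * k + 1 : ℤ) : ZMod 8)
      rw [e8]
      obtain ⟨y, hy⟩ := hx
      rw [hy]; clear hy; revert y; decide
  · rw [one_mul]

/-- The explicit description of a primitive quadratic character. -/
structure QuadForm {N : ℕ} (χ : DirichletCharacter ℂ N) (i : Fin 4) (m : ℕ) : Prop where
  odd : Odd m
  squarefree : Squarefree m
  level : N = etaMod i * m
  apply : ∀ n : ℕ, χ (n : ZMod N) = ((psi i m n : ℤ) : ℂ)

theorem coprime_etaMod_of_odd (i : Fin 4) {n : ℕ} (hn : Odd n) : n.Coprime (etaMod i) :=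
  (etaMod_coprime i hn).symm

theorem jacobiSym_flip {d n : ℕ} (hd : Odd d) (hn : Odd n) :
    J((d : ℤ) | n) = (if d % 4 = 3 then ZMod.χ₄ n else 1) * J((n : ℤ) | d) := by
  split_ifs with h
  · rcases Nat.odd_mod_four_iff.1 (Nat.odd_iff.1 hn) with h' | h'
    · rw [jacobiSym.quadratic_reciprocity_one_mod_four' hd h', ZMod.χ₄_nat_one_mod_four h', one_mul]
    · rw [jacobiSym.quadratic_reciprocity_three_mod_four h h', ZMod.χ₄_nat_three_mod_four h']
      ring
  · have : d % 4 = 1 := by have := Nat.odd_mod_four_iff.1 (Nat.odd_iff.1 hd); omega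
    rw [jacobiSym.quadratic_reciprocity_one_mod_four this hn, one_mul]

theorem psi_twistIndex (i : Fin 4) {d m n : ℕ} (hd : Odd d) (hm : Odd m) (hn : Odd n) :
    psi (twistIndex i d) (d * m) n = J((d : ℤ) | n) * psi i m n := by
  have := hd.pos.ne'
  have := hm.pos.ne'
  rw [psi, psi, eta_twistIndex i d (by exact_mod_cast hn), jacobiSym_flip hd hn, jacobiSym.mul_right' _ ‹_› ‹_›]
  push_cast
  ring

/-- The modulus 4dN forces the value 0 at even n, where `psi` may be ±1; this discrepancy is the
Euler factor at 2. At odd n not prime to the modulus the Jacobi symbol vanishes as well. -/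
theorem twist_apply {N : ℕ} [NeZero N] {χ : DirichletCharacter ℂ N} {i : Fin 4} {m : ℕ}
    (hχ : QuadForm χ i m) (d : ℕ) [NeZero d] (hd : Odd d) (n : ℕ) :
    twist d χ (n : ZMod (4 * d * N)) =
      if Odd n then ((psi (twistIndex i d) (d * m) n : ℤ) : ℂ) else 0 := by
  by_cases hn : n.Coprime (4 * d * N)
  · have ho : Odd n := Nat.coprime_two_right.1 (hn.coprime_dvd_right ⟨2 * d * N, by ring⟩)
    have hu : IsUnit (n : ZMod (4 * d * N)) := (ZMod.isUnit_iff_coprime _ _).2 hn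
    rw [if_pos ho, psi_twistIndex i hd hχ.odd ho, twist, MulChar.mul_apply]
    have e1 : (chi d).changeLevel (Dvd.intro N rfl) (n : ZMod (4 * d * N)) = chi d (n : ZMod (4 * d)) := by
      have := DirichletCharacter.changeLevel_eq_cast_of_dvd (chi d) (Dvd.intro N rfl : 4 * d ∣ 4 * d * N) hu.unit
      rw [IsUnit.unit_spec, ZMod.cast_natCast (Dvd.intro N rfl)] at this
      exact this
    have e2 : χ.changeLevel (Dvd.intro_left (4 * d) rfl) (n : ZMod (4 * d * N)) = χ (n : ZMod N) := by
      have := DirichletCharacter.changeLevel_eq_cast_of_dvd χ (Dvd.intro_left (4 * d) rfl : N ∣ 4 * d * N) hu.unit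
      rw [IsUnit.unit_spec, ZMod.cast_natCast (Dvd.intro_left (4 * d) rfl)] at this
      exact this
    rw [e1, e2, chi_natCast d (hn.coprime_dvd_right (Dvd.intro N rfl)), hχ.apply]
    push_cast; rfl
  · rw [MulChar.map_nonunit _ (by rwa [ZMod.isUnit_iff_coprime])]
    split_ifs with ho
    · have : NeZero (d * m) := ⟨(hd.mul hχ.odd).pos.ne'⟩
      rw [psi, jacobiSym.eq_zero_iff_not_coprime.2, mul_zero, Int.cast_zero]
      rw [Int.gcd_natCast_natCast]
      intro h
      apply hn
      have h' : n.Coprime (d * m) := h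
      rw [hχ.level]
      have h4 : n.Coprime 4 := (Nat.coprime_two_right.2 ho).pow_right 2
      exact (h4.mul_right h'.coprime_mul_right_right).mul_right
        ((coprime_etaMod_of_odd i ho).mul_right h'.coprime_mul_left_right)
    · rfl

end LMoment

end

/-! ### Non-principality, and the correction polynomial as a divisor sum -/

noncomputable section
namespace LMoment
open Complex Filter Topology Finset
open scoped Real NumberTheorySymbols

/-- If χ were principal, ψ would be non-negative at odd integers, hence everywhere: for odd q by
periodicity, for even q because ψ(2) = 0. Self-duality at 0 says that ψ sums to zero over a period,
contradicting ψ(1) = 1. -/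
theorem RealSelfDual.ne_one {q : ℕ} [NeZero q] {a : ℕ} {ψ : ℤ → ℤ} (h : RealSelfDual q a ψ)
    (h2 : Even q → ψ 2 = 0) {M : ℕ} [NeZero M] {χ : DirichletCharacter ℂ M}
    (hval : ∀ n : ℕ, χ (n : ZMod M) = if Odd n then ((ψ n : ℤ) : ℂ) else 0) : χ ≠ 1 := by
  rintro rfl
  have hodd : ∀ n : ℕ, Odd n → 0 ≤ ψ n := by
    intro n hn
    have := hval n
    rw [if_pos hn] at this
    by_cases hu : IsUnit (n : ZMod M)
    · rw [MulChar.one_apply hu] at this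
      have : ψ n = 1 := by exact_mod_cast this.symm
      omega
    · rw [MulChar.map_nonunit _ hu] at this
      have : ψ n = 0 := by exact_mod_cast this.symm
      omega
  have hper : ∃ κ, SelfDual q κ (fun n => (ψ n : ℂ)) := by
    rcases h.dual with ⟨_, _, h⟩ | ⟨_, _, h⟩ <;> exact ⟨_, h⟩
  obtain ⟨κ, hκ⟩ := hper
  have hper' : ∀ a b : ℤ, (a : ZMod q) = b → ψ a = ψ b := fun a b hab => by
    exact_mod_cast hκ.periodic a b hab
  have hall : ∀ n : ℕ, 0 ≤ ψ n := by
    intro n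
    rcases Nat.even_or_odd n with hn | hn
    · rcases Nat.even_or_odd q with hq | hq
      · obtain ⟨k, rfl⟩ := hn
        have : ((k + k : ℕ) : ℤ) = 2 * k := by push_cast; ring
        rw [this, h.map_mul, h2 hq, zero_mul]
      · rw [hper' n ((n + q : ℕ) : ℤ) (by simp)]
        exact hodd _ (hn.add_odd hq)
    · exact hodd n hn
  have hsum := hκ.dual 0
  simp only [h.map_zero, Int.cast_zero, mul_zero, AddChar.map_zero_eq_one, mul_one] at hsum
  have hsum' : ∑ b : ZMod q, ψ (b.val : ℤ) = 0 := by exact_mod_cast hsum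
  rw [Finset.sum_eq_zero_iff_of_nonneg fun b _ => hall _] at hsum'
  have h1 := hsum' 1 (mem_univ _)
  have h3 : ψ 1 = ψ ((1 : ZMod q).val : ℤ) := hper' _ _ (by simp)
  have h4 := hval 1
  simp at h4
  rw [h1] at h3
  rw [h3] at h4
  simp at h4

theorem twist_ne_one {N : ℕ} [NeZero N] {χ : DirichletCharacter ℂ N} {i : Fin 4} {m : ℕ}
    (hχ : QuadForm χ i m) {d : ℕ} [NeZero d] (hd : Odd d) (hsq : Squarefree (d * m))
    (h : twistIndex i d ≠ 0 ∨ 1 < d * m) : twist d χ ≠ 1 := by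
  have hodd : Odd (d * m) := hd.mul hχ.odd
  have : NeZero (d * m) := ⟨hodd.pos.ne'⟩
  refine (realSelfDual_psi hodd hsq h).ne_one ?_ (twist_apply hχ d hd)
  intro he
  have hi : twistIndex i d ≠ 0 := by
    intro hi
    rw [hi, Nat.even_mul] at he
    rcases he with he | he
    · simp [etaMod] at he
    · exact (Nat.not_even_iff_odd.2 hodd) he
  rw [psi, eta_two_of_ne hi, zero_mul]

/-- `μ(r) t(r) / √r` as an arithmetic function. -/
def sieveWeight (t : ℤ → ℤ) : ArithmeticFunction ℝ :=
  ⟨fun r => (ArithmeticFunction.moebius r : ℝ) * t r / √r, by simp⟩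

theorem sieveWeight_isMultiplicative {t : ℤ → ℤ} (h1 : t 1 = 1) (hm : ∀ a b, t (a * b) = t a * t b) :
    (sieveWeight t).IsMultiplicative := by
  refine ⟨by simp [sieveWeight, h1], fun {a b} hab => ?_⟩
  simp only [sieveWeight, ArithmeticFunction.coe_mk]
  rw [ArithmeticFunction.isMultiplicative_moebius.map_mul_of_coprime hab]
  push_cast
  rw [hm, Real.sqrt_mul (Nat.cast_nonneg a)]
  push_cast
  field_simp

/-- Only the exponents 0 and 1 of p survive the Möbius factor. -/
theorem sum_sieveWeight_prime_pow (t : ℤ → ℤ) (h1 : t 1 = 1) {p : ℕ} (hp : p.Prime) (k : ℕ) :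
    (sieveWeight t * ((ArithmeticFunction.sigma 0 : ArithmeticFunction ℕ) : ArithmeticFunction ℝ)) (p ^ k) =
      k + 1 - k * (t p / √p) := by
  rw [ArithmeticFunction.mul_apply, Nat.sum_divisorsAntidiagonal
    (f := fun x y => sieveWeight t x * ((ArithmeticFunction.sigma 0 : ArithmeticFunction ℕ) : ArithmeticFunction ℝ) y),
    Nat.sum_divisors_prime_pow hp]
  have hdiv : ∀ x ∈ Finset.range (k + 1), p ^ k / p ^ x = p ^ (k - x) := fun x hx =>
    Nat.pow_div (by have := Finset.mem_range.1 hx; omega) hp.pos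
  rw [Finset.sum_congr rfl fun x hx => by rw [hdiv x hx]]
  simp only [ArithmeticFunction.natCoe_apply, ArithmeticFunction.sigma_zero_apply_prime_pow hp]
  rcases k with _ | k
  · simp [sieveWeight, h1]
  · rw [Finset.sum_range_succ', Finset.sum_range_succ', Finset.sum_eq_zero]
    · simp [sieveWeight, h1, ArithmeticFunction.moebius_apply_prime hp]
      ring
    · intro x _
      simp [sieveWeight, ArithmeticFunction.moebius_apply_prime_pow hp]

theorem sum_sieveWeight_eq_prod {t : ℤ → ℤ} (h1 : t 1 = 1) (hm : ∀ a b, t (a * b) = t a * t b)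
    {d : ℕ} (hd : d ≠ 0) :
    ∑ x ∈ d.divisorsAntidiagonal, sieveWeight t x.1 * (x.2.divisors.card : ℝ) =
      d.factorization.prod fun p k => (k + 1 - k * (t p / √p) : ℝ) := by
  have hmul := (sieveWeight_isMultiplicative h1 hm).mul
    (ArithmeticFunction.isMultiplicative_sigma (k := 0)).natCast
  have := hmul.multiplicative_factorization _ hd
  rw [ArithmeticFunction.mul_apply] at this
  simp only [ArithmeticFunction.natCoe_apply, ArithmeticFunction.sigma_zero_apply] at this
  rw [this]
  refine Finset.prod_congr rfl fun p hp => ?_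
  exact sum_sieveWeight_prime_pow t h1 (Nat.prime_of_mem_primeFactors hp) _

/-- At s = 1/2 the exponents n - 2ns vanish and χ(p)² = 1, so each term of the first local sum is 1;
by t(p)³ = t(p) each term of the second is t(p)/√p. The local factor α + 1 - α t(p)/√p is that of a
convolution. -/
theorem corr_eq {N : ℕ} [NeZero N] {χ : DirichletCharacter ℂ N} {d₀ d₁ : ℕ} [NeZero d₀]
    (hquad : χ.IsQuadratic) (hodd : Odd d₁) (hcop : d₁.Coprime N) {t : ℤ → ℤ} (h1 : t 1 = 1)
    (hm : ∀ a b, t (a * b) = t a * t b) (hle : ∀ n, |t n| ≤ 1)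
    (ht : ∀ n : ℕ, Odd n → twist d₀ χ (n : ZMod (4 * d₀ * N)) = ((t n : ℤ) : ℂ)) :
    corr d₀ d₁ χ (1 / 2) =
      ((∑ x ∈ d₁.divisorsAntidiagonal, sieveWeight t x.1 * (x.2.divisors.card : ℝ) : ℝ) : ℂ) := by
  rw [sum_sieveWeight_eq_prod h1 hm hodd.pos.ne', corr, Finsupp.prod, Finsupp.prod, ofReal_prod]
  refine Finset.prod_congr rfl fun p hp => ?_
  have hpp := Nat.prime_of_mem_primeFactors hp
  have hpd : p ∣ d₁ := Nat.dvd_of_mem_primeFactors hp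
  have hpo : Odd p := hodd.of_dvd_nat hpd
  have hu : IsUnit (p : ZMod N) := (ZMod.isUnit_iff_coprime _ _).2 (hcop.coprime_dvd_left hpd)
  have hχ2 : χ (p : ZMod N) ^ 2 = 1 := by
    rcases hquad (p : ZMod N) with h | h | h
    · exact absurd h (hu.map χ).ne_zero
    · rw [h, one_pow]
    · rw [h]; norm_num
  have hp0 : (p : ℂ) ≠ 0 := Nat.cast_ne_zero.2 hpp.ne_zero
  have e1 : ∀ n : ℕ, χ ((p ^ (2 * n) : ℕ) : ZMod N) * (p : ℂ) ^ ((n : ℂ) - 2 * n * (1 / 2)) = 1 := by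
    intro n
    have : ((n : ℂ) - 2 * n * (1 / 2)) = 0 := by ring
    rw [this, cpow_zero, mul_one]
    push_cast
    rw [pow_mul, map_pow, map_pow, hχ2, one_pow]
  have ht3 : t p * t p * t p = t p := by
    have := abs_le.1 (hle p)
    have : t p = 0 ∨ t p = 1 ∨ t p = -1 := by omega
    rcases this with h | h | h <;> rw [h] <;> norm_num
  have htp : ∀ n : ℕ, t ((p ^ (2 * n + 1) : ℕ) : ℤ) = t p := by
    intro n
    induction n with
    | zero => simp
    | succ n ih =>
      have : ((p ^ (2 * (n + 1) + 1) : ℕ) : ℤ) = ((p ^ (2 * n + 1) : ℕ) : ℤ) * (p * p) := by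
        push_cast; ring
      rw [this, hm, hm, ih, ← mul_assoc, ht3]
  have e2 : ∀ n : ℕ, twist d₀ χ ((p ^ (2 * n + 1) : ℕ) : ZMod (4 * d₀ * N)) *
      (p : ℂ) ^ ((n : ℂ) - (2 * n + 1) * (1 / 2)) = ((t p / √p : ℝ) : ℂ) := by
    intro n
    have : ((n : ℂ) - (2 * n + 1) * (1 / 2)) = -((1 / 2 : ℝ) : ℂ) := by push_cast; ring
    rw [ht _ hpo.pow, htp, this, cpow_neg, Real.sqrt_eq_rpow, div_eq_mul_inv]
    push_cast
    rw [ofReal_cpow (Nat.cast_nonneg p)]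
    push_cast
    rfl
  simp_rw [e1, e2]
  rw [Finset.sum_const, Finset.sum_const, Finset.card_range, Finset.card_range]
  push_cast
  simp only [nsmul_eq_mul]
  push_cast
  ring

/-- Every prime dividing 2N divides the modulus 4dN, where the character vanishes, so the extra
Euler factors equal 1. -/
theorem LRemoved_twist {N : ℕ} [NeZero N] (χ : DirichletCharacter ℂ N) (d : ℕ) [NeZero d] (s : ℂ) :
    LRemoved (2 * N) s (twist d χ) = DirichletCharacter.LFunction (twist d χ) s := by
  rw [LRemoved, Finset.prod_eq_one, mul_one]
  intro p hp
  have hpp := Nat.prime_of_mem_primeFactors hp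
  have hd := Nat.dvd_of_mem_primeFactors hp
  rw [MulChar.map_nonunit, zero_mul, sub_zero]
  rw [ZMod.isUnit_iff_coprime, hpp.coprime_iff_not_dvd, not_not]
  exact hd.trans ⟨2 * d, by ring⟩

end LMoment

end

/-! ### Absorbing the correction polynomial into the expansion -/

noncomputable section
namespace LMoment
open Complex Filter Topology Finset
open scoped Real NumberTheorySymbols

theorem summable_cutoff_series {c : ℕ → ℝ} (hc : ∀ n, |c n| ≤ 1) (hc0 : c 0 = 0) {σ β y : ℝ} (hσ : 0 < σ)
    (hβ : 1 / 4 < β) (hy : 0 < y) :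
    (Summable fun n : ℕ => |c n| * ((n : ℝ) ^ (-(1 / 2) : ℝ) * cutoff σ (n ^ 2 * y))) ∧
    ∑' n : ℕ, |c n| * ((n : ℝ) ^ (-(1 / 2) : ℝ) * cutoff σ (n ^ 2 * y)) ≤
      piGamma (σ + β) / piGamma σ * (∑' n : ℕ, (n : ℝ) ^ (-(1 / 2) - 2 * β)) * y ^ (-β) := by
  have h0 : Summable fun n : ℕ => (n : ℝ) ^ (-(1 / 2) - 2 * β) :=
    Real.summable_nat_rpow.2 (by linarith)
  have hG := piGamma_pos hσ
  have hG1 := piGamma_pos (show 0 < σ + β by linarith)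
  have hle : ∀ n : ℕ, |c n| * ((n : ℝ) ^ (-(1 / 2) : ℝ) * cutoff σ (n ^ 2 * y)) ≤
      (piGamma (σ + β) / piGamma σ * y ^ (-β)) * (n : ℝ) ^ (-(1 / 2) - 2 * β) := by
    intro n
    rcases Nat.eq_zero_or_pos n with rfl | hn
    · rw [hc0, abs_zero, zero_mul]; positivity
    have hn' : (0 : ℝ) < n := Nat.cast_pos.2 hn
    have hcut := cutoff_le_rpow (β := β) hσ (by linarith) (x := n ^ 2 * y) (by positivity)
    have hcut0 := cutoff_nonneg hσ (x := n ^ 2 * y) (by positivity)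
    calc |c n| * ((n : ℝ) ^ (-(1 / 2) : ℝ) * cutoff σ (n ^ 2 * y))
        ≤ 1 * ((n : ℝ) ^ (-(1 / 2) : ℝ) * (piGamma (σ + β) / piGamma σ * (n ^ 2 * y) ^ (-β))) := by
          gcongr
          exact hc n
      _ = _ := by
          have e : (n : ℝ) ^ (-(1 / 2) - 2 * β) = (n : ℝ) ^ (-(1 / 2) : ℝ) * ((n : ℝ) ^ 2) ^ (-β) := by
            rw [← Real.rpow_natCast, ← Real.rpow_mul hn'.le, ← Real.rpow_add hn']; congr 1; push_cast; ring
          rw [e, Real.mul_rpow (by positivity) hy.le]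
          ring
  have hs : Summable fun n : ℕ => |c n| * ((n : ℝ) ^ (-(1 / 2) : ℝ) * cutoff σ (n ^ 2 * y)) :=
    (h0.mul_left _).of_nonneg_of_le (fun n => by
      have := cutoff_nonneg hσ (x := n ^ 2 * y) (by positivity)
      positivity) hle
  refine ⟨hs, (hs.tsum_le_tsum hle (h0.mul_left _)).trans (le_of_eq ?_)⟩
  rw [tsum_mul_left]; ring

theorem sum_moebius_dvd {k g : ℕ} (hg : g ≠ 0) :
    ∑ r ∈ g.divisors, (if r ∣ k then (ArithmeticFunction.moebius r : ℝ) else 0) =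
      if k.Coprime g then 1 else 0 := by
  rw [← Finset.sum_filter]
  have h1 : g.divisors.filter (· ∣ k) = (k.gcd g).divisors := by
    ext r
    simp only [Finset.mem_filter, Nat.mem_divisors, Nat.dvd_gcd_iff]
    have : k.gcd g ≠ 0 := fun h => hg (Nat.gcd_eq_zero_iff.1 h).2
    tauto
  rw [h1]
  have h2 := congrArg (fun f : ArithmeticFunction ℤ => f (k.gcd g)) ArithmeticFunction.coe_zeta_mul_moebius
  simp only [ArithmeticFunction.coe_zeta_mul_apply, ArithmeticFunction.one_apply] at h2
  have h3 : ((∑ r ∈ (k.gcd g).divisors, ArithmeticFunction.moebius r : ℤ) : ℝ) =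
    ((if k.gcd g = 1 then 1 else 0 : ℤ) : ℝ) := by rw [h2]
  push_cast at h3
  rw [h3]

/-- Removing the sieve weights from a weighted character sum. -/
theorem sum_sieveWeight_series {t : ℤ → ℤ} (hm : ∀ a b, t (a * b) = t a * t b) (hle : ∀ n, |t n| ≤ 1)
    (h0 : t 0 = 0) {σ y : ℝ} (hσ : 0 < σ) (hy : 0 < y) {g : ℕ} (hg : g ≠ 0) :
    ∑ r ∈ g.divisors, sieveWeight t r *
      ∑' n : ℕ, t n * ((n : ℝ) ^ (-(1 / 2) : ℝ) * cutoff σ (n ^ 2 * (r ^ 2 * y))) =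
    ∑' k : ℕ, (if k.Coprime g then (t k : ℝ) else 0) * ((k : ℝ) ^ (-(1 / 2) : ℝ) * cutoff σ (k ^ 2 * y)) := by
  set G : ℕ → ℝ := fun k => t k * ((k : ℝ) ^ (-(1 / 2) : ℝ) * cutoff σ (k ^ 2 * y)) with hG
  have hGs : Summable G := by
    refine Summable.of_norm ((summable_cutoff_series (c := fun n => t n) (fun n => by exact_mod_cast hle n)
      (by simp [h0]) hσ (β := 1) (by norm_num) hy).1.congr fun n => ?_)
    have := cutoff_nonneg hσ (x := n ^ 2 * y) (by positivity)
    rw [hG, Real.norm_eq_abs, abs_mul, abs_of_nonneg (a := (n : ℝ) ^ (-(1 / 2) : ℝ) * _) (by positivity)]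
  have hterm : ∀ r ∈ g.divisors, HasSum (fun k : ℕ => if r ∣ k then (ArithmeticFunction.moebius r : ℝ) * G k else 0)
      (sieveWeight t r *
      ∑' n : ℕ, t n * ((n : ℝ) ^ (-(1 / 2) : ℝ) * cutoff σ (n ^ 2 * (r ^ 2 * y)))) := by
    intro r hr
    have hr0 : 0 < r := Nat.pos_of_mem_divisors hr
    have hinj : Function.Injective (fun n : ℕ => r * n) := fun a b h => Nat.eq_of_mul_eq_mul_left hr0 h
    rw [← hinj.hasSum_iff]
    · have hGr : Summable fun n : ℕ => G (r * n) := hGs.comp_injective hinj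
      -- t(r)t(n) = t(rn), and the factor r² in the cutoff fits as well: the rth series is the
      -- subseries over the multiples of r, weighted by μ(r).
      have e : ∀ n : ℕ, sieveWeight t r * (t n * ((n : ℝ) ^ (-(1 / 2) : ℝ) * cutoff σ (n ^ 2 * (r ^ 2 * y)))) =
          (ArithmeticFunction.moebius r : ℝ) * G (r * n) := by
        intro n
        have hr' : (0 : ℝ) < r := Nat.cast_pos.2 hr0
        rw [hG]
        simp only [sieveWeight, ArithmeticFunction.coe_mk]
        push_cast
        rw [hm, Real.mul_rpow hr'.le (Nat.cast_nonneg n), Real.rpow_neg hr'.le, ← Real.sqrt_eq_rpow]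
        have e3 : ((r : ℝ) * n) ^ 2 * y = n ^ 2 * (r ^ 2 * y) := by ring
        rw [e3]
        push_cast
        field_simp
      rw [← tsum_mul_left, tsum_congr e]
      refine (hGr.mul_left _).hasSum.congr_fun fun n => ?_
      simp
    · intro k hk
      rw [if_neg]
      rintro ⟨n, rfl⟩
      exact hk ⟨n, rfl⟩
  rw [← (hasSum_sum hterm).tsum_eq]
  refine tsum_congr fun k => ?_
  have := sum_moebius_dvd (k := k) hg
  have e : ∀ r ∈ g.divisors, (if r ∣ k then (ArithmeticFunction.moebius r : ℝ) * G k else 0) =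
    (if r ∣ k then (ArithmeticFunction.moebius r : ℝ) else 0) * G k := by
    intro r _; split_ifs <;> simp
  rw [Finset.sum_congr rfl e, ← Finset.sum_mul, this, hG]
  split_ifs <;> simp

/-- Triple factorizations d = r·e·f are regrouped by e instead of r, so that the Möbius sum over r
can be carried out inside g = rf. -/
theorem sum_antidiagonal_assoc (d : ℕ) (F : ℕ → ℕ → ℕ → ℝ) :
    ∑ x ∈ d.divisorsAntidiagonal, ∑ z ∈ x.2.divisorsAntidiagonal, F x.1 z.1 z.2 =
      ∑ x ∈ d.divisorsAntidiagonal, ∑ z ∈ x.2.divisorsAntidiagonal, F z.1 x.1 z.2 := by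
  rw [Finset.sum_sigma', Finset.sum_sigma']
  refine Finset.sum_bij' (fun x _ => ⟨(x.2.1, x.1.1 * x.2.2), (x.1.1, x.2.2)⟩)
    (fun x _ => ⟨(x.2.1, x.1.1 * x.2.2), (x.1.1, x.2.2)⟩) ?_ ?_ ?_ ?_ ?_
  · rintro ⟨⟨a, b⟩, ⟨c, e⟩⟩ h
    simp only [Finset.mem_sigma, Nat.mem_divisorsAntidiagonal] at h ⊢
    obtain ⟨⟨h1, h2⟩, h3, h4⟩ := h
    subst h3; subst h1
    refine ⟨⟨by ring, h2⟩, trivial, ?_⟩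
    intro h; apply h2
    rcases Nat.mul_eq_zero.1 h with h | h <;> simp [h]
  · rintro ⟨⟨a, b⟩, ⟨c, e⟩⟩ h
    simp only [Finset.mem_sigma, Nat.mem_divisorsAntidiagonal] at h ⊢
    obtain ⟨⟨h1, h2⟩, h3, h4⟩ := h
    subst h3; subst h1
    refine ⟨⟨by ring, h2⟩, trivial, ?_⟩
    intro h; apply h2
    rcases Nat.mul_eq_zero.1 h with h | h <;> simp [h]
  · rintro ⟨⟨a, b⟩, ⟨c, e⟩⟩ h
    simp only [Finset.mem_sigma, Nat.mem_divisorsAntidiagonal] at h ⊢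
    obtain ⟨⟨h1, h2⟩, h3, h4⟩ := h
    subst h3; rfl
  · rintro ⟨⟨a, b⟩, ⟨c, e⟩⟩ h
    simp only [Finset.mem_sigma, Nat.mem_divisorsAntidiagonal] at h ⊢
    obtain ⟨⟨h1, h2⟩, h3, h4⟩ := h
    subst h3; rfl
  · rintro ⟨⟨a, b⟩, ⟨c, e⟩⟩ h
    rfl

/-- Optimizing the approximate functional equation against the correction polynomial. -/
theorem mul_sum_sieveWeight {L : ℝ} {t : ℤ → ℤ} (hm : ∀ a b, t (a * b) = t a * t b)
    (hle : ∀ n, |t n| ≤ 1) (h0 : t 0 = 0) {σ q : ℝ} (hσ : 0 < σ) (hq : 0 < q) {v : ℝ}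
    (hL : ∀ Y : ℝ, 0 < Y → L = v *
      ((∑' n : ℕ, t n * ((n : ℝ) ^ (-(1 / 2) : ℝ) * cutoff σ (n ^ 2 * Y / q))) +
        ∑' n : ℕ, t n * ((n : ℝ) ^ (-(1 / 2) : ℝ) * cutoff σ (n ^ 2 * (1 / Y) / q)))) {d : ℕ} (hd : d ≠ 0) :
    L * ∑ x ∈ d.divisorsAntidiagonal, sieveWeight t x.1 * (x.2.divisors.card : ℝ) =
      2 * v * ∑ x ∈ d.divisorsAntidiagonal, ∑' k : ℕ, (if k.Coprime x.2 then (t k : ℝ) else 0) *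
        ((k : ℝ) ^ (-(1 / 2) : ℝ) * cutoff σ (k ^ 2 * ((x.1 : ℝ) ^ 2 / (x.2 ^ 2 * q)))) := by
  set A : ℕ → ℕ → ℝ := fun e f => ∑' n : ℕ, t n * ((n : ℝ) ^ (-(1 / 2) : ℝ) * cutoff σ (n ^ 2 * ((e : ℝ) / f) ^ 2 / q)) with hA
  have hstep : ∀ m : ℕ, m ≠ 0 → L * (m.divisors.card : ℝ) = 2 * v * ∑ z ∈ m.divisorsAntidiagonal, A z.1 z.2 := by
    intro m hm0
    -- The number of divisors counts the factorizations m = ef, and the copy of L attached to (e, f)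
    -- uses Y = (e/f)². Then 1/Y belongs to (f, e), so the two halves have equal sums over all
    -- factorizations.
    have hz : ∀ z ∈ m.divisorsAntidiagonal, L = v * (A z.1 z.2 + A z.2 z.1) := by
      rintro ⟨e, f⟩ hz
      have hne := (Nat.mem_divisorsAntidiagonal.1 hz)
      have he : (0 : ℝ) < e := Nat.cast_pos.2 (Nat.pos_of_ne_zero fun h => hm0 (by rw [← hne.1, h, zero_mul]))
      have hf : (0 : ℝ) < f := Nat.cast_pos.2 (Nat.pos_of_ne_zero fun h => hm0 (by rw [← hne.1, h, mul_zero]))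
      rw [hL (((e : ℝ) / f) ^ 2) (by positivity), hA]
      have : 1 / ((e : ℝ) / f) ^ 2 = ((f : ℝ) / e) ^ 2 := by field_simp
      rw [this]
    have hsum := Finset.sum_congr rfl hz
    have hcard : m.divisorsAntidiagonal.card = m.divisors.card := by
      rw [Finset.card_eq_sum_ones, Finset.card_eq_sum_ones]
      exact Nat.sum_divisorsAntidiagonal (fun _ _ => 1)
    rw [Finset.sum_const, hcard, nsmul_eq_mul, ← Finset.mul_sum, Finset.sum_add_distrib] at hsum
    have hswap : ∑ z ∈ m.divisorsAntidiagonal, A z.2 z.1 = ∑ z ∈ m.divisorsAntidiagonal, A z.1 z.2 := by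
      conv_rhs => rw [← Nat.map_swap_divisorsAntidiagonal, Finset.sum_map]
      rfl
    rw [hswap] at hsum
    linarith
  have h1 : L * ∑ x ∈ d.divisorsAntidiagonal, sieveWeight t x.1 * (x.2.divisors.card : ℝ) =
      2 * v * ∑ x ∈ d.divisorsAntidiagonal, ∑ z ∈ x.2.divisorsAntidiagonal, sieveWeight t x.1 * A z.1 z.2 := by
    rw [Finset.mul_sum, Finset.mul_sum]
    refine Finset.sum_congr rfl fun x hx => ?_
    have hx2 : x.2 ≠ 0 := by
      intro h
      have := (Nat.mem_divisorsAntidiagonal.1 hx).1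
      rw [h, mul_zero] at this
      exact hd this.symm
    rw [← Finset.mul_sum]
    linear_combination (sieveWeight t x.1) * hstep x.2 hx2
  rw [h1, sum_antidiagonal_assoc d fun r e f => sieveWeight t r * A e f]
  congr 1
  refine Finset.sum_congr rfl fun x hx => ?_
  obtain ⟨e, g⟩ := x
  have hne := (Nat.mem_divisorsAntidiagonal.1 hx)
  simp only at hne ⊢
  have he : (0 : ℝ) < e := Nat.cast_pos.2 (Nat.pos_of_ne_zero fun h => hne.2 (by rw [← hne.1, h, zero_mul]))
  have hg0 : g ≠ 0 := fun h => hne.2 (by rw [← hne.1, h, mul_zero])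
  have hg : (0 : ℝ) < g := Nat.cast_pos.2 (Nat.pos_of_ne_zero hg0)
  -- With f = g/r the quotient (e/f)²/q equals r²·e²/(g²q), the shape in which the Möbius weights
  -- can be removed.
  rw [← sum_sieveWeight_series hm hle h0 hσ (y := (e : ℝ) ^ 2 / (g ^ 2 * q)) (by positivity) hg0,
    Nat.sum_divisorsAntidiagonal (f := fun r f => sieveWeight t r * A e f)]
  refine Finset.sum_congr rfl fun r hr => ?_
  have hr0 : (0 : ℝ) < r := Nat.cast_pos.2 (Nat.pos_of_mem_divisors hr)
  congr 1
  rw [hA]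
  refine tsum_congr fun n => ?_
  rw [Nat.cast_div (Nat.dvd_of_mem_divisors hr) hr0.ne']
  congr 3
  field_simp

end LMoment

end

/-! ### The explicit series for the corrected central value -/

noncomputable section
namespace LMoment
open Complex Filter Topology Finset
open scoped Real NumberTheorySymbols

/-- Pairs of an exponent of two and an odd part parametrize the positive integers. -/
theorem two_pow_mul_odd_injective : Function.Injective (fun x : ℕ × ℕ => 2 ^ x.1 * (2 * x.2 + 1)) := by
  rintro ⟨a, b⟩ ⟨c, d⟩ h
  simp only at h
  have key : ∀ a b c d : ℕ, a ≤ c → 2 ^ a * (2 * b + 1) = 2 ^ c * (2 * d + 1) → a = c := by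
    intro a b c d hac h
    obtain ⟨k, rfl⟩ := Nat.exists_eq_add_of_le hac
    rw [pow_add, mul_assoc] at h
    have h' := Nat.eq_of_mul_eq_mul_left (by positivity) h
    rcases k with _ | k
    · rfl
    · rw [pow_succ] at h'
      have : 2 ^ k * 2 * (2 * d + 1) = 2 * (2 ^ k * (2 * d + 1)) := by ring
      omega
  have hac : a = c := by
    rcases le_total a c with h' | h'
    · exact key a b c d h' h
    · exact (key c d a b h' h.symm).symm
  subst hac
  have := Nat.eq_of_mul_eq_mul_left (by positivity) h
  ext <;> simp
  omega

theorem tsum_odd_eq {G : ℕ → ℝ} : ∑' l : ℕ, G (2 * l + 1) = ∑' n : ℕ, if Odd n then G n else 0 := by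
  have hinj : Function.Injective (fun l : ℕ => 2 * l + 1) := fun a b h => by simpa using h
  rw [← hinj.tsum_eq (f := fun n => if Odd n then G n else 0)]
  · refine tsum_congr fun l => ?_
    rw [if_pos ⟨l, rfl⟩]
  · intro n hn
    by_cases ho : Odd n
    · obtain ⟨l, rfl⟩ := ho; exact ⟨l, rfl⟩
    · simp [ho] at hn

/-- Sorting the indices as 2^j times an odd number isolates the prime 2 in a geometric series. Only
odd n remain, for which the character can be written with the symbol (k/n). -/
theorem tsum_two_pow_split {t : ℤ → ℤ} (hm : ∀ a b, t (a * b) = t a * t b) (hle : ∀ n, |t n| ≤ 1)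
    (h0 : t 0 = 0) {σ y : ℝ} (hσ : 0 < σ) (hy : 0 < y) :
    ∑' k : ℕ, (t k : ℝ) * ((k : ℝ) ^ (-(1 / 2) : ℝ) * cutoff σ (k ^ 2 * y)) =
      ∑' j : ℕ, (t 2 / √2 : ℝ) ^ j * ∑' n : ℕ, if Odd n then
        (t n : ℝ) * ((n : ℝ) ^ (-(1 / 2) : ℝ) * cutoff σ (n ^ 2 * (4 ^ j * y))) else 0 := by
  set G : ℕ → ℝ := fun k => t k * ((k : ℝ) ^ (-(1 / 2) : ℝ) * cutoff σ (k ^ 2 * y)) with hG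
  have hGs : Summable G := by
    refine Summable.of_norm ((summable_cutoff_series (c := fun n => t n) (fun n => by exact_mod_cast hle n)
      (by simp [h0]) hσ (β := 1) (by norm_num) hy).1.congr fun n => ?_)
    have := cutoff_nonneg hσ (x := n ^ 2 * y) (by positivity)
    rw [hG, Real.norm_eq_abs, abs_mul, abs_of_nonneg (a := (n : ℝ) ^ (-(1 / 2) : ℝ) * _) (by positivity)]
  have hpow : ∀ j : ℕ, t ((2 : ℤ) ^ j) = t 2 ^ j ∨ j = 0 := by
    intro j
    rcases j with _ | j
    · exact Or.inr rfl
    · left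
      induction j with
      | zero => simp
      | succ j ih => rw [pow_succ, hm, ih, ← pow_succ]
  have h2 : ∀ (j n : ℕ), t ((2 ^ j * n : ℕ) : ℤ) = t 2 ^ j * t n := by
    intro j n
    push_cast
    rcases hpow j with h | rfl
    · rw [hm, h]
    · simp
  rw [← two_pow_mul_odd_injective.tsum_eq (f := G)]
  · refine (hGs.comp_injective two_pow_mul_odd_injective).tsum_prod.trans ?_
    refine tsum_congr fun j => ?_
    rw [← tsum_odd_eq (G := fun n => (t n : ℝ) * ((n : ℝ) ^ (-(1 / 2) : ℝ) * cutoff σ (n ^ 2 * (4 ^ j * y)))),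
      ← tsum_mul_left]
    refine tsum_congr fun l => ?_
    rw [hG]
    simp only [Function.comp_apply]
    rw [h2]
    have e : (((2 ^ j * (2 * l + 1) : ℕ) : ℝ)) ^ (-(1 / 2) : ℝ) = (√2)⁻¹ ^ j * ((2 * l + 1 : ℕ) : ℝ) ^ (-(1 / 2) : ℝ) := by
      push_cast
      rw [Real.mul_rpow (by positivity) (by positivity), Real.sqrt_eq_rpow, ← Real.rpow_neg (by norm_num),
        ← Real.rpow_natCast, ← Real.rpow_mul (by norm_num), ← Real.rpow_natCast, ← Real.rpow_mul (by norm_num), mul_comm (j : ℝ)]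
    have e2 : (((2 ^ j * (2 * l + 1) : ℕ) : ℝ)) ^ 2 * y = ((2 * l + 1 : ℕ) : ℝ) ^ 2 * (4 ^ j * y) := by
      have : (4 : ℝ) ^ j = (2 ^ j) ^ 2 := by rw [← pow_mul, mul_comm, pow_mul]; norm_num
      push_cast; rw [this]; ring
    rw [e, e2]
    push_cast
    rw [div_pow, inv_pow]
    ring
  · intro k hk
    have hk0 : k ≠ 0 := by rintro rfl; simp [hG, h0] at hk
    obtain ⟨j, l, hl, rfl⟩ := Nat.exists_eq_two_pow_mul_odd hk0
    obtain ⟨b, rfl⟩ := hl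
    exact ⟨(j, b), rfl⟩

/-- The sum over odd `n` of `(k / n) χ(n) / √n` with the incomplete Gamma cutoff. -/
def oddSum (σ : ℝ) (i : Fin 4) (m k : ℕ) (y : ℝ) : ℝ :=
  ∑' n : ℕ, if Odd n then
    ((J((k : ℤ) | n) * psi i m n : ℤ) : ℝ) * ((n : ℝ) ^ (-(1 / 2) : ℝ) * cutoff σ (n ^ 2 * y)) else 0

/-- The value at `2` of `χ_d χ`, divided by `√2`. -/
def twoFactor (i : Fin 4) (m c : ℕ) : ℝ :=
  ((eta (twistIndex i c) 2 * J(2 | c * m) : ℤ) : ℝ) / √2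

/-- The part of the conductor of `χ_d χ` that is prime to `d`. -/
def twistLevel (i : Fin 4) (m c : ℕ) : ℕ := etaMod (twistIndex i c) * m

/-- The parameter of the cutoff function attached to the parity. -/
def gammaShape (i : Fin 4) (m : ℕ) : ℝ := if psi i m (-1) = 1 then 1 / 4 else 3 / 4

theorem gammaShape_pos (i : Fin 4) (m : ℕ) : 0 < gammaShape i m := by
  rw [gammaShape]; split_ifs <;> norm_num

/-- The factor (-1/d) of the Jacobi symbol is cancelled by the factor χ₄(-1) of the 2-part. The
Gamma factor is therefore the same for all d. -/
theorem psi_twistIndex_neg_one (i : Fin 4) {d m : ℕ} (hd : Odd d) (hm : Odd m) :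
    psi (twistIndex i d) (d * m) (-1) = psi i m (-1) := by
  rw [psi, psi, eta_twistIndex i d (by decide), jacobiSym.mul_right' _ hd.pos.ne' hm.pos.ne',
    jacobiSym.at_neg_one hd]
  have h1 : ZMod.χ₄ ((-1 : ℤ) : ZMod 4) = -1 := by decide
  rw [h1]
  rcases Nat.odd_mod_four_iff.1 (Nat.odd_iff.1 hd) with h | h
  · rw [ZMod.χ₄_nat_one_mod_four h]; simp [h]
  · rw [ZMod.χ₄_nat_three_mod_four h]; simp [h]

theorem odd_sq_mod_eight {e : ℕ} (he : Odd e) : e ^ 2 % 8 = 1 := by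
  have h : e % 8 = 1 ∨ e % 8 = 3 ∨ e % 8 = 5 ∨ e % 8 = 7 := by have := Nat.odd_iff.1 he; omega
  rw [Nat.pow_mod]
  rcases h with h | h | h | h <;> rw [h]

theorem jacobiSym_two_congr {a b : ℕ} (ha : Odd a) (hb : Odd b) (h : a % 8 = b % 8) :
    J(2 | a) = J(2 | b) := by
  rw [jacobiSym.at_two ha, jacobiSym.at_two hb, ZMod.χ₈_nat_mod_eight a, h, ← ZMod.χ₈_nat_mod_eight b]

theorem twistIndex_congr (i : Fin 4) {a b : ℕ} (h : a % 8 = b % 8) : twistIndex i a = twistIndex i b := by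
  have : a % 4 = b % 4 := by omega
  rw [twistIndex, twistIndex, this]

theorem twoFactor_congr (i : Fin 4) {m a b : ℕ} (hm : Odd m) (ha : Odd a) (hb : Odd b) (h : a % 8 = b % 8) :
    twoFactor i m a = twoFactor i m b := by
  rw [twoFactor, twoFactor, twistIndex_congr i h, jacobiSym_two_congr (ha.mul hm) (hb.mul hm)]
  rw [Nat.mul_mod, h, ← Nat.mul_mod]

theorem twistLevel_congr (i : Fin 4) {m a b : ℕ} (h : a % 8 = b % 8) :
    twistLevel i m a = twistLevel i m b := by
  rw [twistLevel, twistLevel, twistIndex_congr i h]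

/-- The explicit series for the corrected central value. -/
def centralSeries (i : Fin 4) (m d : ℕ) : ℝ :=
  2 * ∑ e ∈ (sqRoot d).divisors, ∑' j : ℕ, (1 - twoFactor i m d) * twoFactor i m d ^ j *
    oddSum (gammaShape i m) i m (d / e ^ 2) (4 ^ j * (e ^ 4 / (d * twistLevel i m d)))

/-- The hypothesis `hne` makes the twist non-principal, so that the approximate functional equation
applies. Passing from the modulus d₀m to d₀g²m inserts the condition (n, g) = 1, and k = d₀g² = d/e²
need no longer be squarefree. Odd squares are 1 modulo 8, so d, d₀ and k share the same value at 2
and the same level F; finally e²/(g²q) = e⁴/(dF). -/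
theorem centralValue_eq {N : ℕ} [NeZero N] {χ : DirichletCharacter ℂ N} {i : Fin 4} {m : ℕ}
    (hχ : QuadForm χ i m) (hquad : χ.IsQuadratic) {d : ℕ} (hd : Odd d) (hdm : d.Coprime m)
    (hne : twistIndex i d ≠ 0 ∨ 1 < sqfree d * m) :
    LRemoved (2 * N) (1 / 2) (twist (sqfree d) χ) * corr (sqfree d) (sqRoot d) χ (1 / 2) =
      (centralSeries i m d : ℂ) := by
  have hd0 := hd.pos.ne'
  have hdec := sqfree_mul_sqRoot_sq hd0
  set d₀ := sqfree d with hd₀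
  set d₁ := sqRoot d with hd₁
  have hdvd0 : d₀ ∣ d := ⟨d₁ ^ 2, hdec.symm⟩
  have hdvd1 : d₁ ∣ d := ⟨d₀ * d₁, by rw [← hdec]; ring⟩
  have ho0 : Odd d₀ := hd.of_dvd_nat hdvd0
  have ho1 : Odd d₁ := hd.of_dvd_nat hdvd1
  have hm0 := hχ.odd.pos
  have hmod : d₀ % 8 = d % 8 := by
    conv_rhs => rw [← hdec]
    rw [Nat.mul_mod, odd_sq_mod_eight ho1]; simp
  have hidx := twistIndex_congr i hmod
  have hsq : Squarefree (d₀ * m) := (Nat.squarefree_mul (hdm.coprime_dvd_left hdvd0)).2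
    ⟨squarefree_sqfree d, hχ.squarefree⟩
  have hodd : Odd (d₀ * m) := ho0.mul hχ.odd
  have : NeZero (d₀ * m) := ⟨hodd.pos.ne'⟩
  rw [← hidx] at hne
  set t : ℤ → ℤ := psi (twistIndex i d₀) (d₀ * m) with ht
  have hS := realSelfDual_psi hodd hsq hne
  rw [← ht] at hS
  have hσ : gammaShape i m = 1 / 4 + ((if t (-1) = 1 then 0 else 1 : ℕ) : ℝ) / 2 := by
    rw [gammaShape, ht, psi_twistIndex_neg_one i ho0 hχ.odd]
    split_ifs <;> norm_num
  have htw := twist_apply hχ d₀ ho0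
  have hfe := fun (Y : ℝ) (hY : 0 < Y) => hS.approx_feq hσ (twist_ne_one hχ ho0 hsq hne) htw hY
  have ht1 : t 1 = 1 := by
    rw [ht, psi, jacobiSym.one_left, mul_one]
    generalize twistIndex i d₀ = k
    fin_cases k <;> simp [eta]
  have hcop : d₁.Coprime N := by
    rw [hχ.level]
    exact (coprime_etaMod_of_odd i ho1).mul_right (hdm.coprime_dvd_left hdvd1)
  rw [LRemoved_twist, corr_eq hquad ho1 hcop ht1 hS.map_mul hS.abs_le_one fun n hn => by
    rw [htw, if_pos hn]]
  have hL := hfe 1 one_pos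
  set L : ℝ := (1 - t 2 / √2) * ((∑' n : ℕ, t n * ((n : ℝ) ^ (-(1 / 2) : ℝ) * cutoff (gammaShape i m) (n ^ 2 * 1 / (etaMod (twistIndex i d₀) * (d₀ * m) : ℕ)))) +
        ∑' n : ℕ, t n * ((n : ℝ) ^ (-(1 / 2) : ℝ) * cutoff (gammaShape i m) (n ^ 2 * (1 / 1) / (etaMod (twistIndex i d₀) * (d₀ * m) : ℕ)))) with hLdef
  rw [hL, ← ofReal_mul]
  congr 1
  have hq : (0 : ℝ) < (etaMod (twistIndex i d₀) * (d₀ * m) : ℕ) := by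
    have : 0 < etaMod (twistIndex i d₀) := NeZero.pos _
    have := hodd.pos
    positivity
  rw [mul_sum_sieveWeight hS.map_mul hS.abs_le_one hS.map_zero (gammaShape_pos i m) hq (v := 1 - t 2 / √2)
    (fun Y hY => by have := hfe Y hY; rw [hL] at this; exact_mod_cast this) ho1.pos.ne']
  have hu : (t 2 / √2 : ℝ) = twoFactor i m d := by
    rw [← twoFactor_congr i hχ.odd ho0 hd hmod, twoFactor, ht, psi]
  rw [hu, centralSeries, mul_assoc]
  congr 1
  rw [Finset.mul_sum, Nat.sum_divisorsAntidiagonal (f := fun e g => (1 - twoFactor i m d) * ∑' k : ℕ, (if k.Coprime g then (t k : ℝ) else 0) *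
        ((k : ℝ) ^ (-(1 / 2) : ℝ) * cutoff (gammaShape i m) (k ^ 2 * ((e : ℝ) ^ 2 / (g ^ 2 * (etaMod (twistIndex i d₀) * (d₀ * m) : ℕ))))))]
  refine Finset.sum_congr rfl fun e he => ?_
  have he0 : 0 < e := Nat.pos_of_mem_divisors he
  obtain ⟨g, hg⟩ : ∃ g, d₁ = e * g := Nat.dvd_of_mem_divisors he
  have hg0 : 0 < g := Nat.pos_of_ne_zero fun h => ho1.pos.ne' (by rw [hg, h, mul_zero])
  have hge : d₁ / e = g := by rw [hg, Nat.mul_div_cancel_left _ he0]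
  have hgodd : Odd g := ho1.of_dvd_nat ⟨e, by rw [hg]; ring⟩
  have hdeq : d = e ^ 2 * (d₀ * g ^ 2) := by rw [← hdec, hg]; ring
  have hde : d / e ^ 2 = d₀ * g ^ 2 := by rw [hdeq, Nat.mul_div_cancel_left _ (by positivity)]
  rw [hge, hde]
  have hk8 : (d₀ * g ^ 2) % 8 = d₀ % 8 := by rw [Nat.mul_mod, odd_sq_mod_eight hgodd]; simp
  have hkodd : Odd (d₀ * g ^ 2) := ho0.mul hgodd.pow
  set t' : ℤ → ℤ := psi (twistIndex i d₀) (d₀ * g ^ 2 * m) with ht'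
  have hNg : NeZero g := ⟨hg0.ne'⟩
  have hNm : NeZero m := ⟨hm0.ne'⟩
  have hNk : NeZero (d₀ * g ^ 2 * m) := ⟨(hkodd.mul hχ.odd).pos.ne'⟩
  have htt : ∀ k : ℕ, (if k.Coprime g then (t k : ℝ) else 0) = t' k := by
    intro k
    have e1 : d₀ * g ^ 2 * m = d₀ * m * (g * g) := by ring
    have e2 : t' k = t k * J((k : ℤ) | g) ^ 2 := by
      rw [ht', ht, psi, psi, e1, jacobiSym.mul_right _ (d₀ * m), jacobiSym.mul_right _ g]; ring
    rw [e2]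
    split_ifs with hkg
    · rw [jacobiSym.sq_one (by rw [Int.gcd_natCast_natCast]; exact hkg), mul_one]
    · rw [jacobiSym.eq_zero_iff_not_coprime.2 (by rw [Int.gcd_natCast_natCast]; exact hkg)]
      simp
  have ht'0 : t' 0 = 0 := by
    rcases hne with h | h
    · exact psi_zero (Or.inl h)
    · refine psi_zero (Or.inr (lt_of_lt_of_le h ?_))
      calc d₀ * m = d₀ * 1 * m := by ring
        _ ≤ _ := by gcongr; exact Nat.one_le_pow _ _ hg0
  have ht'2 : (t' 2 / √2 : ℝ) = twoFactor i m d := by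
    have : twoFactor i m d = twoFactor i m (d₀ * g ^ 2) :=
      twoFactor_congr i hχ.odd hd hkodd (by rw [hk8, hmod])
    rw [this, twoFactor, twistIndex_congr i hk8, ht', psi]
  have hy : ((e : ℝ) ^ 2 / (g ^ 2 * (etaMod (twistIndex i d₀) * (d₀ * m) : ℕ))) =
      (e : ℝ) ^ 4 / (d * twistLevel i m d) := by
    have h1 : (0 : ℝ) < e := Nat.cast_pos.2 he0
    have h2 : (0 : ℝ) < g := Nat.cast_pos.2 hg0
    have h3 : (0 : ℝ) < d₀ := Nat.cast_pos.2 ho0.pos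
    have h4 : (0 : ℝ) < m := Nat.cast_pos.2 hm0
    have h5 : (0 : ℝ) < etaMod (twistIndex i d₀) := Nat.cast_pos.2 (NeZero.pos _)
    have h6 : (d : ℝ) = e ^ 2 * (d₀ * g ^ 2) := by rw [hdeq]; push_cast; ring
    rw [h6, twistLevel, ← hidx]
    push_cast
    field_simp
  have hypos : (0 : ℝ) < (e : ℝ) ^ 4 / (d * twistLevel i m d) := by
    rw [← hy]
    have h1 : (0 : ℝ) < e := Nat.cast_pos.2 he0
    have h2 : (0 : ℝ) < g := Nat.cast_pos.2 hg0
    positivity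
  rw [tsum_congr fun k => by rw [htt k], hy, tsum_two_pow_split (psi_mul _ _) (psi_abs_le_one _ _) ht'0
    (gammaShape_pos i m) hypos, ht'2, ← tsum_mul_left]
  refine tsum_congr fun j => ?_
  rw [← mul_assoc]
  congr 1
  refine tsum_congr fun n => ?_
  split_ifs with hn
  · rw [← twistIndex_congr i hk8, psi_twistIndex i hkodd hχ.odd hn]
  · rfl

end LMoment

end

/-! ### Classification of primitive quadratic characters -/

noncomputable section
namespace LMoment
open Finset
open scoped NumberTheorySymbols

/-- The restriction of a character to the first factor of a coprime factorization. -/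
def leftPart {a b : ℕ} (h : a.Coprime b) (χ : DirichletCharacter ℂ (a * b)) : DirichletCharacter ℂ a where
  toFun z := χ ((ZMod.chineseRemainder h).symm (z, 1))
  map_one' := by rw [show ((1 : ZMod a), (1 : ZMod b)) = 1 from rfl, map_one, map_one]
  map_mul' x y := by
    rw [← map_mul, ← map_mul]
    congr 2
    ext <;> simp
  map_nonunit' x hx := by
    refine MulChar.map_nonunit _ fun hu => hx ?_
    have h1 := hu.map (ZMod.chineseRemainder h)
    rw [RingEquiv.apply_symm_apply] at h1
    exact (Prod.isUnit_iff.1 h1).1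

/-- The restriction of a character to the second factor of a coprime factorization. -/
def rightPart {a b : ℕ} (h : a.Coprime b) (χ : DirichletCharacter ℂ (a * b)) : DirichletCharacter ℂ b where
  toFun z := χ ((ZMod.chineseRemainder h).symm (1, z))
  map_one' := by rw [show ((1 : ZMod a), (1 : ZMod b)) = 1 from rfl, map_one, map_one]
  map_mul' x y := by
    rw [← map_mul, ← map_mul]
    congr 2
    ext <;> simp
  map_nonunit' x hx := by
    refine MulChar.map_nonunit _ fun hu => hx ?_
    have h1 := hu.map (ZMod.chineseRemainder h)
    rw [RingEquiv.apply_symm_apply] at h1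
    exact (Prod.isUnit_iff.1 h1).2

theorem apply_eq_leftPart_mul_rightPart {a b : ℕ} (h : a.Coprime b) (χ : DirichletCharacter ℂ (a * b)) (n : ℕ) :
    χ (n : ZMod (a * b)) = leftPart h χ (n : ZMod a) * rightPart h χ (n : ZMod b) := by
  change _ = χ _ * χ _
  rw [← map_mul, ← map_mul]
  congr 1
  rw [← RingEquiv.symm_apply_apply (ZMod.chineseRemainder h) (n : ZMod (a * b))]
  congr 1
  rw [map_natCast]
  ext <;> simp

theorem leftPart_isQuadratic {a b : ℕ} (h : a.Coprime b) {χ : DirichletCharacter ℂ (a * b)}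
    (hχ : χ.IsQuadratic) : (leftPart h χ).IsQuadratic := fun _ => hχ _

theorem rightPart_isQuadratic {a b : ℕ} (h : a.Coprime b) {χ : DirichletCharacter ℂ (a * b)}
    (hχ : χ.IsQuadratic) : (rightPart h χ).IsQuadratic := fun _ => hχ _

/-- Integers congruent to `1` modulo `8` are squares modulo every power of `2`. -/
theorem exists_sq_modEq_two_pow {c : ℕ} (hc : c % 8 = 1) (k : ℕ) : ∃ y : ℤ, (2 : ℤ) ^ (k + 3) ∣ y ^ 2 - c := by
  induction k with
  | zero => exact ⟨1, by simp; omega⟩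
  | succ k ih =>
    obtain ⟨y, z, hz⟩ := ih
    have hy : Odd y := by
      rcases Int.even_or_odd y with ⟨w, rfl⟩ | h
      · exfalso
        have e : (2 : ℤ) ^ (k + 3) = 8 * 2 ^ k := by rw [pow_add]; ring
        rw [e] at hz
        have : (w + w) ^ 2 = 4 * w ^ 2 := by ring
        have e3 : 8 * (2 : ℤ) ^ k * z = 8 * (2 ^ k * z) := by ring
        omega
      · exact h
    rcases Int.even_or_odd z with ⟨w, rfl⟩ | ⟨w, rfl⟩
    · exact ⟨y, w, by rw [hz]; ring⟩
    · obtain ⟨v, rfl⟩ := hy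
      -- Hensel step for an odd quotient z: adding 2^{k+2} to an odd root changes its square by
      -- 2^{k+3} modulo 2^{k+4}.
      refine ⟨2 * v + 1 + 2 ^ (k + 2), w + v + 1 + 2 ^ k, ?_⟩
      have e : (2 * v + 1 + 2 ^ (k + 2)) ^ 2 - (c : ℤ) =
        ((2 * v + 1) ^ 2 - c) + (2 * (2 * v + 1) * 2 ^ (k + 2) + 2 ^ (k + 2) * 2 ^ (k + 2)) := by ring
      rw [e, hz]
      ring

theorem IsQuadratic.apply_eq_one_of_sq {N : ℕ} {χ : DirichletCharacter ℂ N} (hχ : χ.IsQuadratic)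
    {x y : ZMod N} (hx : IsUnit x) (h : y ^ 2 = x) : χ x = 1 := by
  have hne : χ x ≠ 0 := (hx.map χ).ne_zero
  rw [← h, map_pow] at hne ⊢
  rcases hχ y with h | h | h
  · rw [h] at hne; simp at hne
  · rw [h]; norm_num
  · rw [h]; norm_num

theorem IsQuadratic.mul_self {N : ℕ} {χ : DirichletCharacter ℂ N} (hχ : χ.IsQuadratic)
    {x : ZMod N} (hx : IsUnit x) : χ x * χ x = 1 := by
  rw [← map_mul]
  exact IsQuadratic.apply_eq_one_of_sq hχ (hx.mul hx) (sq x)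

theorem IsQuadratic.eq_one_or {N : ℕ} {χ : DirichletCharacter ℂ N} (hχ : χ.IsQuadratic)
    {x : ZMod N} (hx : IsUnit x) : χ x = 1 ∨ χ x = -1 := by
  rcases hχ x with h | h | h
  · exact absurd h (hx.map χ).ne_zero
  · exact Or.inl h
  · exact Or.inr h

theorem isUnit_natCast_two_pow {k n : ℕ} (hn : Odd n) : IsUnit (n : ZMod (2 ^ k)) :=
  (ZMod.isUnit_iff_coprime _ _).2 ((Nat.coprime_two_right.2 hn).pow_right k)

/-- Quadratic characters of `2`-power modulus. -/
theorem exists_eta_of_two_pow (k : ℕ) {χ : DirichletCharacter ℂ (2 ^ k)} (hχ : χ.IsQuadratic) :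
    ∃ i : Fin 4, etaMod i ∣ 2 ^ k ∧ ∀ n : ℕ, Odd n → χ (n : ZMod (2 ^ k)) = ((eta i n : ℤ) : ℂ) := by
  have hu : ∀ n : ℕ, Odd n → IsUnit (n : ZMod (2 ^ k)) := fun n hn => isUnit_natCast_two_pow hn
  have h1 : χ ((1 : ℕ) : ZMod (2 ^ k)) = 1 := by simp
  have hcongr : ∀ a b : ℕ, a % 2 ^ k = b % 2 ^ k → χ (a : ZMod (2 ^ k)) = χ (b : ZMod (2 ^ k)) := by
    intro a b h
    rw [(ZMod.natCast_eq_natCast_iff a b (2 ^ k)).2 h]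
  rcases Nat.lt_or_ge k 3 with hk | hk
  · interval_cases k
    · exact ⟨0, by simp [etaMod], fun n hn => by rw [hcongr n 1 (by simp [Nat.mod_one]), h1]; simp [eta]⟩
    · exact ⟨0, by simp [etaMod], fun n hn => by
        rw [hcongr n 1 (by have := Nat.odd_iff.1 hn; omega), h1]; simp [eta]⟩
    · rcases IsQuadratic.eq_one_or hχ (hu 3 (by decide)) with h3 | h3
      · refine ⟨0, by simp [etaMod], fun n hn => ?_⟩
        rcases Nat.odd_mod_four_iff.1 (Nat.odd_iff.1 hn) with h | h
        · rw [hcongr n 1 (by omega), h1]; simp [eta]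
        · rw [hcongr n 3 (by omega), h3]; simp [eta]
      · refine ⟨1, by simp [etaMod], fun n hn => ?_⟩
        have e : eta 1 n = ZMod.χ₄ n := by
          change ZMod.χ₄ ((n : ℤ) : ZMod 4) = _
          rw [Int.cast_natCast]
        rcases Nat.odd_mod_four_iff.1 (Nat.odd_iff.1 hn) with h | h
        · rw [hcongr n 1 (by omega), h1, e, ZMod.χ₄_nat_one_mod_four h]; simp
        · rw [hcongr n 3 (by omega), h3, e, ZMod.χ₄_nat_three_mod_four h]; simp
  · obtain ⟨j, rfl⟩ := Nat.exists_eq_add_of_le' hk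
    -- Classes congruent to 1 modulo 8 are squares, so χ depends only on the residue modulo 8 and is
    -- determined by its signs at 3 and 5.
    have hsq : ∀ c : ℕ, c % 8 = 1 → χ (c : ZMod (2 ^ (j + 3))) = 1 := by
      intro c hc
      obtain ⟨y, hy⟩ := exists_sq_modEq_two_pow hc j
      refine IsQuadratic.apply_eq_one_of_sq hχ (hu c (Nat.odd_iff.2 (by omega))) (y := (y : ZMod (2 ^ (j + 3)))) ?_
      have h0 : ((y ^ 2 - c : ℤ) : ZMod (2 ^ (j + 3))) = 0 := by
        rw [ZMod.intCast_zmod_eq_zero_iff_dvd]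
        exact_mod_cast hy
      push_cast at h0
      exact sub_eq_zero.1 h0
    have hsame : ∀ a b : ℕ, Odd a → Odd b → a % 8 = b % 8 →
        χ (a : ZMod (2 ^ (j + 3))) = χ (b : ZMod (2 ^ (j + 3))) := by
      intro a b ha hb hab
      have h2 := hsq (a * b) (by rw [Nat.mul_mod, hab, ← Nat.mul_mod, ← sq, odd_sq_mod_eight hb])
      rw [Nat.cast_mul, map_mul] at h2
      have h3 := IsQuadratic.mul_self hχ (hu b hb)
      calc χ (a : ZMod (2 ^ (j + 3))) = χ a * (χ b * χ b) := by rw [h3, mul_one]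
        _ = _ := by rw [← mul_assoc, h2, one_mul]
    have h7 : χ ((7 : ℕ) : ZMod (2 ^ (j + 3))) = χ ((3 : ℕ) : ZMod (2 ^ (j + 3))) * χ ((5 : ℕ) : ZMod (2 ^ (j + 3))) := by
      rw [hsame 7 (3 * 5) (by decide) (by decide) (by decide), Nat.cast_mul, map_mul]
    have hdvd : ∀ i : Fin 4, etaMod i ∣ 2 ^ (j + 3) := by
      intro i
      refine dvd_trans ?_ (pow_dvd_pow 2 (Nat.le_add_left 3 j))
      fin_cases i <;> simp only [etaMod] <;> decide
    have hfin : ∀ i : Fin 4, ((eta i 3 : ℤ) : ℂ) = χ ((3 : ℕ) : ZMod (2 ^ (j + 3))) →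
        ((eta i 5 : ℤ) : ℂ) = χ ((5 : ℕ) : ZMod (2 ^ (j + 3))) →
        ∀ n : ℕ, Odd n → χ (n : ZMod (2 ^ (j + 3))) = ((eta i n : ℤ) : ℂ) := by
      intro i e3 e5 n hn
      have h8 : n % 8 = 1 ∨ n % 8 = 3 ∨ n % 8 = 5 ∨ n % 8 = 7 := by have := Nat.odd_iff.1 hn; omega
      have hper : ∀ r : ℕ, n % 8 = r % 8 → eta i n = eta i r := by
        intro r hr
        refine eta_periodic i _ _ ?_
        have h8 : ((n : ℤ) : ZMod 8) = ((r : ℤ) : ZMod 8) := by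
          simpa using (ZMod.natCast_eq_natCast_iff n r 8).2 hr
        have hd8 : etaMod i ∣ 8 := by fin_cases i <;> simp only [etaMod] <;> decide
        have := congrArg (ZMod.castHom hd8 (ZMod (etaMod i))) h8
        simpa using this
      have e1 : eta i 1 = 1 := by fin_cases i <;> simp [eta]
      have e7 : eta i 7 = eta i 3 * eta i 5 := by fin_cases i <;> decide
      rcases h8 with h | h | h | h
      · rw [hsame n 1 hn (by decide) (by omega), h1, hper 1 (by omega), Nat.cast_one, e1]; simp
      · rw [hsame n 3 hn (by decide) (by omega), hper 3 (by omega), ← e3]; rfl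
      · rw [hsame n 5 hn (by decide) (by omega), hper 5 (by omega), ← e5]; rfl
      · rw [hsame n 7 hn (by decide) (by omega), hper 7 (by omega), h7, ← e3, ← e5]
        rw [show ((7 : ℕ) : ℤ) = 7 from rfl, e7]; push_cast; rfl
    have v : eta 0 3 = 1 ∧ eta 0 5 = 1 ∧ eta 1 3 = -1 ∧ eta 1 5 = 1 ∧ eta 2 3 = -1 ∧ eta 2 5 = -1 ∧
      eta 3 3 = 1 ∧ eta 3 5 = -1 := by decide
    rcases IsQuadratic.eq_one_or hχ (hu 3 (by decide)) with h3 | h3 <;>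
    rcases IsQuadratic.eq_one_or hχ (hu 5 (by decide)) with h5 | h5
    · exact ⟨0, hdvd 0, hfin 0 (by rw [h3, v.1]; simp) (by rw [h5, v.2.1]; simp)⟩
    · exact ⟨3, hdvd 3, hfin 3 (by rw [h3, v.2.2.2.2.2.2.1]; simp) (by rw [h5, v.2.2.2.2.2.2.2]; simp)⟩
    · exact ⟨1, hdvd 1, hfin 1 (by rw [h3, v.2.2.1]; simp) (by rw [h5, v.2.2.2.1]; simp)⟩
    · exact ⟨2, hdvd 2, hfin 2 (by rw [h3, v.2.2.2.2.1]; simp) (by rw [h5, v.2.2.2.2.2.1]; simp)⟩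

/-- Quadratic characters of odd prime power modulus. -/
theorem exists_jacobi_of_odd_prime_pow {p : ℕ} (hp : p.Prime) (hp2 : p ≠ 2) {k : ℕ} (hk : 0 < k)
    {χ : DirichletCharacter ℂ (p ^ k)} (hχ : χ.IsQuadratic) :
    (∀ n : ℕ, n.Coprime p → χ (n : ZMod (p ^ k)) = 1) ∨
    (∀ n : ℕ, n.Coprime p → χ (n : ZMod (p ^ k)) = ((J((n : ℤ) | p) : ℤ) : ℂ)) := by
  have : Fact p.Prime := ⟨hp⟩
  have : NeZero (p ^ k) := ⟨pow_ne_zero _ hp.ne_zero⟩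
  have hcyc := ZMod.isCyclic_units_of_prime_pow p hp hp2 k
  obtain ⟨g, hg⟩ := hcyc.exists_generator
  have hpk : p ∣ p ^ k := dvd_pow_self p hk.ne'
  have hu : ∀ n : ℕ, n.Coprime p → IsUnit (n : ZMod (p ^ k)) := fun n hn =>
    (ZMod.isUnit_iff_coprime _ _).2 (hn.pow_right k)
  have hgen : ∀ n : ℕ, n.Coprime p → ∃ j : ℕ, (n : ZMod (p ^ k)) = ((g ^ j : (ZMod (p ^ k))ˣ) : ZMod (p ^ k)) := by
    intro n hn
    obtain ⟨j, hj⟩ := (mem_powers_iff_mem_zpowers.2 (hg (hu n hn).unit))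
    refine ⟨j, ?_⟩
    simp only at hj
    rw [hj, IsUnit.unit_spec]
  have hpr : ringChar (ZMod p) ≠ 2 := by rwa [ZMod.ringChar_zmod_n]
  set φ : ZMod (p ^ k) → ℤ := fun x => quadraticChar (ZMod p) (ZMod.castHom hpk (ZMod p) x) with hφ
  have hφn : ∀ n : ℕ, J((n : ℤ) | p) = φ n := by
    intro n
    rw [hφ, ← jacobiSym.legendreSym.to_jacobiSym]
    simp [legendreSym]
  have hφpow : ∀ j : ℕ, φ ((g ^ j : (ZMod (p ^ k))ˣ) : ZMod (p ^ k)) = φ (g : ZMod (p ^ k)) ^ j := by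
    intro j
    simp only [hφ, Units.val_pow_eq_pow_val, map_pow]
  rcases IsQuadratic.eq_one_or hχ g.isUnit with h1 | h1
  · left
    intro n hn
    obtain ⟨j, hj⟩ := hgen n hn
    rw [hj, Units.val_pow_eq_pow_val, map_pow, h1, one_pow]
  · right
    -- Some non-residue is a power of g, so the Legendre symbol cannot be 1 at g; it then agrees
    -- with χ at the generator.
    have hφg : φ (g : ZMod (p ^ k)) = -1 := by
      obtain ⟨a, ha⟩ := quadraticChar_exists_neg_one hpr
      have ha0 : a ≠ 0 := by rintro rfl; simp at ha
      have hcop : a.val.Coprime p := by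
        rw [← ZMod.isUnit_iff_coprime, ZMod.natCast_val, ZMod.cast_id]
        exact isUnit_iff_ne_zero.2 ha0
      obtain ⟨j, hj⟩ := hgen a.val hcop
      have h2 : φ (a.val : ZMod (p ^ k)) = -1 := by
        rw [hφ]; dsimp only; rw [map_natCast, ZMod.natCast_val, ZMod.cast_id]; exact ha
      rw [hj, hφpow] at h2
      have hne : ZMod.castHom hpk (ZMod p) (g : ZMod (p ^ k)) ≠ 0 := (g.isUnit.map _).ne_zero
      rcases quadraticChar_dichotomy hne with h | h
      · have h' : φ (g : ZMod (p ^ k)) = 1 := h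
        rw [h', one_pow] at h2
        norm_num at h2
      · exact h
    intro n hn
    obtain ⟨j, hj⟩ := hgen n hn
    rw [hφn, hj, hφpow, hφg, Units.val_pow_eq_pow_val, map_pow, h1]
    push_cast; rfl

/-- Induction over coprime factorizations of the modulus. Two coprime factors are not both even, so
one of the two 2-parts is trivial and they can be merged. Only a divisor of N appears as level;
primitivity later turns it into N. -/
theorem exists_psi_of_isQuadratic (N : ℕ) : 0 < N → ∀ χ : DirichletCharacter ℂ N, χ.IsQuadratic →
    ∃ (i : Fin 4) (m : ℕ), Odd m ∧ Squarefree m ∧ etaMod i * m ∣ N ∧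
      ∀ n : ℕ, n.Coprime N → χ (n : ZMod N) = ((psi i m n : ℤ) : ℂ) := by
  induction N using Nat.recOnPosPrimePosCoprime with
  | zero => intro h; exact absurd h (lt_irrefl _)
  | one =>
    intro _ χ _
    refine ⟨0, 1, odd_one, squarefree_one, by simp [etaMod], fun n _ => ?_⟩
    rw [DirichletCharacter.level_one χ, MulChar.one_apply (isUnit_of_subsingleton _)]
    simp [psi, eta]
  | prime_pow p k hp hk =>
    intro _ χ hχ
    by_cases hp2 : p = 2
    · subst hp2
      obtain ⟨i, hi, h⟩ := exists_eta_of_two_pow k hχ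
      refine ⟨i, 1, odd_one, squarefree_one, by rwa [mul_one], fun n hn => ?_⟩
      rw [h n (Nat.coprime_two_right.1 (hn.coprime_dvd_right (dvd_pow_self 2 hk.ne')))]
      simp [psi]
    · rcases exists_jacobi_of_odd_prime_pow hp hp2 hk hχ with h | h
      · refine ⟨0, 1, odd_one, squarefree_one, by simp [etaMod], fun n hn => ?_⟩
        rw [h n (hn.coprime_dvd_right (dvd_pow_self p hk.ne'))]
        simp [psi, eta]
      · refine ⟨0, p, hp.odd_of_ne_two hp2, hp.prime.squarefree, ?_, fun n hn => ?_⟩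
        · simpa [etaMod] using dvd_pow_self p hk.ne'
        rw [h n (hn.coprime_dvd_right (dvd_pow_self p hk.ne'))]
        simp [psi, eta]
  | coprime a b ha hb hab iha ihb =>
    intro _ χ hχ
    obtain ⟨i, m, hm, hms, hd, h⟩ := iha (by omega) (leftPart hab χ) (leftPart_isQuadratic hab hχ)
    obtain ⟨i', m', hm', hms', hd', h'⟩ := ihb (by omega) (rightPart hab χ) (rightPart_isQuadratic hab hχ)
    have hmm : m.Coprime m' := Nat.Coprime.coprime_dvd_left ((Dvd.intro_left _ rfl).trans hd)
      (hab.coprime_dvd_right ((Dvd.intro_left _ rfl).trans hd'))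
    have hsq : Squarefree (m * m') := (Nat.squarefree_mul hmm).2 ⟨hms, hms'⟩
    have hval : ∀ n : ℕ, n.Coprime (a * b) → χ (n : ZMod (a * b)) =
        ((psi i m n * psi i' m' n : ℤ) : ℂ) := by
      intro n hn
      rw [apply_eq_leftPart_mul_rightPart hab, h n hn.coprime_mul_right_right, h' n hn.coprime_mul_left_right]
      push_cast; rfl
    have hJ : ∀ n : ℤ, J(n | m * m') = J(n | m) * J(n | m') := fun n =>
      jacobiSym.mul_right' n hm.pos.ne' hm'.pos.ne'
    have hzero : i = 0 ∨ i' = 0 := by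
      by_contra hcon
      push Not at hcon
      have h2 := (etaMod_even_of_ne hcon.1).two_dvd.trans ((Dvd.intro _ rfl).trans hd)
      have h2' := (etaMod_even_of_ne hcon.2).two_dvd.trans ((Dvd.intro _ rfl).trans hd')
      exact Nat.not_coprime_of_dvd_of_dvd one_lt_two h2 h2' hab
    have hdd := mul_dvd_mul hd hd'
    rcases hzero with rfl | rfl
    · refine ⟨i', m * m', hm.mul hm', hsq, ?_, fun n hn => ?_⟩
      · refine dvd_trans (dvd_of_eq ?_) hdd
        simp [etaMod]; ring
      · rw [hval n hn, psi, psi, psi, hJ]; simp [eta]; ring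
    · refine ⟨i, m * m', hm.mul hm', hsq, ?_, fun n hn => ?_⟩
      · refine dvd_trans (dvd_of_eq ?_) hdd
        simp [etaMod]; ring
      · rw [hval n hn, psi, psi, psi, hJ]; simp [eta]; ring

/-- Classification of primitive quadratic characters. -/
theorem exists_quadForm {N : ℕ} [NeZero N] {χ : DirichletCharacter ℂ N} (hp : χ.IsPrimitive)
    (hq : χ.IsQuadratic) : ∃ i m, QuadForm χ i m := by
  obtain ⟨i, m, hm, hms, hd, h⟩ := exists_psi_of_isQuadratic N (NeZero.pos N) χ hq
  have hm0 : NeZero m := ⟨hm.pos.ne'⟩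
  have hlev : N = etaMod i * m := by
    -- By periodicity of `psi` the character is trivial on units that are 1 modulo this divisor of
    -- N; a primitive character allows no proper divisor.
    have hf : χ.FactorsThrough (etaMod i * m) := by
      rw [DirichletCharacter.factorsThrough_iff_ker_unitsMap hd]
      intro u hu
      rw [MonoidHom.mem_ker] at hu ⊢
      have hval : ((u : ZMod N).val : ZMod N) = u := by simp
      have hcop : (u : ZMod N).val.Coprime N := ZMod.val_coe_unit_coprime u
      have h1 := h _ hcop
      rw [hval] at h1
      have hu' : (((u : ZMod N).val : ℕ) : ZMod (etaMod i * m)) = 1 := by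
        have := congrArg Units.val hu
        rw [ZMod.unitsMap_val, Units.val_one] at this
        rw [← this, ZMod.natCast_val]
      have hψ : psi i m ((u : ZMod N).val : ℕ) = 1 := by
        have hS : ∃ κ, SelfDual (etaMod i * m) κ (fun n => ((psi i m n : ℤ) : ℂ)) := by
          rcases selfDual_psi i m hm hms with ⟨_, h⟩ | ⟨_, h⟩ <;> exact ⟨_, h⟩
        obtain ⟨κ, hκ⟩ := hS
        have h2 := hκ.periodic ((u : ZMod N).val : ℕ) 1 (by simpa using hu')
        have h3 : psi i m 1 = 1 := by
          rw [psi, jacobiSym.one_left, mul_one]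
          fin_cases i <;> simp [eta]
        rw [h3] at h2
        exact_mod_cast h2
      rw [hψ] at h1
      ext
      rw [MulChar.coe_toUnitHom, h1]; simp
    have h1 : χ.conductor ≤ etaMod i * m := Nat.sInf_le hf
    have h2 : χ.conductor = N := hp
    rw [h2] at h1
    exact le_antisymm h1 (Nat.le_of_dvd (NeZero.pos N) hd)
  refine ⟨i, m, hm, hms, hlev, fun n => ?_⟩
  by_cases hn : n.Coprime N
  · exact h n hn
  rw [MulChar.map_nonunit _ (by rwa [ZMod.isUnit_iff_coprime]), psi]
  by_cases hnm : n.Coprime m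
  · have he : ¬ n.Coprime (etaMod i) := fun h' => hn (by rw [hlev]; exact h'.mul_right hnm)
    have hi : i ≠ 0 := by rintro rfl; exact he (Nat.coprime_one_right n)
    have hev : Even n := by
      rw [← Nat.not_odd_iff_even]
      exact fun ho => he (coprime_etaMod_of_odd i ho)
    obtain ⟨k, rfl⟩ := hev
    have : ((k + k : ℕ) : ℤ) = 2 * k := by push_cast; ring
    rw [this, eta_mul, eta_two_of_ne hi]; simp
  · rw [jacobiSym.eq_zero_iff_not_coprime.2 (by rw [Int.gcd_natCast_natCast]; exact hnm)]; simp

end LMoment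

end

/-! ### Pólya–Vinogradov and character sums in classes modulo 8 -/

noncomputable section
namespace LMoment
open Complex Filter Topology Finset
open scoped Real NumberTheorySymbols

/-- The sum is at most 1/sin(πb/q), and Jordan's inequality is applied to the nearer endpoint.
Keeping the terms of both endpoints avoids a case distinction when summing over b. -/
theorem norm_geom_sum_stdAddChar_le {q : ℕ} [NeZero q] {b : ℕ} (hb : 0 < b) (hbq : b < q) (M : ℕ) :
    ‖∑ j ∈ Finset.range M, (ZMod.stdAddChar (b : ZMod q) : ℂ) ^ j‖ ≤ q / 2 * (1 / b + 1 / ((q : ℝ) - b)) := by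
  have hq : (0 : ℝ) < q := Nat.cast_pos.2 (NeZero.pos q)
  have hb' : (0 : ℝ) < b := Nat.cast_pos.2 hb
  have hbq' : (0 : ℝ) < (q : ℝ) - b := sub_pos.2 (Nat.cast_lt.2 hbq)
  set x : ℝ := π * (b / q) with hx
  have hz : (ZMod.stdAddChar (b : ZMod q) : ℂ) = cexp (I * (2 * x : ℝ)) := by
    have := ZMod.stdAddChar_coe (N := q) b
    rw [Int.cast_natCast] at this
    rw [this, hx]
    congr 1
    push_cast; ring
  have hxlt : x < π := by
    rw [hx]
    have : (b : ℝ) / q < 1 := (div_lt_one hq).2 (Nat.cast_lt.2 hbq)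
    nlinarith [Real.pi_pos]
  have hx0 : 0 < x := by positivity
  have hsin : 0 < Real.sin x := Real.sin_pos_of_pos_of_lt_pi hx0 hxlt
  have hnorm : ‖(ZMod.stdAddChar (b : ZMod q) : ℂ) - 1‖ = 2 * Real.sin x := by
    rw [hz, Complex.norm_exp_I_mul_ofReal_sub_one, Real.norm_eq_abs, mul_div_cancel_left₀ _ two_ne_zero, abs_of_pos (by positivity)]
  have hne : (ZMod.stdAddChar (b : ZMod q) : ℂ) ≠ 1 := by
    intro h
    rw [h, sub_self, norm_zero] at hnorm
    linarith
  have hz1 : ‖(ZMod.stdAddChar (b : ZMod q) : ℂ)‖ = 1 := by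
    rw [hz, mul_comm]; exact Complex.norm_exp_ofReal_mul_I _
  have h1 : ‖∑ j ∈ Finset.range M, (ZMod.stdAddChar (b : ZMod q) : ℂ) ^ j‖ ≤ 1 / Real.sin x := by
    rw [geom_sum_eq hne, norm_div, hnorm, div_le_div_iff₀ (by positivity) hsin]
    have : ‖(ZMod.stdAddChar (b : ZMod q) : ℂ) ^ M - 1‖ ≤ 2 := by
      refine (norm_sub_le _ _).trans ?_
      rw [norm_pow, hz1, norm_one, one_pow]; norm_num
    nlinarith
  refine h1.trans ?_
  have e : q / 2 * (1 / b + 1 / ((q : ℝ) - b)) = 1 / 2 * (1 / (b / q)) + 1 / 2 * (1 / (1 - b / q)) := by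
    field_simp
  rw [e]
  set y : ℝ := b / q with hy
  have hy0 : 0 < y := by positivity
  have hy1 : 0 < 1 - y := by
    rw [hy, sub_pos, div_lt_one hq]; exact Nat.cast_lt.2 hbq
  have hp := Real.pi_pos
  rcases le_total y (1 / 2) with h | h
  · have h2 : 2 * y ≤ Real.sin x := by
      have := Real.mul_le_sin (x := x) hx0.le (by rw [hx]; nlinarith)
      refine le_trans (le_of_eq ?_) this
      rw [hx]; field_simp
    have h3 : 1 / Real.sin x ≤ 1 / (2 * y) := one_div_le_one_div_of_le (by positivity) h2
    have h4 : 1 / (2 * y) = 1 / 2 * (1 / y) := by field_simp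
    have h5 : 0 ≤ 1 / 2 * (1 / (1 - y)) := by positivity
    linarith
  · have h2 : 2 * (1 - y) ≤ Real.sin x := by
      have := Real.mul_le_sin (x := π - x) (by linarith) (by rw [hx]; nlinarith)
      rw [Real.sin_pi_sub] at this
      refine le_trans (le_of_eq ?_) this
      rw [hx]; field_simp
    have h3 : 1 / Real.sin x ≤ 1 / (2 * (1 - y)) := one_div_le_one_div_of_le (by positivity) h2
    have h4 : 1 / (2 * (1 - y)) = 1 / 2 * (1 / (1 - y)) := by field_simp
    have h5 : 0 ≤ 1 / 2 * (1 / y) := by positivity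
    linarith

theorem sum_inv_le_one_add_log {q : ℕ} (hq : 0 < q) :
    ∑ b ∈ Finset.range (q - 1), (1 / ((b : ℝ) + 1)) ≤ 1 + Real.log q := by
  have h1 := harmonic_le_one_add_log (q - 1)
  rw [harmonic_eq_sum_Icc] at h1
  have h2 : ∑ b ∈ Finset.range (q - 1), (1 / ((b : ℝ) + 1)) = ((∑ i ∈ Finset.Icc 1 (q - 1), (i : ℚ)⁻¹ : ℚ) : ℝ) := by
    rw [Finset.range_eq_Ico, ← Finset.Ico_add_one_right_eq_Icc]
    have := Finset.sum_Ico_add' (fun i : ℕ => (1 / (i : ℝ))) 0 (q - 1) 1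
    push_cast at this ⊢
    rw [this]
    simp
  rw [h2]
  refine h1.trans ?_
  rcases Nat.eq_zero_or_pos (q - 1) with h | h
  · rw [h, Nat.cast_zero, Real.log_zero, add_zero]
    have := Real.log_nonneg (show (1 : ℝ) ≤ q by exact_mod_cast hq)
    linarith
  · have : Real.log ((q - 1 : ℕ) : ℝ) ≤ Real.log q :=
      Real.log_le_log (Nat.cast_pos.2 h) (Nat.cast_le.2 (Nat.sub_le q 1))
    linarith

/-- The Pólya–Vinogradov inequality for self-dual functions. -/
theorem SelfDual.norm_sum_le {q : ℕ} [NeZero q] {κ : ℂ} {ψ : ℤ → ℂ} (h : SelfDual q κ ψ) (hκ : ‖κ‖ = 1)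
    (hle : ∀ n, ‖ψ n‖ ≤ 1) (h0 : ψ 0 = 0) (A : ℤ) (M : ℕ) :
    ‖∑ j ∈ Finset.range M, ψ (A + j)‖ ≤ √q * (1 + Real.log q) := by
  have hq : (0 : ℝ) < q := Nat.cast_pos.2 (NeZero.pos q)
  have hsq : 0 < √(q : ℝ) := Real.sqrt_pos.2 hq
  -- Self-duality writes ψ(A + j) as a combination of additive characters, so the sum over j becomes
  -- geometric.
  have h1 : κ * √q * ∑ j ∈ Finset.range M, ψ (A + j) =
      ∑ b : ZMod q, ψ (b.val : ℤ) * (ZMod.stdAddChar (b * (A : ZMod q)) *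
        ∑ j ∈ Finset.range M, (ZMod.stdAddChar b : ℂ) ^ j) := by
    rw [Finset.mul_sum]
    simp_rw [← h.dual, Finset.mul_sum]
    rw [Finset.sum_comm]
    refine Finset.sum_congr rfl fun b _ => Finset.sum_congr rfl fun j _ => ?_
    push_cast
    rw [mul_add, AddChar.map_add_eq_mul, ← AddChar.map_nsmul_eq_pow, nsmul_eq_mul, mul_comm (j : ZMod q)]
  have h2 : ‖∑ b : ZMod q, ψ (b.val : ℤ) * (ZMod.stdAddChar (b * (A : ZMod q)) *
        ∑ j ∈ Finset.range M, (ZMod.stdAddChar b : ℂ) ^ j)‖ ≤ q * (1 + Real.log q) := by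
    rw [sum_zmod_eq_sum_fin, Fin.sum_univ_eq_sum_range (fun b : ℕ => ψ ((b : ZMod q).val : ℤ) *
      (ZMod.stdAddChar ((b : ZMod q) * (A : ZMod q)) * ∑ j ∈ Finset.range M, (ZMod.stdAddChar (b : ZMod q) : ℂ) ^ j))]
    set F : ℕ → ℂ := fun b => ψ ((b : ZMod q).val : ℤ) *
      (ZMod.stdAddChar ((b : ZMod q) * (A : ZMod q)) * ∑ j ∈ Finset.range M, (ZMod.stdAddChar (b : ZMod q) : ℂ) ^ j) with hF
    have hq1 : (q - 1) + 1 = q := Nat.sub_add_cancel (NeZero.pos q)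
    have hsplit : ∑ b ∈ Finset.range q, F b = ∑ b ∈ Finset.range (q - 1), F (b + 1) + F 0 := by
      rw [← Finset.sum_range_succ', hq1]
    have hF0 : F 0 = 0 := by simp [hF, h0]
    rw [hsplit, hF0, add_zero]
    have hbd : ∀ b ∈ Finset.range (q - 1), ‖F (b + 1)‖ ≤
        q / 2 * (1 / ((b : ℝ) + 1)) + q / 2 * (1 / (((q - 1 - 1 - b : ℕ) : ℝ) + 1)) := by
      intro b hb
      have hb' := Finset.mem_range.1 hb
      have hg := norm_geom_sum_stdAddChar_le (q := q) (b := b + 1) (Nat.succ_pos b) (by omega) M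
      have e : (((q - 1 - 1 - b : ℕ) : ℝ) + 1) = (q : ℝ) - (b + 1 : ℕ) := by
        rw [← Nat.cast_sub (by omega), ← Nat.cast_add_one]
        congr 1; omega
      rw [e, ← mul_add, ← Nat.cast_add_one (R := ℝ) b]
      refine le_trans ?_ hg
      rw [hF]
      simp only [norm_mul]
      have hn1 : ‖(ZMod.stdAddChar (((b + 1 : ℕ) : ZMod q) * (A : ZMod q)) : ℂ)‖ = 1 := AddChar.norm_apply _ _
      rw [hn1, one_mul]
      exact mul_le_of_le_one_left (norm_nonneg _) (hle _)
    refine (_root_.norm_sum_le _ _).trans ((Finset.sum_le_sum hbd).trans ?_)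
    rw [Finset.sum_add_distrib, Finset.sum_range_reflect (fun b : ℕ => (q : ℝ) / 2 * (1 / ((b : ℝ) + 1))) (q - 1),
      ← Finset.mul_sum]
    have := sum_inv_le_one_add_log (NeZero.pos q)
    nlinarith
  have h3 : ‖κ * √q * ∑ j ∈ Finset.range M, ψ (A + j)‖ = √q * ‖∑ j ∈ Finset.range M, ψ (A + j)‖ := by
    rw [norm_mul, norm_mul, hκ, one_mul, Complex.norm_real, Real.norm_of_nonneg hsq.le]
  rw [← h1, h3] at h2
  have h4 : (q : ℝ) = √q * √q := (Real.mul_self_sqrt hq.le).symm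
  rw [h4, mul_assoc, ← h4] at h2
  exact le_of_mul_le_mul_left h2 hsq

theorem norm_gaussSign (m : ℕ) : ‖gaussSign m‖ = 1 := by
  rw [gaussSign]; split_ifs <;> simp

theorem abs_sum_jacobiSym_le {n : ℕ} (hn : Odd n) (hsq : Squarefree n) (h1 : 1 < n) (A : ℤ) (M : ℕ) :
    |((∑ j ∈ Finset.range M, J(A + j | n) : ℤ) : ℝ)| ≤ √n * (1 + Real.log n) := by
  have : NeZero n := ⟨by omega⟩
  have := (selfDual_jacobiSym n hn hsq).norm_sum_le (norm_gaussSign n)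
    (fun m => by rw [Complex.norm_intCast]; exact_mod_cast jacobiSym_abs_le_one m n)
    (by simp [jacobiSym.zero_left h1]) A M
  rw [← Int.cast_sum, Complex.norm_intCast] at this
  exact this

/-- The sum of `(k / n)` over `k ≤ t` in a residue class modulo `8`, prime to the elements of `P`. -/
def classSum (P : Finset ℕ) (n c : ℕ) (t : ℝ) : ℝ :=
  ∑ k ∈ Finset.range (⌊t⌋₊ + 1), if k % 8 = c % 8 ∧ ∀ p ∈ P, ¬ p ∣ k then ((J((k : ℤ) | n) : ℤ) : ℝ) else 0

/-- The range of summation of a residue class. -/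
theorem sum_range_residue (f : ℕ → ℝ) (c T : ℕ) :
    ∑ k ∈ Finset.range (T + 1), (if k % 8 = c % 8 then f k else 0) =
      ∑ j ∈ Finset.range ((T + 8 - c % 8) / 8), f (c % 8 + 8 * j) := by
  rw [← Finset.sum_filter]
  refine Finset.sum_bij' (fun k _ => k / 8) (fun j _ => c % 8 + 8 * j) ?_ ?_ ?_ ?_ ?_
  · intro k hk
    have := Finset.mem_filter.1 hk
    have h1 := Finset.mem_range.1 this.1
    rw [Finset.mem_range]; omega
  · intro j hj
    have := Finset.mem_range.1 hj
    rw [Finset.mem_filter, Finset.mem_range]; omega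
  · intro k hk
    have := Finset.mem_filter.1 hk
    omega
  · intro j hj; omega
  · intro k hk
    have := Finset.mem_filter.1 hk
    congr 1; omega

/-- For n > 1 an inverse of 8 modulo n turns the progression into an interval, to which
Pólya–Vinogradov applies; for n = 1 this is counting, with an error of at most 1. -/
theorem abs_classSum_empty_le {n : ℕ} (hn : Odd n) (hsq : Squarefree n) (c : ℕ) {t : ℝ} (ht : 0 ≤ t) :
    |classSum ∅ n c t - (if n = 1 then t / 8 else 0)| ≤ √n * (1 + Real.log n) := by
  have e : classSum ∅ n c t = ∑ j ∈ Finset.range ((⌊t⌋₊ + 8 - c % 8) / 8), ((J((c % 8 + 8 * j : ℕ) | n) : ℤ) : ℝ) := by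
    rw [classSum, ← sum_range_residue (fun k => ((J((k : ℤ) | n) : ℤ) : ℝ))]
    simp
  rw [e]
  rcases eq_or_ne n 1 with rfl | h1
  · simp only [jacobiSym.one_right, Int.cast_one, Finset.sum_const, Finset.card_range, nsmul_eq_mul, mul_one,
      if_true, Nat.cast_one, Real.sqrt_one, Real.log_one, add_zero]
    have h2 := Nat.floor_le ht
    have h3 := Nat.lt_floor_add_one t
    set T := ⌊t⌋₊
    have h4 : 8 * ((T + 8 - c % 8) / 8) ≤ T + 8 := by omega
    have h5 : T + 1 ≤ 8 * ((T + 8 - c % 8) / 8) + 7 := by omega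
    have h4' : 8 * (((T + 8 - c % 8) / 8 : ℕ) : ℝ) ≤ T + 8 := by exact_mod_cast h4
    have h5' : (T : ℝ) + 1 ≤ 8 * (((T + 8 - c % 8) / 8 : ℕ) : ℝ) + 7 := by exact_mod_cast h5
    rw [abs_le]
    constructor <;> linarith
  · rw [if_neg h1, sub_zero]
    have hn1 : 1 < n := by have := hn.pos; omega
    obtain ⟨r, hr⟩ : ∃ r : ℤ, (8 * r) % n = 1 % n := by
      have hcop : Nat.Coprime 8 n := (Nat.coprime_two_left.2 hn).pow_left 3
      have := Int.isCoprime_iff_gcd_eq_one.2 (show Int.gcd (8 : ℤ) n = 1 from hcop)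
      obtain ⟨a, b, hab⟩ := this
      refine ⟨a, ?_⟩
      rw [← hab]
      have : a * 8 + b * n = 8 * a + n * b := by ring
      rw [this, Int.add_mul_emod_self_left]
    have hterm : ∀ j : ℕ, J((c % 8 + 8 * j : ℕ) | n) = J(8 | n) * J(r * (c % 8 : ℕ) + j | n) := by
      intro j
      rw [← jacobiSym.mul_left]
      apply jacobiSym.mod_left'
      have e1 : (8 : ℤ) * (r * (c % 8 : ℕ) + j) = (8 * r) * (c % 8 : ℕ) + 8 * j := by ring
      rw [e1, Int.add_emod, Int.mul_emod (8 * r), hr, ← Int.mul_emod, ← Int.add_emod, one_mul]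
      push_cast; rfl
    simp_rw [hterm]
    push_cast
    rw [← Finset.mul_sum, abs_mul]
    have h8 : |((J(8 | n) : ℤ) : ℝ)| ≤ 1 := by exact_mod_cast jacobiSym_abs_le_one 8 n
    have hpv := abs_sum_jacobiSym_le hn hsq hn1 (r * (c % 8 : ℕ)) ((⌊t⌋₊ + 8 - c % 8) / 8)
    push_cast at hpv
    exact (mul_le_of_le_one_left (abs_nonneg _) h8).trans hpv

/-- One step of Legendre's sieve: the removed multiples pl contribute (p/n)(l/n), and l runs over
the class of pc because p² ≡ 1 modulo 8. -/
theorem classSum_insert {P : Finset ℕ} {p : ℕ} (hp : p.Prime) (hp2 : p ≠ 2) (hpP : p ∉ P)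
    (hP : ∀ q ∈ P, q.Prime) (n c : ℕ) (t : ℝ) :
    classSum (insert p P) n c t = classSum P n c t - J((p : ℤ) | n) * classSum P n (p * c) (t / p) := by
  have hpp : Odd p := hp.odd_of_ne_two hp2
  have h8 : p * p % 8 = 1 := by rw [← sq]; exact odd_sq_mod_eight hpp
  have hmain : ∑ k ∈ Finset.range (⌊t⌋₊ + 1), (if (k % 8 = c % 8 ∧ ∀ q ∈ P, ¬ q ∣ k) ∧ p ∣ k then
      ((J((k : ℤ) | n) : ℤ) : ℝ) else 0) = J((p : ℤ) | n) * classSum P n (p * c) (t / p) := by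
    rw [classSum, ← Finset.sum_filter, ← Finset.sum_filter, Finset.mul_sum]
    have hfl : ⌊t / p⌋₊ = ⌊t⌋₊ / p := Nat.floor_div_natCast t p
    symm
    refine Finset.sum_bij' (fun l _ => p * l) (fun k _ => k / p) ?_ ?_ ?_ ?_ ?_
    · intro l hl
      rw [Finset.mem_filter, Finset.mem_range, hfl] at hl
      rw [Finset.mem_filter, Finset.mem_range]
      obtain ⟨h1, h2, h3⟩ := hl
      refine ⟨?_, ⟨?_, ?_⟩, Dvd.intro _ rfl⟩
      · have := Nat.mul_le_mul_left p (Nat.lt_succ_iff.1 h1)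
        have := Nat.mul_div_le ⌊t⌋₊ p
        omega
      · rw [Nat.mul_mod, h2, ← Nat.mul_mod, ← mul_assoc, Nat.mul_mod, h8, one_mul, Nat.mod_mod]
      · intro q hq hd
        rcases (hP q hq).dvd_mul.1 hd with h | h
        · have := (Nat.prime_dvd_prime_iff_eq (hP q hq) hp).1 h
          subst this; exact hpP hq
        · exact h3 q hq h
    · intro k hk
      rw [Finset.mem_filter, Finset.mem_range] at hk
      rw [Finset.mem_filter, Finset.mem_range, hfl]
      obtain ⟨h1, ⟨h2, h3⟩, l, rfl⟩ := hk
      rw [Nat.mul_div_cancel_left _ hp.pos]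
      refine ⟨?_, ?_, fun q hq hd => h3 q hq (hd.mul_left p)⟩
      · have : l ≤ ⌊t⌋₊ / p := (Nat.le_div_iff_mul_le hp.pos).2 (by rw [mul_comm]; omega)
        omega
      · rw [Nat.mul_mod p c, ← h2, ← Nat.mul_mod, ← mul_assoc, Nat.mul_mod, h8, one_mul, Nat.mod_mod]
    · intro l hl; exact Nat.mul_div_cancel_left _ hp.pos
    · intro k hk
      rw [Finset.mem_filter] at hk
      exact Nat.mul_div_cancel' hk.2.2
    · intro l hl
      push_cast
      rw [jacobiSym.mul_left]; push_cast; rfl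
  rw [← hmain, classSum, classSum, ← Finset.sum_sub_distrib]
  refine Finset.sum_congr rfl fun k _ => ?_
  simp only [Finset.mem_insert, forall_eq_or_imp]
  by_cases h1 : p ∣ k
  · simp [h1]
  · simp [h1]

/-- Each sieving prime doubles the error and multiplies the main term by 1 - 1/p. -/
theorem abs_classSum_le {n : ℕ} (hn : Odd n) (hsq : Squarefree n) (P : Finset ℕ)
    (hP : ∀ p ∈ P, p.Prime ∧ p ≠ 2) : ∀ (c : ℕ) {t : ℝ}, 0 ≤ t →
    |classSum P n c t - (if n = 1 then t / 8 * ∏ p ∈ P, (1 - 1 / (p : ℝ)) else 0)| ≤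
      2 ^ P.card * (√n * (1 + Real.log n)) := by
  induction P using Finset.induction_on with
  | empty =>
    intro c t ht
    simpa using abs_classSum_empty_le hn hsq c ht
  | insert p P hpP ih =>
    intro c t ht
    have hp := hP p (Finset.mem_insert_self p P)
    have hP' : ∀ q ∈ P, q.Prime ∧ q ≠ 2 := fun q hq => hP q (Finset.mem_insert_of_mem hq)
    have hp0 : (0 : ℝ) < p := Nat.cast_pos.2 hp.1.pos
    rw [classSum_insert hp.1 hp.2 hpP (fun q hq => (hP' q hq).1), Finset.card_insert_of_notMem hpP,
      Finset.prod_insert hpP]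
    have h1 := ih hP' c ht
    have h2 := ih hP' (p * c) (t := t / p) (by positivity)
    have hJ : |((J((p : ℤ) | n) : ℤ) : ℝ)| ≤ 1 := by exact_mod_cast jacobiSym_abs_le_one p n
    set B := √(n : ℝ) * (1 + Real.log n)
    set x := classSum P n c t
    set y := classSum P n (p * c) (t / p)
    set R := ∏ p ∈ P, (1 - 1 / (p : ℝ))
    have key : x - J((p : ℤ) | n) * y - (if n = 1 then t / 8 * ((1 - 1 / (p : ℝ)) * R) else 0) =
        (x - (if n = 1 then t / 8 * R else 0)) - J((p : ℤ) | n) * (y - (if n = 1 then t / p / 8 * R else 0)) := by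
      split_ifs with h
      · subst h
        rw [jacobiSym.one_right]; push_cast; field_simp; ring
      · ring
    rw [key]
    calc |_| ≤ |x - (if n = 1 then t / 8 * R else 0)| + |J((p : ℤ) | n) * (y - (if n = 1 then t / p / 8 * R else 0))| :=
          abs_sub _ _
      _ ≤ 2 ^ P.card * B + 2 ^ P.card * B := by
          rw [abs_mul]
          exact add_le_add h1 ((mul_le_of_le_one_left (abs_nonneg _) hJ).trans h2)
      _ = _ := by rw [pow_succ]; ring

/-- The sum of `(k / n)` over `k ≤ t` prime to `m` in a residue class modulo `8`. -/
def coprimeClassSum (m n c : ℕ) (t : ℝ) : ℝ :=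
  ∑ k ∈ Finset.range (⌊t⌋₊ + 1), if k % 8 = c % 8 ∧ k.Coprime m then ((J((k : ℤ) | n) : ℤ) : ℝ) else 0

theorem two_pow_card_primeFactors_le {n : ℕ} (hn : n ≠ 0) : 2 ^ n.primeFactors.card ≤ n := by
  calc 2 ^ n.primeFactors.card = ∏ _p ∈ n.primeFactors, 2 := by rw [Finset.prod_const]
    _ ≤ ∏ p ∈ n.primeFactors, p :=
        Finset.prod_le_prod' fun p hp => (Nat.prime_of_mem_primeFactors hp).two_le
    _ ≤ n := Nat.le_of_dvd (Nat.pos_of_ne_zero hn) (Nat.prod_primeFactors_dvd n)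

/-- For n = n₀n₁² the symbol (k/n) is (k/n₀) restricted to k prime to n₁, so Pólya–Vinogradov is
used for the squarefree n₀ and the primes of n₁ join the sieve. Their cost 2^{ω(n₁)} ≤ n₁ is covered
by √n = n₁√n₀, so only the primes of m remain visible. -/
theorem abs_coprimeClassSum_le {m n : ℕ} (hm : Odd m) (hn : Odd n) (c : ℕ) {t : ℝ} (ht : 0 ≤ t) :
    |coprimeClassSum m n c t - (if sqfree n = 1 then t / 8 * ∏ p ∈ (m * n).primeFactors, (1 - 1 / (p : ℝ)) else 0)| ≤
      2 ^ m.primeFactors.card * (√n * (1 + Real.log n)) := by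
  have hdec := sqfree_mul_sqRoot_sq hn.pos.ne'
  set n₀ := sqfree n with hn₀
  set n₁ := sqRoot n with hn₁
  have hd0 : n₀ ∣ n := ⟨n₁ ^ 2, hdec.symm⟩
  have hd1 : n₁ ∣ n := ⟨n₀ * n₁, by rw [← hdec]; ring⟩
  have ho0 : Odd n₀ := hn.of_dvd_nat hd0
  have ho1 : Odd n₁ := hn.of_dvd_nat hd1
  have hm1 : m * n₁ ≠ 0 := (hm.mul ho1).pos.ne'
  have hN1 : NeZero n₁ := ⟨ho1.pos.ne'⟩
  have h1 := abs_classSum_le ho0 (squarefree_sqfree n) (m * n₁).primeFactors (fun p hp =>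
    ⟨Nat.prime_of_mem_primeFactors hp, by
      rintro rfl
      exact absurd ((hm.mul ho1).of_dvd_nat (Nat.dvd_of_mem_primeFactors hp)) (by decide)⟩) c ht
  have e1 : coprimeClassSum m n c t = classSum (m * n₁).primeFactors n₀ c t := by
    refine Finset.sum_congr rfl fun k _ => ?_
    have hJ : J((k : ℤ) | n) = J((k : ℤ) | n₀) * J((k : ℤ) | n₁) ^ 2 := by
      have e : n = n₀ * (n₁ * n₁) := by rw [← hdec]; ring
      conv_lhs => rw [e]
      have := sqfree_neZero n
      rw [jacobiSym.mul_right _ n₀, jacobiSym.mul_right _ n₁]; ring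
    have hcop : (∀ p ∈ (m * n₁).primeFactors, ¬ p ∣ k) ↔ k.Coprime m ∧ k.Coprime n₁ := by
      rw [← Nat.coprime_mul_iff_right]
      constructor
      · exact fun h => Nat.coprime_of_dvd fun p hp hpk hpm =>
          h p (Nat.mem_primeFactors.2 ⟨hp, hpm, hm1⟩) hpk
      · exact fun h p hp hpk => Nat.not_coprime_of_dvd_of_dvd (Nat.prime_of_mem_primeFactors hp).one_lt
          hpk (Nat.dvd_of_mem_primeFactors hp) h
    simp only [hcop, hJ]
    by_cases hk : k.Coprime n₁
    · have hs : J((k : ℤ) | n₁) ^ 2 = 1 := jacobiSym.sq_one (by rw [Int.gcd_natCast_natCast]; exact hk)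
      rw [hs, mul_one]
      simp only [iff_true_intro hk, and_true]
    · have hs : J((k : ℤ) | n₁) = 0 :=
        jacobiSym.eq_zero_iff_not_coprime.2 (by rw [Int.gcd_natCast_natCast]; exact hk)
      rw [hs]
      simp only [iff_false_intro hk, and_false, if_false]
      simp
  have e2 : n₀ = 1 → (m * n₁).primeFactors = (m * n).primeFactors := by
    intro h
    have : n = n₁ ^ 2 := by rw [← hdec, h, one_mul]
    rw [Nat.primeFactors_mul hm.pos.ne' ho1.pos.ne', Nat.primeFactors_mul hm.pos.ne' hn.pos.ne']
    conv_rhs => rw [this, Nat.primeFactors_pow _ two_ne_zero]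
  have e3 : (if n₀ = 1 then t / 8 * ∏ p ∈ (m * n).primeFactors, (1 - 1 / (p : ℝ)) else 0) =
     (if n₀ = 1 then t / 8 * ∏ p ∈ (m * n₁).primeFactors, (1 - 1 / (p : ℝ)) else 0) := by
    split_ifs with h
    · rw [e2 h]
    · rfl
  rw [e1, e3]
  refine h1.trans ?_
  have hcard : (m * n₁).primeFactors.card ≤ m.primeFactors.card + n₁.primeFactors.card := by
    rw [Nat.primeFactors_mul hm.pos.ne' ho1.pos.ne']
    exact Finset.card_union_le _ _
  have hn0pos : (1 : ℝ) ≤ n₀ := by exact_mod_cast ho0.pos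
  have hlog : Real.log n₀ ≤ Real.log n := Real.log_le_log (by linarith) (by exact_mod_cast Nat.le_of_dvd hn.pos hd0)
  have hlog0 : 0 ≤ Real.log n₀ := Real.log_nonneg hn0pos
  have hsqrt : √(n : ℝ) = n₁ * √n₀ := by
    rw [← hdec]; push_cast
    rw [Real.sqrt_mul (by positivity), Real.sqrt_sq (by positivity), mul_comm]
  have h2 : (2 : ℝ) ^ n₁.primeFactors.card ≤ n₁ := by exact_mod_cast two_pow_card_primeFactors_le ho1.pos.ne'
  calc (2 : ℝ) ^ (m * n₁).primeFactors.card * (√n₀ * (1 + Real.log n₀))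
      ≤ 2 ^ (m.primeFactors.card + n₁.primeFactors.card) * (√n₀ * (1 + Real.log n)) := by
        gcongr
        norm_num
    _ = 2 ^ m.primeFactors.card * (2 ^ n₁.primeFactors.card * √n₀ * (1 + Real.log n)) := by rw [pow_add]; ring
    _ ≤ 2 ^ m.primeFactors.card * (n₁ * √n₀ * (1 + Real.log n)) := by gcongr
    _ = _ := by rw [hsqrt]

end LMoment

end

/-! ### Partial summation against the cutoff -/

noncomputable section
namespace LMoment
open Filter Topology Finset MeasureTheory
open scoped Real NumberTheorySymbols ContDiff

/-- Partial summation against a function whose summatory function is nearly linear. -/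
theorem abs_sum_mul_sub_integral_le {a : ℕ → ℝ} {ρ B : ℝ}
    (hA : ∀ t : ℝ, 0 ≤ t → |∑ k ∈ Finset.range (⌊t⌋₊ + 1), a k - ρ * t| ≤ B) {u v : ℝ} (hu : 0 < u)
    (huv : u ≤ v) {φ φ' : ℝ → ℝ} (hφ : ∀ t ∈ Set.Icc u v, HasDerivAt φ (φ' t) t)
    (hcont : ContinuousOn φ' (Set.Icc u v)) (h0 : φ u = 0) (h1 : φ v = 0) :
    |∑ k ∈ Finset.Ioc ⌊u⌋₊ ⌊v⌋₊, φ k * a k - ρ * ∫ t in u..v, φ t| ≤ B * ∫ t in u..v, |φ' t| := by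
  have hderiv : ∀ t ∈ Set.Icc u v, deriv φ t = φ' t := fun t ht => (hφ t ht).deriv
  have hint : IntegrableOn φ' (Set.Icc u v) := hcont.integrableOn_Icc
  have hint' : IntegrableOn (deriv φ) (Set.Icc u v) :=
    hint.congr_fun (fun t ht => (hderiv t ht).symm) measurableSet_Icc
  have hab := sum_mul_eq_sub_sub_integral_mul a hu.le huv (fun t ht => (hφ t ht).differentiableAt) hint'
  rw [h0, h1, zero_mul, zero_mul, sub_zero, zero_sub, ← intervalIntegral.integral_of_le huv] at hab
  set A : ℝ → ℝ := fun t => ∑ k ∈ Finset.Icc 0 ⌊t⌋₊, a k with hAdef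
  have hA' : ∀ t : ℝ, 0 ≤ t → |A t - ρ * t| ≤ B := by
    intro t ht
    have := hA t ht
    rwa [Finset.range_eq_Ico, Finset.Ico_add_one_right_eq_Icc] at this
  have hAint : IntervalIntegrable (fun t => φ' t * A t) volume u v := by
    rw [intervalIntegrable_iff_integrableOn_Icc_of_le huv]
    exact integrableOn_mul_sum_Icc a hu.le hint
  have hφ'int : IntervalIntegrable φ' volume u v := by
    rw [intervalIntegrable_iff_integrableOn_Icc_of_le huv]; exact hint
  have hlin : IntervalIntegrable (fun t => φ' t * t) volume u v := by
    apply ContinuousOn.intervalIntegrable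
    rw [Set.uIcc_of_le huv]
    exact hcont.mul continuousOn_id
  have hcong : ∫ t in u..v, deriv φ t * A t = ∫ t in u..v, φ' t * A t := by
    refine intervalIntegral.integral_congr fun t ht => ?_
    rw [Set.uIcc_of_le huv] at ht
    simp only [hderiv t ht]
  have hparts : ∫ t in u..v, φ' t * t = - ∫ t in u..v, φ t := by
    have := intervalIntegral.integral_deriv_mul_eq_sub (u := φ) (v := fun t => t) (u' := φ') (v' := fun _ => 1)
      (a := u) (b := v) (fun t ht => hφ t (by rwa [Set.uIcc_of_le huv] at ht)) (fun t _ => hasDerivAt_id t)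
      hφ'int intervalIntegrable_const
    simp only [mul_one] at this
    have hφc : IntervalIntegrable φ volume u v := by
      apply ContinuousOn.intervalIntegrable
      rw [Set.uIcc_of_le huv]
      exact fun t ht => (hφ t ht).continuousAt.continuousWithinAt
    rw [intervalIntegral.integral_add hlin hφc, h0, h1] at this
    linarith
  have hfinal : ∑ k ∈ Finset.Ioc ⌊u⌋₊ ⌊v⌋₊, φ k * a k - ρ * ∫ t in u..v, φ t =
      - ∫ t in u..v, φ' t * (A t - ρ * t) := by
    have e : ∀ t, φ' t * (A t - ρ * t) = φ' t * A t - ρ * (φ' t * t) := fun t => by ring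
    simp_rw [e]
    rw [intervalIntegral.integral_sub hAint (hlin.const_mul ρ), intervalIntegral.integral_const_mul, hparts, hab, hcong]
    ring
  rw [hfinal, abs_neg, ← intervalIntegral.integral_const_mul, ← Real.norm_eq_abs]
  refine intervalIntegral.norm_integral_le_of_norm_le huv ?_ (hφ'int.abs.const_mul B)
  filter_upwards with t ht
  rw [Real.norm_eq_abs, abs_mul, mul_comm]
  exact mul_le_mul_of_nonneg_right (hA' t (hu.le.trans ht.1.le)) (abs_nonneg _)

theorem hasDerivAt_cutoff {σ x : ℝ} (hσ : 0 < σ) (hx : 0 < x) :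
    HasDerivAt (cutoff σ) (-(x ^ (σ - 1) * Real.exp (-(π * x))) / piGamma σ) x := by
  set g : ℝ → ℝ := fun t => t ^ (σ - 1) * Real.exp (-(π * t)) with hg
  have hint := integrableOn_gamma_kernel (r := π) hσ Real.pi_pos
  have hcont : ∀ t : ℝ, 0 < t → ContinuousAt g t := fun t ht =>
    (Real.continuousAt_rpow_const t _ (Or.inl ht.ne')).mul (by fun_prop)
  have hd : HasDerivAt (fun y => ∫ t in (0 : ℝ)..y, g t) (g x) x := by
    refine intervalIntegral.integral_hasDerivAt_right ?_ ?_ (hcont x hx)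
    · rw [intervalIntegrable_iff_integrableOn_Ioc_of_le hx.le]
      exact hint.mono_set Set.Ioc_subset_Ioi_self
    · exact ContinuousOn.stronglyMeasurableAtFilter isOpen_Ioi
        (fun t ht => (hcont t ht).continuousWithinAt) x (Set.mem_Ioi.2 hx)
  have heq : cutoff σ =ᶠ[𝓝 x] fun y => (piGamma σ - ∫ t in (0 : ℝ)..y, g t) / piGamma σ := by
    filter_upwards [Ioi_mem_nhds hx] with y hy
    have := intervalIntegral.integral_Ioi_sub_Ioi (f := g) (a := 0) (b := y) hint (le_of_lt hy)
    rw [cutoff, ← this, piGamma]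
    congr 1
    ring
  refine HasDerivAt.congr_of_eventuallyEq ?_ heq
  have := ((hasDerivAt_const x (piGamma σ)).sub hd).div_const (piGamma σ)
  rw [zero_sub] at this
  exact this

/-- The density of the cutoff function. -/
def cutoffDensity (σ x : ℝ) : ℝ := x ^ (σ - 1) * Real.exp (-(π * x)) / piGamma σ

theorem continuousOn_cutoffDensity (σ : ℝ) : ContinuousOn (cutoffDensity σ) (Set.Ioi 0) := fun t ht =>
  (((Real.continuousAt_rpow_const t _ (Or.inl (ne_of_gt ht))).mul (by fun_prop)).div_const _).continuousWithinAt

theorem cutoffDensity_nonneg {σ x : ℝ} (hσ : 0 < σ) (hx : 0 < x) : 0 ≤ cutoffDensity σ x := by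
  have := piGamma_pos hσ
  rw [cutoffDensity]; positivity

theorem hasDerivAt_cutoff_div {σ α t : ℝ} (hσ : 0 < σ) (hα : 0 < α) (ht : 0 < t) :
    HasDerivAt (fun t => cutoff σ (α / t)) (cutoffDensity σ (α / t) * (α / t ^ 2)) t := by
  have h1 := (hasDerivAt_cutoff hσ (div_pos hα ht)).comp t ((hasDerivAt_const t α).div (hasDerivAt_id t) ht.ne')
  convert! h1 using 1
  rw [cutoffDensity]
  ring

/-- Total variation of a smooth compactly supported function times a monotone cutoff. -/
theorem integral_abs_deriv_le {H H' : ℝ → ℝ} {C₀ D σ α u v : ℝ} (hσ : 0 < σ) (hα : 0 < α) (hu : 0 < u)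
    (huv : u ≤ v) (hH0 : ∀ t, |H t| ≤ C₀) (hH1 : ∀ t, |H' t| ≤ D) (hHc : Continuous H) (hH'c : Continuous H') :
    ∫ t in u..v, |H' t * cutoff σ (α / t) + H t * (cutoffDensity σ (α / t) * (α / t ^ 2))| ≤
      (D * (v - u) + C₀) * cutoff σ (α / v) := by
  have hD : 0 ≤ D := (abs_nonneg _).trans (hH1 0)
  have hC : 0 ≤ C₀ := (abs_nonneg _).trans (hH0 0)
  have hv : 0 < v := hu.trans_le huv
  have hpos : ∀ t ∈ Set.Icc u v, 0 < t := fun t ht => hu.trans_le ht.1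
  have hc1 : ContinuousOn (fun t => cutoff σ (α / t)) (Set.Icc u v) := fun t ht =>
    (hasDerivAt_cutoff_div hσ hα (hpos t ht)).continuousAt.continuousWithinAt
  have hc2 : ContinuousOn (fun t => cutoffDensity σ (α / t) * (α / t ^ 2)) (Set.Icc u v) := by
    refine ContinuousOn.mul ?_ ?_
    · refine (continuousOn_cutoffDensity σ).comp (continuousOn_const.div continuousOn_id fun t ht => (hpos t ht).ne') ?_
      intro t ht; exact div_pos hα (hpos t ht)
    · exact continuousOn_const.div (continuousOn_pow 2) fun t ht => pow_ne_zero _ (hpos t ht).ne'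
  have hi2 : IntervalIntegrable (fun t => cutoffDensity σ (α / t) * (α / t ^ 2)) volume u v := by
    apply ContinuousOn.intervalIntegrable; rwa [Set.uIcc_of_le huv]
  have hle : ∫ t in u..v, |H' t * cutoff σ (α / t) + H t * (cutoffDensity σ (α / t) * (α / t ^ 2))| ≤
      ∫ t in u..v, (D * cutoff σ (α / v) + C₀ * (cutoffDensity σ (α / t) * (α / t ^ 2))) := by
    refine intervalIntegral.integral_mono_on huv ?_ ?_ fun t ht => ?_
    · apply ContinuousOn.intervalIntegrable
      rw [Set.uIcc_of_le huv]
      exact ((hH'c.continuousOn.mul hc1).add (hHc.continuousOn.mul hc2)).abs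
    · exact intervalIntegrable_const.add (hi2.const_mul _)
    · have ht0 := hpos t ht
      have hg0 : 0 ≤ cutoffDensity σ (α / t) * (α / t ^ 2) :=
        mul_nonneg (cutoffDensity_nonneg hσ (by positivity)) (by positivity)
      have hcut0 : 0 ≤ cutoff σ (α / t) := cutoff_nonneg hσ (by positivity)
      have hcut1 : cutoff σ (α / t) ≤ cutoff σ (α / v) :=
        cutoff_antitone hσ (by positivity) (div_le_div_of_nonneg_left hα.le ht0 ht.2)
      refine (abs_add_le _ _).trans (add_le_add ?_ ?_)
      · rw [abs_mul, abs_of_nonneg hcut0]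
        exact mul_le_mul (hH1 t) hcut1 hcut0 hD
      · rw [abs_mul, abs_of_nonneg hg0]
        exact mul_le_mul_of_nonneg_right (hH0 t) hg0
  refine hle.trans ?_
  -- The derivative of the monotone cutoff is non-negative, so its integral telescopes and no
  -- pointwise bound on the density is needed.
  have hval : ∫ t in u..v, cutoffDensity σ (α / t) * (α / t ^ 2) = cutoff σ (α / v) - cutoff σ (α / u) :=
    intervalIntegral.integral_eq_sub_of_hasDerivAt (fun t ht =>
      hasDerivAt_cutoff_div hσ hα (hpos t (by rwa [Set.uIcc_of_le huv] at ht))) hi2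
  rw [intervalIntegral.integral_add intervalIntegrable_const (hi2.const_mul _), intervalIntegral.integral_const,
    intervalIntegral.integral_const_mul, hval, smul_eq_mul]
  have := cutoff_nonneg hσ (x := α / u) (by positivity)
  nlinarith

end LMoment

end

/-! ### Smooth sums of Jacobi symbols over k -/

noncomputable section
namespace LMoment
open Filter Topology Finset MeasureTheory
open scoped Real NumberTheorySymbols ContDiff

theorem IsSmoothWeight.eq_zero {h : ℝ → ℝ} (hh : IsSmoothWeight h) {x : ℝ} (hx : x < 1 / 4 ∨ 5 / 4 < x) :
    h x = 0 := by
  by_contra hne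
  have := hh.support_subset hne
  rcases hx with hx | hx
  · linarith [this.1]
  · linarith [this.2]

theorem IsSmoothWeight.exists_bound {h : ℝ → ℝ} (hh : IsSmoothWeight h) :
    ∃ C : ℝ, 1 ≤ C ∧ (∀ x, |h x| ≤ C) ∧ ∀ x, |deriv h x| ≤ C := by
  have hc : HasCompactSupport h := HasCompactSupport.of_support_subset_isCompact isCompact_Icc hh.support_subset
  have hd1 : ContDiff ℝ 1 h := hh.smooth.of_le (by exact_mod_cast le_top)
  obtain ⟨C₁, h1⟩ := hc.exists_bound_of_continuous hd1.continuous
  obtain ⟨C₂, h2⟩ := hc.deriv.exists_bound_of_continuous (hd1.continuous_deriv le_rfl)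
  refine ⟨max 1 (max C₁ C₂), le_max_left _ _, fun x => ?_, fun x => ?_⟩
  · exact (h1 x).trans ((le_max_left _ _).trans (le_max_right _ _))
  · exact (h2 x).trans ((le_max_right _ _).trans (le_max_right _ _))

theorem IsSmoothWeight.hasDerivAt {h : ℝ → ℝ} (hh : IsSmoothWeight h) (x : ℝ) : HasDerivAt h (deriv h x) x :=
  ((hh.smooth.differentiable (by simp)) x).hasDerivAt

theorem IsSmoothWeight.continuous {h : ℝ → ℝ} (hh : IsSmoothWeight h) : Continuous h := hh.smooth.continuous

theorem IsSmoothWeight.continuous_deriv {h : ℝ → ℝ} (hh : IsSmoothWeight h) : Continuous (deriv h) :=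
  (hh.smooth.of_le (by exact_mod_cast le_top : (1 : WithTop ℕ∞) ≤ ∞)).continuous_deriv le_rfl

/-- The weighted sum of `(k / n)` over `k` prime to `m` in a residue class modulo `8`. -/
def weightedSum (h : ℝ → ℝ) (σ : ℝ) (m c : ℕ) (X Q : ℝ) (e n : ℕ) : ℝ :=
  ∑ k ∈ Finset.range (⌊2 * X⌋₊ + 1), if k % 8 = c % 8 ∧ k.Coprime m then
    ((J((k : ℤ) | n) : ℤ) : ℝ) * (h (k * e ^ 2 / X) * cutoff σ (n ^ 2 * e ^ 2 / (k * Q))) else 0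

/-- The integral of the weight against the cutoff. -/
def weightIntegral (h : ℝ → ℝ) (σ z : ℝ) : ℝ := ∫ y in (1 / 8 : ℝ)..(5 / 2), h y * cutoff σ (z / y)

/-- The main term of `weightedSum`. -/
def weightedMain (h : ℝ → ℝ) (σ : ℝ) (m : ℕ) (X Q : ℝ) (e n : ℕ) : ℝ :=
  if sqfree n = 1 then 1 / 8 * (∏ p ∈ (m * n).primeFactors, (1 - 1 / (p : ℝ))) *
    (X / e ^ 2 * weightIntegral h σ (n ^ 2 * e ^ 4 / (X * Q))) else 0

theorem prod_one_sub_inv_mem (s : Finset ℕ) : 0 ≤ ∏ p ∈ s, (1 - 1 / (p : ℝ)) ∧ ∏ p ∈ s, (1 - 1 / (p : ℝ)) ≤ 1 := by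
  have h : ∀ p : ℕ, 0 ≤ 1 - 1 / (p : ℝ) ∧ 1 - 1 / (p : ℝ) ≤ 1 := by
    intro p
    have h1 : (0 : ℝ) ≤ 1 / p := by positivity
    have h2 : (1 : ℝ) / p ≤ 1 := by
      rcases Nat.eq_zero_or_pos p with rfl | hp
      · simp
      · exact (div_le_one (Nat.cast_pos.2 hp)).2 (by exact_mod_cast hp)
    constructor <;> linarith
  exact ⟨Finset.prod_nonneg fun p _ => (h p).1, Finset.prod_le_one (fun p _ => (h p).1) fun p _ => (h p).2⟩

section
variable {h : ℝ → ℝ} {σ : ℝ} {C : ℝ} {m : ℕ} {X Q : ℝ} {e n : ℕ}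

theorem abs_weightIntegral_le (hσ : 0 < σ) (hC : ∀ x, |h x| ≤ C) {z : ℝ} (hz : 0 < z) :
    |weightIntegral h σ z| ≤ 19 / 8 * C * cutoff σ (2 / 5 * z) := by
  have hC0 : 0 ≤ C := (abs_nonneg _).trans (hC 0)
  rw [weightIntegral, ← Real.norm_eq_abs]
  have := intervalIntegral.norm_integral_le_of_norm_le_const (a := 1 / 8) (b := 5 / 2)
    (f := fun y => h y * cutoff σ (z / y)) (C := C * cutoff σ (2 / 5 * z)) fun y hy => by
      rw [Set.uIoc_of_le (by norm_num)] at hy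
      have hy0 : (0 : ℝ) < y := by linarith [hy.1]
      rw [Real.norm_eq_abs, abs_mul, abs_of_nonneg (cutoff_nonneg hσ (by positivity) : 0 ≤ cutoff σ (z / y))]
      refine mul_le_mul (hC y) (cutoff_antitone hσ (by positivity) ?_) (cutoff_nonneg hσ (by positivity)) hC0
      rw [le_div_iff₀ hy0]
      nlinarith [hy.2]
  refine this.trans (le_of_eq ?_)
  norm_num
  ring

theorem weightedSum_eq_Ioc (hh : IsSmoothWeight h) (c : ℕ) (hX : 0 < X) (he : 0 < e) :
    weightedSum h σ m c X Q e n = ∑ k ∈ Finset.Ioc ⌊X / (8 * e ^ 2)⌋₊ ⌊5 * X / (2 * e ^ 2)⌋₊,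
      (h (k * (e ^ 2 / X)) * cutoff σ (n ^ 2 * e ^ 2 / Q / k)) *
        (if k % 8 = c % 8 ∧ k.Coprime m then ((J((k : ℤ) | n) : ℤ) : ℝ) else 0) := by
  have he' : (1 : ℝ) ≤ (e : ℝ) ^ 2 := by exact_mod_cast Nat.one_le_pow _ _ he
  have he0 : (0 : ℝ) < (e : ℝ) ^ 2 := by linarith
  have hzero : ∀ k : ℕ, (k : ℝ) * e ^ 2 / X < 1 / 4 ∨ 5 / 4 < (k : ℝ) * e ^ 2 / X →
      (h (k * (e ^ 2 / X)) * cutoff σ (n ^ 2 * e ^ 2 / Q / k)) *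
        (if k % 8 = c % 8 ∧ k.Coprime m then ((J((k : ℤ) | n) : ℤ) : ℝ) else 0) = 0 := by
    intro k hk
    have e1 : (k : ℝ) * (e ^ 2 / X) = k * e ^ 2 / X := by ring
    rw [e1, hh.eq_zero hk, zero_mul, zero_mul]
  have h1 : weightedSum h σ m c X Q e n = ∑ k ∈ Finset.range (⌊2 * X⌋₊ + 1),
      (h (k * (e ^ 2 / X)) * cutoff σ (n ^ 2 * e ^ 2 / Q / k)) *
        (if k % 8 = c % 8 ∧ k.Coprime m then ((J((k : ℤ) | n) : ℤ) : ℝ) else 0) := by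
    refine Finset.sum_congr rfl fun k _ => ?_
    have e1 : (k : ℝ) * (e ^ 2 / X) = k * e ^ 2 / X := by ring
    have e2 : (n : ℝ) ^ 2 * e ^ 2 / Q / k = n ^ 2 * e ^ 2 / (k * Q) := by
      rw [div_div, mul_comm Q]
    rw [e1, e2]
    split_ifs <;> ring
  rw [h1]
  set F : ℕ → ℝ := fun k => (h (k * (e ^ 2 / X)) * cutoff σ (n ^ 2 * e ^ 2 / Q / k)) *
        (if k % 8 = c % 8 ∧ k.Coprime m then ((J((k : ℤ) | n) : ℤ) : ℝ) else 0) with hF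
  -- Neither range need contain the other; both are compared with their union, as the weight
  -- vanishes on the differences.
  have s1 : ∑ k ∈ Finset.range (⌊2 * X⌋₊ + 1), F k = ∑ k ∈ Finset.range (⌊2 * X⌋₊ + 1) ∪
      Finset.Ioc ⌊X / (8 * e ^ 2)⌋₊ ⌊5 * X / (2 * e ^ 2)⌋₊, F k := by
    refine Finset.sum_subset Finset.subset_union_left fun k _ hk => hzero k (Or.inr ?_)
    rw [Finset.mem_range, not_lt] at hk
    have h2 := Nat.lt_of_floor_lt (Nat.lt_of_succ_le hk)
    rw [lt_div_iff₀ hX]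
    nlinarith
  have s2 : ∑ k ∈ Finset.Ioc ⌊X / (8 * e ^ 2)⌋₊ ⌊5 * X / (2 * e ^ 2)⌋₊, F k =
      ∑ k ∈ Finset.range (⌊2 * X⌋₊ + 1) ∪
      Finset.Ioc ⌊X / (8 * e ^ 2)⌋₊ ⌊5 * X / (2 * e ^ 2)⌋₊, F k := by
    refine Finset.sum_subset Finset.subset_union_right fun k _ hk => hzero k ?_
    rw [Finset.mem_Ioc, not_and_or, not_lt, not_le] at hk
    rcases hk with hk | hk
    · left
      have h2 : (k : ℝ) ≤ X / (8 * e ^ 2) := (Nat.le_floor_iff (by positivity)).1 hk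
      rw [le_div_iff₀ (by positivity)] at h2
      rw [div_lt_iff₀ hX]
      nlinarith
    · right
      have h2 := Nat.lt_of_floor_lt hk
      rw [div_lt_iff₀ (by positivity)] at h2
      rw [lt_div_iff₀ hX]
      nlinarith
  rw [s1, s2]

theorem integral_weight_scaled (hX : 0 < X) (he : 0 < e) :
    ∫ t in (X / (8 * e ^ 2))..(5 * X / (2 * e ^ 2)), h (t * (e ^ 2 / X)) * cutoff σ (n ^ 2 * e ^ 2 / Q / t) =
      X / e ^ 2 * weightIntegral h σ (n ^ 2 * e ^ 4 / (X * Q)) := by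
  have he0 : (0 : ℝ) < (e : ℝ) ^ 2 := by positivity
  have hc : (e : ℝ) ^ 2 / X ≠ 0 := by positivity
  have := intervalIntegral.integral_comp_mul_right (a := X / (8 * e ^ 2)) (b := 5 * X / (2 * e ^ 2))
    (fun y => h y * cutoff σ (n ^ 2 * e ^ 4 / (X * Q) / y)) hc
  have e1 : X / (8 * (e : ℝ) ^ 2) * (e ^ 2 / X) = 1 / 8 := by field_simp
  have e2 : 5 * X / (2 * (e : ℝ) ^ 2) * (e ^ 2 / X) = 5 / 2 := by field_simp
  rw [e1, e2, smul_eq_mul, inv_div] at this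
  rw [weightIntegral, ← this]
  refine intervalIntegral.integral_congr fun t _ => ?_
  have e3 : (n : ℝ) ^ 2 * e ^ 4 / (X * Q) / (t * (e ^ 2 / X)) = n ^ 2 * e ^ 2 / Q / t := by
    rcases eq_or_ne Q 0 with rfl | hQ
    · simp
    rcases eq_or_ne t 0 with rfl | ht
    · simp
    field_simp
  simp only [e3]

/-- The Pólya–Vinogradov bound times the variation of weight and cutoff; useful for small n. -/
theorem abs_weightedSum_sub_le (hσ : 0 < σ) (hh : IsSmoothWeight h) (hC : ∀ x, |h x| ≤ C) (hC' : ∀ x, |deriv h x| ≤ C)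
    (hm : Odd m) (hn : Odd n) (c : ℕ) (hX : 0 < X) (hQ : 0 < Q) (he : 0 < e) :
    |weightedSum h σ m c X Q e n - weightedMain h σ m X Q e n| ≤
      2 ^ m.primeFactors.card * (√n * (1 + Real.log n)) * (4 * C * cutoff σ (2 / 5 * (n ^ 2 * e ^ 4 / (X * Q)))) := by
  have hC0 : 0 ≤ C := (abs_nonneg _).trans (hC 0)
  have hn0 : (1 : ℝ) ≤ n := by exact_mod_cast hn.pos
  have he0 : (0 : ℝ) < (e : ℝ) ^ 2 := by positivity
  -- In the variable of h the endpoints are 1/8 and 5/2, strictly outside the support, so boundary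
  -- terms vanish. The endpoint 5/2 is the source of the factor 2/5 in the cutoff.
  set u := X / (8 * (e : ℝ) ^ 2) with hu
  set v := 5 * X / (2 * (e : ℝ) ^ 2) with hv
  have hu0 : 0 < u := by positivity
  have huv : u ≤ v := by
    rw [hu, hv, div_le_div_iff₀ (by positivity) (by positivity)]; nlinarith [mul_pos hX he0]
  set α := (n : ℝ) ^ 2 * e ^ 2 / Q with hα
  have hα0 : 0 < α := by positivity
  set ρ : ℝ := if sqfree n = 1 then 1 / 8 * ∏ p ∈ (m * n).primeFactors, (1 - 1 / (p : ℝ)) else 0 with hρ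
  set B := 2 ^ m.primeFactors.card * (√n * (1 + Real.log n)) with hB
  have hB0 : 0 ≤ B := by
    have := Real.log_nonneg hn0
    positivity
  have hA : ∀ t : ℝ, 0 ≤ t → |∑ k ∈ Finset.range (⌊t⌋₊ + 1),
      (if k % 8 = c % 8 ∧ k.Coprime m then ((J((k : ℤ) | n) : ℤ) : ℝ) else 0) - ρ * t| ≤ B := by
    intro t ht
    have := abs_coprimeClassSum_le hm hn c ht
    have e1 : ρ * t = if sqfree n = 1 then t / 8 * ∏ p ∈ (m * n).primeFactors, (1 - 1 / (p : ℝ)) else 0 := by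
      rw [hρ]; split_ifs <;> ring
    rw [e1]
    exact this
  set H : ℝ → ℝ := fun t => h (t * (e ^ 2 / X)) with hH
  set H' : ℝ → ℝ := fun t => deriv h (t * (e ^ 2 / X)) * (e ^ 2 / X) with hH'
  have hHd : ∀ t, HasDerivAt H (H' t) t := by
    intro t
    have := (hh.hasDerivAt (t * (e ^ 2 / X))).comp t ((hasDerivAt_id t).mul_const ((e : ℝ) ^ 2 / X))
    rw [one_mul] at this
    exact this
  have hHc : Continuous H := hh.continuous.comp (by fun_prop)
  have hH'c : Continuous H' := (hh.continuous_deriv.comp (by fun_prop)).mul continuous_const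
  have hφ : ∀ t ∈ Set.Icc u v, HasDerivAt (fun t => H t * cutoff σ (α / t))
      (H' t * cutoff σ (α / t) + H t * (cutoffDensity σ (α / t) * (α / t ^ 2))) t := fun t ht =>
    (hHd t).mul (hasDerivAt_cutoff_div hσ hα0 (hu0.trans_le ht.1))
  have hcont : ContinuousOn (fun t => H' t * cutoff σ (α / t) + H t * (cutoffDensity σ (α / t) * (α / t ^ 2)))
      (Set.Icc u v) := by
    have hpos : ∀ t ∈ Set.Icc u v, 0 < t := fun t ht => hu0.trans_le ht.1
    refine (hH'c.continuousOn.mul fun t ht =>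
      (hasDerivAt_cutoff_div hσ hα0 (hpos t ht)).continuousAt.continuousWithinAt).add (hHc.continuousOn.mul
      (ContinuousOn.mul ((continuousOn_cutoffDensity σ).comp (continuousOn_const.div continuousOn_id
        fun t ht => (hpos t ht).ne') fun t ht => div_pos hα0 (hpos t ht))
        (continuousOn_const.div (continuousOn_pow 2) fun t ht => pow_ne_zero _ (hpos t ht).ne')))
  have e1 : u * ((e : ℝ) ^ 2 / X) = 1 / 8 := by rw [hu]; field_simp
  have e2 : v * ((e : ℝ) ^ 2 / X) = 5 / 2 := by rw [hv]; field_simp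
  have hφu : H u * cutoff σ (α / u) = 0 := by
    simp only [hH]; rw [e1, hh.eq_zero (Or.inl (by norm_num)), zero_mul]
  have hφv : H v * cutoff σ (α / v) = 0 := by
    simp only [hH]; rw [e2, hh.eq_zero (Or.inr (by norm_num)), zero_mul]
  have habel := abs_sum_mul_sub_integral_le hA hu0 huv hφ hcont hφu hφv
  have hvar := integral_abs_deriv_le (C₀ := C) (D := C * (e ^ 2 / X)) hσ hα0 hu0 huv (fun t => hC _)
    (fun t => by
      rw [hH', abs_mul, abs_of_pos (by positivity : (0 : ℝ) < e ^ 2 / X)]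
      exact mul_le_mul_of_nonneg_right (hC' _) (by positivity)) hHc hH'c
  have hαv : α / v = 2 / 5 * (n ^ 2 * e ^ 4 / (X * Q)) := by rw [hα, hv]; field_simp
  have hmain : weightedMain h σ m X Q e n = ρ * ∫ t in u..v, H t * cutoff σ (α / t) := by
    rw [integral_weight_scaled hX he, weightedMain, hρ]
    split_ifs <;> ring
  rw [weightedSum_eq_Ioc hh c hX he, hmain]
  refine habel.trans (mul_le_mul_of_nonneg_left (hvar.trans ?_) hB0)
  rw [hαv]
  refine mul_le_mul_of_nonneg_right ?_ (cutoff_nonneg hσ (by positivity))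
  have : C * ((e : ℝ) ^ 2 / X) * (v - u) = C * (19 / 8) := by
    rw [mul_assoc, mul_sub, mul_comm _ v, mul_comm _ u, e1, e2]; norm_num
  rw [this]
  linarith

/-- Counting the admissible k and estimating the main term directly; useful for large n. -/
theorem abs_weightedSum_sub_le_trivial (hσ : 0 < σ) (hh : IsSmoothWeight h) (hC : ∀ x, |h x| ≤ C)
    (hn : Odd n) (c : ℕ) (hX : 0 < X) (hQ : 0 < Q) (he : 0 < e) :
    |weightedSum h σ m c X Q e n - weightedMain h σ m X Q e n| ≤
      X / e ^ 2 * (4 * C * cutoff σ (2 / 5 * (n ^ 2 * e ^ 4 / (X * Q)))) := by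
  have hC0 : 0 ≤ C := (abs_nonneg _).trans (hC 0)
  have hn0 : (0 : ℝ) < n := by exact_mod_cast hn.pos
  have he0 : (0 : ℝ) < (e : ℝ) ^ 2 := by positivity
  set W := cutoff σ (2 / 5 * ((n : ℝ) ^ 2 * e ^ 4 / (X * Q))) with hW
  have hW0 : 0 ≤ W := cutoff_nonneg hσ (by positivity)
  have h1 : |weightedSum h σ m c X Q e n| ≤ 5 / 2 * (X / e ^ 2) * (C * W) := by
    rw [weightedSum_eq_Ioc hh c hX he]
    refine (Finset.abs_sum_le_sum_abs _ _).trans ?_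
    have hle : ∀ k ∈ Finset.Ioc ⌊X / (8 * (e : ℝ) ^ 2)⌋₊ ⌊5 * X / (2 * (e : ℝ) ^ 2)⌋₊,
        |(h (k * (e ^ 2 / X)) * cutoff σ (n ^ 2 * e ^ 2 / Q / k)) *
        (if k % 8 = c % 8 ∧ k.Coprime m then ((J((k : ℤ) | n) : ℤ) : ℝ) else 0)| ≤ C * W := by
      intro k hk
      rw [Finset.mem_Ioc] at hk
      have hk0 : (0 : ℝ) < k := Nat.cast_pos.2 (by omega)
      have hk1 : (k : ℝ) ≤ 5 * X / (2 * (e : ℝ) ^ 2) := (Nat.le_floor_iff (by positivity)).1 hk.2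
      rw [abs_mul, abs_mul, abs_of_nonneg (cutoff_nonneg hσ (by positivity) : 0 ≤ cutoff σ (n ^ 2 * e ^ 2 / Q / k))]
      have hJ : |(if k % 8 = c % 8 ∧ k.Coprime m then ((J((k : ℤ) | n) : ℤ) : ℝ) else 0)| ≤ 1 := by
        split_ifs
        · exact_mod_cast jacobiSym_abs_le_one k n
        · simp
      have hcut : cutoff σ (n ^ 2 * e ^ 2 / Q / k) ≤ W := by
        refine cutoff_antitone hσ (by positivity) ?_
        rw [le_div_iff₀ hk0]
        calc 2 / 5 * ((n : ℝ) ^ 2 * e ^ 4 / (X * Q)) * k ≤ 2 / 5 * ((n : ℝ) ^ 2 * e ^ 4 / (X * Q)) * (5 * X / (2 * (e : ℝ) ^ 2)) := by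
              gcongr
          _ = _ := by field_simp
      have hcut0 : 0 ≤ cutoff σ (n ^ 2 * e ^ 2 / Q / k) := cutoff_nonneg hσ (by positivity)
      calc |h (k * (e ^ 2 / X))| * cutoff σ (n ^ 2 * e ^ 2 / Q / k) * _ ≤ C * W * 1 :=
            mul_le_mul (mul_le_mul (hC _) hcut hcut0 hC0) hJ (abs_nonneg _) (by positivity)
        _ = _ := mul_one _
    refine (Finset.sum_le_card_nsmul _ _ _ hle).trans ?_
    rw [nsmul_eq_mul, Nat.card_Ioc]
    refine mul_le_mul_of_nonneg_right ?_ (by positivity)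
    have h2 : ((⌊5 * X / (2 * (e : ℝ) ^ 2)⌋₊ - ⌊X / (8 * (e : ℝ) ^ 2)⌋₊ : ℕ) : ℝ) ≤ ⌊5 * X / (2 * (e : ℝ) ^ 2)⌋₊ := by
      exact_mod_cast Nat.sub_le _ _
    refine h2.trans ((Nat.floor_le (by positivity)).trans (le_of_eq ?_))
    field_simp
  have h2 : |weightedMain h σ m X Q e n| ≤ 1 / 8 * (X / e ^ 2) * (19 / 8 * C * W) := by
    rw [weightedMain]
    split_ifs
    · have hp := prod_one_sub_inv_mem (m * n).primeFactors
      rw [abs_mul, abs_mul, abs_mul, abs_of_nonneg hp.1, abs_of_pos (by positivity : X / (e : ℝ) ^ 2 > 0),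
        abs_of_pos (by norm_num : (1 / 8 : ℝ) > 0)]
      have hI := abs_weightIntegral_le hσ hC (z := (n : ℝ) ^ 2 * e ^ 4 / (X * Q)) (by positivity)
      calc 1 / 8 * (∏ p ∈ (m * n).primeFactors, (1 - 1 / (p : ℝ))) * (X / e ^ 2 * |weightIntegral h σ (n ^ 2 * e ^ 4 / (X * Q))|)
          ≤ 1 / 8 * 1 * (X / e ^ 2 * (19 / 8 * C * W)) := by gcongr; exact hp.2
        _ = _ := by ring
    · rw [abs_zero]; positivity
  refine (abs_sub _ _).trans ((add_le_add h1 h2).trans ?_)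
  have : 0 ≤ X / (e : ℝ) ^ 2 * (C * W) := by positivity
  nlinarith

end

theorem le_sqrt_mul_of_le {a p q : ℝ} (ha : 0 ≤ a) (h1 : a ≤ p) (h2 : a ≤ q) : a ≤ √(p * q) := by
  rw [← Real.sqrt_mul_self ha]
  exact Real.sqrt_le_sqrt (mul_le_mul h1 h2 ha (ha.trans h1))

/-- The geometric mean of the two preceding bounds has size n^{1/4+ε} √X/e, apart from the cutoff at
a multiple of n²e⁴/(XQ). Decay of the cutoff with exponent 3/8 + ε gives the power of n the exponent
-1/2 + 1/4 + ε - 3/4 - 2ε = -1 - ε. Thus 3/8 is the threshold for convergence over n; the sum over e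
converges with room to spare. -/
theorem exists_weightedSum_error {h : ℝ → ℝ} (hh : IsSmoothWeight h) {σ ε : ℝ} (hσ : 0 < σ) (hε : 0 < ε) :
    ∃ K : ℝ, 0 < K ∧ ∀ (m n e c : ℕ) (X Q : ℝ), Odd m → Odd n → 0 < e → 0 < X → 0 < Q →
      (n : ℝ) ^ (-(1 / 2) : ℝ) * |weightedSum h σ m c X Q e n - weightedMain h σ m X Q e n| ≤
        K * (2 ^ m.primeFactors.card * √X * (X * Q) ^ (3 / 8 + ε)) *
          ((n : ℝ) ^ (-1 - ε) * (e : ℝ) ^ (-2 : ℝ)) := by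
  obtain ⟨C, hC1, hC, hC'⟩ := hh.exists_bound
  have hG := piGamma_pos hσ
  have hG1 := piGamma_pos (show 0 < σ + (3 / 8 + ε) by linarith)
  set G := piGamma (σ + (3 / 8 + ε)) / piGamma σ with hGdef
  refine ⟨4 * C * G * (2 / 5) ^ (-(3 / 8 + ε)) * √(1 + 1 / (2 * ε)), by positivity, ?_⟩
  intro m n e c X Q hm hn he hX hQ
  have hn0 : (1 : ℝ) ≤ n := by exact_mod_cast hn.pos
  have hnpos : (0 : ℝ) < n := by linarith
  have he1 : (1 : ℝ) ≤ e := by exact_mod_cast he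
  have hepos : (0 : ℝ) < e := by linarith
  have hlog0 := Real.log_nonneg hn0
  set w := 2 / 5 * ((n : ℝ) ^ 2 * e ^ 4 / (X * Q)) with hw
  have hw0 : 0 < w := by positivity
  have hcut0 := cutoff_nonneg hσ hw0.le
  have hcut := cutoff_le_rpow (β := 3 / 8 + ε) hσ (by linarith) hw0
  have h1 := abs_weightedSum_sub_le hσ hh hC hC' hm hn c hX hQ he
  have h2 := abs_weightedSum_sub_le_trivial (m := m) hσ hh hC hn c hX hQ he
  rw [← hw] at h1 h2
  have h3 := le_sqrt_mul_of_le (abs_nonneg _) h1 h2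
  set V := 4 * C * cutoff σ w with hV
  have hV0 : 0 ≤ V := by positivity
  have hlog : 1 + Real.log n ≤ (1 + 1 / (2 * ε)) * (n : ℝ) ^ (2 * ε) := by
    have h4 := Real.log_le_rpow_div hnpos.le (show 0 < 2 * ε by linarith)
    have h5 : (1 : ℝ) ≤ (n : ℝ) ^ (2 * ε) := Real.one_le_rpow hn0 (by linarith)
    have e1 : (n : ℝ) ^ (2 * ε) / (2 * ε) = 1 / (2 * ε) * (n : ℝ) ^ (2 * ε) := by ring
    rw [e1] at h4
    nlinarith
  have hsqrt : √(2 ^ m.primeFactors.card * (√n * (1 + Real.log n)) * V * (X / e ^ 2 * V)) ≤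
      2 ^ m.primeFactors.card * √X * V * √(1 + 1 / (2 * ε)) * ((n : ℝ) ^ (1 / 4 + ε) * (e : ℝ)⁻¹) := by
    rw [Real.sqrt_le_left (by positivity)]
    have h2ω : (1 : ℝ) ≤ 2 ^ m.primeFactors.card := one_le_pow₀ (by norm_num)
    have e1 : (2 ^ m.primeFactors.card * √X * V * √(1 + 1 / (2 * ε)) * ((n : ℝ) ^ (1 / 4 + ε) * (e : ℝ)⁻¹)) ^ 2 =
      2 ^ m.primeFactors.card * (2 ^ m.primeFactors.card * (√n * ((1 + 1 / (2 * ε)) * (n : ℝ) ^ (2 * ε))) * V * (X / e ^ 2 * V)) := by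
      have f1 : ((n : ℝ) ^ (1 / 4 + ε)) ^ 2 = √n * (n : ℝ) ^ (2 * ε) := by
        rw [← Real.rpow_natCast, ← Real.rpow_mul hnpos.le, Real.sqrt_eq_rpow, ← Real.rpow_add hnpos]
        congr 1; push_cast; ring
      have f2 : √X ^ 2 = X := Real.sq_sqrt hX.le
      have f3 : √(1 + 1 / (2 * ε)) ^ 2 = 1 + 1 / (2 * ε) := Real.sq_sqrt (by positivity)
      calc _ = (2 ^ m.primeFactors.card) ^ 2 * √X ^ 2 * V ^ 2 * √(1 + 1 / (2 * ε)) ^ 2 * (((n : ℝ) ^ (1 / 4 + ε)) ^ 2 * ((e : ℝ)⁻¹) ^ 2) := by ring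
        _ = _ := by rw [f1, f2, f3]; field_simp
    rw [e1]
    have h6 : 2 ^ m.primeFactors.card * (√n * (1 + Real.log n)) * V * (X / e ^ 2 * V) ≤
        2 ^ m.primeFactors.card * (√n * ((1 + 1 / (2 * ε)) * (n : ℝ) ^ (2 * ε))) * V * (X / e ^ 2 * V) := by gcongr
    refine h6.trans ?_
    exact le_mul_of_one_le_left (by positivity) h2ω
  have hVle : V ≤ 4 * C * (G * ((2 / 5) ^ (-(3 / 8 + ε)) * ((n : ℝ) ^ (-2 * (3 / 8 + ε)) * (e : ℝ) ^ (-4 * (3 / 8 + ε)) * (X * Q) ^ (3 / 8 + ε)))) := by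
    have hXQ : 0 < X * Q := by positivity
    have e1 : w ^ (-(3 / 8 + ε)) = (2 / 5) ^ (-(3 / 8 + ε)) * ((n : ℝ) ^ (-2 * (3 / 8 + ε)) * (e : ℝ) ^ (-4 * (3 / 8 + ε)) * (X * Q) ^ (3 / 8 + ε)) := by
      have g1 : ((n : ℝ) ^ 2) ^ (-(3 / 8 + ε)) = (n : ℝ) ^ (-2 * (3 / 8 + ε)) := by
        rw [← Real.rpow_natCast, ← Real.rpow_mul hnpos.le]; congr 1; push_cast; ring
      have g2 : ((e : ℝ) ^ 4) ^ (-(3 / 8 + ε)) = (e : ℝ) ^ (-4 * (3 / 8 + ε)) := by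
        rw [← Real.rpow_natCast, ← Real.rpow_mul hepos.le]; congr 1; push_cast; ring
      rw [hw, Real.mul_rpow (x := 2 / 5) (by norm_num) (by positivity),
        Real.div_rpow (x := (n : ℝ) ^ 2 * e ^ 4) (by positivity) hXQ.le,
        Real.mul_rpow (x := (n : ℝ) ^ 2) (by positivity) (by positivity), g1, g2,
        Real.rpow_neg hXQ.le, div_inv_eq_mul]
    rw [← e1]
    exact mul_le_mul_of_nonneg_left hcut (by positivity)
  have hfac : (n : ℝ) ^ (-(1 / 2) : ℝ) * ((n : ℝ) ^ (1 / 4 + ε) * (n : ℝ) ^ (-2 * (3 / 8 + ε))) = (n : ℝ) ^ (-1 - ε) := by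
    rw [← Real.rpow_add hnpos, ← Real.rpow_add hnpos]; congr 1; ring
  have hfac2 : (e : ℝ)⁻¹ * (e : ℝ) ^ (-4 * (3 / 8 + ε)) ≤ (e : ℝ) ^ (-2 : ℝ) := by
    rw [← Real.rpow_neg_one, ← Real.rpow_add hepos]
    exact Real.rpow_le_rpow_of_exponent_le he1 (by linarith)
  calc (n : ℝ) ^ (-(1 / 2) : ℝ) * |weightedSum h σ m c X Q e n - weightedMain h σ m X Q e n|
      ≤ (n : ℝ) ^ (-(1 / 2) : ℝ) * (2 ^ m.primeFactors.card * √X * V * √(1 + 1 / (2 * ε)) * ((n : ℝ) ^ (1 / 4 + ε) * (e : ℝ)⁻¹)) := by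
        gcongr
        exact h3.trans hsqrt
    _ ≤ (n : ℝ) ^ (-(1 / 2) : ℝ) * (2 ^ m.primeFactors.card * √X * (4 * C * (G * ((2 / 5) ^ (-(3 / 8 + ε)) * ((n : ℝ) ^ (-2 * (3 / 8 + ε)) * (e : ℝ) ^ (-4 * (3 / 8 + ε)) * (X * Q) ^ (3 / 8 + ε))))) * √(1 + 1 / (2 * ε)) * ((n : ℝ) ^ (1 / 4 + ε) * (e : ℝ)⁻¹)) := by
        gcongr
    _ = 4 * C * G * (2 / 5) ^ (-(3 / 8 + ε)) * √(1 + 1 / (2 * ε)) * (2 ^ m.primeFactors.card * √X * (X * Q) ^ (3 / 8 + ε)) *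
          (((n : ℝ) ^ (-(1 / 2) : ℝ) * ((n : ℝ) ^ (1 / 4 + ε) * (n : ℝ) ^ (-2 * (3 / 8 + ε)))) * ((e : ℝ)⁻¹ * (e : ℝ) ^ (-4 * (3 / 8 + ε)))) := by ring
    _ ≤ _ := by
        rw [hfac]
        gcongr

end LMoment

end

/-! ### Sieved harmonic sums and the logarithmic mean of the cutoff -/

noncomputable section
namespace LMoment
open Filter Topology Finset MeasureTheory
open scoped Real

/-- The sum of `1 / l` over `l ≤ x` not divisible by any element of `P`. -/
def invSum (P : Finset ℕ) (x : ℝ) : ℝ :=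
  ∑ l ∈ (Finset.Icc 1 ⌊x⌋₊).filter (fun l => ∀ p ∈ P, ¬ p ∣ l), 1 / (l : ℝ)

/-- The constant term in the asymptotic expansion of `invSum P`. -/
def invSumConst (P : Finset ℕ) : ℝ :=
  Real.eulerMascheroniConstant + ∑ p ∈ P, Real.log p / ((p : ℝ) - 1)

theorem invSum_insert {P : Finset ℕ} {p : ℕ} (hp : p.Prime) (hpP : p ∉ P) (hP : ∀ q ∈ P, q.Prime) (x : ℝ) :
    invSum (insert p P) x = invSum P x - 1 / p * invSum P (x / p) := by
  have hp0 : (0 : ℝ) < p := Nat.cast_pos.2 hp.pos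
  rw [eq_sub_iff_add_eq, invSum, invSum, invSum, mul_sum, Nat.floor_div_natCast,
    ← Finset.sum_filter_add_sum_filter_not ((Finset.Icc 1 ⌊x⌋₊).filter fun l => ∀ p ∈ P, ¬ p ∣ l) (fun l => ¬ p ∣ l)]
  congr 1
  · rw [Finset.filter_filter]
    refine Finset.sum_congr (Finset.filter_congr fun l _ => ?_) fun _ _ => rfl
    rw [Finset.forall_mem_insert, and_comm]
  · symm
    refine Finset.sum_nbij' (fun l => l / p) (fun l => p * l) ?_ ?_ ?_ ?_ ?_
    · intro l hl
      simp only [Finset.mem_filter, Finset.mem_Icc, not_not] at hl ⊢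
      obtain ⟨⟨⟨h1, h2⟩, h3⟩, k, rfl⟩ := hl
      rw [Nat.mul_div_cancel_left _ hp.pos]
      refine ⟨⟨Nat.pos_of_ne_zero (by rintro rfl; simp at h1), ?_⟩, fun q hq hqk => h3 q hq (hqk.mul_left p)⟩
      rw [Nat.le_div_iff_mul_le hp.pos, mul_comm]; exact h2
    · intro l hl
      simp only [Finset.mem_filter, Finset.mem_Icc, not_not] at hl ⊢
      obtain ⟨⟨h1, h2⟩, h3⟩ := hl
      refine ⟨⟨⟨Nat.mul_pos hp.pos h1, ?_⟩, fun q hq hqk => ?_⟩, dvd_mul_right _ _⟩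
      · rw [Nat.le_div_iff_mul_le hp.pos, mul_comm] at h2; exact h2
      · rcases (hP q hq).dvd_mul.1 hqk with h | h
        · rw [Nat.prime_dvd_prime_iff_eq (hP q hq) hp] at h
          exact hpP (h ▸ hq)
        · exact h3 q hq h
    · intro l hl
      simp only [Finset.mem_filter, not_not] at hl
      exact Nat.mul_div_cancel' hl.2
    · intro l _
      exact Nat.mul_div_cancel_left _ hp.pos
    · intro l hl
      simp only [Finset.mem_filter, not_not] at hl
      obtain ⟨_, k, rfl⟩ := hl
      rw [Nat.mul_div_cancel_left _ hp.pos]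
      push_cast
      rw [one_div_mul_one_div]

/-- The weak error x^{-1/2} is chosen so that the estimate also holds for x < 1, where the sum is
empty and -log x must be absorbed; later x runs over all positive reals under an integral. -/
theorem abs_invSum_empty_sub_le {x : ℝ} (hx : 0 < x) :
    |invSum ∅ x - (Real.log x + Real.eulerMascheroniConstant)| ≤ 2 * x ^ (-(1 / 2) : ℝ) := by
  have hγ0 := Real.one_half_lt_eulerMascheroniConstant
  have hγ1 := Real.eulerMascheroniConstant_lt_two_thirds
  have hsum : invSum ∅ x = (harmonic ⌊x⌋₊ : ℝ) := by
    rw [invSum, harmonic_eq_sum_Icc]; push_cast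
    simp [one_div]
  rw [hsum]
  rcases lt_or_ge x 1 with h1 | h1
  · rw [Nat.floor_eq_zero.2 h1]
    simp only [harmonic_zero, Rat.cast_zero, zero_sub, abs_neg]
    have h2 := Real.log_le_sub_one_of_pos (Real.rpow_pos_of_pos hx (-(1 / 2) : ℝ))
    rw [Real.log_rpow hx] at h2
    have h3 : (1 : ℝ) ≤ x ^ (-(1 / 2) : ℝ) := Real.one_le_rpow_of_pos_of_le_one_of_nonpos hx h1.le (by norm_num)
    have h4 := Real.log_neg hx h1
    rw [abs_le]; constructor <;> linarith
  · set n := ⌊x⌋₊ with hn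
    have hn1 : 1 ≤ n := Nat.one_le_floor_iff x |>.2 h1
    have hn0 : (1 : ℝ) ≤ n := by exact_mod_cast hn1
    have hnx : (n : ℝ) ≤ x := Nat.floor_le hx.le
    have hxn : x < n + 1 := Nat.lt_floor_add_one x
    have g1 := Real.eulerMascheroniSeq_lt_eulerMascheroniConstant n
    have g2 := Real.eulerMascheroniConstant_lt_eulerMascheroniSeq' n
    rw [Real.eulerMascheroniSeq] at g1
    rw [Real.eulerMascheroniSeq', if_neg (by omega)] at g2
    have l1 : Real.log n ≤ Real.log x := Real.log_le_log (by linarith) hnx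
    have l2 : Real.log x ≤ Real.log (n + 1) := Real.log_le_log hx hxn.le
    have l3 : Real.log (n + 1) - Real.log n ≤ 1 / n := by
      rw [← Real.log_div (by positivity) (by positivity)]
      have := Real.log_le_sub_one_of_pos (show (0 : ℝ) < (n + 1) / n by positivity)
      have e : ((n : ℝ) + 1) / n - 1 = 1 / n := by field_simp; ring
      linarith
    have l4 : (1 : ℝ) / n ≤ 2 * x ^ (-(1 / 2) : ℝ) := by
      have : (1 : ℝ) / n ≤ 2 * x ^ (-1 : ℝ) := by
        rw [Real.rpow_neg_one, ← div_eq_mul_inv, div_le_div_iff₀ (by linarith) hx]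
        linarith
      refine this.trans ?_
      gcongr 2 * ?_
      exact Real.rpow_le_rpow_of_exponent_le h1 (by norm_num)
    rw [abs_le]; constructor <;> linarith

/-- Sieving by p multiplies the density by 1 - 1/p and adds log p/(p - 1) to the constant. The error
at most doubles, since p^{-1}(x/p)^{-1/2} ≤ x^{-1/2}. -/
theorem abs_invSum_sub_le {P : Finset ℕ} (hP : ∀ q ∈ P, q.Prime) {x : ℝ} (hx : 0 < x) :
    |invSum P x - (∏ p ∈ P, (1 - 1 / (p : ℝ))) * (Real.log x + invSumConst P)| ≤
      2 * 2 ^ P.card * x ^ (-(1 / 2) : ℝ) := by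
  induction P using Finset.induction_on generalizing x with
  | empty => simpa [invSumConst] using abs_invSum_empty_sub_le hx
  | insert p P hpP ih =>
    have hp := hP p (mem_insert_self _ _)
    have hP' : ∀ q ∈ P, q.Prime := fun q hq => hP q (mem_insert_of_mem hq)
    have hp2 : (2 : ℝ) ≤ p := by exact_mod_cast hp.two_le
    have hp0 : (0 : ℝ) < p := by linarith
    rw [invSum_insert hp hpP hP', prod_insert hpP, card_insert_of_notMem hpP]
    have i1 := ih hP' hx
    have i2 := ih hP' (div_pos hx hp0)
    set M := ∏ q ∈ P, (1 - 1 / (q : ℝ))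
    have e0 : invSumConst (insert p P) = invSumConst P + Real.log p / ((p : ℝ) - 1) := by
      rw [invSumConst, sum_insert hpP, invSumConst]; ring
    have e1 : (1 - 1 / (p : ℝ)) * M * (Real.log x + invSumConst (insert p P)) =
        M * (Real.log x + invSumConst P) - 1 / p * (M * (Real.log (x / p) + invSumConst P)) := by
      rw [e0, Real.log_div hx.ne' hp0.ne']
      have : (p : ℝ) - 1 ≠ 0 := by linarith
      field_simp
      ring
    have e2 : invSum P x - 1 / p * invSum P (x / p) - (1 - 1 / (p : ℝ)) * M * (Real.log x + invSumConst (insert p P)) =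
        (invSum P x - M * (Real.log x + invSumConst P)) -
          1 / p * (invSum P (x / p) - M * (Real.log (x / p) + invSumConst P)) := by
      rw [e1]; ring
    rw [e2]
    have e3 : 1 / (p : ℝ) * (x / p) ^ (-(1 / 2) : ℝ) ≤ x ^ (-(1 / 2) : ℝ) := by
      rw [Real.div_rpow hx.le hp0.le, Real.rpow_neg hp0.le, div_inv_eq_mul]
      have : 1 / (p : ℝ) * (p : ℝ) ^ (1 / 2 : ℝ) ≤ 1 := by
        rw [one_div, inv_mul_le_iff₀ hp0, mul_one]
        conv_rhs => rw [← Real.rpow_one (p : ℝ)]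
        exact Real.rpow_le_rpow_of_exponent_le (by linarith) (by norm_num)
      calc _ = x ^ (-(1 / 2) : ℝ) * (1 / (p : ℝ) * (p : ℝ) ^ (1 / 2 : ℝ)) := by ring
        _ ≤ _ := mul_le_of_le_one_right (by positivity) this
    refine (abs_sub _ _).trans ?_
    rw [abs_mul, abs_of_pos (show (0 : ℝ) < 1 / p by positivity)]
    have i3 := mul_le_mul_of_nonneg_left i2 (show (0 : ℝ) ≤ 1 / p by positivity)
    have i4 := mul_le_mul_of_nonneg_left e3 (show (0 : ℝ) ≤ 2 * 2 ^ P.card by positivity)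
    calc _ ≤ 2 * 2 ^ P.card * x ^ (-(1 / 2) : ℝ) + 2 * 2 ^ P.card * x ^ (-(1 / 2) : ℝ) := by
          refine add_le_add i1 (i3.trans ?_)
          linarith
      _ = _ := by rw [pow_succ]; ring

/-- The mean value of the logarithm against the density of the cutoff. -/
def logMean (σ : ℝ) : ℝ := ∫ t in Set.Ioi (0 : ℝ), cutoffDensity σ t * Real.log t

theorem integrableOn_cutoffDensity {σ : ℝ} (hσ : 0 < σ) : IntegrableOn (cutoffDensity σ) (Set.Ioi 0) :=
  (integrableOn_gamma_kernel hσ Real.pi_pos).div_const _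

theorem integral_cutoffDensity {σ : ℝ} (x : ℝ) : ∫ t in Set.Ioi x, cutoffDensity σ t = cutoff σ x := by
  simp only [cutoffDensity, cutoff, integral_div]

theorem integral_cutoffDensity_zero {σ : ℝ} (hσ : 0 < σ) : ∫ t in Set.Ioi 0, cutoffDensity σ t = 1 := by
  rw [integral_cutoffDensity, cutoff_zero hσ]

theorem cutoffDensity_mul_rpow {σ β t : ℝ} (hσβ : 0 < σ + β) (ht : 0 < t) :
    cutoffDensity σ t * t ^ β = piGamma (σ + β) / piGamma σ * cutoffDensity (σ + β) t := by
  have := (piGamma_pos hσβ).ne'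
  rw [cutoffDensity, cutoffDensity, show σ + β - 1 = (σ - 1) + β by ring, Real.rpow_add ht]
  field_simp

/-- The Mellin transform of exp(-πt) is π^{-s}Γ(s). Differentiating at s = σ brings down log t, and
dividing by the value gives the logarithmic derivative. -/
theorem logMean_spec {σ : ℝ} (hσ : 0 < σ) :
    IntegrableOn (fun t => cutoffDensity σ t * Real.log t) (Set.Ioi 0) ∧
      (logMean σ : ℂ) = Complex.digamma σ - Real.log π := by
  set f : ℝ → ℂ := fun t => ((Real.exp (-(π * t)) : ℝ) : ℂ) with hf
  have hcont : Continuous f := by fun_prop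
  have hO : ∀ a : ℝ, (fun t : ℝ => Real.exp (-(π * t))) =O[atTop] fun t => t ^ (-a) := fun a => by
    have := (isLittleO_exp_neg_mul_rpow_atTop Real.pi_pos (-a)).isBigO
    simpa [neg_mul] using this
  have hbot : f =O[𝓝[>] 0] (fun t : ℝ => t ^ (-(0 : ℝ))) := by
    refine Asymptotics.IsBigO.of_bound 1 ?_
    filter_upwards [self_mem_nhdsWithin] with t ht
    have ht' : 0 < t := ht
    simp only [hf, neg_zero, Real.rpow_zero, Complex.norm_real, norm_one, mul_one, Real.norm_eq_abs, Real.abs_exp,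
      Real.exp_le_one_iff, Left.neg_nonpos_iff]
    positivity
  have htop : f =O[atTop] (fun t : ℝ => t ^ (-(σ + 1))) := by
    refine Asymptotics.IsBigO.trans (Asymptotics.IsBigO.of_bound 1 ?_) (hO (σ + 1))
    filter_upwards with t
    simp only [hf, Complex.norm_real, one_mul, le_refl]
  obtain ⟨hconv, hder⟩ := mellin_hasDerivAt_of_isBigO_rpow (s := (σ : ℂ)) (hcont.locallyIntegrable.locallyIntegrableOn _) htop
    (by simp) hbot (by simpa using hσ)
  have hG := piGamma_pos hσ
  have hkey : ∀ t ∈ Set.Ioi (0 : ℝ), (t : ℂ) ^ ((σ : ℂ) - 1) • (Real.log t • f t) =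
      ((piGamma σ * (cutoffDensity σ t * Real.log t) : ℝ) : ℂ) := by
    intro t ht
    have ht0 : (0 : ℝ) < t := ht
    rw [show (σ : ℂ) - 1 = ((σ - 1 : ℝ) : ℂ) by push_cast; rfl, ← Complex.ofReal_cpow ht0.le, hf, cutoffDensity,
      smul_eq_mul, Complex.real_smul]
    rw [← Complex.ofReal_mul, ← Complex.ofReal_mul]
    congr 1
    field_simp
  have hint : IntegrableOn (fun t => cutoffDensity σ t * Real.log t) (Set.Ioi 0) := by
    have h1 : IntegrableOn (fun t => ((piGamma σ * (cutoffDensity σ t * Real.log t) : ℝ) : ℂ)) (Set.Ioi 0) :=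
      hconv.congr_fun hkey measurableSet_Ioi
    have h2 := h1.re
    simp only [RCLike.re_to_complex, Complex.ofReal_re] at h2
    have h3 := h2.const_mul (piGamma σ)⁻¹
    refine h3.congr (Eventually.of_forall fun t => ?_)
    simp only
    field_simp
  refine ⟨hint, ?_⟩
  have hval : mellin (fun t => Real.log t • f t) σ = ((piGamma σ * logMean σ : ℝ) : ℂ) := by
    rw [mellin, setIntegral_congr_fun measurableSet_Ioi hkey, integral_complex_ofReal, integral_const_mul, logMean]
  rw [hval] at hder
  have hσre : 0 < (σ : ℂ).re := by simpa using hσ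
  have heq : mellin f =ᶠ[𝓝 (σ : ℂ)] fun z => (π : ℂ) ^ (-z) * Complex.Gamma z := by
    have hopen : IsOpen {z : ℂ | 0 < z.re} := isOpen_lt continuous_const Complex.continuous_re
    filter_upwards [hopen.mem_nhds hσre] with z hz
    have := Complex.integral_cpow_mul_exp_neg_mul_Ioi (a := z) (r := π) hz Real.pi_pos
    rw [mellin]
    simp only [hf, smul_eq_mul]
    push_cast
    rw [this, one_div, Complex.inv_cpow _ _ (by rw [Complex.arg_ofReal_of_nonneg Real.pi_pos.le]; exact Real.pi_pos.ne), Complex.cpow_neg]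
  have hne : ∀ m : ℕ, (σ : ℂ) ≠ -m := by
    intro m hm
    have := congrArg Complex.re hm
    simp at this
    have : (0 : ℝ) ≤ m := by positivity
    linarith
  have hder2 : HasDerivAt (fun z => (π : ℂ) ^ (-z) * Complex.Gamma z)
      ((π : ℂ) ^ (-(σ : ℂ)) * Complex.log π * (-1) * Complex.Gamma σ + (π : ℂ) ^ (-(σ : ℂ)) * deriv Complex.Gamma σ) (σ : ℂ) := by
    refine HasDerivAt.mul ?_ (Complex.differentiableAt_Gamma _ hne).hasDerivAt
    exact (hasDerivAt_neg (σ : ℂ)).const_cpow (Or.inl (by exact_mod_cast Real.pi_pos.ne'))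
  have hfin := hder.unique (hder2.congr_of_eventuallyEq heq)
  have hGσ : Complex.Gamma σ ≠ 0 := Complex.Gamma_ne_zero_of_re_pos hσre
  have hπ : (π : ℂ) ^ (-(σ : ℂ)) ≠ 0 := by
    rw [Complex.cpow_ne_zero_iff]; left; exact_mod_cast Real.pi_pos.ne'
  have hpg : ((piGamma σ : ℝ) : ℂ) = (π : ℂ) ^ (-(σ : ℂ)) * Complex.Gamma σ := by
    rw [piGamma_eq hσ, Complex.ofReal_mul, Complex.ofReal_cpow Real.pi_pos.le, ← Complex.Gamma_ofReal]
    push_cast; rfl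
  rw [Complex.ofReal_mul, hpg, ← Complex.ofReal_log Real.pi_pos.le] at hfin
  rw [Complex.digamma_def, logDeriv_apply]
  have : (logMean σ : ℂ) * ((π : ℂ) ^ (-(σ : ℂ)) * Complex.Gamma σ) = (deriv Complex.Gamma σ / Complex.Gamma σ - Real.log π) * ((π : ℂ) ^ (-(σ : ℂ)) * Complex.Gamma σ) := by
    rw [mul_comm, hfin]
    field_simp
    ring
  exact mul_right_cancel₀ (mul_ne_zero hπ hGσ) this

end LMoment

end

/-! ### Asymptotics of the harmonic sum with cutoff -/

noncomputable section
namespace LMoment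
open Filter Topology Finset MeasureTheory
open scoped Real

/-- The weight `1 / l` restricted to `l` not divisible by any element of `P`. -/
def sievedInv (P : Finset ℕ) (l : ℕ) : ℝ := if ∀ p ∈ P, ¬ p ∣ l then 1 / (l : ℝ) else 0

theorem sievedInv_nonneg (P : Finset ℕ) (l : ℕ) : 0 ≤ sievedInv P l := by
  rw [sievedInv]; split_ifs <;> positivity

theorem sievedInv_le (P : Finset ℕ) (l : ℕ) : sievedInv P l ≤ 1 / l := by
  rw [sievedInv]; split_ifs
  · exact le_rfl
  · positivity

theorem sievedInv_zero (P : Finset ℕ) : sievedInv P 0 = 0 := by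
  rw [sievedInv]; split_ifs <;> simp

theorem invSum_eq (P : Finset ℕ) (x : ℝ) : invSum P x = ∑ l ∈ Finset.Icc 1 ⌊x⌋₊, sievedInv P l := by
  rw [invSum, Finset.sum_filter]; rfl

theorem sievedInv_mul_cutoff_le {σ Z : ℝ} (hσ : 0 < σ) (hZ : 0 < Z) (P : Finset ℕ) (l : ℕ) :
    sievedInv P l * cutoff σ (l ^ 4 / Z) ≤
      piGamma (σ + 1 / 4) / piGamma σ * Z ^ (1 / 4 : ℝ) * (1 / (l : ℝ) ^ 2) := by
  rcases Nat.eq_zero_or_pos l with rfl | hl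
  · rw [sievedInv_zero]; simp
  have hl0 : (0 : ℝ) < l := Nat.cast_pos.2 hl
  have h1 := cutoff_le_rpow (β := 1 / 4) hσ (by norm_num) (show 0 < (l : ℝ) ^ 4 / Z by positivity)
  have e1 : ((l : ℝ) ^ 4 / Z) ^ (-(1 / 4) : ℝ) = Z ^ (1 / 4 : ℝ) * (1 / l) := by
    rw [Real.div_rpow (by positivity) hZ.le, Real.rpow_neg hZ.le, div_inv_eq_mul, ← Real.rpow_natCast,
      ← Real.rpow_mul hl0.le]
    norm_num
    rw [Real.rpow_neg_one, mul_comm]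
  rw [e1] at h1
  calc sievedInv P l * cutoff σ (l ^ 4 / Z) ≤ 1 / l * (piGamma (σ + 1 / 4) / piGamma σ * (Z ^ (1 / 4 : ℝ) * (1 / l))) :=
        mul_le_mul (sievedInv_le P l) h1 (cutoff_nonneg hσ (by positivity)) (by positivity)
    _ = _ := by ring

theorem summable_sievedInv_mul_cutoff {σ Z : ℝ} (hσ : 0 < σ) (hZ : 0 < Z) (P : Finset ℕ) :
    Summable fun l : ℕ => sievedInv P l * cutoff σ (l ^ 4 / Z) :=
  Summable.of_nonneg_of_le (fun l => mul_nonneg (sievedInv_nonneg P l) (cutoff_nonneg hσ (by positivity)))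
    (fun l => sievedInv_mul_cutoff_le hσ hZ P l)
    ((Real.summable_one_div_nat_pow.2 (by norm_num)).mul_left _)

/-- Writing the cutoff as the integral of its density over t ≥ l⁴/Z and interchanging, the series is
the mean of `invSum P` at (tZ)^{1/4}. The logarithm there yields ¼ log Z and ¼ `logMean σ`; the
error (tZ)^{-1/8} is integrable against the density because σ > 1/8. -/
theorem abs_tsum_sievedInv_cutoff_sub_le {σ Z : ℝ} (hσ : 1 / 8 < σ) (hZ : 0 < Z) {P : Finset ℕ}
    (hP : ∀ q ∈ P, q.Prime) :
    |∑' l : ℕ, sievedInv P l * cutoff σ (l ^ 4 / Z) -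
        (∏ p ∈ P, (1 - 1 / (p : ℝ))) * (1 / 4 * Real.log Z + invSumConst P + 1 / 4 * logMean σ)| ≤
      2 * 2 ^ P.card * (piGamma (σ + -(1 / 8)) / piGamma σ) * Z ^ (-(1 / 8) : ℝ) := by
  have hσ0 : 0 < σ := by linarith
  set M := ∏ p ∈ P, (1 - 1 / (p : ℝ)) with hM
  set F : ℕ → ℝ → ℝ := fun l => (Set.Ici ((l : ℝ) ^ 4 / Z)).indicator (fun t => sievedInv P l * cutoffDensity σ t) with hF
  have hd := integrableOn_cutoffDensity hσ0
  have hint : ∀ l, Integrable (F l) (volume.restrict (Set.Ioi 0)) := fun l =>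
    (hd.const_mul _).indicator measurableSet_Ici
  have hval : ∀ l, ∫ t in Set.Ioi (0 : ℝ), F l t = sievedInv P l * cutoff σ (l ^ 4 / Z) := by
    intro l
    rcases Nat.eq_zero_or_pos l with rfl | hl
    · simp [hF, sievedInv_zero]
    have hl0 : (0 : ℝ) < (l : ℝ) ^ 4 / Z := by positivity
    rw [hF, setIntegral_indicator measurableSet_Ici,
      Set.inter_eq_self_of_subset_right (Set.Ici_subset_Ioi.2 hl0), integral_Ici_eq_integral_Ioi,
      integral_const_mul, integral_cutoffDensity]
  have hnn : ∀ l, ∀ t ∈ Set.Ioi (0 : ℝ), 0 ≤ F l t := fun l t ht =>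
    Set.indicator_apply_nonneg fun _ => mul_nonneg (sievedInv_nonneg P l) (cutoffDensity_nonneg hσ0 ht)
  have hnorm : ∀ l, ∫ t in Set.Ioi (0 : ℝ), ‖F l t‖ = sievedInv P l * cutoff σ (l ^ 4 / Z) := by
    intro l
    rw [← hval l]
    exact setIntegral_congr_fun measurableSet_Ioi fun t ht => Real.norm_of_nonneg (hnn l t ht)
  have hS := hasSum_integral_of_summable_integral_norm hint
    (by simpa only [hnorm] using summable_sievedInv_mul_cutoff hσ0 hZ P)
  simp only [hval] at hS
  rw [hS.tsum_eq]
  have hpt : ∀ t ∈ Set.Ioi (0 : ℝ), ∑' l, F l t = cutoffDensity σ t * invSum P ((t * Z) ^ (1 / 4 : ℝ)) := by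
    intro t ht
    have ht0 : 0 < t := ht
    have hmem : ∀ l : ℕ, (l : ℝ) ^ 4 / Z ≤ t ↔ l ≤ ⌊(t * Z) ^ (1 / 4 : ℝ)⌋₊ := by
      intro l
      have e4 : ((l : ℝ) ^ 4) ^ (1 / 4 : ℝ) = l := by
        rw [← Real.rpow_natCast, ← Real.rpow_mul (by positivity)]; norm_num
      rw [div_le_iff₀ hZ, Nat.le_floor_iff (by positivity)]
      conv_rhs => rw [← e4]
      exact (Real.rpow_le_rpow_iff (by positivity) (by positivity) (by norm_num)).symm
    rw [tsum_eq_sum (s := Finset.Icc 1 ⌊(t * Z) ^ (1 / 4 : ℝ)⌋₊), invSum_eq, mul_sum]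
    · refine Finset.sum_congr rfl fun l hl => ?_
      have hl2 : t ∈ Set.Ici ((l : ℝ) ^ 4 / Z) := (hmem l).2 (Finset.mem_Icc.1 hl).2
      simp only [hF]
      rw [Set.indicator_of_mem hl2, mul_comm]
    · intro l hl
      rcases Nat.eq_zero_or_pos l with rfl | hl1
      · simp [hF, sievedInv_zero]
      · refine Set.indicator_of_notMem (fun h => hl ?_) _
        exact Finset.mem_Icc.2 ⟨hl1, (hmem l).1 h⟩
  rw [setIntegral_congr_fun measurableSet_Ioi hpt]
  obtain ⟨hlogint, _⟩ := logMean_spec hσ0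
  set c := invSumConst P with hc
  set m : ℝ → ℝ := fun t => cutoffDensity σ t * (M * (1 / 4 * Real.log Z + c)) + M * (1 / 4) * (cutoffDensity σ t * Real.log t) with hm
  have hmint : IntegrableOn m (Set.Ioi 0) := (hd.mul_const _).add (hlogint.const_mul _)
  have hmval : ∫ t in Set.Ioi (0 : ℝ), m t = M * (1 / 4 * Real.log Z + c + 1 / 4 * logMean σ) := by
    rw [hm, integral_add (hd.mul_const _) (hlogint.const_mul _), integral_mul_const, integral_const_mul,
      integral_cutoffDensity_zero hσ0, logMean]
    ring
  set G := piGamma (σ + -(1 / 8)) / piGamma σ with hG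
  have hbound : ∀ t ∈ Set.Ioi (0 : ℝ), |cutoffDensity σ t * invSum P ((t * Z) ^ (1 / 4 : ℝ)) - m t| ≤
      2 * 2 ^ P.card * G * Z ^ (-(1 / 8) : ℝ) * cutoffDensity (σ + -(1 / 8)) t := by
    intro t ht
    have ht0 : 0 < t := ht
    have htZ : 0 < t * Z := by positivity
    have h1 := abs_invSum_sub_le hP (Real.rpow_pos_of_pos htZ (1 / 4))
    rw [Real.log_rpow htZ, Real.log_mul ht0.ne' hZ.ne', ← Real.rpow_mul htZ.le, ← hc, ← hM] at h1
    have e1 : cutoffDensity σ t * invSum P ((t * Z) ^ (1 / 4 : ℝ)) - m t = cutoffDensity σ t *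
        (invSum P ((t * Z) ^ (1 / 4 : ℝ)) - M * (1 / 4 * (Real.log t + Real.log Z) + c)) := by
      rw [hm]; ring
    rw [e1, abs_mul, abs_of_nonneg (cutoffDensity_nonneg hσ0 ht0)]
    refine (mul_le_mul_of_nonneg_left h1 (cutoffDensity_nonneg hσ0 ht0)).trans (le_of_eq ?_)
    rw [show (1 / 4 : ℝ) * -(1 / 2) = -(1 / 8) by norm_num, Real.mul_rpow ht0.le hZ.le]
    calc _ = 2 * 2 ^ P.card * Z ^ (-(1 / 8) : ℝ) * (cutoffDensity σ t * t ^ (-(1 / 8) : ℝ)) := by ring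
      _ = _ := by rw [cutoffDensity_mul_rpow (by linarith) ht0]; ring
  have hmono : Monotone (invSum P) := by
    intro x y hxy
    rw [invSum_eq, invSum_eq]
    exact Finset.sum_le_sum_of_subset_of_nonneg (Finset.Icc_subset_Icc_right (Nat.floor_mono hxy))
      fun l _ _ => sievedInv_nonneg P l
  have hd' := integrableOn_cutoffDensity (show 0 < σ + -(1 / 8) by linarith)
  have hdiff : IntegrableOn (fun t => cutoffDensity σ t * invSum P ((t * Z) ^ (1 / 4 : ℝ)) - m t) (Set.Ioi 0) := by
    refine (hd'.const_mul (2 * 2 ^ P.card * G * Z ^ (-(1 / 8) : ℝ))).mono' ?_ ?_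
    · refine (hd.aestronglyMeasurable.mul ?_).sub hmint.aestronglyMeasurable
      exact (hmono.measurable.comp ((measurable_id.mul_const Z).pow_const (1 / 4 : ℝ))).aestronglyMeasurable
    · exact (ae_restrict_iff' measurableSet_Ioi).2 (Eventually.of_forall hbound)
  have hfint : IntegrableOn (fun t => cutoffDensity σ t * invSum P ((t * Z) ^ (1 / 4 : ℝ))) (Set.Ioi 0) := by
    refine (hdiff.add hmint).congr (Eventually.of_forall fun t => ?_)
    simp
  rw [← hmval, ← integral_sub hfint hmint, ← Real.norm_eq_abs]
  refine (norm_integral_le_of_norm_le (hd'.const_mul (2 * 2 ^ P.card * G * Z ^ (-(1 / 8) : ℝ)))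
    ((ae_restrict_iff' measurableSet_Ioi).2 (Eventually.of_forall hbound))).trans (le_of_eq ?_)
  rw [integral_const_mul, integral_cutoffDensity_zero (by linarith), mul_one]

/-- The total mass of a weight. -/
def weightMass (h : ℝ → ℝ) : ℝ := ∫ y in (1 / 8 : ℝ)..(5 / 2), h y

/-- The logarithmic moment of a weight. -/
def weightLogMass (h : ℝ → ℝ) : ℝ := ∫ y in (1 / 8 : ℝ)..(5 / 2), h y * Real.log y

theorem continuousOn_cutoff_div {σ z : ℝ} (hσ : 0 < σ) (hz : 0 < z) :
    ContinuousOn (fun y => cutoff σ (z / y)) (Set.Icc (1 / 8) (5 / 2)) := fun y hy =>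
  (hasDerivAt_cutoff_div hσ hz (by linarith [hy.1])).continuousAt.continuousWithinAt

/-- The preceding estimate with Zy in place of Z, integrated against h(y); the term ¼ log y is the
source of the logarithmic moment. -/
theorem hasSum_sievedInv_weightIntegral {h : ℝ → ℝ} (hh : IsSmoothWeight h) {σ : ℝ} (hσ : 1 / 8 < σ) :
    ∃ K : ℝ, 0 < K ∧ ∀ (P : Finset ℕ) (Z : ℝ), (∀ q ∈ P, q.Prime) → 0 < Z →
      ∃ V : ℝ, HasSum (fun l : ℕ => sievedInv P l * weightIntegral h σ (l ^ 4 / Z)) V ∧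
        |V - (∏ p ∈ P, (1 - 1 / (p : ℝ))) * (weightMass h * (1 / 4 * Real.log Z + invSumConst P + 1 / 4 * logMean σ) +
          1 / 4 * weightLogMass h)| ≤ K * 2 ^ P.card * Z ^ (-(1 / 8) : ℝ) := by
  have hσ0 : 0 < σ := by linarith
  obtain ⟨C, hC1, hC, -⟩ := hh.exists_bound
  have hC0 : 0 < C := by linarith
  have hG1 := piGamma_pos hσ0
  have hG2 := piGamma_pos (show 0 < σ + -(1 / 8) by linarith)
  have hG3 := piGamma_pos (show 0 < σ + 1 / 4 by linarith)
  set G := piGamma (σ + -(1 / 8)) / piGamma σ with hG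
  refine ⟨19 / 8 * (C * (2 * G * 2)), by positivity, fun P Z hP hZ => ?_⟩
  set T : ℝ → ℝ := fun y => ∑' l : ℕ, sievedInv P l * cutoff σ (l ^ 4 / Z / y) with hT
  set u : ℕ → ℝ := fun l => piGamma (σ + 1 / 4) / piGamma σ * (Z * (5 / 2)) ^ (1 / 4 : ℝ) * (1 / (l : ℝ) ^ 2) with hu
  have husum : Summable u := (Real.summable_one_div_nat_pow.2 (by norm_num)).mul_left _
  have hle : ∀ (l : ℕ) (y : ℝ), y ∈ Set.Icc (1 / 8 : ℝ) (5 / 2) → ‖sievedInv P l * cutoff σ (l ^ 4 / Z / y)‖ ≤ u l := by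
    intro l y hy
    have hy0 : 0 < y := by linarith [hy.1]
    rw [Real.norm_of_nonneg (mul_nonneg (sievedInv_nonneg P l) (cutoff_nonneg hσ0 (by positivity))), div_div]
    refine (sievedInv_mul_cutoff_le hσ0 (by positivity) P l).trans ?_
    simp only [hu]
    gcongr
    exact hy.2
  have hcont : ∀ l : ℕ, ContinuousOn (fun y => sievedInv P l * cutoff σ (l ^ 4 / Z / y)) (Set.Icc (1 / 8) (5 / 2)) := by
    intro l
    rcases Nat.eq_zero_or_pos l with rfl | hl
    · simp only [sievedInv_zero, zero_mul]; exact continuousOn_const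
    · exact continuousOn_const.mul (continuousOn_cutoff_div hσ0 (by positivity))
  have hTc : ContinuousOn T (Set.Icc (1 / 8) (5 / 2)) := continuousOn_tsum hcont husum hle
  have hI : Set.uIcc (1 / 8 : ℝ) (5 / 2) = Set.Icc (1 / 8) (5 / 2) := Set.uIcc_of_le (by norm_num)
  have hI' : Set.uIoc (1 / 8 : ℝ) (5 / 2) = Set.Ioc (1 / 8) (5 / 2) := Set.uIoc_of_le (by norm_num)
  refine ⟨∫ y in (1 / 8 : ℝ)..(5 / 2), h y * T y, ?_, ?_⟩
  · have e1 : ∀ l : ℕ, sievedInv P l * weightIntegral h σ (l ^ 4 / Z) =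
        ∫ y in (1 / 8 : ℝ)..(5 / 2), h y * (sievedInv P l * cutoff σ (l ^ 4 / Z / y)) := by
      intro l
      rw [weightIntegral, ← intervalIntegral.integral_const_mul]
      congr 1; ext y; ring
    simp only [e1]
    refine intervalIntegral.hasSum_integral_of_dominated_convergence (fun l _ => C * u l) ?_ ?_ ?_ ?_ ?_
    · intro l
      rw [hI']
      exact ((hh.continuous.continuousOn.mul (hcont l)).mono Set.Ioc_subset_Icc_self).aestronglyMeasurable measurableSet_Ioc
    · intro l
      refine Eventually.of_forall fun y hy => ?_
      rw [hI'] at hy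
      rw [norm_mul]
      exact mul_le_mul (hC y) (hle l y (Set.Ioc_subset_Icc_self hy)) (norm_nonneg _) hC0.le
    · exact Eventually.of_forall fun y _ => husum.mul_left C
    · exact intervalIntegrable_const
    · refine Eventually.of_forall fun y hy => ?_
      rw [hI'] at hy
      exact (Summable.of_norm_bounded husum fun l => hle l y (Set.Ioc_subset_Icc_self hy)).hasSum.mul_left _
  · set M := ∏ p ∈ P, (1 - 1 / (p : ℝ)) with hM
    have hlogc : ContinuousOn Real.log (Set.Icc (1 / 8) (5 / 2)) := fun y hy =>
      (Real.continuousAt_log (by linarith [hy.1])).continuousWithinAt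
    have hi1 : IntervalIntegrable (fun y => h y * T y) volume (1 / 8) (5 / 2) :=
      (by rw [hI]; exact hh.continuous.continuousOn.mul hTc : ContinuousOn _ _).intervalIntegrable
    have hi2 : IntervalIntegrable h volume (1 / 8) (5 / 2) := hh.continuous.intervalIntegrable _ _
    have hi3 : IntervalIntegrable (fun y => h y * Real.log y) volume (1 / 8) (5 / 2) :=
      (by rw [hI]; exact hh.continuous.continuousOn.mul hlogc : ContinuousOn _ _).intervalIntegrable
    have e2 : M * (weightMass h * (1 / 4 * Real.log Z + invSumConst P + 1 / 4 * logMean σ) + 1 / 4 * weightLogMass h) =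
        ∫ y in (1 / 8 : ℝ)..(5 / 2), (h y * (M * (1 / 4 * Real.log Z + invSumConst P + 1 / 4 * logMean σ)) +
          h y * Real.log y * (M * (1 / 4))) := by
      rw [intervalIntegral.integral_add (hi2.mul_const _) (hi3.mul_const _), intervalIntegral.integral_mul_const,
        intervalIntegral.integral_mul_const, weightMass, weightLogMass]
      ring
    rw [e2, ← intervalIntegral.integral_sub hi1 ((hi2.mul_const _).add (hi3.mul_const _)), ← Real.norm_eq_abs]
    have := intervalIntegral.norm_integral_le_of_norm_le_const (a := 1 / 8) (b := 5 / 2)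
      (f := fun y => h y * T y - (h y * (M * (1 / 4 * Real.log Z + invSumConst P + 1 / 4 * logMean σ)) +
          h y * Real.log y * (M * (1 / 4)))) (C := C * (2 * 2 ^ P.card * G * Z ^ (-(1 / 8) : ℝ) * 2)) fun y hy => by
        rw [hI'] at hy
        have hy0 : 0 < y := by linarith [hy.1]
        have h1 := abs_tsum_sievedInv_cutoff_sub_le (P := P) hσ (mul_pos hZ hy0) hP
        rw [Real.log_mul hZ.ne' hy0.ne', Real.mul_rpow hZ.le hy0.le, ← hM, ← hG] at h1
        simp only [← div_div] at h1
        have e3 : h y * T y - (h y * (M * (1 / 4 * Real.log Z + invSumConst P + 1 / 4 * logMean σ)) +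
          h y * Real.log y * (M * (1 / 4))) = h y * (T y - M * (1 / 4 * (Real.log Z + Real.log y) + invSumConst P + 1 / 4 * logMean σ)) := by
          ring
        rw [e3, norm_mul]
        refine mul_le_mul (hC y) (h1.trans ?_) (norm_nonneg _) hC0.le
        -- Since y ≥ 1/8, the power is at most 8^{1/8} ≤ 8^{1/3} = 2.
        have h2 : y ^ (-(1 / 8) : ℝ) ≤ 2 := by
          calc y ^ (-(1 / 8) : ℝ) ≤ (1 / 8 : ℝ) ^ (-(1 / 8) : ℝ) :=
                Real.rpow_le_rpow_of_nonpos (by norm_num) hy.1.le (by norm_num)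
            _ ≤ (1 / 8 : ℝ) ^ (-(1 / 3) : ℝ) :=
                Real.rpow_le_rpow_of_exponent_ge (by norm_num) (by norm_num) (by norm_num)
            _ = 2 := by
                rw [show (1 / 8 : ℝ) = 2 ^ (-3 : ℝ) by norm_num, ← Real.rpow_mul (by norm_num)]; norm_num
        calc _ = 2 * 2 ^ P.card * G * Z ^ (-(1 / 8) : ℝ) * y ^ (-(1 / 8) : ℝ) := by ring
          _ ≤ _ := by gcongr
    refine this.trans (le_of_eq ?_)
    rw [show |(5 / 2 : ℝ) - 1 / 8| = 19 / 8 by norm_num [abs_of_pos]]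
    ring

end LMoment

end

/-! ### Collapsing the square terms to a single sum -/

noncomputable section
namespace LMoment
open Filter Topology Finset
open scoped Real NumberTheorySymbols

/-- The summand of the double sum over `e` and `n`. -/
def corePair (h : ℝ → ℝ) (σ : ℝ) (i : Fin 4) (m c : ℕ) (X Q : ℝ) (p : ℕ × ℕ) : ℝ :=
  if p.1.Coprime (2 * m) ∧ Odd p.2 then
    (psi i m p.2 : ℝ) * ((p.2 : ℝ) ^ (-(1 / 2) : ℝ) * weightedSum h σ m c X Q p.1 p.2) else 0

/-- The main term of `corePair`. -/
def mainPair (h : ℝ → ℝ) (σ : ℝ) (i : Fin 4) (m : ℕ) (X Q : ℝ) (p : ℕ × ℕ) : ℝ :=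
  if p.1.Coprime (2 * m) ∧ Odd p.2 then
    (psi i m p.2 : ℝ) * ((p.2 : ℝ) ^ (-(1 / 2) : ℝ) * weightedMain h σ m X Q p.1 p.2) else 0

theorem coprime_iff_forall_primeFactors {l r : ℕ} (hr : r ≠ 0) :
    l.Coprime r ↔ ∀ p ∈ r.primeFactors, ¬ p ∣ l := by
  constructor
  · intro h p hp hpl
    exact Nat.not_coprime_of_dvd_of_dvd (Nat.prime_of_mem_primeFactors hp).one_lt hpl (Nat.dvd_of_mem_primeFactors hp) h
  · intro h
    refine Nat.coprime_of_dvd fun p hp hpl hpr => h p (Nat.mem_primeFactors.2 ⟨hp, hpr, hr⟩) hpl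

theorem sqfree_sq (l : ℕ) : sqfree (l ^ 2) = 1 := by
  rw [sqfree, Nat.factorization_pow, Finsupp.prod]
  exact Finset.prod_eq_one fun p _ => by simp

theorem eq_sqRoot_sq {n : ℕ} (hn : n ≠ 0) (h : sqfree n = 1) : n = sqRoot n ^ 2 := by
  conv_lhs => rw [← sqfree_mul_sqRoot_sq hn, h, one_mul]

theorem psi_sq_eq_one (i : Fin 4) {m l : ℕ} (hl : l.Coprime (2 * m)) : psi i m ((l ^ 2 : ℕ) : ℤ) = 1 := by
  have h2 : Odd l := Nat.coprime_two_right.1 (hl.coprime_dvd_right (dvd_mul_right _ _))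
  have hm : l.Coprime m := hl.coprime_dvd_right (dvd_mul_left _ _)
  have he : eta i l * eta i l = 1 := by
    have h8 : (l : ZMod 8) = 1 ∨ (l : ZMod 8) = 3 ∨ (l : ZMod 8) = 5 ∨ (l : ZMod 8) = 7 := by
      have : l % 8 = 1 ∨ l % 8 = 3 ∨ l % 8 = 5 ∨ l % 8 = 7 := by
        have := Nat.odd_iff.1 h2; omega
      rw [← Nat.mod_add_div l 8]
      push_cast
      rw [show (8 : ZMod 8) = 0 from rfl, zero_mul, add_zero]
      rcases this with h | h | h | h <;> rw [h] <;> simp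
    have h4 : (l : ZMod 4) = 1 ∨ (l : ZMod 4) = 3 := by
      have : l % 4 = 1 ∨ l % 4 = 3 := Nat.odd_mod_four_iff.1 (Nat.odd_iff.1 h2)
      rw [← Nat.mod_add_div l 4]
      push_cast
      rw [show (4 : ZMod 4) = 0 from rfl, zero_mul, add_zero]
      rcases this with h | h <;> rw [h] <;> simp
    fin_cases i
    · rfl
    · change ZMod.χ₄ ((l : ℤ) : ZMod 4) * ZMod.χ₄ ((l : ℤ) : ZMod 4) = 1
      rw [Int.cast_natCast]
      rcases h4 with h | h <;> rw [h] <;> decide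
    · change ZMod.χ₈ ((l : ℤ) : ZMod 8) * ZMod.χ₈ ((l : ℤ) : ZMod 8) = 1
      rw [Int.cast_natCast]
      rcases h8 with h | h | h | h <;> rw [h] <;> decide
    · change ZMod.χ₈' ((l : ℤ) : ZMod 8) * ZMod.χ₈' ((l : ℤ) : ZMod 8) = 1
      rw [Int.cast_natCast]
      rcases h8 with h | h | h | h <;> rw [h] <;> decide
  rw [Nat.cast_pow, pow_two, psi_mul, psi]
  have hj := jacobiSym.sq_one (a := (l : ℤ)) (b := m) (by rw [Int.gcd_natCast_natCast]; exact hm)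
  calc eta i l * J((l : ℤ) | m) * (eta i l * J((l : ℤ) | m)) = (eta i l * eta i l) * J((l : ℤ) | m) ^ 2 := by ring
    _ = 1 := by rw [he, hj, one_mul]

theorem psi_eq_zero (i : Fin 4) {m l : ℕ} (hm : m ≠ 0) (hl : ¬ l.Coprime m) : psi i m l = 0 := by
  have : NeZero m := ⟨hm⟩
  rw [psi, jacobiSym.eq_zero_iff_not_coprime.2 (by rwa [Int.gcd_natCast_natCast]), mul_zero]

/-- Gauss's identity ∑_{l ∣ L} φ(l) = L. It merges the sums over e and l into one harmonic sum over
L = el. -/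
theorem sum_totient_div (L : ℕ) (hL : L ≠ 0) :
    ∑ p ∈ L.divisorsAntidiagonal, (p.2.totient : ℝ) / ((p.2 : ℝ) ^ 2 * (p.1 : ℝ) ^ 2) = 1 / L := by
  have hL0 : (L : ℝ) ≠ 0 := by exact_mod_cast hL
  have h1 : ∀ p ∈ L.divisorsAntidiagonal, (p.2.totient : ℝ) / ((p.2 : ℝ) ^ 2 * (p.1 : ℝ) ^ 2) = p.2.totient / (L : ℝ) ^ 2 := by
    intro p hp
    have := (Nat.mem_divisorsAntidiagonal.1 hp).1
    rw [← mul_pow, ← this]; push_cast; ring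
  rw [Finset.sum_congr rfl h1, ← Finset.sum_div, Nat.sum_divisorsAntidiagonal' (f := fun _ y => (y.totient : ℝ)),
    ← Nat.cast_sum, Nat.sum_totient]
  field_simp

theorem weightIntegral_nonneg {h : ℝ → ℝ} (hh : IsSmoothWeight h) {σ z : ℝ} (hσ : 0 < σ) (hz : 0 ≤ z) :
    0 ≤ weightIntegral h σ z :=
  intervalIntegral.integral_nonneg (by norm_num) fun y hy =>
    mul_nonneg (hh.nonneg y) (cutoff_nonneg hσ (div_nonneg hz (by linarith [hy.1])))

/-- For n = l² the factor n^{-1/2} = 1/l and the density ∏_{p ∣ l}(1 - 1/p) of k prime to l combine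
to φ(l)/l². The value ψ(l²) is 1 for l prime to 2m; an odd l not prime to m gives 0 and an even l is
excluded. Since n²e⁴ = L⁴, the cutoff depends only on L. -/
theorem mainPair_sq {h : ℝ → ℝ} {σ X Q : ℝ} (i : Fin 4) {m e l L : ℕ} (hm : Odd m) (hel : e * l = L) (hL : L ≠ 0) :
    mainPair h σ i m X Q (e, l ^ 2) = (X / 8 * (∏ p ∈ m.primeFactors, (1 - 1 / (p : ℝ)))) *
      ((if ∀ p ∈ (2 * m).primeFactors, ¬ p ∣ L then weightIntegral h σ (L ^ 4 / (X * Q)) else 0) *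
        ((l.totient : ℝ) / ((l : ℝ) ^ 2 * (e : ℝ) ^ 2))) := by
  have hm0 : m ≠ 0 := hm.pos.ne'
  have h2m : 2 * m ≠ 0 := by omega
  have he0 : e ≠ 0 := by rintro rfl; simp at hel; exact hL hel.symm
  have hl0 : l ≠ 0 := by rintro rfl; simp at hel; exact hL hel.symm
  have hlr : (0 : ℝ) < l := Nat.cast_pos.2 (Nat.pos_of_ne_zero hl0)
  have her : (0 : ℝ) < e := Nat.cast_pos.2 (Nat.pos_of_ne_zero he0)
  have hcop : (∀ p ∈ (2 * m).primeFactors, ¬ p ∣ L) ↔ e.Coprime (2 * m) ∧ l.Coprime (2 * m) := by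
    rw [← coprime_iff_forall_primeFactors h2m, ← hel, Nat.coprime_mul_iff_left]
  subst hel
  rw [mainPair]
  simp only [hcop]
  by_cases he : e.Coprime (2 * m)
  swap
  · simp [he]
  by_cases hl : l.Coprime (2 * m)
  · have hodd : Odd l := Nat.coprime_two_right.1 (hl.coprime_dvd_right (dvd_mul_right _ _))
    have hlm : l.Coprime m := hl.coprime_dvd_right (dvd_mul_left _ _)
    rw [if_pos ⟨he, hodd.pow⟩, if_pos ⟨he, hl⟩, psi_sq_eq_one i hl, weightedMain, if_pos (sqfree_sq l),
      Nat.Coprime.primeFactors_mul (Nat.Coprime.pow_right 2 hlm.symm),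
      Finset.prod_union (Nat.Coprime.pow_right 2 hlm.symm).disjoint_primeFactors, Nat.primeFactors_pow _ (by norm_num)]
    have ht : (l.totient : ℝ) = l * ∏ p ∈ l.primeFactors, (1 - 1 / (p : ℝ)) := by
      have := congrArg (fun q : ℚ => (q : ℝ)) (Nat.totient_eq_mul_prod_factors l)
      push_cast at this
      simpa only [one_div] using this
    have hs : ((l ^ 2 : ℕ) : ℝ) ^ (-(1 / 2) : ℝ) = 1 / l := by
      push_cast
      rw [← Real.rpow_natCast, ← Real.rpow_mul hlr.le]
      norm_num
      rw [Real.rpow_neg_one]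
    have hz : (((l ^ 2 : ℕ) : ℝ)) ^ 2 * (e : ℝ) ^ 4 / (X * Q) = ((e * l : ℕ) : ℝ) ^ 4 / (X * Q) := by push_cast; ring
    rw [ht, hs, hz]
    field_simp
    push_cast
    ring
  · rw [if_neg (fun hc : e.Coprime (2 * m) ∧ l.Coprime (2 * m) => hl hc.2), zero_mul, mul_zero]
    split_ifs with hc
    · have hodd : Odd l := by
        have := hc.2
        rwa [Nat.odd_pow_iff (by norm_num)] at this
      have hlm : ¬ l.Coprime m := fun h => hl (Nat.Coprime.mul_right (Nat.coprime_two_right.2 hodd) h)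
      rw [Nat.cast_pow, pow_two, psi_mul, psi_eq_zero i hm0 hlm]
      simp
    · rfl

/-- The pairs (e, n) with n not a square contribute nothing; the others are fibred over L = e√n. All
terms are non-negative, so summing along the fibres is legitimate. -/
theorem exists_hasSum_mainPair {h : ℝ → ℝ} (hh : IsSmoothWeight h) {σ : ℝ} (hσ : 1 / 8 < σ) :
    ∃ K : ℝ, 0 < K ∧ ∀ (i : Fin 4) (m : ℕ) (X Q : ℝ), Odd m → 0 < X → 0 < Q →
      ∃ V : ℝ, HasSum (mainPair h σ i m X Q) V ∧
        |V - X / 8 * (∏ p ∈ m.primeFactors, (1 - 1 / (p : ℝ))) * ((∏ p ∈ (2 * m).primeFactors, (1 - 1 / (p : ℝ))) *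
          (weightMass h * (1 / 4 * Real.log (X * Q) + invSumConst (2 * m).primeFactors + 1 / 4 * logMean σ) +
            1 / 4 * weightLogMass h))| ≤ K * 2 ^ (2 * m).primeFactors.card * X * (X * Q) ^ (-(1 / 8) : ℝ) := by
  have hσ0 : 0 < σ := by linarith
  obtain ⟨K, hK, H⟩ := hasSum_sievedInv_weightIntegral hh hσ
  refine ⟨K, hK, fun i m X Q hm hX hQ => ?_⟩
  obtain ⟨V, hV, hVle⟩ := H (2 * m).primeFactors (X * Q) (fun q hq => Nat.prime_of_mem_primeFactors hq) (by positivity)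
  have hP := prod_one_sub_inv_mem m.primeFactors
  set R := ∏ p ∈ m.primeFactors, (1 - 1 / (p : ℝ)) with hR
  refine ⟨X / 8 * R * V, ?_, ?_⟩
  · set g : (Σ L : ℕ, {p : ℕ × ℕ // p ∈ L.divisorsAntidiagonal}) → ℕ × ℕ := fun x => (x.2.1.1, x.2.1.2 ^ 2) with hg
    have hginj : Function.Injective g := by
      rintro ⟨L, ⟨⟨a, b⟩, hab⟩⟩ ⟨L', ⟨⟨a', b'⟩, hab'⟩⟩ hxy
      simp only [hg, Prod.mk.injEq] at hxy
      obtain ⟨rfl, h2⟩ := hxy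
      have h3 : b = b' := Nat.pow_left_injective (by norm_num) h2
      subst h3
      have h4 := (Nat.mem_divisorsAntidiagonal.1 hab).1
      have h5 := (Nat.mem_divisorsAntidiagonal.1 hab').1
      simp only at h4 h5
      subst h4; subst h5
      rfl
    have hrange : ∀ p ∉ Set.range g, mainPair h σ i m X Q p = 0 := by
      rintro ⟨e, n⟩ hp
      rw [mainPair]
      split_ifs with hc
      · simp only at hc ⊢
        rw [weightedMain]
        split_ifs with hs
        · exfalso
          refine hp ⟨⟨e * sqRoot n, ⟨(e, sqRoot n), ?_⟩⟩, ?_⟩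
          · refine Nat.mem_divisorsAntidiagonal.2 ⟨rfl, Nat.mul_ne_zero ?_ (sqRoot_pos n).ne'⟩
            rintro rfl
            have := hc.1
            rw [Nat.coprime_zero_left] at this
            omega
          · simp only [hg]
            rw [← eq_sqRoot_sq hc.2.pos.ne' hs]
        · simp
      · rfl
    rw [← hginj.hasSum_iff hrange]
    have hterm : ∀ (L : ℕ) (p : {p : ℕ × ℕ // p ∈ L.divisorsAntidiagonal}), (mainPair h σ i m X Q ∘ g) ⟨L, p⟩ =
        (X / 8 * R) * ((if ∀ p ∈ (2 * m).primeFactors, ¬ p ∣ L then weightIntegral h σ (L ^ 4 / (X * Q)) else 0) *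
        ((p.1.2.totient : ℝ) / ((p.1.2 : ℝ) ^ 2 * (p.1.1 : ℝ) ^ 2))) := by
      rintro L ⟨⟨e, l⟩, hp⟩
      obtain ⟨h1, h2⟩ := Nat.mem_divisorsAntidiagonal.1 hp
      exact mainPair_sq i hm h1 h2
    have hfib : ∀ L : ℕ, HasSum (fun p : {p : ℕ × ℕ // p ∈ L.divisorsAntidiagonal} => (mainPair h σ i m X Q ∘ g) ⟨L, p⟩)
        (X / 8 * R * (sievedInv (2 * m).primeFactors L * weightIntegral h σ (L ^ 4 / (X * Q)))) := by
      intro L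
      simp only [hterm]
      have h1 := hasSum_fintype (fun p : {p : ℕ × ℕ // p ∈ L.divisorsAntidiagonal} =>
        (X / 8 * R) * ((if ∀ p ∈ (2 * m).primeFactors, ¬ p ∣ L then weightIntegral h σ (L ^ 4 / (X * Q)) else 0) *
        ((p.1.2.totient : ℝ) / ((p.1.2 : ℝ) ^ 2 * (p.1.1 : ℝ) ^ 2))))
      convert! h1 using 1
      rw [← Finset.mul_sum, ← Finset.mul_sum,
        Finset.sum_coe_sort L.divisorsAntidiagonal (fun p : ℕ × ℕ => (p.2.totient : ℝ) / ((p.2 : ℝ) ^ 2 * (p.1 : ℝ) ^ 2))]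
      rcases Nat.eq_zero_or_pos L with rfl | hL
      · simp [sievedInv_zero]
      · rw [sum_totient_div L hL.ne', sievedInv]
        split_ifs <;> ring
    have hnonneg : ∀ x, 0 ≤ (mainPair h σ i m X Q ∘ g) x := by
      rintro ⟨L, p⟩
      rw [hterm]
      have hW := weightIntegral_nonneg hh hσ0 (show 0 ≤ (L : ℝ) ^ 4 / (X * Q) by positivity)
      have := hP.1
      refine mul_nonneg (by positivity) (mul_nonneg ?_ (by positivity))
      split_ifs
      · exact hW
      · exact le_rfl
    refine HasSum.sigma_of_hasSum (hV.mul_left (X / 8 * R)) hfib ?_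
    rw [summable_sigma_of_nonneg hnonneg]
    refine ⟨fun L => (hfib L).summable, ?_⟩
    simp only [fun L => (hfib L).tsum_eq]
    exact (hV.mul_left (X / 8 * R)).summable
  · rw [← mul_sub, abs_mul, abs_of_nonneg (mul_nonneg (by positivity) hP.1)]
    have hB : 0 ≤ K * 2 ^ (2 * m).primeFactors.card * (X * Q) ^ (-(1 / 8) : ℝ) := by positivity
    calc X / 8 * R * |_| ≤ X / 8 * R * (K * 2 ^ (2 * m).primeFactors.card * (X * Q) ^ (-(1 / 8) : ℝ)) :=
          mul_le_mul_of_nonneg_left hVle (mul_nonneg (by positivity) hP.1)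
      _ ≤ X * (K * 2 ^ (2 * m).primeFactors.card * (X * Q) ^ (-(1 / 8) : ℝ)) := by
          refine mul_le_mul_of_nonneg_right ?_ hB
          nlinarith [hP.2, hP.1]
      _ = _ := by ring

end LMoment

end

/-! ### The double sum over e and n, and the substitution d = ke² -/

noncomputable section
namespace LMoment
open Filter Topology Finset
open scoped Real NumberTheorySymbols

/-- Any exponent above 1/4 would give convergence; 3/8 is small enough for the O(√X) exceptional
squares to total X^{7/8}. -/
theorem oddSum_spec {σ : ℝ} (hσ : 0 < σ) : ∃ K : ℝ, 0 < K ∧ ∀ (i : Fin 4) (m k : ℕ) (y : ℝ), 0 < y →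
    (Summable fun n : ℕ => if Odd n then
      ((J((k : ℤ) | n) * psi i m n : ℤ) : ℝ) * ((n : ℝ) ^ (-(1 / 2) : ℝ) * cutoff σ (n ^ 2 * y)) else 0) ∧
    |oddSum σ i m k y| ≤ K * y ^ (-(3 / 8) : ℝ) := by
  have hG := piGamma_pos hσ
  have hG1 := piGamma_pos (show 0 < σ + 3 / 8 by linarith)
  have hz : 0 ≤ ∑' n : ℕ, (n : ℝ) ^ (-(1 / 2) - 2 * (3 / 8) : ℝ) := tsum_nonneg fun n => by positivity
  refine ⟨piGamma (σ + 3 / 8) / piGamma σ * (∑' n : ℕ, (n : ℝ) ^ (-(1 / 2) - 2 * (3 / 8) : ℝ)) + 1, by positivity,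
    fun i m k y hy => ?_⟩
  set c : ℕ → ℝ := fun n => if Odd n then ((J((k : ℤ) | n) * psi i m n : ℤ) : ℝ) else 0 with hc
  have hc1 : ∀ n, |c n| ≤ 1 := by
    intro n
    simp only [hc]
    split_ifs
    · rw [← Int.cast_abs, abs_mul]
      exact_mod_cast mul_le_one₀ (jacobiSym_abs_le_one _ _) (abs_nonneg _) (psi_abs_le_one i m n)
    · simp
  have hc0 : c 0 = 0 := by simp [hc]
  obtain ⟨h1, h2⟩ := summable_cutoff_series hc1 hc0 hσ (show (1 / 4 : ℝ) < 3 / 8 by norm_num) hy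
  have hterm : ∀ n : ℕ, (if Odd n then ((J((k : ℤ) | n) * psi i m n : ℤ) : ℝ) * ((n : ℝ) ^ (-(1 / 2) : ℝ) * cutoff σ (n ^ 2 * y)) else 0) =
      c n * ((n : ℝ) ^ (-(1 / 2) : ℝ) * cutoff σ (n ^ 2 * y)) := by
    intro n
    simp only [hc]
    split_ifs <;> ring
  have hnorm : ∀ n : ℕ, ‖c n * ((n : ℝ) ^ (-(1 / 2) : ℝ) * cutoff σ (n ^ 2 * y))‖ =
      |c n| * ((n : ℝ) ^ (-(1 / 2) : ℝ) * cutoff σ (n ^ 2 * y)) := by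
    intro n
    have := cutoff_nonneg hσ (show 0 ≤ (n : ℝ) ^ 2 * y by positivity)
    rw [norm_mul, Real.norm_eq_abs, Real.norm_of_nonneg (by positivity)]
  have hs : Summable fun n : ℕ => ‖c n * ((n : ℝ) ^ (-(1 / 2) : ℝ) * cutoff σ (n ^ 2 * y))‖ := by
    simpa only [hnorm] using h1
  simp only [oddSum, hterm]
  refine ⟨hs.of_norm, ?_⟩
  rw [← Real.norm_eq_abs]
  refine (norm_tsum_le_tsum_norm hs).trans ?_
  simp only [hnorm]
  refine h2.trans ?_
  have : 0 ≤ y ^ (-(3 / 8) : ℝ) := by positivity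
  nlinarith

/-- The asymptotic value of the sum of `corePair` over all pairs. -/
def pairMain (h : ℝ → ℝ) (σ : ℝ) (m : ℕ) (X Q : ℝ) : ℝ :=
  X / 8 * (∏ p ∈ m.primeFactors, (1 - 1 / (p : ℝ))) * ((∏ p ∈ (2 * m).primeFactors, (1 - 1 / (p : ℝ))) *
    (weightMass h * (1 / 4 * Real.log (X * Q) + invSumConst (2 * m).primeFactors + 1 / 4 * logMean σ) +
      1 / 4 * weightLogMass h))

/-- The deviation from the main term is bounded by a product of convergent series in e and n.
Summability of the whole follows from that of the deviation and that of the main term. -/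
theorem exists_tsum_corePair_sub_le {h : ℝ → ℝ} (hh : IsSmoothWeight h) {σ ε : ℝ} (hσ : 1 / 8 < σ) (hε : 0 < ε) :
    ∃ K : ℝ, 0 < K ∧ ∀ (i : Fin 4) (m c : ℕ) (X Q : ℝ), Odd m → 0 < X → 0 < Q →
      Summable (corePair h σ i m c X Q) ∧
      |∑' p, corePair h σ i m c X Q p - pairMain h σ m X Q| ≤
        K * 2 ^ (2 * m).primeFactors.card * (√X * (X * Q) ^ (3 / 8 + ε) + X * (X * Q) ^ (-(1 / 8) : ℝ)) := by
  have hσ0 : 0 < σ := by linarith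
  obtain ⟨K₁, hK₁, H₁⟩ := exists_weightedSum_error hh hσ0 hε
  obtain ⟨K₂, hK₂, H₂⟩ := exists_hasSum_mainPair hh hσ
  have hs1 : Summable fun e : ℕ => (e : ℝ) ^ (-2 : ℝ) := Real.summable_nat_rpow.2 (by norm_num)
  have hs2 : Summable fun n : ℕ => (n : ℝ) ^ (-1 - ε) := Real.summable_nat_rpow.2 (by linarith)
  have hs : Summable fun p : ℕ × ℕ => (p.1 : ℝ) ^ (-2 : ℝ) * (p.2 : ℝ) ^ (-1 - ε) :=
    hs1.mul_of_nonneg hs2 (fun _ => by positivity) fun _ => by positivity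
  set Z := ∑' p : ℕ × ℕ, (p.1 : ℝ) ^ (-2 : ℝ) * (p.2 : ℝ) ^ (-1 - ε) with hZ
  have hZ0 : 0 ≤ Z := tsum_nonneg fun p => by positivity
  refine ⟨K₁ * Z + K₂, by positivity, fun i m c X Q hm hX hQ => ?_⟩
  obtain ⟨V, hV, hVle⟩ := H₂ i m X Q hm hX hQ
  set B := K₁ * (2 ^ m.primeFactors.card * √X * (X * Q) ^ (3 / 8 + ε)) with hB
  have hB0 : 0 ≤ B := by positivity
  have hle : ∀ p : ℕ × ℕ, ‖corePair h σ i m c X Q p - mainPair h σ i m X Q p‖ ≤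
      B * ((p.1 : ℝ) ^ (-2 : ℝ) * (p.2 : ℝ) ^ (-1 - ε)) := by
    rintro ⟨e, n⟩
    rw [corePair, mainPair]
    simp only
    split_ifs with hc
    · have he : 0 < e := Nat.pos_of_ne_zero (by
        rintro rfl
        have := hc.1
        rw [Nat.coprime_zero_left] at this
        omega)
      rw [← mul_sub, ← mul_sub, norm_mul, norm_mul, Real.norm_of_nonneg (show 0 ≤ (n : ℝ) ^ (-(1 / 2) : ℝ) by positivity),
        mul_comm ((e : ℝ) ^ (-2 : ℝ))]
      have hψ : ‖(psi i m n : ℝ)‖ ≤ 1 := by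
        rw [Real.norm_eq_abs, ← Int.cast_abs]; exact_mod_cast psi_abs_le_one i m n
      exact (mul_le_of_le_one_left (by positivity) hψ).trans (H₁ m n e c X Q hm hc.2 he hX hQ)
    · rw [sub_zero, norm_zero]; positivity
  have hsd : Summable fun p => corePair h σ i m c X Q p - mainPair h σ i m X Q p :=
    Summable.of_norm_bounded (hs.mul_left B) hle
  have hsc : Summable (corePair h σ i m c X Q) := by
    refine (hsd.add hV.summable).congr fun p => ?_
    ring
  refine ⟨hsc, ?_⟩
  have e1 : ∑' p, corePair h σ i m c X Q p - V = ∑' p, (corePair h σ i m c X Q p - mainPair h σ i m X Q p) := by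
    rw [hsc.tsum_sub hV.summable, hV.tsum_eq]
  have e2 : |∑' p, corePair h σ i m c X Q p - V| ≤ B * Z := by
    rw [e1, ← Real.norm_eq_abs, hZ, ← tsum_mul_left]
    exact tsum_of_norm_bounded (hs.mul_left B).hasSum hle
  have hcard : (2 : ℝ) ^ m.primeFactors.card ≤ 2 ^ (2 * m).primeFactors.card :=
    pow_le_pow_right₀ (by norm_num) (Finset.card_le_card (Nat.primeFactors_mono (dvd_mul_left _ _) (by have := hm.pos; omega)))
  have e3 : B * Z ≤ K₁ * Z * 2 ^ (2 * m).primeFactors.card * (√X * (X * Q) ^ (3 / 8 + ε)) := by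
    calc B * Z = K₁ * Z * 2 ^ m.primeFactors.card * (√X * (X * Q) ^ (3 / 8 + ε)) := by rw [hB]; ring
      _ ≤ _ := by gcongr
  rw [pairMain]
  refine (abs_sub_le _ V _).trans ?_
  refine (add_le_add (e2.trans e3) hVle).trans ?_
  have t1 : 0 ≤ 2 ^ (2 * m).primeFactors.card * (√X * (X * Q) ^ (3 / 8 + ε)) := by positivity
  have t2 : 0 ≤ 2 ^ (2 * m).primeFactors.card * (X * (X * Q) ^ (-(1 / 8) : ℝ)) := by positivity
  nlinarith [mul_nonneg hK₂.le t1, mul_nonneg (mul_nonneg hK₁.le hZ0) t2]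

theorem weightedSum_eq_zero {h : ℝ → ℝ} (hh : IsSmoothWeight h) {σ X Q : ℝ} {m c e n : ℕ} (hc : Odd c) (hX : 0 < X)
    (he : ⌊2 * X⌋₊ + 1 ≤ e) : weightedSum h σ m c X Q e n = 0 := by
  refine Finset.sum_eq_zero fun k _ => ?_
  split_ifs with hk
  · have hk1 : 1 ≤ k := by have := Nat.odd_iff.1 hc; omega
    have he2 : 2 * X < e := (Nat.lt_floor_add_one _).trans_le (by exact_mod_cast he)
    have he1 : (1 : ℝ) ≤ e := by exact_mod_cast (Nat.le_add_left 1 _).trans he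
    have hk1' : (1 : ℝ) ≤ k := by exact_mod_cast hk1
    rw [hh.eq_zero (Or.inr ?_)]
    · ring
    · rw [lt_div_iff₀ hX]
      nlinarith [mul_le_mul hk1' (show (e : ℝ) ≤ e ^ 2 by nlinarith) (by positivity) (by positivity)]
  · rfl

/-- The support of h leaves finitely many e and k, so the sum over n can be moved inside. -/
theorem tsum_corePair {h : ℝ → ℝ} (hh : IsSmoothWeight h) {σ X Q : ℝ} (hσ : 0 < σ) (i : Fin 4) {m c : ℕ} (hc : Odd c)
    (hX : 0 < X) (hQ : 0 < Q) (hs : Summable (corePair h σ i m c X Q)) :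
    ∑' p, corePair h σ i m c X Q p = ∑ e ∈ Finset.range (⌊2 * X⌋₊ + 1), if e.Coprime (2 * m) then
      ∑ k ∈ Finset.range (⌊2 * X⌋₊ + 1), (if k % 8 = c % 8 ∧ k.Coprime m then
        h (k * e ^ 2 / X) * oddSum σ i m k (e ^ 2 / (k * Q)) else 0) else 0 := by
  obtain ⟨_, _, hodd⟩ := oddSum_spec hσ
  rw [hs.tsum_prod, tsum_eq_sum (s := Finset.range (⌊2 * X⌋₊ + 1))]
  · refine Finset.sum_congr rfl fun e _ => ?_
    by_cases he : e.Coprime (2 * m)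
    · rw [if_pos he]
      have he0 : 0 < e := Nat.pos_of_ne_zero (by
        rintro rfl
        rw [Nat.coprime_zero_left] at he
        omega)
      have hsum : ∀ k ∈ Finset.range (⌊2 * X⌋₊ + 1), HasSum (fun n : ℕ => if k % 8 = c % 8 ∧ k.Coprime m then
          h (k * e ^ 2 / X) * (if Odd n then ((J((k : ℤ) | n) * psi i m n : ℤ) : ℝ) *
            ((n : ℝ) ^ (-(1 / 2) : ℝ) * cutoff σ (n ^ 2 * (e ^ 2 / (k * Q)))) else 0) else 0)
          (if k % 8 = c % 8 ∧ k.Coprime m then h (k * e ^ 2 / X) * oddSum σ i m k (e ^ 2 / (k * Q)) else 0) := by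
        intro k _
        split_ifs with hk
        · have hk1 : 1 ≤ k := by have := Nat.odd_iff.1 hc; omega
          have hk0 : (0 : ℝ) < k := by exact_mod_cast hk1
          exact (hodd i m k (e ^ 2 / (k * Q)) (by positivity)).1.hasSum.mul_left _
        · exact hasSum_zero
      rw [← (hasSum_sum hsum).tsum_eq]
      refine tsum_congr fun n => ?_
      rw [corePair]
      by_cases hn : Odd n
      · rw [if_pos ⟨he, hn⟩, weightedSum, mul_sum, mul_sum]
        simp only [if_pos hn]
        refine Finset.sum_congr rfl fun k _ => ?_
        split_ifs
        · rw [mul_div_assoc ((n : ℝ) ^ 2)]; push_cast; ring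
        · ring
      · rw [if_neg fun hc => hn hc.2]
        simp only [if_neg hn, mul_zero, ite_self]
        exact Finset.sum_const_zero.symm
    · rw [if_neg he]
      simp [corePair, he]
  · intro e he
    rw [Finset.mem_range, not_lt] at he
    have : ∀ n, corePair h σ i m c X Q (e, n) = 0 := by
      intro n
      rw [corePair]
      simp only [weightedSum_eq_zero hh hc hX he, mul_zero, ite_self]
    simp [this]

theorem dvd_sqRoot_iff {d e : ℕ} (hd : d ≠ 0) : e ∣ sqRoot d ↔ e ^ 2 ∣ d := by
  constructor
  · intro h
    rw [← sqfree_mul_sqRoot_sq hd]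
    exact (pow_dvd_pow_of_dvd h 2).mul_left _
  · intro h
    have he0 : e ≠ 0 := by rintro rfl; simp at h; exact hd h
    have hfac : ∀ p, (sqRoot d).factorization p = d.factorization p / 2 := by
      have h1 : (sqRoot d).factorization = d.factorization.mapRange (fun k => k / 2) rfl := by
        have h2 : sqRoot d = (d.factorization.mapRange (fun k => k / 2) rfl).prod (fun p k => p ^ k) := by
          rw [sqRoot, Finsupp.prod_mapRange_index (by simp)]
        rw [h2]
        refine Nat.prod_pow_factorization_eq_self fun p hp => ?_
        have := Finsupp.support_mapRange hp
        exact Nat.prime_of_mem_primeFactors this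
      intro p; rw [h1, Finsupp.mapRange_apply]
    rw [← Nat.factorization_le_iff_dvd he0 (sqRoot_pos d).ne']
    have h3 := (Nat.factorization_le_iff_dvd (pow_ne_zero 2 he0) hd).2 h
    intro p
    have h4 := h3 p
    rw [Nat.factorization_pow, Finsupp.smul_apply, smul_eq_mul] at h4
    rw [hfac]
    omega

/-- The bijection d ↔ (k, e) with d = ke². For odd e, d and k lie in the same class modulo 8; e is
prime to 2m because d is. -/
theorem sum_divisors_sqRoot_eq {h : ℝ → ℝ} (hh : IsSmoothWeight h) {X : ℝ} (hX : 0 < X) {m c : ℕ} (hc : Odd c)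
    (f : ℕ → ℕ → ℝ) :
    ∑ d ∈ Finset.range (⌊2 * X⌋₊ + 1), (if d % 8 = c % 8 ∧ d.Coprime m then
      h (d / X) * ∑ e ∈ (sqRoot d).divisors, f (d / e ^ 2) e else 0) =
    ∑ e ∈ Finset.range (⌊2 * X⌋₊ + 1), if e.Coprime (2 * m) then
      ∑ k ∈ Finset.range (⌊2 * X⌋₊ + 1), (if k % 8 = c % 8 ∧ k.Coprime m then h (k * e ^ 2 / X) * f k e else 0) else 0 := by
  set B := ⌊2 * X⌋₊ + 1 with hB
  have hpos : ∀ k : ℕ, k % 8 = c % 8 → 0 < k := fun k hk => by have := Nat.odd_iff.1 hc; omega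
  have step1 : ∀ d ∈ Finset.range B, (if d % 8 = c % 8 ∧ d.Coprime m then
      h (d / X) * ∑ e ∈ (sqRoot d).divisors, f (d / e ^ 2) e else 0) =
      ∑ e ∈ Finset.range B, if (d % 8 = c % 8 ∧ d.Coprime m) ∧ e ^ 2 ∣ d then h (d / X) * f (d / e ^ 2) e else 0 := by
    intro d hd
    by_cases hcd : d % 8 = c % 8 ∧ d.Coprime m
    · have hd0 := hpos d hcd.1
      rw [if_pos hcd, mul_sum]
      simp only [eq_true hcd, true_and]
      rw [← Finset.sum_filter]
      refine Finset.sum_congr ?_ fun _ _ => rfl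
      ext e
      rw [Nat.mem_divisors, dvd_sqRoot_iff hd0.ne', Finset.mem_filter, Finset.mem_range]
      constructor
      · rintro ⟨h1, _⟩
        refine ⟨?_, h1⟩
        have h2 := Nat.le_of_dvd hd0 h1
        have h3 : e ≤ e ^ 2 := Nat.le_self_pow (by norm_num) e
        have := Finset.mem_range.1 hd
        omega
      · rintro ⟨_, h1⟩
        exact ⟨h1, (sqRoot_pos d).ne'⟩
    · rw [if_neg hcd]
      exact (Finset.sum_eq_zero fun e _ => if_neg fun hx => hcd hx.1).symm
  rw [Finset.sum_congr rfl step1, Finset.sum_comm]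
  refine Finset.sum_congr rfl fun e _ => ?_
  by_cases he : e.Coprime (2 * m)
  · rw [if_pos he]
    have hodd : Odd e := Nat.coprime_two_right.1 (he.coprime_dvd_right (dvd_mul_right _ _))
    have hem : e.Coprime m := he.coprime_dvd_right (dvd_mul_left _ _)
    have he2 : 0 < e ^ 2 := pow_pos hodd.pos 2
    have hmod : ∀ k, (k * e ^ 2) % 8 = k % 8 := fun k => by
      rw [Nat.mul_mod, odd_sq_mod_eight hodd]; omega
    have hcop : ∀ k, (k * e ^ 2).Coprime m ↔ k.Coprime m := fun k => by
      rw [Nat.coprime_mul_iff_left]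
      exact and_iff_left (hem.pow_left 2)
    rw [← Finset.sum_filter, ← Finset.sum_filter]
    symm
    rw [← Finset.sum_filter_of_ne (p := fun k => k * e ^ 2 < B)]
    · rw [Finset.filter_filter]
      refine Finset.sum_nbij' (fun k => k * e ^ 2) (fun d => d / e ^ 2) ?_ ?_ ?_ ?_ ?_
      · intro k hk
        simp only [Finset.mem_filter, Finset.mem_range] at hk ⊢
        exact ⟨hk.2.2, ⟨by rw [hmod]; exact hk.2.1.1, (hcop k).2 hk.2.1.2⟩, dvd_mul_left _ _⟩
      · intro d hd
        simp only [Finset.mem_filter, Finset.mem_range] at hd ⊢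
        obtain ⟨h1, ⟨h2, h3⟩, k, rfl⟩ := hd
        rw [mul_comm] at h1 h2 h3
        rw [Nat.mul_div_cancel_left _ he2]
        rw [hmod] at h2
        refine ⟨lt_of_le_of_lt (Nat.le_mul_of_pos_right k he2) h1, ⟨h2, (hcop k).1 h3⟩, h1⟩
      · intro k _
        exact Nat.mul_div_cancel _ he2
      · intro d hd
        simp only [Finset.mem_filter] at hd
        exact Nat.div_mul_cancel hd.2.2
      · intro k _
        rw [Nat.mul_div_cancel _ he2]
        push_cast
        rfl
    · intro k hk hne
      by_contra hlt
      rw [not_lt, hB] at hlt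
      apply hne
      have h1 : 2 * X < (k * e ^ 2 : ℕ) := (Nat.lt_floor_add_one _).trans_le (by exact_mod_cast hlt)
      rw [hh.eq_zero (Or.inr ?_), zero_mul]
      rw [lt_div_iff₀ hX]
      push_cast at h1
      linarith
  · rw [if_neg he]
    refine Finset.sum_eq_zero fun d _ => if_neg ?_
    rintro ⟨⟨h1, h2⟩, h3⟩
    apply he
    have hd : Odd d := by rw [Nat.odd_iff] at hc ⊢; omega
    have h4 : d.Coprime (2 * m) := Nat.Coprime.mul_right (Nat.coprime_two_right.2 hd) h2
    exact h4.coprime_dvd_left ((dvd_pow_self e (by norm_num)).trans h3)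

end LMoment

end

/-! ### The moment over one class modulo 8 -/

noncomputable section
namespace LMoment
open Filter Topology Finset
open scoped Real NumberTheorySymbols

theorem abs_twoFactor_le (i : Fin 4) (m c : ℕ) : |twoFactor i m c| ≤ 1 / √2 := by
  rw [twoFactor, abs_div, abs_of_pos (show (0 : ℝ) < √2 by positivity), ← Int.cast_abs, abs_mul]
  gcongr
  exact_mod_cast mul_le_one₀ (eta_abs_le_one _ _) (abs_nonneg _) (jacobiSym_abs_le_one _ _)

theorem abs_twoFactor_lt_one (i : Fin 4) (m c : ℕ) : |twoFactor i m c| < 1 := by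
  refine (abs_twoFactor_le i m c).trans_lt ?_
  rw [div_lt_one (by positivity)]
  exact Real.lt_sqrt_of_sq_lt (by norm_num)

theorem abs_one_sub_twoFactor_le (i : Fin 4) (m c : ℕ) : |1 - twoFactor i m c| ≤ 2 := by
  have := abs_lt.1 (abs_twoFactor_lt_one i m c)
  rw [abs_le]; constructor <;> linarith

theorem twistLevel_pos (i : Fin 4) {m : ℕ} (hm : Odd m) (c : ℕ) : 0 < twistLevel i m c :=
  Nat.mul_pos (Nat.pos_of_ne_zero (NeZero.ne _)) hm.pos

theorem twistLevel_le (i : Fin 4) (m c : ℕ) : twistLevel i m c ≤ 8 * m := by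
  refine Nat.mul_le_mul_right m ?_
  generalize twistIndex i c = j
  fin_cases j <;> simp [etaMod]

theorem oddSum_gammaShape_spec : ∃ K : ℝ, 0 < K ∧ ∀ (i : Fin 4) (m k : ℕ) (y : ℝ), 0 < y →
    |oddSum (gammaShape i m) i m k y| ≤ K * y ^ (-(3 / 8) : ℝ) := by
  obtain ⟨K₁, h1, H1⟩ := oddSum_spec (σ := 1 / 4) (by norm_num)
  obtain ⟨K₂, h2, H2⟩ := oddSum_spec (σ := 3 / 4) (by norm_num)
  refine ⟨K₁ + K₂, by positivity, fun i m k y hy => ?_⟩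
  have hy' : 0 ≤ y ^ (-(3 / 8) : ℝ) := by positivity
  have t1 := mul_nonneg h1.le hy'
  have t2 := mul_nonneg h2.le hy'
  rw [gammaShape, add_mul]
  split_ifs
  · linarith [(H1 i m k y hy).2]
  · linarith [(H2 i m k y hy).2]

theorem exists_tsum_corePair_gammaShape_sub_le {h : ℝ → ℝ} (hh : IsSmoothWeight h) {ε : ℝ} (hε : 0 < ε) :
    ∃ K : ℝ, 0 < K ∧ ∀ (i : Fin 4) (m c : ℕ) (X Q : ℝ), Odd m → 0 < X → 0 < Q →
      Summable (corePair h (gammaShape i m) i m c X Q) ∧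
      |∑' p, corePair h (gammaShape i m) i m c X Q p - pairMain h (gammaShape i m) m X Q| ≤
        K * 2 ^ (2 * m).primeFactors.card * (√X * (X * Q) ^ (3 / 8 + ε) + X * (X * Q) ^ (-(1 / 8) : ℝ)) := by
  obtain ⟨K₁, h1, H1⟩ := exists_tsum_corePair_sub_le hh (σ := 1 / 4) (by norm_num) hε
  obtain ⟨K₂, h2, H2⟩ := exists_tsum_corePair_sub_le hh (σ := 3 / 4) (by norm_num) hε
  refine ⟨K₁ + K₂, by positivity, fun i m c X Q hm hX hQ => ?_⟩
  have t : 0 ≤ 2 ^ (2 * m).primeFactors.card * (√X * (X * Q) ^ (3 / 8 + ε) + X * (X * Q) ^ (-(1 / 8) : ℝ)) := by positivity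
  have t1 := mul_nonneg h1.le t
  have t2 := mul_nonneg h2.le t
  rw [gammaShape, mul_assoc, add_mul]
  split_ifs
  · refine ⟨(H1 i m c X Q hm hX hQ).1, ?_⟩
    have := (H1 i m c X Q hm hX hQ).2
    rw [mul_assoc] at this
    linarith
  · refine ⟨(H2 i m c X Q hm hX hQ).1, ?_⟩
    have := (H2 i m c X Q hm hX hQ).2
    rw [mul_assoc] at this
    linarith

/-- The part of the first moment over a residue class modulo `8`. -/
def momentClass (h : ℝ → ℝ) (i : Fin 4) (m c : ℕ) (X : ℝ) : ℝ :=
  ∑ d ∈ Finset.range (⌊2 * X⌋₊ + 1), if d % 8 = c % 8 ∧ d.Coprime m then h (d / X) * centralSeries i m d else 0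

theorem summable_oddSum_geometric (i : Fin 4) (m k : ℕ) {u y : ℝ} (hu : |u| < 1) (hy : 0 < y) :
    Summable fun j : ℕ => (1 - u) * u ^ j * oddSum (gammaShape i m) i m k (4 ^ j * y) := by
  obtain ⟨K, hK, H⟩ := oddSum_gammaShape_spec
  refine Summable.of_norm_bounded (g := fun j => |1 - u| * (K * y ^ (-(3 / 8) : ℝ)) * |u| ^ j)
    ((summable_geometric_of_lt_one (abs_nonneg u) hu).mul_left _) fun j => ?_
  have h1 : (4 ^ j * y) ^ (-(3 / 8) : ℝ) ≤ y ^ (-(3 / 8) : ℝ) :=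
    Real.rpow_le_rpow_of_nonpos hy (le_mul_of_one_le_left hy.le (one_le_pow₀ (by norm_num))) (by norm_num)
  have h2 := (H i m k (4 ^ j * y) (by positivity)).trans (mul_le_mul_of_nonneg_left h1 hK.le)
  rw [norm_mul, norm_mul, norm_pow, Real.norm_eq_abs, Real.norm_eq_abs, Real.norm_eq_abs]
  calc |1 - u| * |u| ^ j * _ ≤ |1 - u| * |u| ^ j * (K * y ^ (-(3 / 8) : ℝ)) := by gcongr
    _ = _ := by ring

/-- On a class modulo 8 the factor at 2 and the level F are constant, so the geometric series leaves
the sum over d; the factor 4^j in the cutoff amounts to replacing F by F/4^j. -/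
theorem hasSum_momentClass {h : ℝ → ℝ} (hh : IsSmoothWeight h) (i : Fin 4) {m c : ℕ} (hm : Odd m) (hc : Odd c) {X : ℝ}
    (hX : 0 < X) (hs : ∀ j : ℕ, Summable (corePair h (gammaShape i m) i m c X (twistLevel i m c / 4 ^ j))) :
    HasSum (fun j : ℕ => 2 * ((1 - twoFactor i m c) * twoFactor i m c ^ j) *
      ∑' p, corePair h (gammaShape i m) i m c X (twistLevel i m c / 4 ^ j) p) (momentClass h i m c X) := by
  set σ := gammaShape i m with hσ
  set u := twoFactor i m c with hu
  have hF : (0 : ℝ) < twistLevel i m c := Nat.cast_pos.2 (twistLevel_pos i hm c)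
  set F : ℝ := (twistLevel i m c : ℝ) with hFdef
  have hu1 : |u| < 1 := abs_twoFactor_lt_one i m c
  have key : ∀ d ∈ Finset.range (⌊2 * X⌋₊ + 1), HasSum (fun j : ℕ => if d % 8 = c % 8 ∧ d.Coprime m then
      h (d / X) * (2 * ∑ e ∈ (sqRoot d).divisors, (1 - u) * u ^ j * oddSum σ i m (d / e ^ 2) (4 ^ j * (e ^ 4 / (d * F)))) else 0)
      (if d % 8 = c % 8 ∧ d.Coprime m then h (d / X) * centralSeries i m d else 0) := by
    intro d _
    split_ifs with hd
    · have hdo : Odd d := by rw [Nat.odd_iff] at hc ⊢; omega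
      have hd0 : (0 : ℝ) < d := by exact_mod_cast hdo.pos
      rw [centralSeries, twoFactor_congr i hm hdo hc hd.1, twistLevel_congr i hd.1]
      refine (HasSum.mul_left 2 (hasSum_sum fun e he => ?_)).mul_left _
      have he0 : (0 : ℝ) < e := Nat.cast_pos.2 (Nat.pos_of_mem_divisors he)
      exact (summable_oddSum_geometric i m _ hu1 (by positivity)).hasSum
    · exact hasSum_zero
  have hfin := hasSum_sum key
  rw [momentClass]
  convert! hfin using 1
  funext j
  have hQ : 0 < F / 4 ^ j := by positivity
  rw [tsum_corePair hh (gammaShape_pos i m) i hc hX hQ (hs j),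
    ← sum_divisors_sqRoot_eq hh hX hc (fun k e => oddSum σ i m k (e ^ 2 / (k * (F / 4 ^ j)))), mul_sum]
  refine Finset.sum_congr rfl fun d _ => ?_
  split_ifs with hd
  · have hdo : Odd d := by rw [Nat.odd_iff] at hc ⊢; omega
    have hd0 : (0 : ℝ) < d := by exact_mod_cast hdo.pos
    rw [← mul_sum]
    have : ∀ e ∈ (sqRoot d).divisors, oddSum σ i m (d / e ^ 2) (4 ^ j * (e ^ 4 / (d * F))) =
        oddSum σ i m (d / e ^ 2) (e ^ 2 / ((d / e ^ 2 : ℕ) * (F / 4 ^ j))) := by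
      intro e he
      have he0 : (0 : ℝ) < e := Nat.cast_pos.2 (Nat.pos_of_mem_divisors he)
      have hed := (dvd_sqRoot_iff hdo.pos.ne').1 (Nat.dvd_of_mem_divisors he)
      rw [Nat.cast_div hed (by exact_mod_cast (pow_pos (Nat.pos_of_mem_divisors he) 2).ne')]
      congr 1
      push_cast
      field_simp
    rw [Finset.sum_congr rfl this]
    ring
  · ring

/-- The main term of `momentClass`. -/
def momentClassMain (h : ℝ → ℝ) (i : Fin 4) (m c : ℕ) (X : ℝ) : ℝ :=
  X / 4 * (∏ p ∈ m.primeFactors, (1 - 1 / (p : ℝ))) * ((∏ p ∈ (2 * m).primeFactors, (1 - 1 / (p : ℝ))) *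
    (weightMass h * (1 / 4 * (Real.log X + Real.log (twistLevel i m c) -
        Real.log 4 * (twoFactor i m c / (1 - twoFactor i m c))) + invSumConst (2 * m).primeFactors +
          1 / 4 * logMean (gammaShape i m)) + 1 / 4 * weightLogMass h))

/-- The main term is affine in log(F/4^j), hence in j, and ∑ u^j and ∑ ju^j are known; the second
one produces -log 4 · u/(1 - u) after normalization by 1 - u. -/
theorem hasSum_momentClassMain (h : ℝ → ℝ) (i : Fin 4) {m : ℕ} (hm : Odd m) (c : ℕ) {X : ℝ} (hX : 0 < X) :
    HasSum (fun j : ℕ => 2 * ((1 - twoFactor i m c) * twoFactor i m c ^ j) *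
      pairMain h (gammaShape i m) m X (twistLevel i m c / 4 ^ j)) (momentClassMain h i m c X) := by
  have hF : (0 : ℝ) < twistLevel i m c := Nat.cast_pos.2 (twistLevel_pos i hm c)
  set u := twoFactor i m c with hu
  set F : ℝ := (twistLevel i m c : ℝ) with hFdef
  have hu1 : |u| < 1 := abs_twoFactor_lt_one i m c
  have hu0 : 1 - u ≠ 0 := by have := (abs_lt.1 hu1).2; linarith
  set R := ∏ p ∈ m.primeFactors, (1 - 1 / (p : ℝ)) with hR
  set P := ∏ p ∈ (2 * m).primeFactors, (1 - 1 / (p : ℝ)) with hP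
  have h1 := (hasSum_geometric_of_abs_lt_one hu1).mul_left (2 * (1 - u) * pairMain h (gammaShape i m) m X F)
  have h2 := (hasSum_coe_mul_geometric_of_norm_lt_one (by rwa [Real.norm_eq_abs] : ‖u‖ < 1)).mul_left
    (2 * (1 - u) * (X / 8 * R * (P * (weightMass h * (1 / 4 * Real.log 4)))))
  convert! h1.sub h2 using 1
  · funext j
    rw [pairMain, pairMain, Real.log_mul hX.ne' (by positivity), Real.log_div hF.ne' (by positivity), Real.log_pow,
      Real.log_mul hX.ne' hF.ne', ← hR, ← hP]
    ring
  · rw [momentClassMain, pairMain, Real.log_mul hX.ne' hF.ne', ← hR, ← hP, ← hu, ← hFdef]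
    field_simp
    ring

theorem exists_momentClass_sub_le {h : ℝ → ℝ} (hh : IsSmoothWeight h) {ε : ℝ} (hε : 0 < ε) :
    ∃ K : ℝ, 0 < K ∧ ∀ (i : Fin 4) (m c : ℕ) (X : ℝ), Odd m → Odd c → 0 < X →
      |momentClass h i m c X - momentClassMain h i m c X| ≤ K * 2 ^ (2 * m).primeFactors.card *
        (√X * (X * twistLevel i m c) ^ (3 / 8 + ε) + X * (X * twistLevel i m c) ^ (-(1 / 8) : ℝ)) := by
  obtain ⟨K, hK, H⟩ := exists_tsum_corePair_gammaShape_sub_le hh hε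
  -- The error for level F/4^j may grow like 4^{j/8} because of the negative exponent, while |u|^j ≤
  -- 2^{-j/2}; the quotient r = 2^{-1/4} is below 1.
  set r : ℝ := 1 / √2 * (4 : ℝ) ^ (1 / 8 : ℝ) with hr
  have hr0 : 0 < r := by positivity
  have hr1 : r < 1 := by
    rw [hr, Real.sqrt_eq_rpow, one_div_mul_eq_div, div_lt_one (by positivity),
      show (4 : ℝ) = 2 ^ (2 : ℝ) by norm_num, ← Real.rpow_mul (by norm_num)]
    exact Real.rpow_lt_rpow_of_exponent_lt (by norm_num) (by norm_num)
  have hr2 : 1 / √2 ≤ r := le_mul_of_one_le_right (by positivity) (Real.one_le_rpow (by norm_num) (by norm_num))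
  refine ⟨4 * K * (1 - r)⁻¹, by have : 0 < 1 - r := by linarith
                                positivity, fun i m c X hm hc hX => ?_⟩
  have hF : (0 : ℝ) < twistLevel i m c := Nat.cast_pos.2 (twistLevel_pos i hm c)
  have h1 := hasSum_momentClass hh i hm hc hX fun j => (H i m c X _ hm hX (by positivity)).1
  have h2 := (h1.sub (hasSum_momentClassMain h i hm c hX))
  set F : ℝ := (twistLevel i m c : ℝ) with hFdef
  set u := twoFactor i m c with hu
  set B := K * 2 ^ (2 * m).primeFactors.card * (√X * (X * F) ^ (3 / 8 + ε) + X * (X * F) ^ (-(1 / 8) : ℝ)) with hB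
  have hXF : 0 < X * F := by positivity
  have hterm : ∀ j : ℕ, ‖2 * ((1 - u) * u ^ j) * ∑' p, corePair h (gammaShape i m) i m c X (F / 4 ^ j) p -
      2 * ((1 - u) * u ^ j) * pairMain h (gammaShape i m) m X (F / 4 ^ j)‖ ≤ 4 * B * r ^ j := by
    intro j
    have h3 := (H i m c X (F / 4 ^ j) hm hX (by positivity)).2
    have e1 : (X * (F / 4 ^ j)) ^ (3 / 8 + ε) ≤ (X * F) ^ (3 / 8 + ε) := by
      refine Real.rpow_le_rpow (by positivity) ?_ (by positivity)
      gcongr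
      exact div_le_self hF.le (one_le_pow₀ (by norm_num))
    have e2 : (X * (F / 4 ^ j)) ^ (-(1 / 8) : ℝ) = (X * F) ^ (-(1 / 8) : ℝ) * ((4 : ℝ) ^ (1 / 8 : ℝ)) ^ j := by
      rw [← mul_div_assoc, Real.div_rpow hXF.le (by positivity), Real.rpow_neg (by positivity : (0 : ℝ) ≤ 4 ^ j),
        div_inv_eq_mul, ← Real.rpow_natCast, ← Real.rpow_natCast, ← Real.rpow_mul (by norm_num), ← Real.rpow_mul (by norm_num),
        mul_comm (j : ℝ)]
    have hq1 : (1 : ℝ) ≤ ((4 : ℝ) ^ (1 / 8 : ℝ)) ^ j := one_le_pow₀ (Real.one_le_rpow (by norm_num) (by norm_num))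
    have e3 : √X * (X * (F / 4 ^ j)) ^ (3 / 8 + ε) + X * (X * (F / 4 ^ j)) ^ (-(1 / 8) : ℝ) ≤
        (√X * (X * F) ^ (3 / 8 + ε) + X * (X * F) ^ (-(1 / 8) : ℝ)) * ((4 : ℝ) ^ (1 / 8 : ℝ)) ^ j := by
      rw [e2, add_mul]
      refine add_le_add ?_ (le_of_eq (by ring))
      calc _ ≤ √X * (X * F) ^ (3 / 8 + ε) := by gcongr
        _ ≤ _ := le_mul_of_one_le_right (by positivity) hq1
    rw [← mul_sub, norm_mul, norm_mul, norm_mul, norm_pow, Real.norm_eq_abs, Real.norm_eq_abs, Real.norm_eq_abs, Real.norm_eq_abs]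
    have hu1 := abs_twoFactor_le i m c
    have hu2 := abs_one_sub_twoFactor_le i m c
    rw [← hu] at hu1 hu2
    calc |(2 : ℝ)| * (|1 - u| * |u| ^ j) * _ ≤ 2 * (2 * (1 / √2) ^ j) * (K * 2 ^ (2 * m).primeFactors.card *
          ((√X * (X * F) ^ (3 / 8 + ε) + X * (X * F) ^ (-(1 / 8) : ℝ)) * ((4 : ℝ) ^ (1 / 8 : ℝ)) ^ j)) := by
          rw [abs_of_pos (by norm_num : (0 : ℝ) < 2)]
          refine mul_le_mul (by gcongr) (h3.trans ?_) (abs_nonneg _) (by positivity)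
          gcongr
      _ = 4 * B * r ^ j := by rw [hB, hr, mul_pow]; ring
  have h4 := tsum_of_norm_bounded ((hasSum_geometric_of_lt_one hr0.le hr1).mul_left (4 * B)) hterm
  rw [h2.tsum_eq, Real.norm_eq_abs] at h4
  refine h4.trans (le_of_eq ?_)
  rw [hB]; ring

end LMoment

end

/-! ### Crude bounds for the exceptional squares -/

noncomputable section
namespace LMoment
open Filter Topology Finset
open scoped Real NumberTheorySymbols

/-- For p ≥ 9 one has (2k + 1)² ≤ 9^k ≤ p^k. Smaller p need a factor 3, from (2k + 1)² ≤ 9·2^k;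
fewer than nine primes do, which allows the constant 3⁹ below. -/
theorem two_mul_add_one_le {p : ℕ} (hp : 2 ≤ p) (k : ℕ) :
    (2 * k + 1 : ℝ) ≤ (if p < 9 then 3 else 1) * √((p ^ k : ℕ) : ℝ) := by
  have h1 : (2 * (k : ℝ) + 1) ^ 2 ≤ (if p < 9 then 3 else 1) ^ 2 * ((p ^ k : ℕ) : ℝ) := by
    split_ifs with h9
    · have h2 : (2 * (k : ℝ) + 1) ^ 2 ≤ 9 * 2 ^ k := by
        induction k with
        | zero => norm_num
        | succ k ih =>
          rcases Nat.lt_or_ge k 2 with hk | hk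
          · interval_cases k <;> norm_num
          · have : (2 : ℝ) ≤ k := by exact_mod_cast hk
            push_cast
            rw [pow_succ (2 : ℝ)]
            nlinarith
      refine h2.trans ?_
      push_cast
      have : (2 : ℝ) ^ k ≤ (p : ℝ) ^ k := pow_le_pow_left₀ (by norm_num) (by exact_mod_cast hp) k
      linarith
    · have h2 : (2 * (k : ℝ) + 1) ^ 2 ≤ 9 ^ k := by
        have h3 : (2 * (k : ℝ) + 1) ≤ 3 ^ k := by
          have := one_add_mul_le_pow (show (-2 : ℝ) ≤ 2 by norm_num) k
          norm_num at this
          linarith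
        calc (2 * (k : ℝ) + 1) ^ 2 ≤ (3 ^ k) ^ 2 := by gcongr
          _ = 9 ^ k := by rw [← pow_mul, mul_comm, pow_mul]; norm_num
      refine h2.trans ?_
      push_cast
      rw [one_pow, one_mul]
      exact pow_le_pow_left₀ (by norm_num) (by exact_mod_cast not_lt.1 h9) k
  have h2 := Real.sqrt_le_sqrt h1
  rw [Real.sqrt_sq (by positivity), Real.sqrt_mul (by positivity), Real.sqrt_sq (by split_ifs <;> norm_num)] at h2
  exact h2

theorem norm_corr_le {N d₀ d₁ : ℕ} [NeZero d₀] [NeZero N] (hd : d₁ ≠ 0) (χ : DirichletCharacter ℂ N) :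
    ‖corr d₀ d₁ χ (1 / 2)‖ ≤ 3 ^ 9 * √d₁ := by
  have hsplit : √(d₁ : ℝ) = ∏ p ∈ d₁.primeFactors, √((p ^ d₁.factorization p : ℕ) : ℝ) := by
    conv_lhs => rw [← Nat.prod_factorization_pow_eq_self hd]
    rw [Finsupp.prod, Nat.cast_prod, Real.sqrt_prod]
    · rfl
    · intro p _; positivity
  have hw : ∏ p ∈ d₁.primeFactors, (if p < 9 then 3 else 1 : ℝ) ≤ 3 ^ 9 := by
    rw [← Finset.prod_filter]
    rw [Finset.prod_const]
    refine pow_le_pow_right₀ (by norm_num) ?_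
    calc _ ≤ (Finset.range 9).card := Finset.card_le_card fun p hp => Finset.mem_range.2 (Finset.mem_filter.1 hp).2
      _ = 9 := Finset.card_range 9
  rw [corr, Finsupp.prod, norm_prod]
  calc _ ≤ ∏ p ∈ d₁.primeFactors, ((if p < 9 then 3 else 1 : ℝ) * √((p ^ d₁.factorization p : ℕ) : ℝ)) := by
        refine Finset.prod_le_prod (fun _ _ => norm_nonneg _) fun p hp => ?_
        have hpp := Nat.prime_of_mem_primeFactors hp
        refine le_trans ?_ (two_mul_add_one_le hpp.two_le _)
        have hp0 : 0 < p := hpp.pos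
        have hnorm1 : ∀ n : ℕ, ‖(p : ℂ) ^ ((n : ℂ) - 2 * n * (1 / 2))‖ = 1 := by
          intro n
          rw [show (n : ℂ) - 2 * n * (1 / 2) = 0 by ring, Complex.cpow_zero, norm_one]
        have hnorm2 : ∀ n : ℕ, ‖(p : ℂ) ^ ((n : ℂ) - (2 * n + 1) * (1 / 2))‖ ≤ 1 := by
          intro n
          rw [show (n : ℂ) - (2 * n + 1) * (1 / 2) = ((-(1 / 2) : ℝ) : ℂ) by push_cast; ring,
            Complex.norm_natCast_cpow_of_pos hp0, Complex.ofReal_re]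
          exact Real.rpow_le_one_of_one_le_of_nonpos (by exact_mod_cast hp0) (by norm_num)
        refine (norm_sub_le _ _).trans ?_
        have b1 : ‖∑ n ∈ Finset.range (d₁.factorization p + 1), χ ((p ^ (2 * n) : ℕ) : ZMod N) * (p : ℂ) ^ ((n : ℂ) - 2 * n * (1 / 2))‖ ≤
            d₁.factorization p + 1 := by
          refine (norm_sum_le_of_le _ (f := fun n : ℕ => χ ((p ^ (2 * n) : ℕ) : ZMod N) * (p : ℂ) ^ ((n : ℂ) - 2 * n * (1 / 2)))
            (n := fun _ => (1 : ℝ)) fun n _ => ?_).trans (by simp)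
          rw [norm_mul, hnorm1, mul_one]
          exact DirichletCharacter.norm_le_one _ _
        have b2 : ‖∑ n ∈ Finset.range (d₁.factorization p), twist d₀ χ ((p ^ (2 * n + 1) : ℕ) : ZMod (4 * d₀ * N)) *
            (p : ℂ) ^ ((n : ℂ) - (2 * n + 1) * (1 / 2))‖ ≤ d₁.factorization p := by
          refine (norm_sum_le_of_le _ (f := fun n : ℕ => twist d₀ χ ((p ^ (2 * n + 1) : ℕ) : ZMod (4 * d₀ * N)) *
            (p : ℂ) ^ ((n : ℂ) - (2 * n + 1) * (1 / 2)))
            (n := fun _ => (1 : ℝ)) fun n _ => ?_).trans (by simp)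
          rw [norm_mul]
          exact mul_le_one₀ (DirichletCharacter.norm_le_one _ _) (norm_nonneg _) (hnorm2 n)
        linarith
    _ ≤ 3 ^ 9 * √d₁ := by
        rw [Finset.prod_mul_distrib, ← hsplit]
        gcongr

/-- The term of e is O((e⁴/D)^{-3/8}) = O(D^{3/8} e^{-3/2}) with D = dF, which is summable over e.
-/
theorem abs_centralSeries_le : ∃ K : ℝ, 0 < K ∧ ∀ (i : Fin 4) (m d : ℕ), Odd m → 0 < d →
    |centralSeries i m d| ≤ K * (d * twistLevel i m d : ℝ) ^ (3 / 8 : ℝ) := by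
  obtain ⟨K, hK, H⟩ := oddSum_gammaShape_spec
  have hs1 : Summable fun e : ℕ => (e : ℝ) ^ (-(3 / 2) : ℝ) := Real.summable_nat_rpow.2 (by norm_num)
  set Z := ∑' e : ℕ, (e : ℝ) ^ (-(3 / 2) : ℝ) with hZ
  have hZ0 : 0 ≤ Z := tsum_nonneg fun e => by positivity
  have hr1 : 1 / √(2 : ℝ) < 1 := by
    rw [div_lt_one (by positivity)]; exact Real.lt_sqrt_of_sq_lt (by norm_num)
  set r := 1 / √(2 : ℝ) with hr
  have hr2 : 0 < (1 - r)⁻¹ := inv_pos.2 (by linarith)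
  refine ⟨2 * (Z + 1) * (2 * K * (1 - r)⁻¹), by positivity, fun i m d hm hd => ?_⟩
  have hF : (0 : ℝ) < twistLevel i m d := Nat.cast_pos.2 (twistLevel_pos i hm d)
  have hd0 : (0 : ℝ) < d := Nat.cast_pos.2 hd
  set D : ℝ := d * twistLevel i m d with hD
  have hD0 : 0 < D := by positivity
  have hterm : ∀ e ∈ (sqRoot d).divisors, |∑' j : ℕ, (1 - twoFactor i m d) * twoFactor i m d ^ j *
      oddSum (gammaShape i m) i m (d / e ^ 2) (4 ^ j * (e ^ 4 / D))| ≤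
        2 * K * (1 - r)⁻¹ * D ^ (3 / 8 : ℝ) * (e : ℝ) ^ (-(3 / 2) : ℝ) := by
    intro e he
    have he0 : (0 : ℝ) < e := Nat.cast_pos.2 (Nat.pos_of_mem_divisors he)
    have hy : 0 < (e : ℝ) ^ 4 / D := by positivity
    have e1 : ((e : ℝ) ^ 4 / D) ^ (-(3 / 8) : ℝ) = D ^ (3 / 8 : ℝ) * (e : ℝ) ^ (-(3 / 2) : ℝ) := by
      rw [Real.div_rpow (by positivity) hD0.le, Real.rpow_neg hD0.le, div_inv_eq_mul, ← Real.rpow_natCast,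
        ← Real.rpow_mul he0.le, mul_comm]
      norm_num
    rw [← Real.norm_eq_abs]
    have := tsum_of_norm_bounded (f := fun j : ℕ => (1 - twoFactor i m d) * twoFactor i m d ^ j *
      oddSum (gammaShape i m) i m (d / e ^ 2) (4 ^ j * (e ^ 4 / D)))
      ((hasSum_geometric_of_lt_one (by positivity) hr1).mul_left (2 * (K * ((e : ℝ) ^ 4 / D) ^ (-(3 / 8) : ℝ)))) fun j => by
        have h1 : (4 ^ j * ((e : ℝ) ^ 4 / D)) ^ (-(3 / 8) : ℝ) ≤ ((e : ℝ) ^ 4 / D) ^ (-(3 / 8) : ℝ) :=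
          Real.rpow_le_rpow_of_nonpos hy (le_mul_of_one_le_left hy.le (one_le_pow₀ (by norm_num))) (by norm_num)
        have h2 := (H i m (d / e ^ 2) (4 ^ j * ((e : ℝ) ^ 4 / D)) (by positivity)).trans (mul_le_mul_of_nonneg_left h1 hK.le)
        rw [norm_mul, norm_mul, norm_pow, Real.norm_eq_abs, Real.norm_eq_abs, Real.norm_eq_abs]
        calc _ ≤ 2 * r ^ j * (K * ((e : ℝ) ^ 4 / D) ^ (-(3 / 8) : ℝ)) := by
              gcongr
              · exact abs_one_sub_twoFactor_le i m d
              · exact abs_twoFactor_le i m d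
          _ = _ := by ring
    refine this.trans (le_of_eq ?_)
    rw [e1]; ring
  rw [centralSeries, abs_mul, abs_of_pos (by norm_num : (0 : ℝ) < 2)]
  have h1 := (Finset.abs_sum_le_sum_abs _ _).trans (Finset.sum_le_sum hterm)
  rw [← Finset.mul_sum] at h1
  have h2 : ∑ e ∈ (sqRoot d).divisors, (e : ℝ) ^ (-(3 / 2) : ℝ) ≤ Z := hs1.sum_le_tsum _ fun e _ => by positivity
  calc _ ≤ 2 * (2 * K * (1 - r)⁻¹ * D ^ (3 / 8 : ℝ) * (Z + 1)) := by
        gcongr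
        refine h1.trans ?_
        gcongr
        linarith
    _ = _ := by ring

end LMoment

end

/-! ### Assembling the first moment -/

noncomputable section
namespace LMoment
open Filter Topology Finset
open scoped Real NumberTheorySymbols

/-- The summand of the first moment, without the weight. -/
def centralValue {N : ℕ} [NeZero N] (χ : DirichletCharacter ℂ N) (d : ℕ) : ℂ :=
  LRemoved (2 * N) (1 / 2) (twist (sqfree d) χ) * corr (sqfree d) (sqRoot d) χ (1 / 2)

/-- For trivial χ and square d the L-value is one fixed number, and the correction polynomial is
O(√d₁) = O(d^{1/4}). -/
theorem exists_norm_centralValue_le (χ : DirichletCharacter ℂ 1) : ∃ K : ℝ, 0 < K ∧ ∀ d : ℕ, 0 < d → sqfree d = 1 →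
    ‖centralValue χ d‖ ≤ K * (d : ℝ) ^ (3 / 8 : ℝ) := by
  refine ⟨(‖LRemoved (2 * 1) (1 / 2) (twist 1 χ)‖ + 1) * 3 ^ 9, by positivity, fun d hd hs => ?_⟩
  -- The modulus of the twist is part of its type, so d₀ = 1 has to be substituted rather than
  -- rewritten.
  have hL : ∀ (d₀ : ℕ) [NeZero d₀], d₀ = 1 → LRemoved (2 * 1) (1 / 2) (twist d₀ χ) = LRemoved (2 * 1) (1 / 2) (twist 1 χ) := by
    intro d₀ _ h
    subst h
    rfl
  have hc := norm_corr_le (d₀ := sqfree d) (sqRoot_pos d).ne' χ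
  have hd1 : (1 : ℝ) ≤ d := by exact_mod_cast hd
  have hsq : √(sqRoot d : ℝ) ≤ (d : ℝ) ^ (3 / 8 : ℝ) := by
    have h1 : (sqRoot d : ℝ) ^ 2 = d := by
      have := sqfree_mul_sqRoot_sq hd.ne'
      rw [hs, one_mul] at this
      exact_mod_cast this
    have h2 : √(sqRoot d : ℝ) = (d : ℝ) ^ (1 / 4 : ℝ) := by
      rw [← h1, Real.sqrt_eq_rpow, ← Real.rpow_natCast, ← Real.rpow_mul (by positivity)]
      norm_num
    rw [h2]
    exact Real.rpow_le_rpow_of_exponent_le hd1 (by norm_num)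
  rw [centralValue, norm_mul, hL (sqfree d) hs]
  calc _ ≤ (‖LRemoved (2 * 1) (1 / 2) (twist 1 χ)‖ + 1) * (3 ^ 9 * (d : ℝ) ^ (3 / 8 : ℝ)) := by
        gcongr
        · linarith
        · exact hc.trans (by gcongr)
    _ = _ := by ring

theorem coprime_two_mul_level_iff (i : Fin 4) {m d : ℕ} : d.Coprime (2 * (etaMod i * m)) ↔ Odd d ∧ d.Coprime m := by
  rw [Nat.coprime_mul_iff_right, Nat.coprime_mul_iff_right, Nat.coprime_two_right]
  constructor
  · rintro ⟨h1, _, h2⟩; exact ⟨h1, h2⟩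
  · rintro ⟨h1, h2⟩; exact ⟨h1, coprime_etaMod_of_odd i h1, h2⟩

theorem S_eq_sum {h : ℝ → ℝ} (hh : IsSmoothWeight h) {N : ℕ} [NeZero N] (χ : DirichletCharacter ℂ N) {X : ℝ} (hX : 0 < X) :
    S h χ X = ∑ d ∈ Finset.range (⌊2 * X⌋₊ + 1), if d.Coprime (2 * N) then centralValue χ d * (h (d / X) : ℂ) else 0 := by
  rw [S, tsum_eq_sum (s := Finset.range (⌊2 * X⌋₊ + 1))]
  · rfl
  · intro d hd
    rw [Finset.mem_range, not_lt] at hd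
    have h1 : 2 * X < d := (Nat.lt_floor_add_one _).trans_le (by exact_mod_cast hd)
    split_ifs
    · rw [hh.eq_zero (Or.inr (by rw [lt_div_iff₀ hX]; linarith)), Complex.ofReal_zero, mul_zero]
    · rfl

theorem sum_momentClass (h : ℝ → ℝ) (i : Fin 4) (m : ℕ) (X : ℝ) :
    ∑ c ∈ ({1, 3, 5, 7} : Finset ℕ), momentClass h i m c X =
      ∑ d ∈ Finset.range (⌊2 * X⌋₊ + 1), if Odd d ∧ d.Coprime m then h (d / X) * centralSeries i m d else 0 := by
  simp only [momentClass]
  rw [Finset.sum_comm]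
  refine Finset.sum_congr rfl fun d _ => ?_
  by_cases hm : d.Coprime m
  · by_cases ho : Odd d
    · rw [if_pos ⟨ho, hm⟩]
      have h8 : d % 8 = 1 ∨ d % 8 = 3 ∨ d % 8 = 5 ∨ d % 8 = 7 := by have := Nat.odd_iff.1 ho; omega
      rcases h8 with h8 | h8 | h8 | h8 <;> simp [h8, eq_true hm]
    · rw [if_neg fun hc => ho hc.1]
      have h8 : d % 8 ≠ 1 ∧ d % 8 ≠ 3 ∧ d % 8 ≠ 5 ∧ d % 8 ≠ 7 := by rw [Nat.odd_iff] at ho; omega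
      simp [h8.1, h8.2.1, h8.2.2.1, h8.2.2.2]
  · simp [hm]

/-- An odd square is 1 modulo 8 and leaves the 2-part unchanged, so the twist can be principal only
if χ is trivial and d is a square. -/
theorem twistIndex_ne_zero_or_of_sqfree {i : Fin 4} {m d : ℕ} (hm : 0 < m) (hd : Odd d) (h : ¬ (i = 0 ∧ m = 1 ∧ sqfree d = 1)) :
    twistIndex i d ≠ 0 ∨ 1 < sqfree d * m := by
  by_contra hcon
  push Not at hcon
  obtain ⟨h1, h2⟩ := hcon
  have h3 : sqfree d * m = 1 := le_antisymm h2 (Nat.mul_pos (sqfree_pos d) hm)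
  obtain ⟨h4, h5⟩ := mul_eq_one.1 h3
  refine h ⟨?_, h5, h4⟩
  have h6 := sqfree_mul_sqRoot_sq hd.pos.ne'
  rw [h4, one_mul] at h6
  have h7 : Odd (sqRoot d) := by
    rw [← h6, Nat.odd_pow_iff (by norm_num)] at hd; exact hd
  have h8 := odd_sq_mod_eight h7
  rw [h6] at h8
  rw [twistIndex, if_neg (by omega)] at h1
  exact h1

theorem card_filter_sqfree_eq_one_le {X : ℝ} (hX : 1 ≤ X) :
    (((Finset.range (⌊2 * X⌋₊ + 1)).filter fun d => 0 < d ∧ sqfree d = 1).card : ℝ) ≤ 3 * √X := by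
  have hsub : ((Finset.range (⌊2 * X⌋₊ + 1)).filter fun d => 0 < d ∧ sqfree d = 1) ⊆
      (Finset.range (⌊√(2 * X)⌋₊ + 1)).image fun l => l ^ 2 := by
    intro d hd
    simp only [Finset.mem_filter, Finset.mem_range, Finset.mem_image] at hd ⊢
    obtain ⟨h1, h2, h3⟩ := hd
    have h4 := eq_sqRoot_sq h2.ne' h3
    refine ⟨sqRoot d, ?_, h4.symm⟩
    rw [Nat.lt_add_one_iff, Nat.le_floor_iff (by positivity)]
    refine Real.le_sqrt_of_sq_le ?_
    have h5 : (d : ℝ) ≤ 2 * X := by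
      rw [← Nat.le_floor_iff (by positivity)]; omega
    rw [h4] at h5
    exact_mod_cast h5
  have h1 : (((Finset.range (⌊2 * X⌋₊ + 1)).filter fun d => 0 < d ∧ sqfree d = 1).card : ℝ) ≤ ⌊√(2 * X)⌋₊ + 1 := by
    have := (Finset.card_le_card hsub).trans Finset.card_image_le
    rw [Finset.card_range] at this
    exact_mod_cast this
  have h2 : (⌊√(2 * X)⌋₊ : ℝ) ≤ √(2 * X) := Nat.floor_le (by positivity)
  have h3 : √(2 * X) ≤ 2 * √X := by
    rw [Real.sqrt_le_left (by positivity), mul_pow, Real.sq_sqrt (by linarith)]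
    linarith
  have h4 : 1 ≤ √X := Real.one_le_sqrt.2 hX
  linarith

/-- The terms agree exactly unless χ is trivial and d is a square. Those d number at most 3√X and
cost O(X^{3/8}) each. -/
theorem exists_S_sub_sum_momentClass_le {h : ℝ → ℝ} (hh : IsSmoothWeight h) :
    ∃ K : ℝ, 0 < K ∧ ∀ (N : ℕ) [NeZero N] (χ : DirichletCharacter ℂ N) (i : Fin 4) (m : ℕ), QuadForm χ i m →
      χ.IsQuadratic → ∀ X : ℝ, 1 ≤ X →
        ‖S h χ X - ((∑ c ∈ ({1, 3, 5, 7} : Finset ℕ), momentClass h i m c X : ℝ) : ℂ)‖ ≤ K * X ^ (7 / 8 : ℝ) := by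
  obtain ⟨C, hC1, hC, -⟩ := hh.exists_bound
  obtain ⟨K₁, hK₁, H₁⟩ := exists_norm_centralValue_le (1 : DirichletCharacter ℂ 1)
  obtain ⟨K₂, hK₂, H₂⟩ := abs_centralSeries_le
  have hC0 : 0 < C := by linarith
  refine ⟨3 * ((K₁ + K₂ * 8) * 2 * C), by positivity, fun N _ χ i m hχ hquad X hX => ?_⟩
  have hX0 : 0 < X := by linarith
  have hN := hχ.level
  rw [S_eq_sum hh χ hX0, sum_momentClass]
  push_cast
  rw [← Finset.sum_sub_distrib]
  have hterm : ∀ d ∈ Finset.range (⌊2 * X⌋₊ + 1), ‖(if d.Coprime (2 * N) then centralValue χ d * (h (d / X) : ℂ) else 0) -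
      (((if Odd d ∧ d.Coprime m then h (d / X) * centralSeries i m d else 0 : ℝ)) : ℂ)‖ ≤
        if 0 < d ∧ sqfree d = 1 then (K₁ + K₂ * 8) * 2 * C * X ^ (3 / 8 : ℝ) else 0 := by
    intro d hdr
    have hcop : d.Coprime (2 * N) ↔ Odd d ∧ d.Coprime m := by rw [hN]; exact coprime_two_mul_level_iff i
    have hrhs : 0 ≤ if 0 < d ∧ sqfree d = 1 then (K₁ + K₂ * 8) * 2 * C * X ^ (3 / 8 : ℝ) else 0 := by
      split_ifs <;> positivity
    by_cases hc : Odd d ∧ d.Coprime m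
    · rw [if_pos (hcop.2 hc), if_pos hc]
      by_cases hex : i = 0 ∧ m = 1 ∧ sqfree d = 1
      · obtain ⟨rfl, rfl, hs⟩ := hex
        have hN1 : N = 1 := by rw [hN]; simp [etaMod]
        subst hN1
        have hχ1 : χ = 1 := Subsingleton.elim _ _
        subst hχ1
        rw [if_pos ⟨hc.1.pos, hs⟩]
        have hd1 : (0 : ℝ) < d := by exact_mod_cast hc.1.pos
        have hdX : (d : ℝ) ≤ 2 * X := by
          rw [← Nat.le_floor_iff (by positivity)]
          have := Finset.mem_range.1 hdr; omega
        have hp2 : (d : ℝ) ^ (3 / 8 : ℝ) ≤ 2 * X ^ (3 / 8 : ℝ) := by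
          refine (Real.rpow_le_rpow hd1.le hdX (by norm_num)).trans ?_
          rw [Real.mul_rpow (by norm_num) hX0.le]
          gcongr
          calc (2 : ℝ) ^ (3 / 8 : ℝ) ≤ 2 ^ (1 : ℝ) := Real.rpow_le_rpow_of_exponent_le (by norm_num) (by norm_num)
            _ = 2 := by norm_num
        have h8 : (twistLevel 0 1 d : ℝ) ^ (3 / 8 : ℝ) ≤ 8 := by
          have h1 : (twistLevel 0 1 d : ℝ) ≤ 8 := by exact_mod_cast twistLevel_le 0 1 d
          calc _ ≤ (8 : ℝ) ^ (3 / 8 : ℝ) := Real.rpow_le_rpow (by positivity) h1 (by norm_num)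
            _ ≤ 8 ^ (1 : ℝ) := Real.rpow_le_rpow_of_exponent_le (by norm_num) (by norm_num)
            _ = 8 := by norm_num
        have hcs := H₂ 0 1 d odd_one hc.1.pos
        rw [Real.mul_rpow hd1.le (by positivity)] at hcs
        have hcs' : |centralSeries 0 1 d| ≤ K₂ * 8 * (d : ℝ) ^ (3 / 8 : ℝ) := by
          refine hcs.trans ?_
          calc _ ≤ K₂ * ((d : ℝ) ^ (3 / 8 : ℝ) * 8) := by gcongr
            _ = _ := by ring
        have e1 : centralValue (1 : DirichletCharacter ℂ 1) d * (h (d / X) : ℂ) - ((h (d / X) * centralSeries 0 1 d : ℝ) : ℂ) =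
            (centralValue (1 : DirichletCharacter ℂ 1) d - (centralSeries 0 1 d : ℝ)) * (h (d / X) : ℂ) := by
          push_cast; ring
        rw [e1, norm_mul, Complex.norm_real]
        calc _ ≤ (K₁ * (d : ℝ) ^ (3 / 8 : ℝ) + K₂ * 8 * (d : ℝ) ^ (3 / 8 : ℝ)) * C := by
              refine mul_le_mul ((norm_sub_le _ _).trans (add_le_add (H₁ d hc.1.pos hs) ?_)) (hC _) (norm_nonneg _) (by positivity)
              rw [Complex.norm_real]; exact hcs'
          _ = (K₁ + K₂ * 8) * C * (d : ℝ) ^ (3 / 8 : ℝ) := by ring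
          _ ≤ (K₁ + K₂ * 8) * C * (2 * X ^ (3 / 8 : ℝ)) := by gcongr
          _ = _ := by ring
      · have := centralValue_eq hχ hquad hc.1 hc.2 (twistIndex_ne_zero_or_of_sqfree hχ.odd.pos hc.1 hex)
        rw [← centralValue] at this
        rw [this, Complex.ofReal_mul, mul_comm, sub_self, norm_zero]
        exact hrhs
    · rw [if_neg (fun h => hc (hcop.1 h)), if_neg hc]
      simpa using hrhs
  refine (norm_sum_le_of_le _ hterm).trans ?_
  rw [← Finset.sum_filter, Finset.sum_const, nsmul_eq_mul]
  calc _ ≤ 3 * √X * ((K₁ + K₂ * 8) * 2 * C * X ^ (3 / 8 : ℝ)) := by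
        gcongr
        exact card_filter_sqfree_eq_one_le hX
    _ = 3 * ((K₁ + K₂ * 8) * 2 * C) * (X ^ (1 / 2 : ℝ) * X ^ (3 / 8 : ℝ)) := by rw [Real.sqrt_eq_rpow]; ring
    _ = _ := by rw [← Real.rpow_add hX0]; norm_num

/-- The mean over residue classes of the logarithmic level of the twists. -/
def levelMean (i : Fin 4) (m : ℕ) : ℝ :=
  1 / 4 * ∑ c ∈ ({1, 3, 5, 7} : Finset ℕ), (Real.log (twistLevel i m c) -
    Real.log 4 * (twoFactor i m c / (1 - twoFactor i m c)))

/-- The coefficient of `X log X`. -/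
def logCoeff (h : ℝ → ℝ) (m : ℕ) : ℝ :=
  1 / 2 * (∏ p ∈ (2 * m).primeFactors, (1 - 1 / (p : ℝ))) ^ 2 * weightMass h

/-- The coefficient of `X`. -/
def linCoeff (h : ℝ → ℝ) (i : Fin 4) (m : ℕ) : ℝ :=
  1 / 2 * (∏ p ∈ (2 * m).primeFactors, (1 - 1 / (p : ℝ))) ^ 2 *
    (weightMass h * (levelMean i m + 4 * invSumConst (2 * m).primeFactors + logMean (gammaShape i m)) + weightLogMass h)

theorem prod_primeFactors_two_mul {m : ℕ} (hm : Odd m) :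
    ∏ p ∈ (2 * m).primeFactors, (1 - 1 / (p : ℝ)) = 1 / 2 * ∏ p ∈ m.primeFactors, (1 - 1 / (p : ℝ)) := by
  have h2 : Nat.Coprime 2 m := Nat.coprime_two_left.2 hm
  rw [h2.primeFactors_mul, Finset.prod_union h2.disjoint_primeFactors, Nat.prime_two.primeFactors, Finset.prod_singleton]
  norm_num

theorem sum_momentClassMain (h : ℝ → ℝ) (i : Fin 4) {m : ℕ} (hm : Odd m) (X : ℝ) :
    ∑ c ∈ ({1, 3, 5, 7} : Finset ℕ), momentClassMain h i m c X =
      logCoeff h m * X * Real.log X + linCoeff h i m * X := by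
  simp only [momentClassMain, logCoeff, linCoeff, levelMean, prod_primeFactors_two_mul hm]
  rw [Finset.sum_insert (by decide), Finset.sum_insert (by decide), Finset.sum_insert (by decide), Finset.sum_singleton,
    Finset.sum_insert (by decide), Finset.sum_insert (by decide), Finset.sum_insert (by decide), Finset.sum_singleton]
  ring

/-- Primes p ≥ 2^{1/ε} satisfy 2 ≤ p^ε; the smaller ones are bounded in number and go into the
constant. -/
theorem exists_two_pow_card_primeFactors_le {ε : ℝ} (hε : 0 < ε) :
    ∃ K : ℝ, 1 ≤ K ∧ ∀ n : ℕ, n ≠ 0 → (2 : ℝ) ^ n.primeFactors.card ≤ K * (n : ℝ) ^ ε := by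
  set A : ℕ := ⌈(2 : ℝ) ^ (1 / ε)⌉₊ with hA
  refine ⟨2 ^ A, one_le_pow₀ (by norm_num), fun n hn => ?_⟩
  have hn1 : (1 : ℝ) ≤ n := by exact_mod_cast Nat.pos_of_ne_zero hn
  rw [← Finset.prod_const]
  have h1 : ∀ p ∈ n.primeFactors, (2 : ℝ) ≤ (if p < A then 2 else 1) * (p : ℝ) ^ ε := by
    intro p hp
    have hp1 : (1 : ℝ) ≤ p := by exact_mod_cast (Nat.prime_of_mem_primeFactors hp).one_le
    split_ifs with hpA
    · have := Real.one_le_rpow hp1 hε.le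
      linarith
    · have h2 : (2 : ℝ) ^ (1 / ε) ≤ p := (Nat.le_ceil _).trans (by exact_mod_cast not_lt.1 hpA)
      have h3 := Real.rpow_le_rpow (by positivity) h2 hε.le
      rw [← Real.rpow_mul (by norm_num), one_div_mul_cancel hε.ne', Real.rpow_one] at h3
      linarith
  refine (Finset.prod_le_prod (fun _ _ => by norm_num) h1).trans ?_
  rw [Finset.prod_mul_distrib]
  refine mul_le_mul ?_ ?_ (Finset.prod_nonneg fun _ _ => by positivity) (by positivity)
  · rw [← Finset.prod_filter, Finset.prod_const]
    refine pow_le_pow_right₀ (by norm_num) ?_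
    calc _ ≤ (Finset.range A).card := Finset.card_le_card fun p hp => Finset.mem_range.2 (Finset.mem_filter.1 hp).2
      _ = A := Finset.card_range A
  · rw [Real.finsetProd_rpow _ _ fun _ _ => by positivity, ← Nat.cast_prod]
    exact Real.rpow_le_rpow (by positivity) (by exact_mod_cast Nat.le_of_dvd (Nat.pos_of_ne_zero hn) (Nat.prod_primeFactors_dvd n)) hε.le

end LMoment

end

/-! ### The asymptotic formula -/

noncomputable section
namespace LMoment
open Filter Topology Finset
open scoped Real

theorem exists_S_asymptotic {h : ℝ → ℝ} (hh : IsSmoothWeight h) {ε : ℝ} (hε : 0 < ε) :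
    ∃ C : ℝ, 0 < C ∧ ∀ (N : ℕ) [NeZero N] (χ : DirichletCharacter ℂ N) (i : Fin 4) (m : ℕ), QuadForm χ i m →
      χ.IsQuadratic → ∀ X : ℝ, 1 ≤ X →
        ‖S h χ X - ((logCoeff h m * X * Real.log X + linCoeff h i m * X : ℝ) : ℂ)‖ ≤
          C * (N : ℝ) ^ (3 / 8 + ε) * X ^ (1 - 1 / 16 : ℝ) := by
  -- 1/2 + 3/8 + η ≤ 15/16 fixes the saving 1/16 in X; 2η ≤ ε pays for both the exponent of the
  -- level and the factor 2^ω.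
  set η := min (ε / 2) (1 / 16) with hη
  have hη0 : 0 < η := by rw [hη]; positivity
  have hη1 : η ≤ ε / 2 := min_le_left _ _
  have hη2 : η ≤ 1 / 16 := min_le_right _ _
  obtain ⟨K₁, hK₁, H₁⟩ := exists_momentClass_sub_le hh hη0
  obtain ⟨K₂, hK₂, H₂⟩ := exists_two_pow_card_primeFactors_le hη0
  obtain ⟨K₃, hK₃, H₃⟩ := exists_S_sub_sum_momentClass_le hh
  refine ⟨K₃ + 72 * K₁ * K₂, by positivity, fun N _ χ i m hχ hquad X hX => ?_⟩
  have hX0 : 0 < X := by linarith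
  have hm0 : 0 < m := hχ.odd.pos
  have hN1 : (1 : ℝ) ≤ N := by exact_mod_cast Nat.pos_of_ne_zero (NeZero.ne N)
  have hN0 : (0 : ℝ) < N := by linarith
  have hmN : (m : ℝ) ≤ N := by
    rw [hχ.level]
    exact_mod_cast Nat.le_mul_of_pos_left m (Nat.pos_of_ne_zero (NeZero.ne (etaMod i)))
  have hω : (2 : ℝ) ^ (2 * m).primeFactors.card ≤ K₂ * 2 * (N : ℝ) ^ η := by
    refine (H₂ (2 * m) (by omega)).trans ?_
    push_cast
    rw [Real.mul_rpow (by norm_num) (by positivity), mul_assoc]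
    gcongr
    calc (2 : ℝ) ^ η ≤ 2 ^ (1 : ℝ) := Real.rpow_le_rpow_of_exponent_le (by norm_num) (by linarith)
      _ = 2 := by norm_num
  set Y := X ^ (1 - 1 / 16 : ℝ) with hY
  have hY0 : 0 < Y := by positivity
  have hclass : ∀ c ∈ ({1, 3, 5, 7} : Finset ℕ), |momentClass h i m c X - momentClassMain h i m c X| ≤
      18 * K₁ * K₂ * (N : ℝ) ^ (3 / 8 + ε) * Y := by
    intro c hc
    have hco : Odd c := by
      fin_cases hc <;> decide
    have hF1 : (1 : ℝ) ≤ twistLevel i m c := by exact_mod_cast twistLevel_pos i hχ.odd c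
    have hF8 : (twistLevel i m c : ℝ) ≤ 8 * N := by
      have : (twistLevel i m c : ℝ) ≤ 8 * m := by exact_mod_cast twistLevel_le i m c
      linarith
    have e1 : √X * (X * twistLevel i m c) ^ (3 / 8 + η) ≤ 8 * (N : ℝ) ^ (3 / 8 + η) * Y := by
      rw [Real.mul_rpow hX0.le (by positivity), Real.sqrt_eq_rpow, ← mul_assoc, ← Real.rpow_add hX0]
      have f1 : X ^ (1 / 2 + (3 / 8 + η)) ≤ Y := Real.rpow_le_rpow_of_exponent_le hX (by linarith)
      have f2 : (twistLevel i m c : ℝ) ^ (3 / 8 + η) ≤ 8 * (N : ℝ) ^ (3 / 8 + η) := by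
        refine (Real.rpow_le_rpow (by positivity) hF8 (by positivity)).trans ?_
        rw [Real.mul_rpow (by norm_num) hN0.le]
        gcongr
        calc (8 : ℝ) ^ (3 / 8 + η) ≤ 8 ^ (1 : ℝ) := Real.rpow_le_rpow_of_exponent_le (by norm_num) (by linarith)
          _ = 8 := by norm_num
      rw [mul_comm]
      exact mul_le_mul f2 f1 (by positivity) (by positivity)
    have e2 : X * (X * twistLevel i m c) ^ (-(1 / 8) : ℝ) ≤ (N : ℝ) ^ (3 / 8 + η) * Y := by
      have f1 : (X * twistLevel i m c) ^ (-(1 / 8) : ℝ) ≤ X ^ (-(1 / 8) : ℝ) :=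
        Real.rpow_le_rpow_of_nonpos hX0 (le_mul_of_one_le_right hX0.le hF1) (by norm_num)
      have f2 : X * X ^ (-(1 / 8) : ℝ) ≤ Y := by
        nth_rewrite 1 [← Real.rpow_one X]
        rw [← Real.rpow_add hX0]
        exact Real.rpow_le_rpow_of_exponent_le hX (by norm_num)
      calc _ ≤ X * X ^ (-(1 / 8) : ℝ) := by gcongr
        _ ≤ 1 * Y := by rw [one_mul]; exact f2
        _ ≤ _ := by
          gcongr
          exact Real.one_le_rpow hN1 (by positivity)
    have e3 : (N : ℝ) ^ η * (N : ℝ) ^ (3 / 8 + η) ≤ (N : ℝ) ^ (3 / 8 + ε) := by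
      rw [← Real.rpow_add hN0]
      exact Real.rpow_le_rpow_of_exponent_le hN1 (by linarith)
    calc _ ≤ K₁ * 2 ^ (2 * m).primeFactors.card *
          (√X * (X * twistLevel i m c) ^ (3 / 8 + η) + X * (X * twistLevel i m c) ^ (-(1 / 8) : ℝ)) :=
          H₁ i m c X hχ.odd hco hX0
      _ ≤ K₁ * (K₂ * 2 * (N : ℝ) ^ η) * (8 * (N : ℝ) ^ (3 / 8 + η) * Y + (N : ℝ) ^ (3 / 8 + η) * Y) := by
          gcongr
      _ = 18 * K₁ * K₂ * ((N : ℝ) ^ η * (N : ℝ) ^ (3 / 8 + η)) * Y := by ring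
      _ ≤ _ := by gcongr
  have hsum : |∑ c ∈ ({1, 3, 5, 7} : Finset ℕ), momentClass h i m c X - (logCoeff h m * X * Real.log X + linCoeff h i m * X)| ≤
      72 * K₁ * K₂ * (N : ℝ) ^ (3 / 8 + ε) * Y := by
    rw [← sum_momentClassMain h i hχ.odd X, ← Finset.sum_sub_distrib]
    refine (Finset.abs_sum_le_sum_abs _ _).trans ((Finset.sum_le_sum hclass).trans (le_of_eq ?_))
    rw [Finset.sum_const, nsmul_eq_mul]
    norm_num
    ring
  have hS := H₃ N χ i m hχ hquad X hX
  have hX78 : K₃ * X ^ (7 / 8 : ℝ) ≤ K₃ * (N : ℝ) ^ (3 / 8 + ε) * Y := by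
    have f1 : X ^ (7 / 8 : ℝ) ≤ Y := Real.rpow_le_rpow_of_exponent_le hX (by norm_num)
    have f2 : (1 : ℝ) ≤ (N : ℝ) ^ (3 / 8 + ε) := Real.one_le_rpow hN1 (by positivity)
    calc K₃ * X ^ (7 / 8 : ℝ) ≤ K₃ * 1 * Y := by rw [mul_one]; gcongr
      _ ≤ _ := by gcongr
  set T := ∑ c ∈ ({1, 3, 5, 7} : Finset ℕ), momentClass h i m c X with hT
  set M := logCoeff h m * X * Real.log X + linCoeff h i m * X with hM
  calc ‖S h χ X - (M : ℂ)‖ = ‖(S h χ X - (T : ℂ)) + ((T - M : ℝ) : ℂ)‖ := by push_cast; ring_nf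
    _ ≤ ‖S h χ X - (T : ℂ)‖ + ‖((T - M : ℝ) : ℂ)‖ := norm_add_le _ _
    _ ≤ K₃ * (N : ℝ) ^ (3 / 8 + ε) * Y + 72 * K₁ * K₂ * (N : ℝ) ^ (3 / 8 + ε) * Y := by
        refine add_le_add (hS.trans hX78) ?_
        rw [Complex.norm_real]
        exact hsum
    _ = _ := by ring

/-! ### Digamma values at 1/4 and 3/4 -/

/-- Logarithmic derivative of the reflection formula at 1/4, where cot(π/4) = 1. -/
theorem digamma_one_quarter_sub : Complex.digamma (1 / 4) - Complex.digamma (3 / 4) = -π := by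
  have hne : ∀ x : ℂ, 0 < x.re → ∀ n : ℕ, x ≠ -n := by
    intro x hx n h
    rw [h] at hx
    simp at hx
    have : (0 : ℝ) ≤ n := by positivity
    linarith
  have hd1 := Complex.differentiableAt_Gamma (1 / 4) (hne _ (by norm_num))
  have hd3 := Complex.differentiableAt_Gamma (3 / 4) (hne _ (by norm_num))
  have hg1 : Complex.Gamma (1 / 4) ≠ 0 := Complex.Gamma_ne_zero_of_re_pos (by norm_num)
  have hg3 : Complex.Gamma (3 / 4) ≠ 0 := Complex.Gamma_ne_zero_of_re_pos (by norm_num)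
  have e0 : (1 : ℂ) - 1 / 4 = 3 / 4 := by norm_num
  have hdc : HasDerivAt (fun z : ℂ => 1 - z) (-1) (1 / 4) := by simpa using (hasDerivAt_id (1 / 4 : ℂ)).const_sub 1
  have hl := hd1.hasDerivAt.mul ((e0 ▸ hd3.hasDerivAt : HasDerivAt Complex.Gamma (deriv Complex.Gamma (3 / 4)) (1 - 1 / 4)).comp (1 / 4 : ℂ) hdc)
  have harg : (π : ℂ) * (1 / 4) = ((π / 4 : ℝ) : ℂ) := by push_cast; ring
  have hsin : Complex.sin (π * (1 / 4)) = ((√2 / 2 : ℝ) : ℂ) := by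
    rw [harg, ← Complex.ofReal_sin, Real.sin_pi_div_four]
  have hcos : Complex.cos (π * (1 / 4)) = ((√2 / 2 : ℝ) : ℂ) := by
    rw [harg, ← Complex.ofReal_cos, Real.cos_pi_div_four]
  have hs0 : Complex.sin (π * (1 / 4)) ≠ 0 := by
    rw [hsin]; norm_cast; positivity
  have hlin : HasDerivAt (fun z : ℂ => (π : ℂ) * z) π (1 / 4) := by simpa using (hasDerivAt_id (1 / 4 : ℂ)).const_mul (π : ℂ)
  have hr := (hasDerivAt_const (1 / 4 : ℂ) (π : ℂ)).div ((Complex.hasDerivAt_sin _).comp (1 / 4 : ℂ) hlin) hs0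
  have hfun : (Complex.Gamma * (Complex.Gamma ∘ fun z : ℂ => 1 - z)) = (fun _ => (π : ℂ)) / (Complex.sin ∘ fun z : ℂ => (π : ℂ) * z) := by
    funext z
    simpa using Complex.Gamma_mul_Gamma_one_sub z
  rw [hfun] at hl
  have huniq := hl.unique hr
  have hval := Complex.Gamma_mul_Gamma_one_sub (1 / 4)
  rw [e0] at hval
  simp only [Function.comp_apply, e0] at huniq
  rw [Complex.digamma_def, logDeriv_apply, logDeriv_apply, div_sub_div _ _ hg1 hg3, hval, div_eq_iff (div_ne_zero (by exact_mod_cast Real.pi_ne_zero) hs0)]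
  have h2 : deriv Complex.Gamma (1 / 4) * Complex.Gamma (3 / 4) - Complex.Gamma (1 / 4) * deriv Complex.Gamma (3 / 4) =
      (0 * Complex.sin (π * (1 / 4)) - π * (Complex.cos (π * (1 / 4)) * π)) / Complex.sin (π * (1 / 4)) ^ 2 := by
    rw [← huniq]; ring
  rw [h2, hcos, ← hsin]
  field_simp
  ring

/-- Logarithmic derivative of the duplication formula at 1/4, together with the digamma value -γ - 2
log 2 at 1/2. -/
theorem digamma_one_quarter_add : Complex.digamma (1 / 4) + Complex.digamma (3 / 4) =
    -2 * Real.eulerMascheroniConstant - 6 * Real.log 2 := by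
  have hne : ∀ x : ℂ, 0 < x.re → ∀ n : ℕ, x ≠ -n := by
    intro x hx n h
    rw [h] at hx
    simp at hx
    have : (0 : ℝ) ≤ n := by positivity
    linarith
  have e0 : (1 / 4 : ℂ) + 1 / 2 = 3 / 4 := by norm_num
  have e1 : (2 : ℂ) * (1 / 4) = 1 / 2 := by norm_num
  have hd1 := Complex.differentiableAt_Gamma (1 / 4) (hne _ (by norm_num))
  have hd2 : DifferentiableAt ℂ Complex.Gamma (2 * (1 / 4)) := by
    rw [e1]; exact Complex.differentiableAt_Gamma (1 / 2) (hne _ (by norm_num))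
  have hd3 : DifferentiableAt ℂ Complex.Gamma (1 / 4 + 1 / 2) := by
    rw [e0]; exact Complex.differentiableAt_Gamma (3 / 4) (hne _ (by norm_num))
  have hdd : HasDerivAt (fun z : ℂ => 2 * z) 2 (1 / 4) := by simpa using (hasDerivAt_id (1 / 4 : ℂ)).const_mul (2 : ℂ)
  have hde : HasDerivAt (fun z : ℂ => 1 - 2 * z) (-2) (1 / 4) := by simpa using hdd.const_sub 1
  have hdc : HasDerivAt (fun z : ℂ => z + 1 / 2) 1 (1 / 4) := (hasDerivAt_id (1 / 4 : ℂ)).add_const _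
  have hdp := hde.const_cpow (c := 2) (Or.inl (by norm_num))
  have hpow : (2 : ℂ) ^ (1 - 2 * (1 / 4) : ℂ) ≠ 0 := by
    rw [Complex.cpow_ne_zero_iff]; left; norm_num
  have hsq : ((√π : ℝ) : ℂ) ≠ 0 := by
    norm_cast; exact (Real.sqrt_pos.2 Real.pi_pos).ne'
  have hg1 : Complex.Gamma (1 / 4) ≠ 0 := Complex.Gamma_ne_zero_of_re_pos (by norm_num)
  have hg2 : (Complex.Gamma ∘ fun z : ℂ => 2 * z) (1 / 4) ≠ 0 := by
    rw [Function.comp_apply, e1]; exact Complex.Gamma_ne_zero_of_re_pos (by norm_num)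
  have hg3 : (Complex.Gamma ∘ fun z : ℂ => z + 1 / 2) (1 / 4) ≠ 0 := by
    rw [Function.comp_apply, e0]; exact Complex.Gamma_ne_zero_of_re_pos (by norm_num)
  have hc3 : DifferentiableAt ℂ (Complex.Gamma ∘ fun z : ℂ => z + 1 / 2) (1 / 4) :=
    DifferentiableAt.comp (1 / 4 : ℂ) hd3 hdc.differentiableAt
  have hc2 : DifferentiableAt ℂ (Complex.Gamma ∘ fun z : ℂ => 2 * z) (1 / 4) :=
    DifferentiableAt.comp (1 / 4 : ℂ) hd2 hdd.differentiableAt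
  have hL := logDeriv_mul (f := Complex.Gamma) (g := Complex.Gamma ∘ fun z : ℂ => z + 1 / 2) (1 / 4) hg1 hg3 hd1 hc3
  have hR1 := logDeriv_mul (f := Complex.Gamma ∘ fun z : ℂ => 2 * z) (g := fun z : ℂ => (2 : ℂ) ^ (1 - 2 * z)) (1 / 4)
    hg2 hpow hc2 hdp.differentiableAt
  have hR2 := logDeriv_mul_const (f := fun z : ℂ => (Complex.Gamma ∘ fun z : ℂ => 2 * z) z * (2 : ℂ) ^ (1 - 2 * z)) (1 / 4) _ hsq
  have hfun : (fun z : ℂ => Complex.Gamma z * (Complex.Gamma ∘ fun z : ℂ => z + 1 / 2) z) =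
      fun z => (Complex.Gamma ∘ fun z : ℂ => 2 * z) z * (2 : ℂ) ^ (1 - 2 * z) * ((√π : ℝ) : ℂ) :=
    funext fun z => Complex.Gamma_mul_Gamma_add_half z
  rw [hfun, hR2, hR1, logDeriv_comp (g := fun z : ℂ => 2 * z) hd2 hdd.differentiableAt,
    logDeriv_comp (g := fun z : ℂ => z + 1 / 2) hd3 hdc.differentiableAt, hdd.deriv, hdc.deriv,
    e0, e1, logDeriv_apply (fun z : ℂ => (2 : ℂ) ^ (1 - 2 * z)), hdp.deriv, ← Complex.digamma_def, Complex.digamma_one_half,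
    mul_one] at hL
  rw [← hL, Complex.ofReal_log (by norm_num)]
  rw [mul_assoc ((2 : ℂ) ^ (1 - 2 * (1 / 4) : ℂ)), mul_div_cancel_left₀ _ hpow]
  push_cast
  ring

end LMoment

end

/-! ### Numerical bounds deciding the sign of the coefficient of X -/

noncomputable section
namespace LMoment
open Filter Topology Finset
open scoped Real NumberTheorySymbols

/-- The index 64 makes log n a multiple of log 2. The sign for N = 1, as estimated in
`coeffRatio_one`, needs γ below about 0.588, so the bound 2/3 would not do. -/
theorem eulerMascheroniConstant_lt : Real.eulerMascheroniConstant < 5852 / 10000 := by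
  have h := Real.eulerMascheroniConstant_lt_eulerMascheroniSeq' 64
  rw [Real.eulerMascheroniSeq', if_neg (by norm_num)] at h
  have h2 := Real.log_two_gt_d9
  have h3 : Real.log ((64 : ℕ) : ℝ) = 6 * Real.log 2 := by
    rw [show ((64 : ℕ) : ℝ) = 2 ^ 6 by norm_num, Real.log_pow]; norm_num
  have h4 : ((harmonic 64 : ℚ) : ℝ) < 47439 / 10000 := by
    have : harmonic 64 < 47439 / 10000 := by
      simp only [harmonic, Finset.sum_range_succ, Finset.sum_range_zero]
      norm_num
    exact (Rat.cast_lt (K := ℝ).2 this).trans_eq (by norm_num)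
  rw [h3] at h
  linarith

/-- π³ ≈ 31.006 is close to 32, so log x ≤ x - 1 at π³/32 loses little. -/
theorem log_pi_lt : Real.log π < 1145 / 1000 := by
  have h1 : Real.log (π ^ 3 / 32) ≤ π ^ 3 / 32 - 1 := Real.log_le_sub_one_of_pos (by positivity)
  rw [Real.log_div (by positivity) (by norm_num), Real.log_pow, show (32 : ℝ) = 2 ^ 5 by norm_num, Real.log_pow] at h1
  have h2 := Real.log_two_lt_d9
  have h3 : π ^ 3 < 3.1416 ^ 3 := by
    gcongr
    exact Real.pi_lt_d4
  norm_num at h1 h3 ⊢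
  linarith

theorem logMean_one_quarter :
    logMean (1 / 4) = -Real.eulerMascheroniConstant - 3 * Real.log 2 - π / 2 - Real.log π := by
  have h := (logMean_spec (σ := 1 / 4) (by norm_num)).2
  have h1 := digamma_one_quarter_sub
  have h2 := digamma_one_quarter_add
  have h3 : Complex.digamma ((1 / 4 : ℝ) : ℂ) = Complex.digamma (1 / 4) := by push_cast; rfl
  rw [h3] at h
  have h4 : Complex.digamma (1 / 4) = -Real.eulerMascheroniConstant - 3 * Real.log 2 - π / 2 := by
    linear_combination (h1 + h2) / 2
  rw [h4] at h
  exact_mod_cast h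

theorem logMean_three_quarters :
    logMean (3 / 4) = -Real.eulerMascheroniConstant - 3 * Real.log 2 + π / 2 - Real.log π := by
  have h := (logMean_spec (σ := 3 / 4) (by norm_num)).2
  have h1 := digamma_one_quarter_sub
  have h2 := digamma_one_quarter_add
  have h3 : Complex.digamma ((3 / 4 : ℝ) : ℂ) = Complex.digamma (3 / 4) := by push_cast; rfl
  rw [h3] at h
  have h4 : Complex.digamma (3 / 4) = -Real.eulerMascheroniConstant - 3 * Real.log 2 + π / 2 := by
    linear_combination (h2 - h1) / 2
  rw [h4] at h
  exact_mod_cast h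

/-- Two classes with opposite symbols at 2 together give 2s²/(1 - s²), independent of the sign. -/
theorem twoFactor_add_of_neg {s : ℝ} (hs : s ^ 2 = 1 / 2) : s / (1 - s) + -s / (1 - -s) = 2 := by
  have h1 : 1 - s ≠ 0 := by
    intro h
    have : s = 1 := by linarith
    rw [this] at hs; norm_num at hs
  have h2 : 1 - -s ≠ 0 := by
    intro h
    have : s = -1 := by linarith
    rw [this] at hs; norm_num at hs
  rw [div_add_div _ _ h1 h2, div_eq_iff (mul_ne_zero h1 h2)]
  linear_combination 4 * hs

theorem jacobiSym_two_mul (c m : ℕ) (hc : c ≠ 0) (hm : m ≠ 0) : J(2 | c * m) = J(2 | c) * J(2 | m) :=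
  jacobiSym.mul_right' 2 hc hm

/-- For i = 0, 1 two classes have level m and two have level 4m, a mean excess of log 2 over log m.
The two classes of level m have opposite values at 2, and their Euler factors contribute exactly
-log 2. For i = 2, 3 the level is always 8m and the value at 2 is 0. -/
theorem levelMean_eq (i : Fin 4) {m : ℕ} (hm : Odd m) :
    levelMean i m = Real.log m + if 2 ≤ i then 3 * Real.log 2 else 0 := by
  have hm0 : m ≠ 0 := hm.pos.ne'
  have hmr : (m : ℝ) ≠ 0 := by exact_mod_cast hm0
  have hJ : J(2 | m) ^ 2 = 1 := jacobiSym.sq_one (by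
    rw [show (2 : ℤ) = ((2 : ℕ) : ℤ) by rfl, Int.gcd_natCast_natCast]; exact Nat.coprime_two_left.2 hm)
  have hs : (((J(2 | m) : ℤ) : ℝ) / √2) ^ 2 = 1 / 2 := by
    rw [div_pow, Real.sq_sqrt (by norm_num)]
    have : ((J(2 | m) : ℤ) : ℝ) ^ 2 = 1 := by exact_mod_cast hJ
    rw [this]
  have j1 : J(2 | 1) = 1 := jacobiSym.one_right _
  have j3 : J(2 | 3) = -1 := by rw [jacobiSym.at_two (by decide)]; decide
  have j5 : J(2 | 5) = -1 := by rw [jacobiSym.at_two (by decide)]; decide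
  have j7 : J(2 | 7) = 1 := by rw [jacobiSym.at_two (by decide)]; decide
  have hadd := twoFactor_add_of_neg hs
  have l4 : Real.log 4 = 2 * Real.log 2 := by rw [show (4 : ℝ) = 2 ^ 2 by norm_num, Real.log_pow]; norm_num
  have l8 : Real.log 8 = 3 * Real.log 2 := by rw [show (8 : ℝ) = 2 ^ 3 by norm_num, Real.log_pow]; norm_num
  have L : ∀ a : ℕ, a ≠ 0 → Real.log ((a * m : ℕ) : ℝ) = Real.log a + Real.log m := by
    intro a ha
    rw [Nat.cast_mul, Real.log_mul (by exact_mod_cast ha) hmr]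
  have e0 : eta 0 2 = 1 := rfl
  have e1 : eta 1 2 = 0 := eta_two_of_ne (by decide)
  have e2 : eta 2 2 = 0 := eta_two_of_ne (by decide)
  have e3 : eta 3 2 = 0 := eta_two_of_ne (by decide)
  have t : ∀ c, twoFactor i m c = ((eta (twistIndex i c) 2 * J(2 | c * m) : ℤ) : ℝ) / √2 := fun c => rfl
  rw [levelMean, Finset.sum_insert (by decide), Finset.sum_insert (by decide), Finset.sum_insert (by decide),
    Finset.sum_singleton]
  simp only [t, twistLevel, jacobiSym_two_mul 1 m (by norm_num) hm0, jacobiSym_two_mul 3 m (by norm_num) hm0,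
    jacobiSym_two_mul 5 m (by norm_num) hm0, jacobiSym_two_mul 7 m (by norm_num) hm0, j1, j3, j5, j7]
  have hneg : ((1 * (-1 * J(2 | m)) : ℤ) : ℝ) / √2 = -(((J(2 | m) : ℤ) : ℝ) / √2) := by push_cast; ring
  have hpos : ((1 * (1 * J(2 | m)) : ℤ) : ℝ) / √2 = ((J(2 | m) : ℤ) : ℝ) / √2 := by push_cast; ring
  fin_cases i
  · have i1 : twistIndex 0 1 = 0 := rfl
    have i3 : twistIndex 0 3 = 1 := rfl
    have i5 : twistIndex 0 5 = 0 := rfl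
    have i7 : twistIndex 0 7 = 1 := rfl
    simp only [Fin.zero_eta, i1, i3, i5, i7, e0, e1, hneg, hpos, zero_mul, Int.cast_zero, zero_div, mul_zero]
    rw [show etaMod 0 = 1 from rfl, show etaMod 1 = 4 from rfl, L 1 (by norm_num), L 4 (by norm_num), if_neg (by decide)]
    push_cast
    rw [Real.log_one, l4]
    linear_combination (-(Real.log 2) / 2) * hadd
  · have i1 : twistIndex 1 1 = 1 := rfl
    have i3 : twistIndex 1 3 = 0 := rfl
    have i5 : twistIndex 1 5 = 1 := rfl
    have i7 : twistIndex 1 7 = 0 := rfl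
    simp only [Fin.mk_one, i1, i3, i5, i7, e0, e1, hneg, hpos, zero_mul, Int.cast_zero, zero_div, mul_zero]
    rw [show etaMod 0 = 1 from rfl, show etaMod 1 = 4 from rfl, L 1 (by norm_num), L 4 (by norm_num), if_neg (by decide)]
    push_cast
    rw [Real.log_one, l4]
    linear_combination (-(Real.log 2) / 2) * hadd
  · have i1 : twistIndex 2 1 = 2 := rfl
    have i3 : twistIndex 2 3 = 3 := rfl
    have i5 : twistIndex 2 5 = 2 := rfl
    have i7 : twistIndex 2 7 = 3 := rfl
    simp only [Fin.reduceFinMk, i1, i3, i5, i7, e2, e3, zero_mul, Int.cast_zero, zero_div, mul_zero]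
    rw [show etaMod 2 = 8 from rfl, show etaMod 3 = 8 from rfl, L 8 (by norm_num), if_pos (by decide)]
    push_cast
    rw [l8]
    ring
  · have i1 : twistIndex 3 1 = 3 := rfl
    have i3 : twistIndex 3 3 = 2 := rfl
    have i5 : twistIndex 3 5 = 3 := rfl
    have i7 : twistIndex 3 7 = 2 := rfl
    simp only [Fin.reduceFinMk, i1, i3, i5, i7, e2, e3, zero_mul, Int.cast_zero, zero_div, mul_zero]
    rw [show etaMod 2 = 8 from rfl, show etaMod 3 = 8 from rfl, L 8 (by norm_num), if_pos (by decide)]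
    push_cast
    rw [l8]
    ring

theorem invSumConst_two_mul {m : ℕ} (hm : Odd m) : invSumConst (2 * m).primeFactors =
    Real.eulerMascheroniConstant + Real.log 2 + ∑ p ∈ m.primeFactors, Real.log p / ((p : ℝ) - 1) := by
  have h2 : Nat.Coprime 2 m := Nat.coprime_two_left.2 hm
  rw [invSumConst, h2.primeFactors_mul, Finset.sum_union h2.disjoint_primeFactors, Nat.prime_two.primeFactors,
    Finset.sum_singleton]
  norm_num
  ring

/-- The ratio of the coefficients, with the contribution of the logarithmic moment of the weight left out. -/
def coeffRatio (i : Fin 4) (m : ℕ) : ℝ :=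
  levelMean i m + 4 * invSumConst (2 * m).primeFactors + logMean (gammaShape i m)

/-- The value 3γ + log 2 - π/2 - log π ≈ -0.291 has to be separated from -log(5/4) ≈ -0.223.
Comparing π with 5/2 = 2·(5/4) makes log 2 and log(5/4) cancel. -/
theorem coeffRatio_one : coeffRatio 0 1 < -Real.log (5 / 4) - 1 / 100 := by
  have hg : gammaShape 0 1 = 1 / 4 := by rw [gammaShape, if_pos (by rw [psi, jacobiSym.one_right]; rfl)]
  rw [coeffRatio, levelMean_eq 0 odd_one, invSumConst_two_mul odd_one, hg, logMean_one_quarter, if_neg (by decide)]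
  have h1 := eulerMascheroniConstant_lt
  have h2 := Real.one_sub_inv_le_log_of_pos (show 0 < π / (5 / 2) by positivity)
  rw [Real.log_div (by positivity) (by norm_num), show (5 / 2 : ℝ) = 2 * (5 / 4) by norm_num,
    Real.log_mul (by norm_num) (by norm_num), inv_div] at h2
  have h3 := Real.pi_gt_d4
  have h4 : 2 * (5 / 4) / π < 7958 / 10000 := by
    rw [div_lt_iff₀ Real.pi_pos]; linarith
  simp only [Nat.primeFactors_one, Finset.sum_empty, Nat.cast_one, Real.log_one]
  linarith

theorem sum_log_div_nonneg (m : ℕ) : 0 ≤ ∑ p ∈ m.primeFactors, Real.log p / ((p : ℝ) - 1) :=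
  Finset.sum_nonneg fun p hp => by
    have hp1 : (1 : ℝ) ≤ p := by exact_mod_cast (Nat.prime_of_mem_primeFactors hp).one_le
    exact div_nonneg (Real.log_nonneg hp1) (by linarith)

/-- One prime factor p suffices. For p = 3 and p = 5 the term log p/(p - 1) helps; for p ≥ 7 log p
alone is enough, with log 7 ≈ 1.946 the tight case. -/
theorem log_add_sum_log_div_gt {m : ℕ} (hm : Odd m) (h1 : 1 < m) :
    193 / 100 < Real.log m + 4 * ∑ p ∈ m.primeFactors, Real.log p / ((p : ℝ) - 1) := by
  obtain ⟨p, hp, hpm⟩ := Nat.exists_prime_and_dvd h1.ne'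
  have hpm' : p ∈ m.primeFactors := Nat.mem_primeFactors.2 ⟨hp, hpm, by omega⟩
  have hpo : Odd p := hm.of_dvd_nat hpm
  have hp1 : (1 : ℝ) < p := by exact_mod_cast hp.one_lt
  have hlog : Real.log p ≤ Real.log m :=
    Real.log_le_log (by linarith) (by exact_mod_cast Nat.le_of_dvd (by omega) hpm)
  have hsum : Real.log p / ((p : ℝ) - 1) ≤ ∑ p ∈ m.primeFactors, Real.log p / ((p : ℝ) - 1) :=
    Finset.single_le_sum (f := fun p : ℕ => Real.log p / ((p : ℝ) - 1)) (fun q hq => by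
      have hq1 : (1 : ℝ) ≤ q := by exact_mod_cast (Nat.prime_of_mem_primeFactors hq).one_le
      exact div_nonneg (Real.log_nonneg hq1) (by linarith)) hpm'
  have l2 := Real.log_two_gt_d9
  have hkey : 193 / 100 < Real.log p + 4 * (Real.log p / ((p : ℝ) - 1)) := by
    have hcase : p = 3 ∨ p = 5 ∨ 7 ≤ p := by
      have := hp.two_le
      have := Nat.odd_iff.1 hpo
      omega
    rcases hcase with rfl | rfl | h7
    · have : Real.log 2 ≤ Real.log 3 := Real.log_le_log (by norm_num) (by norm_num)
      norm_num
      linarith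
    · have : Real.log (2 ^ 2) ≤ Real.log 5 := Real.log_le_log (by norm_num) (by norm_num)
      rw [Real.log_pow] at this
      norm_num at this ⊢
      linarith
    · have h7' : (7 : ℝ) ≤ p := by exact_mod_cast h7
      have a1 : Real.log 7 ≤ Real.log p := Real.log_le_log (by norm_num) h7'
      have a2 := Real.one_sub_inv_le_log_of_pos (show (0 : ℝ) < 7 / 2 ^ 3 by norm_num)
      rw [Real.log_div (by norm_num) (by norm_num), Real.log_pow] at a2
      have a3 : 0 ≤ Real.log p / ((p : ℝ) - 1) := div_nonneg (Real.log_nonneg hp1.le) (by linarith)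
      norm_num at a2
      linarith
  linarith

/-- Odd characters gain π over even ones through the digamma value. Even characters with 8 ∣ N gain
3 log 2. The remaining even characters have odd part m > 1, because χ₄ is odd, and gain from the
primes of m. -/
theorem coeffRatio_gt {i : Fin 4} {m : ℕ} (hm : Odd m) (hN : 1 < etaMod i * m) :
    Real.log 4 + 1 / 100 < coeffRatio i m := by
  have h1 := Real.one_half_lt_eulerMascheroniConstant
  have h2 := log_pi_lt
  have h3 := Real.log_two_gt_d9
  have h3' := Real.log_two_lt_d9
  have l4 : Real.log 4 = 2 * Real.log 2 := by rw [show (4 : ℝ) = 2 ^ 2 by norm_num, Real.log_pow]; norm_num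
  have hs := sum_log_div_nonneg m
  have hlm : 0 ≤ Real.log m := Real.log_nonneg (by exact_mod_cast hm.pos)
  have p1 := Real.pi_gt_d4
  have p2 := Real.pi_lt_d4
  rw [coeffRatio, levelMean_eq i hm, invSumConst_two_mul hm, l4]
  by_cases hpsi : psi i m (-1) = 1
  · rw [gammaShape, if_pos hpsi, logMean_one_quarter]
    split_ifs with hi
    · norm_num at p2
      linarith
    · have hm1 : 1 < m := by
        by_contra hcon
        have hm1 : m = 1 := by have := hm.pos; omega
        subst hm1
        rw [psi, jacobiSym.one_right, mul_one] at hpsi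
        fin_cases i
        · simp [etaMod] at hN
        · revert hpsi; decide
        · exact hi (by decide)
        · exact hi (by decide)
      have := log_add_sum_log_div_gt hm hm1
      norm_num at p2
      linarith
  · rw [gammaShape, if_neg hpsi, logMean_three_quarters]
    have : (0 : ℝ) ≤ if 2 ≤ i then 3 * Real.log 2 else 0 := by split_ifs <;> linarith
    norm_num at p1
    linarith

end LMoment

end

/-! ### Bounds for the coefficients and conclusion -/

noncomputable section
namespace LMoment
open Filter Topology Finset MeasureTheory
open scoped Real NumberTheorySymbols

theorem half_le_weightMass {h : ℝ → ℝ} (hh : IsSmoothWeight h) : 1 / 2 ≤ weightMass h := by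
  have h1 : ∫ y in (1 / 2 : ℝ)..1, h y = 1 / 2 := by
    rw [intervalIntegral.integral_congr (g := fun _ => (1 : ℝ)) fun y hy => ?_, intervalIntegral.integral_const]
    · norm_num
    · rw [Set.uIcc_of_le (by norm_num)] at hy
      exact hh.eq_one y hy
  rw [← h1, weightMass]
  exact intervalIntegral.integral_mono_interval (by norm_num) (by norm_num) (by norm_num)
    (Eventually.of_forall hh.nonneg) (hh.continuous.intervalIntegrable _ _)

theorem intervalIntegrable_mul_log {h : ℝ → ℝ} (hh : IsSmoothWeight h) :
    IntervalIntegrable (fun y => h y * Real.log y) volume (1 / 8) (5 / 2) := by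
  refine ContinuousOn.intervalIntegrable ?_
  rw [Set.uIcc_of_le (by norm_num)]
  exact hh.continuous.continuousOn.mul fun y hy => (Real.continuousAt_log (by linarith [hy.1])).continuousWithinAt

/-- The extreme values of log y on the support [1/4, 5/4]; these are the two thresholds that
`coeffRatio` clears. -/
theorem weightLogMass_mem {h : ℝ → ℝ} (hh : IsSmoothWeight h) :
    -Real.log 4 * weightMass h ≤ weightLogMass h ∧ weightLogMass h ≤ Real.log (5 / 4) * weightMass h := by
  have hi : IntervalIntegrable h volume (1 / 8) (5 / 2) := hh.continuous.intervalIntegrable _ _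
  have hzero : ∀ y : ℝ, y < 1 / 4 ∨ 5 / 4 < y → h y = 0 := fun y hy => hh.eq_zero hy
  rw [weightMass, weightLogMass, ← intervalIntegral.integral_const_mul, ← intervalIntegral.integral_const_mul]
  constructor
  · refine intervalIntegral.integral_mono_on (by norm_num) (hi.const_mul _) (intervalIntegrable_mul_log hh) fun y _ => ?_
    rcases lt_or_ge y (1 / 4) with h1 | h1
    · rw [hzero y (Or.inl h1)]; simp
    · have := Real.log_le_log (by norm_num) h1
      rw [one_div, Real.log_inv] at this
      rw [mul_comm]
      exact mul_le_mul_of_nonneg_left this (hh.nonneg y)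
  · refine intervalIntegral.integral_mono_on (by norm_num) (intervalIntegrable_mul_log hh) (hi.const_mul _) fun y hy => ?_
    rcases lt_or_ge (5 / 4) y with h1 | h1
    · rw [hzero y (Or.inr h1)]; simp
    · have := Real.log_le_log (by linarith [hy.1]) h1
      rw [mul_comm (Real.log (5 / 4))]
      exact mul_le_mul_of_nonneg_left this (hh.nonneg y)

theorem linCoeff_eq (h : ℝ → ℝ) (i : Fin 4) (m : ℕ) :
    linCoeff h i m = 1 / 2 * (∏ p ∈ (2 * m).primeFactors, (1 - 1 / (p : ℝ))) ^ 2 *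
      (weightMass h * coeffRatio i m + weightLogMass h) := rfl

theorem sum_log_div_le {m : ℕ} (hm : Odd m) : ∑ p ∈ m.primeFactors, Real.log p / ((p : ℝ) - 1) ≤ Real.log m := by
  have h1 : ∑ p ∈ m.primeFactors, Real.log p / ((p : ℝ) - 1) ≤ ∑ p ∈ m.primeFactors, Real.log p := by
    refine Finset.sum_le_sum fun p hp => ?_
    have hp2 : (2 : ℝ) ≤ p := by exact_mod_cast (Nat.prime_of_mem_primeFactors hp).two_le
    exact div_le_self (Real.log_nonneg (by linarith)) (by linarith)
  refine h1.trans ?_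
  rw [← Real.log_prod fun p hp => by exact_mod_cast (Nat.prime_of_mem_primeFactors hp).ne_zero, ← Nat.cast_prod]
  refine Real.log_le_log ?_ (by exact_mod_cast Nat.le_of_dvd hm.pos (Nat.prod_primeFactors_dvd m))
  exact_mod_cast Finset.prod_pos fun p hp => (Nat.prime_of_mem_primeFactors hp).pos

theorem abs_coeffRatio_le : ∃ A : ℝ, 0 < A ∧ ∀ (i : Fin 4) (m : ℕ), Odd m → |coeffRatio i m| ≤ 5 * Real.log m + A := by
  have h3 := Real.log_two_gt_d9
  have h3' := Real.log_two_lt_d9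
  have g0 := Real.one_half_lt_eulerMascheroniConstant
  have g1 := Real.eulerMascheroniConstant_lt_two_thirds
  refine ⟨|logMean (1 / 4)| + |logMean (3 / 4)| + 10, by positivity, fun i m hm => ?_⟩
  have hs := sum_log_div_nonneg m
  have hs' := sum_log_div_le hm
  have hlm : 0 ≤ Real.log m := Real.log_nonneg (by exact_mod_cast hm.pos)
  rw [coeffRatio, levelMean_eq i hm, invSumConst_two_mul hm]
  have hκ : |logMean (gammaShape i m)| ≤ |logMean (1 / 4)| + |logMean (3 / 4)| := by
    rw [gammaShape]
    split_ifs
    · linarith [abs_nonneg (logMean (3 / 4))]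
    · linarith [abs_nonneg (logMean (1 / 4))]
  have hc : 0 ≤ (if 2 ≤ i then 3 * Real.log 2 else 0) ∧ (if 2 ≤ i then 3 * Real.log 2 else 0) ≤ 3 := by
    split_ifs <;> constructor <;> linarith
  have := abs_le.1 hκ
  rw [abs_le]
  constructor <;> linarith [hc.1, hc.2, this.1, this.2]

/-- The product P over primes dividing 2m is at least 2^{-ω(2m)}, hence P² ≫ N^{-ε}. The remaining
factor of the linear coefficient stays away from 0 by at least M/100 ≥ 1/200, with the sign decided
by N = 1 or N > 1; its growth is at most logarithmic in N. -/
theorem exists_coeff_bounds {h : ℝ → ℝ} (hh : IsSmoothWeight h) {ε : ℝ} (hε : 0 < ε) :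
    ∃ c C : ℝ, 0 < c ∧ 0 < C ∧ ∀ (i : Fin 4) (m N : ℕ), Odd m → N = etaMod i * m →
      c * (N : ℝ) ^ (-ε) ≤ logCoeff h m ∧ logCoeff h m ≤ C * (N : ℝ) ^ ε ∧
      c * (N : ℝ) ^ (-ε) ≤ |linCoeff h i m| ∧ |linCoeff h i m| ≤ C * (N : ℝ) ^ ε ∧ (1 < N → 0 < linCoeff h i m) := by
  obtain ⟨K, hK, H⟩ := exists_two_pow_card_primeFactors_le (show 0 < ε / 2 by positivity)
  obtain ⟨A, hA, HA⟩ := abs_coeffRatio_le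
  have hM := half_le_weightMass hh
  obtain ⟨hL1, hL2⟩ := weightLogMass_mem hh
  set M := weightMass h with hMdef
  set L := weightLogMass h with hLdef
  set κ : ℝ := (K ^ 2 * 2 ^ ε)⁻¹ with hκ
  have hκ0 : 0 < κ := by positivity
  have hlog4 : 0 ≤ Real.log 4 := Real.log_nonneg (by norm_num)
  -- 1/400 is the factor 1/2 of the coefficient times the lower bound 1/200 proved below.
  refine ⟨κ / 400, M * (5 / ε + A) + |L| + M, by positivity, by positivity, fun i m N hm hN => ?_⟩
  have hm0 : 0 < m := hm.pos
  have hmN : m ≤ N := by rw [hN]; exact Nat.le_mul_of_pos_left m (Nat.pos_of_ne_zero (NeZero.ne (etaMod i)))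
  have hN1 : (1 : ℝ) ≤ N := by exact_mod_cast hm0.trans_le hmN
  have hm1 : (1 : ℝ) ≤ m := by exact_mod_cast hm0
  have hmN' : (m : ℝ) ≤ N := by exact_mod_cast hmN
  have hNε : 1 ≤ (N : ℝ) ^ ε := Real.one_le_rpow hN1 hε.le
  obtain ⟨hP0, hP1⟩ := prod_one_sub_inv_mem (2 * m).primeFactors
  set P := ∏ p ∈ (2 * m).primeFactors, (1 - 1 / (p : ℝ)) with hP
  have hPlow : κ * (N : ℝ) ^ (-ε) ≤ P ^ 2 := by
    have h1 : ((2 : ℝ) ^ (2 * m).primeFactors.card)⁻¹ ≤ P := by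
      rw [hP, ← inv_pow, ← Finset.prod_const]
      refine Finset.prod_le_prod (fun _ _ => by norm_num) fun p hp => ?_
      have hp2 : (2 : ℝ) ≤ p := by exact_mod_cast (Nat.prime_of_mem_primeFactors hp).two_le
      have : 1 / (p : ℝ) ≤ 1 / 2 := one_div_le_one_div_of_le (by norm_num) hp2
      norm_num at this ⊢
      linarith
    have h2 := H (2 * m) (by omega)
    have h3 : (K * ((2 * m : ℕ) : ℝ) ^ (ε / 2)) ^ 2 ≤ K ^ 2 * 2 ^ ε * (N : ℝ) ^ ε := by
      have e1 : (((2 * m : ℕ) : ℝ) ^ (ε / 2)) ^ 2 = 2 ^ ε * (m : ℝ) ^ ε := by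
        rw [← Real.rpow_natCast, ← Real.rpow_mul (by positivity), show ε / 2 * ((2 : ℕ) : ℝ) = ε by push_cast; ring]
        push_cast
        rw [Real.mul_rpow (by norm_num) (by positivity)]
      rw [mul_pow, e1, mul_assoc]
      gcongr
    have h4 : (K * ((2 * m : ℕ) : ℝ) ^ (ε / 2))⁻¹ ≤ P := (inv_anti₀ (by positivity) h2).trans h1
    calc κ * (N : ℝ) ^ (-ε) = (K ^ 2 * 2 ^ ε * (N : ℝ) ^ ε)⁻¹ := by
          rw [hκ, Real.rpow_neg (by positivity), ← mul_inv]
      _ ≤ ((K * ((2 * m : ℕ) : ℝ) ^ (ε / 2)) ^ 2)⁻¹ := inv_anti₀ (by positivity) h3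
      _ = ((K * ((2 * m : ℕ) : ℝ) ^ (ε / 2))⁻¹) ^ 2 := by rw [inv_pow]
      _ ≤ P ^ 2 := by gcongr
  have hPpos : 0 < P ^ 2 := lt_of_lt_of_le (by positivity) hPlow
  have hPle : P ^ 2 ≤ 1 := pow_le_one₀ hP0 hP1
  have hsmall : 1 / 200 ≤ |M * coeffRatio i m + L| ∧ (1 < N → 1 / 200 ≤ M * coeffRatio i m + L) := by
    by_cases hN1' : 1 < N
    · have hr := coeffRatio_gt hm (hN ▸ hN1')
      have h1 : 1 / 200 ≤ M * coeffRatio i m + L := by nlinarith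
      exact ⟨h1.trans (le_abs_self _), fun _ => h1⟩
    · have h1 : etaMod i * m = 1 := by
        have : 0 < N := hm0.trans_le hmN
        omega
      obtain ⟨h2, h3⟩ := mul_eq_one.1 h1
      have hi : i = 0 := by
        fin_cases i
        · rfl
        all_goals simp [etaMod] at h2
      subst hi
      subst h3
      have hr := coeffRatio_one
      have h4 : M * coeffRatio 0 1 + L ≤ -(1 / 200) := by nlinarith
      refine ⟨?_, fun h => absurd h hN1'⟩
      rw [abs_of_nonpos (by linarith)]
      linarith
  have hNneg : 0 ≤ (N : ℝ) ^ (-ε) := by positivity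
  refine ⟨?_, ?_, ?_, ?_, ?_⟩
  · rw [logCoeff, ← hP, ← hMdef]
    nlinarith [mul_nonneg hκ0.le hNneg]
  · rw [logCoeff, ← hP, ← hMdef]
    have h1 : 1 / 2 * P ^ 2 * M ≤ M := by nlinarith
    have h2 : 0 ≤ M * (5 / ε + A) + |L| := by positivity
    calc _ ≤ M := h1
      _ ≤ (M * (5 / ε + A) + |L| + M) * 1 := by linarith
      _ ≤ _ := by gcongr
  · rw [linCoeff_eq, ← hP, ← hMdef, ← hLdef, abs_mul, abs_of_nonneg (by positivity)]
    calc κ / 400 * (N : ℝ) ^ (-ε) = 1 / 2 * (κ * (N : ℝ) ^ (-ε)) * (1 / 200) := by ring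
      _ ≤ _ := by gcongr; exact hsmall.1
  · rw [linCoeff_eq, ← hP, ← hMdef, ← hLdef, abs_mul, abs_of_nonneg (by positivity)]
    have h1 : Real.log m ≤ (N : ℝ) ^ ε / ε :=
      (Real.log_le_rpow_div (by positivity) hε).trans (by gcongr)
    have h2 : |M * coeffRatio i m + L| ≤ (M * (5 / ε + A) + |L|) * (N : ℝ) ^ ε := by
      have h3 : |coeffRatio i m| ≤ (5 / ε + A) * (N : ℝ) ^ ε := by
        refine (HA i m hm).trans ?_
        calc 5 * Real.log m + A ≤ 5 * ((N : ℝ) ^ ε / ε) + A * (N : ℝ) ^ ε := by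
              gcongr
              exact le_mul_of_one_le_right hA.le hNε
          _ = _ := by ring
      refine (abs_add_le _ _).trans ?_
      rw [abs_mul, abs_of_pos (show 0 < M by linarith)]
      calc M * |coeffRatio i m| + |L| ≤ M * ((5 / ε + A) * (N : ℝ) ^ ε) + |L| * (N : ℝ) ^ ε := by
            gcongr
            exact le_mul_of_one_le_right (abs_nonneg L) hNε
        _ = _ := by ring
    calc 1 / 2 * P ^ 2 * |M * coeffRatio i m + L| ≤ 1 * |M * coeffRatio i m + L| :=
          mul_le_mul_of_nonneg_right (by linarith) (abs_nonneg _)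
      _ ≤ (M * (5 / ε + A) + |L|) * (N : ℝ) ^ ε := by rw [one_mul]; exact h2
      _ ≤ _ := mul_le_mul_of_nonneg_right (by linarith) (by positivity)
  · intro h
    rw [linCoeff_eq, ← hP, ← hMdef, ← hLdef]
    have := hsmall.2 h
    positivity

open Classical in
/-- The coefficient of `X log X`, as a function of the character. -/
def charLogCoeff (h : ℝ → ℝ) (N : ℕ) (χ : DirichletCharacter ℂ N) : ℝ :=
  if hx : ∃ p : Fin 4 × ℕ, QuadForm χ p.1 p.2 then logCoeff h hx.choose.2 else 0

open Classical in
/-- The coefficient of `X`, as a function of the character. -/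
def charLinCoeff (h : ℝ → ℝ) (N : ℕ) (χ : DirichletCharacter ℂ N) : ℝ :=
  if hx : ∃ p : Fin 4 × ℕ, QuadForm χ p.1 p.2 then linCoeff h hx.choose.1 hx.choose.2 else 0

/-- The coefficients must be functions of χ fixed before ε, so the pair (i, m) is chosen once for
each χ; characters without such a pair receive 0. -/
theorem exists_quadForm_coeff (h : ℝ → ℝ) {N : ℕ} [NeZero N] {χ : DirichletCharacter ℂ N} (hp : χ.IsPrimitive)
    (hq : χ.IsQuadratic) :
    ∃ i m, QuadForm χ i m ∧ charLogCoeff h N χ = logCoeff h m ∧ charLinCoeff h N χ = linCoeff h i m := by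
  obtain ⟨i, m, him⟩ := exists_quadForm hp hq
  have hx : ∃ p : Fin 4 × ℕ, QuadForm χ p.1 p.2 := ⟨(i, m), him⟩
  exact ⟨hx.choose.1, hx.choose.2, hx.choose_spec, dif_pos hx, dif_pos hx⟩

end LMoment

end

theorem theorem3 :
    ∃ δ : ℝ, 0 < δ ∧
      ∀ h : ℝ → ℝ, LMoment.IsSmoothWeight h →
        ∃ (a b : ∀ N : ℕ, DirichletCharacter ℂ N → ℝ),
          ∀ ε : ℝ, 0 < ε →
            ∃ c C : ℝ, 0 < c ∧ 0 < C ∧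
              ∀ (N : ℕ) [NeZero N] (χ : DirichletCharacter ℂ N),
                χ.IsPrimitive → χ.IsQuadratic →
                  (∀ X : ℝ, 1 ≤ X →
                    ‖LMoment.S h χ X -
                        ((a N χ * X * Real.log X + b N χ * X : ℝ) : ℂ)‖ ≤
                      C * (N : ℝ) ^ (3 / 8 + ε) * X ^ (1 - δ)) ∧
                  c * (N : ℝ) ^ (-ε) ≤ a N χ ∧ a N χ ≤ C * (N : ℝ) ^ ε ∧
                  c * (N : ℝ) ^ (-ε) ≤ |b N χ| ∧ |b N χ| ≤ C * (N : ℝ) ^ ε ∧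
                  (1 < N → 0 < b N χ) := by
  refine ⟨1 / 16, by norm_num, fun h hh => ⟨LMoment.charLogCoeff h, LMoment.charLinCoeff h, fun ε hε => ?_⟩⟩
  obtain ⟨C₁, hC₁, H₁⟩ := LMoment.exists_S_asymptotic hh hε
  obtain ⟨c, C₂, hc, hC₂, H₂⟩ := LMoment.exists_coeff_bounds hh hε
  refine ⟨c, C₁ + C₂, hc, by positivity, fun N _ χ hp hq => ?_⟩
  obtain ⟨i, m, hχ, ha, hb⟩ := LMoment.exists_quadForm_coeff h hp hq
  obtain ⟨b₁, b₂, b₃, b₄, b₅⟩ := H₂ i m N hχ.odd hχ.level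
  rw [ha, hb]
  have hNε : 0 ≤ (N : ℝ) ^ ε := by positivity
  have hadd : C₂ * (N : ℝ) ^ ε ≤ (C₁ + C₂) * (N : ℝ) ^ ε := by gcongr; linarith
  refine ⟨fun X hX => (H₁ N χ i m hχ hq X hX).trans ?_, b₁, b₂.trans hadd, b₃, b₄.trans hadd, b₅⟩
  gcongr
  linarith
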